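/- Let $K$ be an imaginary quadratic field of class number $1$ with ring of integers $\mathcal O_K$, let $\mathfrak p$ be a prime ideal of $\mathcal O_K$ not dividing $2$, and let $E/K$ be an elliptic curve with a $K$-rational point of order $2$ whose conductor is a power of $\mathfrak p$. Suppose that $E$ has a quadratic twist with good reduction at $\mathfrak p$, or that $E$ has an equation $y^2=x^3+bx$ and has a quartic twist $y^2=x^3+dbx$ ($d\in K^*$) with good reduction at $\mathfrak p$. Then one of the following holds. 1. $K=\mathbb Q(\sqrt{-7})$, and for a suitable choice of $\sqrt{-7}$ there is a generator $\pi$ of $\mathfrak p$ with $\pi\equiv\sqrt{-7}\pmod 4$ such that $E$ is isomorphic over $K$ to the quadratic twist by $\pi\sqrt{-7}$ of the base change to $K$ of one of the four curves in the isogeny class 49a over $\mathbb Q$ (with minimal models $[a_1,a_2,a_3,a_4,a_6]=[1,-1,0,-2,-1]$, $[1,-1,0,-37,-78]$, $[1,-1,0,-107,552]$, $[1,-1,0,-1822,30393]$). Moreover $j(E)\in\{-15^3,\,255^3\}$, and $E$ has complex multiplication by an order in $K$. 2. $K=\mathbb Q(i)$, and there are a generator $\pi$ of $\mathfrak p$ and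 $b\in\{\pi,\pi^3\}$ with $b\equiv-1+2i$ or $b\equiv-1-2i\pmod 8$ such that $E$ has an equation $y^2=x(x^2+b)$. In particular $E$ is a twist of the base change to $K$ of a curve in the isogeny class 64a over $\mathbb Q$ (with minimal models $[0,0,0,-4,0]$, $[0,0,0,-44,-112]$, $[0,0,0,-44,112]$, $[0,0,0,1,0]$). Moreover $j(E)=12^3$, and $E$ has complex multiplication by an order in $K$. 3. $K=\mathbb Q(\sqrt{-2})$, and for a suitable choice of $\sqrt{-2}$ there is a generator $\pi$ of $\mathfrak p$ with $\pi\equiv 1+\sqrt{-2}$ or $\pi\equiv-1+\sqrt{-2}\pmod 4$ such that $E$ has an equation $y^2=x(x^2+ax+b)$ with $(a,b)=(2\pi\sqrt{-2},-\pi^2)$. In particular $E$ is a twist of the base change to $K$ of a curve in the isogeny class 256a over $\mathbb Q$ (with minimal models $[0,1,0,-3,1]$, $[0,1,0,-13,-21]$). Moreover $j(E)=20^3$, and $E$ has complex multiplication by $\mathbb Z[\sqrt{-2}]$. In all three cases the conductor of $E$ is $\mathfrak p^2$. -/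

import Mathlib

open scoped NumberField WeierstrassCurve
open IsDedekindDomain

namespace GoodTwist

noncomputable section

/-! ### Isomorphisms and twists -/

/-- Two Weierstrass curves over `F` are isomorphic over `F`. -/
def IsIsomorphic {F : Type*} [Field F] (W W' : WeierstrassCurve F) : Prop :=
  ∃ C : WeierstrassCurve.VariableChange F, C • W = W'

/-- `W'` is a twist of `W`: they become isomorphic over an algebraic closure of `F`. -/
def IsTwist {F : Type*} [Field F] (W W' : WeierstrassCurve F) : Prop :=
  IsIsomorphic (W⁄(AlgebraicClosure F)) (W'⁄(AlgebraicClosure F))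

/-- The quadratic twist of `W` by `d` (in characteristic different from `2`): completing the square
turns `W` into `y² = x³ + (b₂/4) x² + (b₄/2) x + b₆/4`, which is isomorphic to
`d y² = x³ + (b₂/4) x² + (b₄/2) x + b₆/4` over `F(√d)`. -/
def quadraticTwist {F : Type*} [Field F] (W : WeierstrassCurve F) (d : F) : WeierstrassCurve F :=
  ⟨0, d * (W.b₂ / 4), 0, d ^ 2 * (W.b₄ / 2), d ^ 3 * (W.b₆ / 4)⟩

/-- The curve `y² = x (x² + a x + b)`. -/
def curveAB {F : Type*} [Field F] (a b : F) : WeierstrassCurve F :=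
  ⟨0, a, 0, b, 0⟩

open scoped Classical in
/-- `W` has a rational point of order `2`. -/
def HasPointOfOrderTwo {F : Type*} [Field F] (W : WeierstrassCurve F) : Prop :=
  ∃ P : W.toAffine.Point, addOrderOf P = 2

/-! ### Three isogeny classes over `ℚ`, given by their minimal models -/

/-- The isogeny class 49a. -/
def isogenyClass49a : Set (WeierstrassCurve ℚ) :=
  {⟨1, -1, 0, -2, -1⟩, ⟨1, -1, 0, -37, -78⟩, ⟨1, -1, 0, -107, 552⟩, ⟨1, -1, 0, -1822, 30393⟩}

/-- The isogeny class 64a. -/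
def isogenyClass64a : Set (WeierstrassCurve ℚ) :=
  {⟨0, 0, 0, -4, 0⟩, ⟨0, 0, 0, -44, -112⟩, ⟨0, 0, 0, -44, 112⟩, ⟨0, 0, 0, 1, 0⟩}

/-- The isogeny class 256a. -/
def isogenyClass256a : Set (WeierstrassCurve ℚ) :=
  {⟨0, 1, 0, -3, 1⟩, ⟨0, 1, 0, -13, -21⟩}

/-! ### Complex multiplication -/

open scoped Classical in
/-- A group endomorphism of `W(F)` is algebraic if it is zero or is given by rational functions
`(x, y) ↦ (f(x, y) / h(x, y), g(x, y) / h(x, y))` outside finitely many points. For `F`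
algebraically closed and `W` elliptic, these are the endomorphisms of the elliptic curve `W`. -/
def IsAlgebraicEndomorphism {F : Type*} [Field F] (W : WeierstrassCurve F)
    (φ : AddMonoid.End W.toAffine.Point) : Prop :=
  φ = 0 ∨ ∃ f g h : MvPolynomial (Fin 2) F, ∃ S : Set W.toAffine.Point, S.Finite ∧
    ∀ (x y : F) (hxy : W.toAffine.Nonsingular x y),
      WeierstrassCurve.Affine.Point.some x y hxy ∉ S →
        h.eval ![x, y] ≠ 0 ∧
        ∃ hφ : W.toAffine.Nonsingular (f.eval ![x, y] / h.eval ![x, y])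
            (g.eval ![x, y] / h.eval ![x, y]),
          φ (WeierstrassCurve.Affine.Point.some x y hxy) =
            WeierstrassCurve.Affine.Point.some _ _ hφ

open scoped Classical in
/-- `W` has complex multiplication by the ring `R`: its endomorphism ring over an algebraic closure
is isomorphic to `R`. -/
def HasCMBy {F : Type*} [Field F] (W : WeierstrassCurve F) (R : Type*) [CommRing R] : Prop :=
  ∃ ι : R →+* AddMonoid.End (W⁄(AlgebraicClosure F)).toAffine.Point,
    Function.Injective ι ∧
      Set.range ι = {φ | IsAlgebraicEndomorphism (W⁄(AlgebraicClosure F)) φ}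

/-- An order in a number field `K`: a subring that is finitely generated as an abelian group
and spans `K` over `ℚ`. -/
def IsOrder {K : Type*} [Field K] [NumberField K] (O : Subring K) : Prop :=
  O.toAddSubgroup.FG ∧ Submodule.span ℚ (O : Set K) = ⊤

section NumberField

variable {K : Type*} [Field K] [NumberField K]

/-! ### Reduction types -/

/-- `W` has good reduction at `q`: some Weierstrass model that is minimal over the localization of
the ring of integers at `q` has good reduction. -/
def HasGoodReductionAt (W : WeierstrassCurve K) (q : HeightOneSpectrum (𝓞 K)) : Prop :=
  ∃ C : WeierstrassCurve.VariableChange K, (C • W).HasGoodReduction (q.valuation K).integer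

/-- `W` has multiplicative reduction at `q`. -/
def HasMultiplicativeReductionAt (W : WeierstrassCurve K) (q : HeightOneSpectrum (𝓞 K)) : Prop :=
  ∃ C : WeierstrassCurve.VariableChange K,
    (C • W).HasMultiplicativeReduction (q.valuation K).integer

/-! ### The conductor -/

open scoped Classical in
/-- The `ℓ`-division field `K(W[ℓ])`, generated by the coordinates of the affine points of
order dividing `ℓ` over an algebraic closure. -/
def divisionField (W : WeierstrassCurve K) (l : ℕ) :
    IntermediateField K (AlgebraicClosure K) :=
  IntermediateField.adjoin K
    {z | ∃ (x y : AlgebraicClosure K)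
      (h : (W⁄(AlgebraicClosure K)).toAffine.Nonsingular x y),
      l • WeierstrassCurve.Affine.Point.some x y h = 0 ∧ (z = x ∨ z = y)}

section Wild

variable (L : Type*) [Field L] [Algebra K L]

/-- The `i`-th ramification group (in the lower numbering, `i ≥ 0`) of `L / K` at an ideal `P` of
the ring of integers of `L`: all `σ` with `σ x ≡ x` modulo `P ^ (i + 1)` for all integers `x`. -/
def ramificationGroup (P : Ideal (𝓞 L)) (i : ℕ) : Subgroup (L ≃ₐ[K] L) :=
  (P ^ (i + 1)).toAddSubgroup.inertia (L ≃ₐ[K] L)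

open scoped Classical in
/-- The group `W[ℓ](L)`. -/
def torsionSubgroup (W : WeierstrassCurve K) (l : ℕ) : AddSubgroup (W⁄L).toAffine.Point :=
  (nsmulAddMonoidHom l).ker

open scoped Classical in
/-- The points of `W(L)` fixed by the group `G` of automorphisms of `L / K`. -/
def fixedPoints (W : WeierstrassCurve K) (G : Subgroup (L ≃ₐ[K] L)) :
    AddSubgroup (W⁄L).toAffine.Point :=
  ⨅ σ ∈ G, (WeierstrassCurve.Affine.Point.map (W' := W.toAffine)
    (σ : L →ₐ[K] L) - AddMonoidHom.id _).ker

open scoped Classical in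
/-- The dimension over `𝔽_ℓ` of `W[ℓ] / W[ℓ]^G`, for an intermediate field over which all
of `W[ℓ]` is rational; that quotient has `ℓ ^ dim` elements. -/
def codimFixed (W : WeierstrassCurve K) (l : ℕ) (G : Subgroup (L ≃ₐ[K] L)) : ℕ :=
  Nat.log l ((fixedPoints L W G).relIndex (torsionSubgroup L W l))

/-- `∑_{i ≥ 1} (g_i / g_0) dim (W[ℓ] / W[ℓ]^{G_i})`, where `G_i` are the ramification groups of
`L = K(W[ℓ])` at `P` and `g_i` is the order of `G_i`. -/
def wildExponentAux (W : WeierstrassCurve K) (l : ℕ) (P : Ideal (𝓞 L)) : ℕ :=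
  (∑ᶠ i : ℕ, Nat.card (ramificationGroup (K := K) L P (i + 1)) *
      codimFixed L W l (ramificationGroup L P (i + 1))) /
    Nat.card (ramificationGroup (K := K) L P 0)

end Wild

/-- The smallest prime number different from the residue characteristic of `q`. -/
def auxPrime (q : HeightOneSpectrum (𝓞 K)) : ℕ :=
  open scoped Classical in if (2 : 𝓞 K) ∈ q.asIdeal then 3 else 2

/-- The wild part of the conductor exponent of `W` at `q`; it does not depend on the choice of the
prime `P` above `q`. -/
def wildExponent (W : WeierstrassCurve K) (q : HeightOneSpectrum (𝓞 K)) : ℕ :=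
  wildExponentAux (divisionField W (auxPrime q)) W (auxPrime q)
    (Classical.arbitrary (q.asIdeal.primesOver (𝓞 (divisionField W (auxPrime q))))).1

open scoped Classical in
/-- The conductor exponent of `W` at `q`: `0` for good reduction, `1` for multiplicative reduction,
and `2` plus the wild part for additive reduction. -/
def conductorExponent (W : WeierstrassCurve K) (q : HeightOneSpectrum (𝓞 K)) : ℕ :=
  if HasGoodReductionAt W q then 0
  else if HasMultiplicativeReductionAt W q then 1
  else 2 + wildExponent W q

/-- The conductor of `W` (an elliptic curve), an ideal of the ring of integers. -/
def conductor (W : WeierstrassCurve K) : Ideal (𝓞 K) :=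
  ∏ᶠ q : HeightOneSpectrum (𝓞 K), q.asIdeal ^ conductorExponent W q

end NumberField

end

end GoodTwist

set_option linter.unusedSectionVars false
set_option linter.unusedSimpArgs false

/-! The point of order two puts `E` in the form y² = x(x² + ax + b). Since the class number is one,
the pair (a, b) can be chosen integral and minimal at every prime at once under (a, b) ↦ (u²a, u⁴b)
(`exists_isMinimalAt`). If a quadratic twist has good reduction at 𝔭, a factor δ ∈ {1, π} splits off
from a, and δ² from b (`exists_of_quadraticTwist`); after that b and a² − 4b are units at all primes
not above 2.

At a prime above 2 the relation B²(A² − 4B) = 2⁸Δ and the position of the point of order two leave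
few possibilities. Ordinary reduction gives b and a² − 4b the valuations of (16, 1) or of (1, 256);
supersingular reduction requires 2 = ωτ² and gives those of (1, 4) (`valuation_of_unramified`,
`valuation_of_ramified`). So b and a² − 4b are known up to units, and a, halved where it is even,
solves a² = ε + 64η or a² = ε + η with units ε, η, or a mixed equation when 2 splits and its two
prime factors behave differently. Units of an imaginary quadratic field are roots of unity, so norms
settle these equations. The first and the mixed one force √-7 ∈ K (`exists_of_sq_eq_add`,
`exists_of_mixed`). The supersingular one leads to √-2; its solutions with a ≠ 0 over ℚ(i)
contradict the local equations. For a = 0 only ℚ(i) survives.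

Each solution is an explicit curve depending on one parameter: D = unit · δ, or b itself if a = 0.
Good reduction above 2 becomes a congruence modulo 4 or 8 for this parameter. No unit satisfies it,
so D generates 𝔭, and b is π or π³.

It remains to identify the invariants. Additive reduction at 𝔭 follows from the integrality of j and
from a valuation of b that is not divisible by 4. The conductor has no wild part, because all
automorphisms of K(E[2])/K are involutions and an involution cannot lie in the first ramification
group at a prime not above 2.

Complex multiplication is derived from explicit rational maps. An algebraic endomorphism is
generically (x, y) ↦ (R(x), yS(x)), and it multiplies dx/y by the function R'/S. A degree count
shows that this function is a constant, the multiplier (`Rep.exists_mult`), and multipliers embed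
the endomorphism ring in the ground field. The degree is multiplicative and obeys the parallelogram
law, so each multiplier is a root of an integral monic quadratic polynomial. Hence one irrational
multiplier in K makes the whole ring an order of K. Such a multiplier is obtained by composing the
quotient by a point of order two with an isomorphism back to the curve, or, for j = 12³, from the
automorphism of order 4. -/

namespace GoodTwist

noncomputable section

open Polynomial Filter
open scoped Classical

/-! ### Points of `y² = x (x² + a x + b)` -/

section Points

variable {F : Type*} [Field F]

/-- The points of `y² = x (x² + A x + B)`. -/
abbrev Pt (A B : F) : Type _ := (curveAB A B).toAffine.Point

theorem equation_curveAB {A B x y : F} :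
    (curveAB A B).toAffine.Equation x y ↔ y ^ 2 = x ^ 3 + A * x ^ 2 + B * x := by
  rw [WeierstrassCurve.Affine.equation_iff]
  simp [curveAB]

theorem negY_curveAB {A B x y : F} : (curveAB A B).toAffine.negY x y = -y := by
  simp [curveAB, WeierstrassCurve.Affine.negY]

theorem delta_curveAB (A B : F) : (curveAB A B).Δ = 16 * B ^ 2 * (A ^ 2 - 4 * B) := by
  simp only [curveAB, WeierstrassCurve.Δ, WeierstrassCurve.b₂, WeierstrassCurve.b₄,
    WeierstrassCurve.b₆, WeierstrassCurve.b₈]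
  ring

/-- The parameters of a nonsingular curve `y² = x (x² + A x + B)`. -/
structure Smooth (A B : F) : Prop where
  left : B ≠ 0
  right : A ^ 2 - 4 * B ≠ 0

variable [CharZero F]

theorem nonsingular_curveAB {A B : F} (h : Smooth A B) {x y : F} :
    (curveAB A B).toAffine.Nonsingular x y ↔ y ^ 2 = x ^ 3 + A * x ^ 2 + B * x := by
  rw [← WeierstrassCurve.Affine.equation_iff_nonsingular_of_Δ_ne_zero, equation_curveAB]
  rw [delta_curveAB]
  exact mul_ne_zero (mul_ne_zero (by norm_num) (pow_ne_zero 2 h.1)) h.2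

/-- The point with given coordinates. -/
def mkPt {A B : F} (h : Smooth A B) (x y : F) (hxy : y ^ 2 = x ^ 3 + A * x ^ 2 + B * x) : Pt A B :=
  .some x y ((nonsingular_curveAB h).2 hxy)

variable {A B : F} (h : Smooth A B)

include h in
theorem pt_cases (P : Pt A B) : P = 0 ∨ ∃ x y hxy, P = mkPt h x y hxy := by
  rcases P with _ | ⟨x, y, hxy⟩
  · exact .inl rfl
  · exact .inr ⟨x, y, (nonsingular_curveAB h).1 hxy, rfl⟩

variable {h}

theorem mkPt_ne_zero {x y : F} (hxy) : mkPt h x y hxy ≠ 0 :=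
  WeierstrassCurve.Affine.Point.some_ne_zero _

theorem mkPt_inj {x y x' y' : F} {hxy hxy'} :
    mkPt h x y hxy = mkPt h x' y' hxy' ↔ x = x' ∧ y = y' := by
  simp [mkPt]

theorem mkPt_congr {x y x' y' : F} {hxy} (hx : x = x') (hy : y = y') :
    mkPt h x y hxy = mkPt h x' y' (by rw [← hx, ← hy, hxy]) := by
  subst hx hy; rfl

theorem neg_mkPt {x y : F} (hxy) :
    -mkPt h x y hxy = mkPt h x (-y) (by rw [neg_sq]; exact hxy) := by
  simp only [mkPt, WeierstrassCurve.Affine.Point.neg_some, negY_curveAB]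

theorem mkPt_add_neg {x y : F} (hxy) (hxy') : mkPt h x y hxy + mkPt h x (-y) hxy' = 0 := by
  rw [← neg_mkPt hxy, add_neg_cancel]

/-- The chord law: `l` is the slope of the line through the two points. -/
theorem mkPt_add_of_ne {x₁ y₁ x₂ y₂ x₃ y₃ l : F} {h₁ h₂} (hx : x₁ ≠ x₂)
    (hl : l * (x₁ - x₂) = y₁ - y₂) (hx₃ : x₃ = l ^ 2 - A - x₁ - x₂)
    (hy₃ : y₃ = -(l * (x₃ - x₁) + y₁)) :
    ∃ h₃, mkPt h x₁ y₁ h₁ + mkPt h x₂ y₂ h₂ = mkPt h x₃ y₃ h₃ := by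
  have hs : (curveAB A B).toAffine.slope x₁ x₂ y₁ y₂ = l := by
    rw [WeierstrassCurve.Affine.slope_of_X_ne hx, ← hl, mul_div_cancel_right₀ _ (sub_ne_zero.2 hx)]
  have hX : (curveAB A B).toAffine.addX x₁ x₂ l = x₃ := by
    simp only [WeierstrassCurve.Affine.addX, curveAB, hx₃]; ring
  have hY : (curveAB A B).toAffine.addY x₁ x₂ y₁ l = y₃ := by
    simp only [WeierstrassCurve.Affine.addY, WeierstrassCurve.Affine.negAddY, negY_curveAB, hX, hy₃]
  have key := WeierstrassCurve.Affine.Point.add_of_X_ne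
    (h₁ := (nonsingular_curveAB h).2 h₁) (h₂ := (nonsingular_curveAB h).2 h₂) hx
  refine ⟨?_, ?_⟩
  · rw [← nonsingular_curveAB h, ← hX, ← hY, ← hs]
    exact WeierstrassCurve.Affine.nonsingular_add ((nonsingular_curveAB h).2 h₁)
      ((nonsingular_curveAB h).2 h₂) (fun hxy => hx hxy.1)
  · unfold mkPt
    rw [key]
    simp only [hs, hX, hY]

/-- The tangent law. -/
theorem mkPt_add_self {x y x₃ y₃ l : F} {h₁} (hy : y ≠ 0)
    (hl : l * (2 * y) = 3 * x ^ 2 + 2 * A * x + B) (hx₃ : x₃ = l ^ 2 - A - x - x)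
    (hy₃ : y₃ = -(l * (x₃ - x) + y)) :
    ∃ h₃, mkPt h x y h₁ + mkPt h x y h₁ = mkPt h x₃ y₃ h₃ := by
  have hne : y ≠ (curveAB A B).toAffine.negY x y := by
    rw [negY_curveAB]
    intro h0
    exact hy (self_eq_neg.mp h0)
  have hs : (curveAB A B).toAffine.slope x x y y = l := by
    rw [WeierstrassCurve.Affine.slope_of_Y_ne rfl hne, negY_curveAB]
    have h2 : y - -y ≠ 0 := by
      rw [sub_neg_eq_add, ← two_mul]; exact mul_ne_zero two_ne_zero hy
    rw [div_eq_iff h2]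
    simp only [curveAB]
    linear_combination -hl
  have hX : (curveAB A B).toAffine.addX x x l = x₃ := by
    simp only [WeierstrassCurve.Affine.addX, curveAB, hx₃]; ring
  have hY : (curveAB A B).toAffine.addY x x y l = y₃ := by
    simp only [WeierstrassCurve.Affine.addY, WeierstrassCurve.Affine.negAddY, negY_curveAB, hX, hy₃]
  have key := WeierstrassCurve.Affine.Point.add_self_of_Y_ne
    (h₁ := (nonsingular_curveAB h).2 h₁) hne
  refine ⟨?_, ?_⟩
  · rw [← nonsingular_curveAB h, ← hX, ← hY, ← hs]
    exact WeierstrassCurve.Affine.nonsingular_add ((nonsingular_curveAB h).2 h₁)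
      ((nonsingular_curveAB h).2 h₁) (fun hxy => hne hxy.2)
  · unfold mkPt
    rw [key]
    simp only [hs, hX, hY]

theorem eq_or_eq_neg_of_mkPt {x y₁ y₂ : F} (h₁ h₂) :
    mkPt h x y₁ h₁ = mkPt h x y₂ h₂ ∨ mkPt h x y₁ h₁ = -mkPt h x y₂ h₂ := by
  rw [neg_mkPt, mkPt_inj, mkPt_inj]
  rcases sq_eq_sq_iff_eq_or_eq_neg.1 (h₁.trans h₂.symm) with h | h <;> simp [h]

end Points

/-! ### Homomorphisms determined by their values at almost all points. -/

section Generic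

/-- A map of abelian groups that is additive at `(P, R)` for all `P` and almost all `R` is
additive. -/
theorem map_add_of_cofinite {G H : Type*} [AddCommGroup G] [Infinite G] [AddCommGroup H]
    (φ : G → H) (hφ : ∀ P, ∀ᶠ R in cofinite, φ (P + R) = φ P + φ R) (P Q : G) :
    φ (P + Q) = φ P + φ Q := by
  -- The value φ(P + Q + R) is expanded in two ways for an R that avoids three finite sets; such an
  -- R exists because G is infinite.
  have h3 : ∀ᶠ R in cofinite, φ (P + (Q + R)) = φ P + φ (Q + R) :=
    (add_right_injective Q).tendsto_cofinite.eventually (hφ P)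
  obtain ⟨R, ⟨h1, h2⟩, h3⟩ := (((hφ (P + Q)).and (hφ Q)).and h3).exists
  rw [← add_assoc, h1, h2, ← add_assoc] at h3
  exact add_right_cancel h3

/-- Two homomorphisms that agree almost everywhere are equal. -/
theorem hom_eq_of_cofinite {G H : Type*} [AddCommGroup G] [Infinite G] [AddCommGroup H]
    {φ ψ : G →+ H} (hφ : ∀ᶠ R in cofinite, φ R = ψ R) : φ = ψ := by
  ext P
  have h3 : ∀ᶠ R in cofinite, φ (P + R) = ψ (P + R) :=
    (add_right_injective P).tendsto_cofinite.eventually hφ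
  obtain ⟨R, h1, h2⟩ := (hφ.and h3).exists
  rw [map_add, map_add, h1] at h2
  exact add_right_cancel h2

end Generic

/-! ### The abscissa as a finite-to-one map. -/

section AlgClosed

variable {F : Type*} [Field F] [CharZero F] {A B : F}

/-- The `x`-coordinate of a point, `0` for the point at infinity. -/
def xc : Pt A B → F
  | .zero => 0
  | .some x _ _ => x

theorem xc_mkPt {h : Smooth A B} {x y : F} (hxy) : xc (mkPt h x y hxy) = x := rfl

omit [CharZero F] in
theorem exists_y [IsAlgClosed F] (A B x : F) : ∃ y, y ^ 2 = x ^ 3 + A * x ^ 2 + B * x :=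
  IsAlgClosed.exists_pow_nat_eq _ (by norm_num)

theorem finite_preimage_xc (h : Smooth A B) (x : F) : (xc ⁻¹' {x} : Set (Pt A B)).Finite := by
  have : (xc ⁻¹' {x} : Set (Pt A B)) ⊆ {0} ∪ {P | ∃ y hxy, P = mkPt h x y hxy} := by
    intro P hP
    rcases pt_cases h P with rfl | ⟨x', y, hxy, rfl⟩
    · exact .inl rfl
    · rw [Set.mem_preimage, xc_mkPt, Set.mem_singleton_iff] at hP
      subst hP
      exact .inr ⟨y, hxy, rfl⟩
  refine Set.Finite.subset (Set.Finite.union (Set.finite_singleton _) ?_) this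
  by_cases hne : ∃ y, y ^ 2 = x ^ 3 + A * x ^ 2 + B * x
  · obtain ⟨y, hy⟩ := hne
    refine Set.Finite.subset (Set.toFinite {mkPt h x y hy, -mkPt h x y hy}) ?_
    rintro P ⟨y', hy', rfl⟩
    exact eq_or_eq_neg_of_mkPt hy' hy
  · convert Set.finite_empty
    ext P
    simp only [Set.mem_ofPred_eq, Set.mem_empty_iff_false, iff_false]
    rintro ⟨y, hy, -⟩
    exact hne ⟨y, hy⟩

theorem tendsto_xc (h : Smooth A B) : Tendsto (xc : Pt A B → F) cofinite cofinite :=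
  Tendsto.cofinite_of_finite_preimage_singleton (finite_preimage_xc h)

theorem surjective_xc [IsAlgClosed F] (h : Smooth A B) : Function.Surjective (xc : Pt A B → F) := by
  intro x
  obtain ⟨y, hxy⟩ := exists_y A B x
  exact ⟨mkPt h x y hxy, xc_mkPt hxy⟩

theorem infinite_pt [IsAlgClosed F] (h : Smooth A B) : Infinite (Pt A B) :=
  haveI := CharZero.infinite F
  Infinite.of_surjective xc (surjective_xc h)

omit [CharZero F] in
theorem eventually_eval_ne_zero {p : F[X]} (hp : p ≠ 0) : ∀ᶠ x in cofinite, p.eval x ≠ 0 := by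
  rw [eventually_cofinite]
  simpa using Polynomial.finite_setOfPred_isRoot hp

theorem eq_zero_of_eventually_eval {p : F[X]} (hp : ∀ᶠ x in cofinite, p.eval x = 0) : p = 0 := by
  by_contra hne
  have := CharZero.infinite F
  obtain ⟨x, h1, h2⟩ := (hp.and (eventually_eval_ne_zero hne)).exists
  exact h2 h1

/-- The abscissa is surjective with finite fibres, so generic statements about points become generic
statements about x ∈ F. -/
theorem eventually_mkPt [IsAlgClosed F] (h : Smooth A B) {p : Pt A B → Prop} :
    (∀ᶠ P in cofinite, p P) ↔ ∀ᶠ x in cofinite, ∀ y hxy, p (mkPt h x y hxy) := by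
  constructor
  · intro hp
    rw [eventually_cofinite] at hp ⊢
    refine (hp.image xc).subset fun x hx => ?_
    simp only [Set.mem_ofPred_eq, not_forall] at hx
    obtain ⟨y, hxy, hn⟩ := hx
    exact ⟨_, hn, rfl⟩
  · intro hp
    have h0 : ∀ᶠ P : Pt A B in cofinite, P ≠ 0 := by
      rw [eventually_cofinite]; simp
    filter_upwards [(tendsto_xc h).eventually hp, h0] with P hP hP0
    rcases pt_cases h P with rfl | ⟨x', y, hxy, rfl⟩
    · exact absurd rfl hP0
    · exact hP y hxy

end AlgClosed

/-! ### Values and derivatives of rational functions -/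

section RatFuncValues

variable {F : Type*} [Field F]

/-- The rational function `R` is regular at `x` with value `v`. -/
def EvAt (R : RatFunc F) (x v : F) : Prop :=
  ∃ n d : F[X], d.eval x ≠ 0 ∧ R * algebraMap F[X] (RatFunc F) d = algebraMap F[X] (RatFunc F) n ∧
    n.eval x = v * d.eval x

theorem algebraMap_ratFunc_ne_zero {p : F[X]} (hp : p ≠ 0) :
    algebraMap F[X] (RatFunc F) p ≠ 0 :=
  RatFunc.algebraMap_ne_zero hp

theorem evAt_poly (p : F[X]) (x : F) : EvAt (algebraMap F[X] (RatFunc F) p) x (p.eval x) :=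
  ⟨p, 1, by simp, by simp, by simp⟩

theorem evAt_C (c x : F) : EvAt (algebraMap F[X] (RatFunc F) (C c)) x c := by
  simpa using evAt_poly (C c) x

theorem EvAt.add {R S : RatFunc F} {x v w : F} (hR : EvAt R x v) (hS : EvAt S x w) :
    EvAt (R + S) x (v + w) := by
  obtain ⟨n, d, hd, h1, h2⟩ := hR
  obtain ⟨n', d', hd', h1', h2'⟩ := hS
  refine ⟨n * d' + n' * d, d * d', by simp [hd, hd'], ?_, ?_⟩
  · simp only [map_mul, map_add]
    linear_combination algebraMap F[X] (RatFunc F) d' * h1 + algebraMap F[X] (RatFunc F) d * h1'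
  · simp only [eval_mul, eval_add]
    linear_combination d'.eval x * h2 + d.eval x * h2'

theorem EvAt.mul {R S : RatFunc F} {x v w : F} (hR : EvAt R x v) (hS : EvAt S x w) :
    EvAt (R * S) x (v * w) := by
  obtain ⟨n, d, hd, h1, h2⟩ := hR
  obtain ⟨n', d', hd', h1', h2'⟩ := hS
  refine ⟨n * n', d * d', by simp [hd, hd'], ?_, ?_⟩
  · simp only [map_mul]
    rw [← h1, ← h1']; ring
  · simp only [eval_mul]
    rw [h2, h2']; ring

theorem EvAt.neg {R : RatFunc F} {x v : F} (hR : EvAt R x v) : EvAt (-R) x (-v) := by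
  obtain ⟨n, d, hd, h1, h2⟩ := hR
  exact ⟨-n, d, hd, by rw [map_neg, ← h1]; ring, by rw [eval_neg, h2]; ring⟩

theorem EvAt.sub {R S : RatFunc F} {x v w : F} (hR : EvAt R x v) (hS : EvAt S x w) :
    EvAt (R - S) x (v - w) := by
  simpa only [sub_eq_add_neg] using hR.add hS.neg

theorem EvAt.pow {R : RatFunc F} {x v : F} (hR : EvAt R x v) (k : ℕ) : EvAt (R ^ k) x (v ^ k) := by
  induction k with
  | zero => simpa using evAt_poly (1 : F[X]) x
  | succ k ih => simpa only [pow_succ] using ih.mul hR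

theorem EvAt.inv {R : RatFunc F} {x v : F} (hR : EvAt R x v) (hv : v ≠ 0) : EvAt R⁻¹ x v⁻¹ := by
  obtain ⟨n, d, hd, h1, h2⟩ := hR
  have hn : n.eval x ≠ 0 := by rw [h2]; exact mul_ne_zero hv hd
  have hn0 : n ≠ 0 := by rintro rfl; simp at hn
  have hR0 : R ≠ 0 := by
    rintro rfl
    rw [zero_mul] at h1
    exact algebraMap_ratFunc_ne_zero hn0 h1.symm
  refine ⟨d, n, hn, ?_, ?_⟩
  · rw [← h1]; field_simp
  · rw [h2]; field_simp

theorem EvAt.div {R S : RatFunc F} {x v w : F} (hR : EvAt R x v) (hS : EvAt S x w) (hw : w ≠ 0) :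
    EvAt (R / S) x (v / w) := by
  simpa only [div_eq_mul_inv] using hR.mul (hS.inv hw)

theorem EvAt.congr {R : RatFunc F} {x v w : F} (hR : EvAt R x v) (h : v = w) : EvAt R x w := h ▸ hR

theorem evAt_zero_iff {R : RatFunc F} {x v : F} (hR : EvAt R x v) (h0 : R = 0) : v = 0 := by
  obtain ⟨n, d, hd, h1, h2⟩ := hR
  rw [h0, zero_mul, eq_comm, map_eq_zero_iff _ (RatFunc.algebraMap_injective F)] at h1
  rw [h1, eval_zero, eq_comm, mul_eq_zero] at h2
  exact h2.resolve_right hd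

theorem EvAt.unique {R : RatFunc F} {x v w : F} (hv : EvAt R x v) (hw : EvAt R x w) : v = w :=
  sub_eq_zero.1 (evAt_zero_iff (hv.sub hw) (sub_self R))

theorem mul_denom (R : RatFunc F) :
    R * algebraMap F[X] (RatFunc F) R.denom = algebraMap F[X] (RatFunc F) R.num := by
  have h := RatFunc.num_div_denom R
  rwa [div_eq_iff (algebraMap_ratFunc_ne_zero (RatFunc.denom_ne_zero R)), eq_comm] at h

theorem EvAt.num_denom {R : RatFunc F} {x v : F} (hR : EvAt R x v) :
    R.num.eval x = v * R.denom.eval x := by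
  obtain ⟨n, d, hd, h1, h2⟩ := hR
  have h3 : R.num * d = n * R.denom := by
    apply RatFunc.algebraMap_injective F
    rw [map_mul, map_mul, ← h1, ← mul_denom R]
    ring
  have h4 := congrArg (eval x) h3
  simp only [eval_mul, h2] at h4
  apply mul_right_cancel₀ hd
  rw [h4]; ring

theorem evAt_of_denom {R : RatFunc F} {x : F} (hx : R.denom.eval x ≠ 0) :
    EvAt R x (R.num.eval x / R.denom.eval x) := by
  exact ⟨R.num, R.denom, hx, mul_denom R, (div_mul_cancel₀ _ hx).symm⟩

theorem eventually_denom (R : RatFunc F) : ∀ᶠ x in cofinite, R.denom.eval x ≠ 0 :=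
  eventually_eval_ne_zero (RatFunc.denom_ne_zero R)

theorem eventually_evAt (R : RatFunc F) : ∀ᶠ x in cofinite, ∃ v, EvAt R x v :=
  (eventually_denom R).mono fun _ hx => ⟨_, evAt_of_denom hx⟩

theorem eventually_ne_zero_of_evAt {R : RatFunc F} (hR : R ≠ 0) :
    ∀ᶠ x in cofinite, ∀ v, EvAt R x v → v ≠ 0 := by
  have : R.num ≠ 0 := by rwa [Ne, RatFunc.num_eq_zero_iff]
  filter_upwards [eventually_eval_ne_zero this] with x hx v hv h0
  rw [hv.num_denom, h0, zero_mul] at hx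
  exact hx rfl

theorem eq_zero_of_evAt [CharZero F] {R : RatFunc F} (hR : ∀ᶠ x in cofinite, EvAt R x 0) :
    R = 0 := by
  rw [← RatFunc.num_eq_zero_iff]
  refine eq_zero_of_eventually_eval (hR.mono fun x hx => ?_)
  rw [hx.num_denom, zero_mul]

theorem eq_of_evAt [CharZero F] {R S : RatFunc F}
    (hR : ∀ᶠ x in cofinite, ∃ v, EvAt R x v ∧ EvAt S x v) : R = S := by
  refine sub_eq_zero.1 (eq_zero_of_evAt (hR.mono fun x hx => ?_))
  obtain ⟨v, h1, h2⟩ := hx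
  simpa using h1.sub h2

/-- A nonconstant rational function takes every value finitely often. -/
theorem eventually_ne_of_evAt [CharZero F] {R : RatFunc F} (c : F)
    (hR : R ≠ algebraMap F[X] (RatFunc F) (C c)) :
    ∀ᶠ x in cofinite, ∀ v, EvAt R x v → v ≠ c := by
  filter_upwards [eventually_ne_zero_of_evAt (sub_ne_zero.2 hR)] with x hx v hv h0
  exact hx _ (hv.sub (evAt_C c x)) (by rw [h0, sub_self])

/-- The ring homomorphism `R ↦ (R, R')`. -/
def derivHom (F : Type*) [Field F] : RatFunc F →+* TrivSqZeroExt (RatFunc F) (RatFunc F) :=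
  -- Universal property of the fraction field, applied to p ↦ p + p'ε with values in the dual
  -- numbers, where an element is invertible as soon as its first component is.
  IsLocalization.lift (M := nonZeroDivisors F[X])
    (g := { toFun := fun p => (TrivSqZeroExt.inl (algebraMap F[X] (RatFunc F) p) +
              TrivSqZeroExt.inr (algebraMap F[X] (RatFunc F) (derivative p)))
            map_one' := by simp
            map_zero' := by simp
            map_add' := fun p q => by
              ext
              · simp
              · simp only [derivative_add, map_add, TrivSqZeroExt.snd_add, TrivSqZeroExt.snd_inl,
                  TrivSqZeroExt.snd_inr, zero_add]
            map_mul' := fun p q => by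
              ext
              · simp
              · simp only [derivative_mul, map_add, map_mul, TrivSqZeroExt.snd_add,
                  TrivSqZeroExt.snd_inl, TrivSqZeroExt.snd_inr, TrivSqZeroExt.snd_mul,
                  TrivSqZeroExt.fst_add, TrivSqZeroExt.fst_inl, TrivSqZeroExt.fst_inr,
                  smul_eq_mul, MulOpposite.smul_eq_mul_unop, MulOpposite.unop_op]
                ring })
    (fun p => by
      rw [TrivSqZeroExt.isUnit_iff_isUnit_fst]
      simpa using nonZeroDivisors.ne_zero p.2)

theorem derivHom_poly (p : F[X]) : derivHom F (algebraMap F[X] (RatFunc F) p) =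
    (TrivSqZeroExt.inl (algebraMap F[X] (RatFunc F) p) +
      TrivSqZeroExt.inr (algebraMap F[X] (RatFunc F) (derivative p))) :=
  IsLocalization.lift_eq _ _

theorem fst_derivHom (R : RatFunc F) : (derivHom F R).fst = R := by
  have : (TrivSqZeroExt.fstHom (RatFunc F) (RatFunc F) (RatFunc F) :
      TrivSqZeroExt (RatFunc F) (RatFunc F) →+* RatFunc F).comp (derivHom F) =
      RingHom.id (RatFunc F) := by
    apply IsLocalization.ringHom_ext (nonZeroDivisors F[X])
    apply RingHom.ext
    intro p
    simp only [RingHom.comp_apply, derivHom_poly, RingHom.id_apply]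
    simp
  exact DFunLike.congr_fun this R

/-- The derivative of a rational function. -/
def dr (R : RatFunc F) : RatFunc F := (derivHom F R).snd

theorem dr_poly (p : F[X]) :
    dr (algebraMap F[X] (RatFunc F) p) = algebraMap F[X] (RatFunc F) (derivative p) := by
  simp only [dr, derivHom_poly, TrivSqZeroExt.snd_add, TrivSqZeroExt.snd_inl,
    TrivSqZeroExt.snd_inr, zero_add]

theorem dr_add (R S : RatFunc F) : dr (R + S) = dr R + dr S := by simp [dr]

theorem dr_sub (R S : RatFunc F) : dr (R - S) = dr R - dr S := by simp [dr]

theorem dr_mul (R S : RatFunc F) : dr (R * S) = dr R * S + R * dr S := by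
  simp only [dr, map_mul, TrivSqZeroExt.snd_mul, fst_derivHom, smul_eq_mul,
    MulOpposite.smul_eq_mul_unop, MulOpposite.unop_op]
  ring

theorem dr_C (c : F) : dr (algebraMap F[X] (RatFunc F) (C c)) = 0 := by
  rw [dr_poly, derivative_C, map_zero]

end RatFuncValues

/-! ### Homomorphisms given by rational functions -/

section Rep

variable {F : Type*} [Field F] [CharZero F] [IsAlgClosed F]

/-- The constant rational function. -/
abbrev cst (c : F) : RatFunc F := algebraMap F[X] (RatFunc F) (C c)

/-- The rational function `x³ + A x² + B x`. -/
def fAB (A B : F) : F[X] := X ^ 3 + C A * X ^ 2 + C B * X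

theorem eval_fAB (A B x : F) : (fAB A B).eval x = x ^ 3 + A * x ^ 2 + B * x := by
  simp [fAB]

theorem fAB_ne_zero (A B : F) : fAB A B ≠ 0 := by
  intro h
  have := congrArg (fun p => p.coeff 3) h
  simp [fAB] at this

variable {A B A' B' A'' B'' : F} {h : Smooth A B} {h' : Smooth A' B'} {h'' : Smooth A'' B''}

/-- The homomorphism `φ` is `(x, y) ↦ (R(x), y S(x))` at almost all points. -/
def Rep (h : Smooth A B) (h' : Smooth A' B') (φ : Pt A B →+ Pt A' B') (R S : RatFunc F) : Prop :=
  ∀ᶠ x in cofinite, ∀ y hxy, ∃ x' s hxy', φ (mkPt h x y hxy) = mkPt h' x' (y * s) hxy' ∧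
    EvAt R x x' ∧ EvAt S x s

theorem eventually_y_ne_zero (A B : F) :
    ∀ᶠ x in cofinite, ∀ y : F, y ^ 2 = x ^ 3 + A * x ^ 2 + B * x → y ≠ 0 := by
  filter_upwards [eventually_eval_ne_zero (fAB_ne_zero A B)] with x hx y hy h0
  rw [eval_fAB, ← hy, h0] at hx
  exact hx (by ring)

theorem eventually_evAt_of_ne_cst {R : RatFunc F} (hR : ∀ c, R ≠ cst c) {p : F → Prop}
    (hp : ∀ᶠ v in cofinite, p v) : ∀ᶠ x in cofinite, ∀ v, EvAt R x v → p v := by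
  rw [eventually_cofinite] at hp
  have : ∀ᶠ x in cofinite, ∀ c ∈ {v | ¬ p v}, ∀ v, EvAt R x v → v ≠ c :=
    (Filter.eventually_all_finite hp).2 fun c _ => eventually_ne_of_evAt c (hR c)
  filter_upwards [this] with x hx v hv
  by_contra hn
  exact hx v hn v hv rfl

variable {φ ψ : Pt A B →+ Pt A' B'} {R S R' S' : RatFunc F}

theorem Rep.equation (hφ : Rep h h' φ R S) :
    algebraMap F[X] (RatFunc F) (fAB A B) * S ^ 2 = R ^ 3 + cst A' * R ^ 2 + cst B' * R := by
  apply eq_of_evAt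
  filter_upwards [hφ] with x hx
  obtain ⟨y, hxy⟩ := exists_y A B x
  obtain ⟨x', s, hxy', -, h1, h2⟩ := hx y hxy
  refine ⟨_, (evAt_poly _ x).mul (h2.pow 2), ?_⟩
  refine (((h1.pow 3).add ((evAt_C A' x).mul (h1.pow 2))).add ((evAt_C B' x).mul h1)).congr ?_
  rw [eval_fAB, ← hxy, ← hxy', mul_pow]

theorem Rep.eventually_ne_zero (hφ : Rep h h' φ R S) : ∀ᶠ P in cofinite, φ P ≠ 0 := by
  rw [eventually_mkPt h]
  filter_upwards [hφ] with x hx y hxy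
  obtain ⟨x', s, hxy', h0, -⟩ := hx y hxy
  rw [h0]
  exact mkPt_ne_zero _

theorem Rep.ne_zero (hφ : Rep h h' φ R S) : φ ≠ 0 := by
  rintro rfl
  have := infinite_pt h
  obtain ⟨P, hP⟩ := hφ.eventually_ne_zero.exists
  exact hP rfl

/-- If R were a constant c, almost all points would map to one of the two points of abscissa c. For
a fixed such P and a generic Q, the image of P + Q or of P − Q would then be zero, although generic
images are nonzero. -/
theorem Rep.ne_cst (hφ : Rep h h' φ R S) (c : F) : R ≠ cst c := by
  rintro rfl
  have := infinite_pt h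
  have h1 : ∀ᶠ P in cofinite, ∃ y hxy, φ P = mkPt h' c y hxy := by
    rw [eventually_mkPt h]
    filter_upwards [hφ] with x hx y hxy
    obtain ⟨x', s, hxy', h0, h1, -⟩ := hx y hxy
    obtain rfl := h1.unique (evAt_C c x)
    exact ⟨_, _, h0⟩
  have h0 := hφ.eventually_ne_zero
  obtain ⟨P, y, hxy, hP⟩ := h1.exists
  obtain ⟨Q, ⟨⟨y', hxy', hQ⟩, h2⟩, h3⟩ := ((h1.and
    ((add_right_injective P).tendsto_cofinite.eventually h0)).and
    ((sub_right_injective (b := P)).tendsto_cofinite.eventually h0)).exists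
  rw [map_add] at h2
  rw [map_sub] at h3
  rcases eq_or_eq_neg_of_mkPt hxy hxy' with h4 | h4
  · exact h3 (by rw [hP, hQ, h4, sub_self])
  · exact h2 (by rw [hP, hQ, h4, neg_add_cancel])

theorem cst_injective : Function.Injective (cst : F → RatFunc F) :=
  (RatFunc.algebraMap_injective F).comp C_injective

theorem ne_zero_of_ne_cst (A' B' : F) (hR : ∀ c, R ≠ cst c) :
    R ^ 3 + cst A' * R ^ 2 + cst B' * R ≠ 0 := by
  obtain ⟨d, hd⟩ := IsAlgClosed.exists_pow_nat_eq (A' ^ 2 - 4 * B') (n := 2) (by norm_num)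
  have h2 : (2 : F) ≠ 0 := two_ne_zero
  -- Over an algebraically closed field the cubic splits; no factor vanishes, since R is not
  -- constant.
  have hα : R ^ 3 + cst A' * R ^ 2 + cst B' * R =
      (R - cst 0) * ((R - cst ((-A' + d) / 2)) * (R - cst ((-A' - d) / 2))) := by
    have e1 : cst A' = -(cst ((-A' + d) / 2) + cst ((-A' - d) / 2)) := by
      simp only [cst, ← map_add, ← map_neg]
      congr 2
      field_simp; ring
    have e2 : cst B' = cst ((-A' + d) / 2) * cst ((-A' - d) / 2) := by
      simp only [cst, ← map_mul]
      congr 2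
      field_simp
      linear_combination hd
    rw [e1, e2]
    simp only [cst, map_zero]
    ring
  rw [hα]
  exact mul_ne_zero (sub_ne_zero.2 (hR _))
    (mul_ne_zero (sub_ne_zero.2 (hR _)) (sub_ne_zero.2 (hR _)))

theorem Rep.S_ne_zero (hφ : Rep h h' φ R S) : S ≠ 0 := by
  rintro rfl
  refine ne_zero_of_ne_cst A' B' hφ.ne_cst ?_
  rw [← hφ.equation]
  ring

theorem rep_id : Rep h h (AddMonoidHom.id _) (algebraMap F[X] (RatFunc F) X) 1 := by
  refine Eventually.of_forall fun x y hxy => ⟨x, 1, by simpa using hxy, ?_, ?_, ?_⟩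
  · simp
  · simpa using evAt_poly X x
  · simpa using evAt_poly (1 : F[X]) x

theorem Rep.neg (hφ : Rep h h' φ R S) : Rep h h' (-φ) R (-S) := by
  filter_upwards [hφ] with x hx y hxy
  obtain ⟨x', s, hxy', h0, h1, h2⟩ := hx y hxy
  refine ⟨x', -s, by rw [hxy'.symm]; ring, ?_, h1, h2.neg⟩
  rw [AddMonoidHom.neg_apply, h0, neg_mkPt]
  exact mkPt_congr rfl (by ring)

/-! #### Composition -/

/-- Substitution of a nonconstant rational function. -/
def subst (R : RatFunc F) (hR : ∀ c, R ≠ cst c) : RatFunc F →+* RatFunc F :=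
  IsLocalization.lift (M := nonZeroDivisors F[X])
    (g := (Polynomial.aeval R).toRingHom) (fun p => by
      -- p(R) ≠ 0 for p ≠ 0: the values of a nonconstant R avoid the finitely many roots of p at
      -- almost every x.
      have hp := nonZeroDivisors.ne_zero p.2
      rw [isUnit_iff_ne_zero]
      intro h0
      have := CharZero.infinite F
      have h1 := eventually_evAt_of_ne_cst hR (eventually_eval_ne_zero hp)
      obtain ⟨x, hx, v, hv⟩ := (h1.and (eventually_evAt R)).exists
      refine hx v hv ?_
      have h2 : EvAt (Polynomial.aeval R (p : F[X])) x (eval v (p : F[X])) := by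
        generalize (p : F[X]) = q
        induction q using Polynomial.induction_on' with
        | add p q hp hq => simpa using hp.add hq
        | monomial n a =>
          rw [aeval_monomial, eval_monomial]
          exact (evAt_C a x).mul (hv.pow n)
      exact evAt_zero_iff h2 h0)

theorem subst_poly (hR : ∀ c, R ≠ cst c) (p : F[X]) :
    subst R hR (algebraMap F[X] (RatFunc F) p) = Polynomial.aeval R p :=
  IsLocalization.lift_eq _ _

theorem evAt_aeval {x v : F} (hv : EvAt R x v) (p : F[X]) :
    EvAt (Polynomial.aeval R p) x (eval v p) := by
  induction p using Polynomial.induction_on' with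
  | add p q hp hq => simpa using hp.add hq
  | monomial n a =>
    rw [aeval_monomial, eval_monomial]
    exact (evAt_C a x).mul (hv.pow n)

theorem EvAt.subst (hR : ∀ c, R ≠ cst c) {x v w : F} (hv : EvAt R x v) (hw : EvAt R' v w) :
    EvAt (subst R hR R') x w := by
  obtain ⟨n, d, hd, h1, h2⟩ := hw
  have h3 := congrArg (GoodTwist.subst R hR) h1
  rw [map_mul, subst_poly, subst_poly] at h3
  have hd' := evAt_aeval hv d
  have hd0 : Polynomial.aeval R d ≠ 0 := fun h0 => hd (evAt_zero_iff hd' h0)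
  rw [eq_div_of_mul_eq hd0 h3]
  refine ((evAt_aeval hv n).div hd' hd).congr ?_
  rw [h2, mul_div_cancel_right₀ _ hd]

theorem dr_aeval (R : RatFunc F) (p : F[X]) :
    dr (Polynomial.aeval R p) = Polynomial.aeval R (derivative p) * dr R := by
  induction p using Polynomial.induction_on with
  | C a => simpa using dr_C a
  | add p q hp hq => simp only [map_add, dr_add, hp, hq]; ring
  | monomial n a ih =>
    rw [pow_succ, ← mul_assoc, map_mul, dr_mul, ih, derivative_mul (f := C a * X ^ n),
      derivative_X, mul_one, map_add, map_mul _ (derivative _), aeval_X]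
    ring

/-- Chain rule. It is known for polynomials, and passes to quotients by differentiating R' · denom =
num before and after the substitution. -/
theorem dr_subst (hR : ∀ c, R ≠ cst c) : dr (subst R hR R') = subst R hR (dr R') * dr R := by
  have h1 := mul_denom R'
  have hd : subst R hR (algebraMap F[X] (RatFunc F) R'.denom) ≠ 0 := by
    rw [Ne, map_eq_zero]
    exact algebraMap_ratFunc_ne_zero (RatFunc.denom_ne_zero R')
  have h2 := congrArg dr (congrArg (subst R hR) h1)
  have h3 := congrArg (subst R hR) (congrArg dr h1)
  rw [map_mul, dr_mul] at h2
  rw [dr_mul, map_add, map_mul, map_mul] at h3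
  simp only [subst_poly, dr_aeval, dr_poly] at h2 h3 hd
  apply mul_right_cancel₀ hd
  linear_combination h2 - dr R * h3

theorem subst_cst (hR : ∀ c, R ≠ cst c) (c : F) : subst R hR (cst c) = cst c := by
  rw [cst, subst_poly, aeval_C]
  rfl

theorem Rep.comp {χ : Pt A' B' →+ Pt A'' B''} (hχ : Rep h' h'' χ R' S') (hφ : Rep h h' φ R S) :
    Rep h h'' (χ.comp φ) (subst R hφ.ne_cst R') (S * subst R hφ.ne_cst S') := by
  filter_upwards [hφ, eventually_evAt_of_ne_cst hφ.ne_cst hχ] with x hx hx' y hxy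
  obtain ⟨x', s, hxy', h0, h1, h2⟩ := hx y hxy
  obtain ⟨x'', s', hxy'', h0', h1', h2'⟩ := hx' x' h1 _ hxy'
  refine ⟨x'', s * s', by rw [← hxy'']; ring, ?_, h1.subst _ h1', h2.mul (h1.subst _ h2')⟩
  rw [AddMonoidHom.comp_apply, h0, h0']
  exact mkPt_congr rfl (by ring)

/-- `φ` acts as multiplication by `a` on invariant differentials. -/
def HasMult (h : Smooth A B) (h' : Smooth A' B') (φ : Pt A B →+ Pt A' B') (a : F) : Prop :=
  (φ = 0 ∧ a = 0) ∨ ∃ R S, Rep h h' φ R S ∧ dr R = cst a * S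

theorem hasMult_zero : HasMult h h' (0 : Pt A B →+ Pt A' B') 0 := .inl ⟨rfl, rfl⟩

theorem hasMult_id : HasMult h h (AddMonoidHom.id _) 1 :=
  .inr ⟨_, _, rep_id, by rw [dr_poly, derivative_X]; simp [cst]⟩

theorem HasMult.neg {a : F} (hφ : HasMult h h' φ a) : HasMult h h' (-φ) (-a) := by
  rcases hφ with ⟨rfl, rfl⟩ | ⟨R, S, h1, h2⟩
  · exact .inl (by simp)
  · refine .inr ⟨R, -S, h1.neg, ?_⟩
    rw [h2]; simp [cst]

theorem HasMult.comp {χ : Pt A' B' →+ Pt A'' B''} {a b : F} (hχ : HasMult h' h'' χ b)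
    (hφ : HasMult h h' φ a) : HasMult h h'' (χ.comp φ) (b * a) := by
  rcases hφ with ⟨rfl, rfl⟩ | ⟨R, S, h1, h2⟩
  · exact .inl (by simp)
  rcases hχ with ⟨rfl, rfl⟩ | ⟨R', S', h1', h2'⟩
  · exact .inl (by simp)
  refine .inr ⟨_, _, h1'.comp h1, ?_⟩
  rw [dr_subst, h2', h2, map_mul, subst_cst]
  simp only [cst, map_mul]
  ring

end Rep

/-! #### Sums -/

section RepAdd

variable {F : Type*} [Field F] [CharZero F] [IsAlgClosed F]
  {A B A' B' : F} {h : Smooth A B} {h' : Smooth A' B'} {φ ψ : Pt A B →+ Pt A' B'}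
  {R S R₁ S₁ R₂ S₂ : RatFunc F}

/-- Derivative of `Rep.equation` with one factor S cancelled; it supplies S' when the derivative of
a sum of maps is computed. -/
theorem Rep.deriv_equation (hφ : Rep h h' φ R S) {a : RatFunc F} (ha : dr R = a * S) :
    dr (algebraMap F[X] (RatFunc F) (fAB A B)) * S +
      2 * algebraMap F[X] (RatFunc F) (fAB A B) * dr S =
        a * (3 * R ^ 2 + 2 * cst A' * R + cst B') := by
  have h1 := congrArg dr hφ.equation
  simp only [pow_succ, pow_zero, one_mul, dr_add, dr_mul, dr_C, ha] at h1
  apply mul_right_cancel₀ hφ.S_ne_zero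
  linear_combination h1

/-- Chord law for generic points: the slope is y · l, so y enters the abscissa only through y² = x³
+ Ax² + Bx, and the ordinate is again y times a function of x. -/
theorem Rep.add (hφ : Rep h h' φ R₁ S₁) (hψ : Rep h h' ψ R₂ S₂) (hne : R₁ ≠ R₂)
    {l R₃ S₃ : RatFunc F} (hl : l = (S₁ - S₂) / (R₁ - R₂))
    (hR₃ : R₃ = algebraMap F[X] (RatFunc F) (fAB A B) * l ^ 2 - cst A' - R₁ - R₂)
    (hS₃ : S₃ = -(l * (R₃ - R₁) + S₁)) : Rep h h' (φ + ψ) R₃ S₃ := by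
  filter_upwards [hφ, hψ, eventually_ne_zero_of_evAt (sub_ne_zero.2 hne)] with x hx₁ hx₂ hx y hxy
  obtain ⟨x₁, s₁, hxy₁, e₁, r₁, t₁⟩ := hx₁ y hxy
  obtain ⟨x₂, s₂, hxy₂, e₂, r₂, t₂⟩ := hx₂ y hxy
  have hne' := hx _ (r₁.sub r₂)
  have el : EvAt l x ((s₁ - s₂) / (x₁ - x₂)) := hl ▸ (t₁.sub t₂).div (r₁.sub r₂) hne'
  have er := hR₃ ▸ ((((evAt_poly (fAB A B) x).mul (el.pow 2)).sub (evAt_C A' x)).sub r₁).sub r₂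
  have es := hS₃ ▸ ((el.mul (er.sub r₁)).add t₁).neg
  obtain ⟨h₃, e₃⟩ := mkPt_add_of_ne (h := h') (h₁ := hxy₁) (h₂ := hxy₂)
    (l := y * ((s₁ - s₂) / (x₁ - x₂))) (sub_ne_zero.1 hne') (by field_simp) rfl rfl
  rw [AddMonoidHom.add_apply, e₁, e₂, e₃]
  have hX : (y * ((s₁ - s₂) / (x₁ - x₂))) ^ 2 - A' - x₁ - x₂ =
      eval x (fAB A B) * ((s₁ - s₂) / (x₁ - x₂)) ^ 2 - A' - x₁ - x₂ := by
    rw [eval_fAB, mul_pow, hxy]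
  have hY := mkPt_congr (h := h') (hxy := h₃) hX (y' := y * -((s₁ - s₂) / (x₁ - x₂) *
    (eval x (fAB A B) * ((s₁ - s₂) / (x₁ - x₂)) ^ 2 - A' - x₁ - x₂ - x₁) + s₁)) (by rw [hX]; ring)
  exact ⟨_, _, _, hY, er, es⟩

theorem Rep.add_self (hφ : Rep h h' φ R S) {l R₃ S₃ : RatFunc F}
    (hl : l = (3 * R ^ 2 + 2 * cst A' * R + cst B') /
      (2 * algebraMap F[X] (RatFunc F) (fAB A B) * S))
    (hR₃ : R₃ = algebraMap F[X] (RatFunc F) (fAB A B) * l ^ 2 - cst A' - R - R)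
    (hS₃ : S₃ = -(l * (R₃ - R) + S)) : Rep h h' (φ + φ) R₃ S₃ := by
  filter_upwards [hφ, eventually_ne_zero_of_evAt hφ.S_ne_zero, eventually_y_ne_zero A B]
    with x hx₁ hs hy y hxy
  obtain ⟨x₁, s₁, hxy₁, e₁, r₁, t₁⟩ := hx₁ y hxy
  have hs := hs _ t₁
  have hy := hy y hxy
  have c2 : EvAt (2 : RatFunc F) x 2 := by simpa [map_ofNat] using evAt_poly (C (2 : F)) x
  have c3 : EvAt (3 : RatFunc F) x 3 := by simpa [map_ofNat] using evAt_poly (C (3 : F)) x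
  have hf : eval x (fAB A B) = y ^ 2 := by rw [eval_fAB, hxy]
  have hd : 2 * eval x (fAB A B) * s₁ ≠ 0 := by
    rw [hf]; exact mul_ne_zero (mul_ne_zero two_ne_zero (pow_ne_zero 2 hy)) hs
  have el := hl ▸ (((c3.mul (r₁.pow 2)).add ((c2.mul (evAt_C A' x)).mul r₁)).add
    (evAt_C B' x)).div ((c2.mul (evAt_poly (fAB A B) x)).mul t₁) hd
  set m := (3 * x₁ ^ 2 + 2 * A' * x₁ + B') / (2 * eval x (fAB A B) * s₁) with hm
  have er := hR₃ ▸ ((((evAt_poly (fAB A B) x).mul (el.pow 2)).sub (evAt_C A' x)).sub r₁).sub r₁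
  have es := hS₃ ▸ ((el.mul (er.sub r₁)).add t₁).neg
  obtain ⟨h₃, e₃⟩ := mkPt_add_self (h := h') (h₁ := hxy₁)
    (l := y * m) (mul_ne_zero hy hs) (by rw [hm, hf]; field_simp) rfl rfl
  rw [AddMonoidHom.add_apply, e₁, e₃]
  have hX : (y * m) ^ 2 - A' - x₁ - x₁ = eval x (fAB A B) * m ^ 2 - A' - x₁ - x₁ := by
    rw [hf, mul_pow]
  have hY := mkPt_congr (h := h') (hxy := h₃) hX (y' := y * -(m *
    (eval x (fAB A B) * m ^ 2 - A' - x₁ - x₁ - x₁) + s₁)) (by rw [hX]; ring)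
  exact ⟨_, _, _, hY, er, es⟩

/-- The equation of the target determines S² from R, hence S up to sign. -/
theorem Rep.eq_or_eq_neg (hφ : Rep h h' φ R S₁) (hψ : Rep h h' ψ R S₂) : φ = ψ ∨ φ = -ψ := by
  have := infinite_pt h
  have h1 : (S₁ - S₂) * (S₁ + S₂) = 0 := by
    apply mul_left_cancel₀ (algebraMap_ratFunc_ne_zero (fAB_ne_zero A B))
    linear_combination hφ.equation - hψ.equation
  have key : ∀ {ψ : Pt A B →+ Pt A' B'} {S : RatFunc F}, Rep h h' φ R S → Rep h h' ψ R S →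
      φ = ψ := by
    intro ψ S hφ hψ
    apply hom_eq_of_cofinite
    rw [eventually_mkPt h]
    filter_upwards [hφ, hψ] with x hx₁ hx₂ y hxy
    obtain ⟨x₁, s₁, hxy₁, e₁, r₁, t₁⟩ := hx₁ y hxy
    obtain ⟨x₂, s₂, hxy₂, e₂, r₂, t₂⟩ := hx₂ y hxy
    rw [e₁, e₂]
    exact mkPt_congr (r₁.unique r₂) (by rw [t₁.unique t₂])
  rcases mul_eq_zero.1 h1 with h2 | h2
  · rw [sub_eq_zero] at h2
    exact .inl (key hφ (h2 ▸ hψ))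
  · rw [add_eq_zero_iff_eq_neg] at h2
    exact .inr (key hφ (h2 ▸ hψ.neg))

theorem Rep.unique (hφ : Rep h h' φ R₁ S₁) (hψ : Rep h h' φ R₂ S₂) : R₁ = R₂ ∧ S₁ = S₂ := by
  constructor
  all_goals
    apply eq_of_evAt
    filter_upwards [hφ, hψ, eventually_y_ne_zero A B] with x hx₁ hx₂ hy
    obtain ⟨y, hxy⟩ := exists_y A B x
    obtain ⟨x₁, s₁, hxy₁, e₁, r₁, t₁⟩ := hx₁ y hxy
    obtain ⟨x₂, s₂, hxy₂, e₂, r₂, t₂⟩ := hx₂ y hxy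
    rw [e₁, mkPt_inj] at e₂
  · exact ⟨_, r₁, e₂.1 ▸ r₂⟩
  · exact ⟨_, t₁, mul_left_cancel₀ (hy y hxy) e₂.2 ▸ t₂⟩

theorem HasMult.unique {a b : F} (ha : HasMult h h' φ a) (hb : HasMult h h' φ b) : a = b := by
  rcases ha with ⟨h0, rfl⟩ | ⟨R₁, S₁, h1, h2⟩ <;> rcases hb with ⟨h0', rfl⟩ | ⟨R₂, S₂, h1', h2'⟩
  · rfl
  · exact absurd h0 h1'.ne_zero
  · exact absurd h0' h1.ne_zero
  · obtain ⟨rfl, rfl⟩ := h1.unique h1'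
    exact cst_injective (mul_right_cancel₀ h1.S_ne_zero (h2.symm.trans h2'))

/-- This is the invariance of dx/y under translation. For R₁ = R₂ the maps are equal or opposite,
and the tangent law or cancellation applies; otherwise the derivative of the chord formula is
computed. -/
theorem HasMult.add {a b : F} (hφ : HasMult h h' φ a) (hψ : HasMult h h' ψ b) :
    HasMult h h' (φ + ψ) (a + b) := by
  have hφ' := hφ
  rcases hφ with ⟨rfl, rfl⟩ | ⟨R₁, S₁, h1, h2⟩
  · simpa using hψ
  have hψ' := hψ
  rcases hψ with ⟨rfl, rfl⟩ | ⟨R₂, S₂, h1', h2'⟩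
  · simpa using hφ'
  have hf := algebraMap_ratFunc_ne_zero (fAB_ne_zero A B)
  set f := algebraMap F[X] (RatFunc F) (fAB A B) with hfdef
  by_cases hR : R₁ = R₂
  · subst hR
    rcases h1.eq_or_eq_neg h1' with rfl | rfl
    · obtain rfl := hφ'.unique hψ'
      have hE := h1.deriv_equation h2
      rw [← hfdef] at hE
      have h2f : 2 * f * S₁ ≠ 0 := mul_ne_zero (mul_ne_zero two_ne_zero hf) h1.S_ne_zero
      have hm := div_mul_cancel₀ (3 * R₁ ^ 2 + 2 * cst A' * R₁ + cst B') h2f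
      set m := (3 * R₁ ^ 2 + 2 * cst A' * R₁ + cst B') / (2 * f * S₁) with hmdef
      have hdm := congrArg dr hm
      have e2 : (2 : RatFunc F) = cst 2 := by simp [cst, map_ofNat]
      have e3 : (3 : RatFunc F) = cst 3 := by simp [cst, map_ofNat]
      have hd2 : dr (2 : RatFunc F) = 0 := e2 ▸ dr_C 2
      have hd3 : dr (3 : RatFunc F) = 0 := e3 ▸ dr_C 3
      simp only [pow_succ, pow_zero, one_mul, dr_add, dr_mul, dr_C, h2, hd2, hd3] at hdm
      refine .inr ⟨_, _, h1.add_self hmdef rfl rfl, ?_⟩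
      simp only [pow_succ, pow_zero, one_mul, dr_sub, dr_mul, dr_C, h2]
      rw [← hfdef, show cst (a + a) = cst a + cst a by simp [cst]]
      apply mul_right_cancel₀ h1.S_ne_zero
      clear_value m
      linear_combination m * hdm - m ^ 2 * hE + m ^ 2 * cst a * hm
    · obtain rfl : a = -b := hφ'.unique hψ'.neg
      exact .inl (by simp)
  · have hE := h1.deriv_equation h2
    have hE' := h1'.deriv_equation h2'
    rw [← hfdef] at hE hE'
    have hΔ : R₁ - R₂ ≠ 0 := sub_ne_zero.2 hR
    have hL := div_mul_cancel₀ (S₁ - S₂) hΔ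
    set l := (S₁ - S₂) / (R₁ - R₂) with hl
    have hdl := congrArg dr hL
    simp only [dr_mul, dr_sub, h2, h2'] at hdl
    -- Difference of the two curve equations divided by R₁ − R₂.
    have hK : f * l * (S₁ + S₂) =
        R₁ ^ 2 + R₁ * R₂ + R₂ ^ 2 + cst A' * (R₁ + R₂) + cst B' := by
      apply mul_right_cancel₀ hΔ
      linear_combination h1.equation - h1'.equation + f * (S₁ + S₂) * hL
    refine .inr ⟨_, _, h1.add h1' hR hl rfl rfl, ?_⟩
    simp only [pow_succ, pow_zero, one_mul, dr_sub, dr_mul, dr_C, h2, h2']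
    rw [← hfdef, show cst (a + b) = cst a + cst b by simp [cst]]
    apply mul_right_cancel₀ hΔ
    linear_combination (dr f * l + cst a * (l * f * l) + cst b * (l * f * l - (R₁ - R₂))) * hL +
      2 * f * l * hdl + l * (hE - hE') + (cst b * l - cst a * l) * hK

end RepAdd

/-! #### The multiplier exists -/

section Mult

variable {F : Type*} [Field F] [CharZero F] [IsAlgClosed F] {A B A' B' : F}

theorem isCoprime_of_eval {p q : F[X]} (hpq : ∀ x, ¬(p.eval x = 0 ∧ q.eval x = 0)) :
    IsCoprime p q := by
  rw [Polynomial.isCoprime_iff_aeval_ne_zero_of_isAlgClosed F F]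
  intro x
  simp only [coe_aeval_eq_eval]
  by_cases hp : p.eval x = 0
  · exact .inr fun hq => hpq x ⟨hp, hq⟩
  · exact .inl hp

theorem squarefree_fAB (h : Smooth A B) : Squarefree (fAB A B) := by
  apply Separable.squarefree
  apply isCoprime_of_eval
  rintro x ⟨h1, h2⟩
  have h3 : 3 * x ^ 2 + 2 * A * x + B = 0 := by
    rw [← h2]; simp [fAB]; ring
  rw [eval_fAB] at h1
  rcases eq_or_ne x 0 with rfl | hx
  · exact h.1 (by simpa using h3)
  · have h4 : x ^ 2 + A * x + B = 0 := by
      apply mul_left_cancel₀ hx; linear_combination h1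
    have h5 : x * (2 * x + A) = 0 := by linear_combination h3 - h4
    have h6 := (mul_eq_zero.1 h5).resolve_left hx
    exact h.2 (by linear_combination (2 * x + A) * h6 - 4 * h4)

/-- A pair of coprime polynomials of different degrees: bound for the degree of the Wronskian. -/
theorem natDegree_wronskian_lt {u v : F[X]} (huv : u.natDegree < v.natDegree) :
    (derivative u * v - u * derivative v).natDegree + 1 ≤ u.natDegree + v.natDegree := by
  have h1 : (u * derivative v).natDegree + 1 ≤ u.natDegree + v.natDegree := by
    have := natDegree_derivative_lt (p := v) (by omega)
    have := natDegree_mul_le (p := u) (q := derivative v)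
    omega
  have h2 : (derivative u * v).natDegree + 1 ≤ u.natDegree + v.natDegree := by
    by_cases h0 : u.natDegree = 0
    · rw [derivative_eq_zero.2 h0, zero_mul, natDegree_zero]
      omega
    · have := natDegree_derivative_lt h0
      have := natDegree_mul_le (p := derivative u) (q := v)
      omega
  have h3 := natDegree_sub_le (derivative u * v) (u * derivative v)
  omega

/-- The quartic form `p q (p² + A p q + B q²)` in two polynomials: after a change of the basis
of the pencil, its degree is `3 deg v + deg u` with `deg u < deg v`, if it is odd. -/
theorem exists_pencil (h : Smooth A B) {p q : F[X]} (hq : q ≠ 0) (hpq : IsCoprime p q)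
    (hc : ¬(p.natDegree = 0 ∧ q.natDegree = 0))
    (hodd : Odd (p * q * (p ^ 2 + C A * p * q + C B * q ^ 2)).natDegree) :
    ∃ u v : F[X], u ≠ 0 ∧ u.natDegree < v.natDegree ∧
      (p * q * (p ^ 2 + C A * p * q + C B * q ^ 2)).natDegree = u.natDegree + 3 * v.natDegree ∧
      (derivative p * q - p * derivative q = derivative u * v - u * derivative v ∨
        derivative p * q - p * derivative q = -(derivative u * v - u * derivative v)) := by
  have hp : p ≠ 0 := by
    rintro rfl
    simp at hodd
  have hGne : p * q * (p ^ 2 + C A * p * q + C B * q ^ 2) ≠ 0 := by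
    intro h0; rw [h0] at hodd; simp at hodd
  have hG2ne := right_ne_zero_of_mul hGne
  have hdeg : (p * q * (p ^ 2 + C A * p * q + C B * q ^ 2)).natDegree =
      p.natDegree + q.natDegree + (p ^ 2 + C A * p * q + C B * q ^ 2).natDegree := by
    rw [natDegree_mul (mul_ne_zero hp hq) hG2ne, natDegree_mul hp hq]
  -- coefficient of the quadratic form at twice a degree bound
  have hco : ∀ {u v : F[X]} {n : ℕ} (a b c : F), u.natDegree ≤ n → v.natDegree ≤ n →
      (C a * u ^ 2 + C b * u * v + C c * v ^ 2).natDegree ≤ 2 * n ∧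
      (C a * u ^ 2 + C b * u * v + C c * v ^ 2).coeff (2 * n) =
        a * u.coeff n ^ 2 + b * u.coeff n * v.coeff n + c * v.coeff n ^ 2 := by
    intro u v n a b c hu hv
    have e1 : (C a * u ^ 2).natDegree ≤ 2 * n := by compute_degree!
    have e2 : (C b * u * v).natDegree ≤ 2 * n := by compute_degree!; omega
    have e3 : (C c * v ^ 2).natDegree ≤ 2 * n := by compute_degree!
    refine ⟨natDegree_add_le_of_degree_le (natDegree_add_le_of_degree_le e1 e2) e3, ?_⟩
    rw [coeff_add, coeff_add, coeff_C_mul, coeff_C_mul, mul_assoc, coeff_C_mul, sq, sq, two_mul,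
      coeff_mul_add_eq_of_natDegree_le hu hu, coeff_mul_add_eq_of_natDegree_le hu hv,
      coeff_mul_add_eq_of_natDegree_le hv hv]
    ring
  rcases lt_trichotomy p.natDegree q.natDegree with hlt | heq | hgt
  · refine ⟨p, q, hp, hlt, ?_, .inl rfl⟩
    obtain ⟨e1, e2⟩ := hco 1 A B hlt.le le_rfl
    rw [coeff_eq_zero_of_natDegree_lt hlt] at e2
    have e3 : (C 1 * p ^ 2 + C A * p * q + C B * q ^ 2).natDegree = 2 * q.natDegree := by
      refine natDegree_eq_of_le_of_coeff_ne_zero e1 ?_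
      rw [e2]
      simpa using ⟨h.1, hq⟩
    rw [hdeg, ← one_mul (p ^ 2), ← C_1, e3]
    ring
  · set n := q.natDegree with hn
    have hlq : q.coeff n ≠ 0 := by rw [hn]; simpa using hq
    obtain ⟨e1, e2⟩ := hco 1 A B heq.le le_rfl
    -- For equal degrees n, either the ratio c of the leading coefficients is a root of T² + AT + B,
    -- and u = p − cq has smaller degree, or no leading terms cancel and the form has the even
    -- degree 4n.
    by_cases h0 : 1 * p.coeff n ^ 2 + A * p.coeff n * q.coeff n + B * q.coeff n ^ 2 = 0
    · set c := p.coeff n / q.coeff n with hcdef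
      have hc2 : c ^ 2 + A * c + B = 0 := by
        rw [hcdef]; field_simp; linear_combination h0
      set u := p - C c * q with hu
      have hule : u.natDegree ≤ n := by
        exact (natDegree_sub_le_of_le heq.le (natDegree_C_mul_le c q)).trans (max_self n).le
      have hucoeff : u.coeff n = 0 := by
        rw [hu, coeff_sub, coeff_C_mul, hcdef, div_mul_cancel₀ _ hlq, sub_self]
      have hn0 : n ≠ 0 := fun hn0 => hc ⟨heq.trans hn0, hn0⟩
      have hfac : p ^ 2 + C A * p * q + C B * q ^ 2 = u * (p + C (c + A) * q) := by
        have : C B = -(C c * (C c + C A)) := by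
          rw [← C_add, ← C_mul, ← C_neg]; congr 1; linear_combination hc2
        rw [hu, this, C_add]; ring
      have hu0 : u ≠ 0 := by
        intro h; rw [hfac, h, zero_mul] at hG2ne; exact hG2ne rfl
      have hult : u.natDegree < n := by
        refine lt_of_le_of_ne hule fun h => hu0 ?_
        rw [← leadingCoeff_eq_zero, leadingCoeff, h, hucoeff]
      have hpc : p.coeff n = c * q.coeff n := by rw [hcdef, div_mul_cancel₀ _ hlq]
      have hlast : (p + C (c + A) * q).natDegree = n := by
        refine natDegree_eq_of_le_of_coeff_ne_zero
          (natDegree_add_le_of_degree_le heq.le (by compute_degree!)) ?_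
        rw [coeff_add, coeff_C_mul, hpc, ← add_mul]
        refine mul_ne_zero ?_ hlq
        intro h1
        clear_value c
        exact h.2 (by linear_combination (2 * c + A) * h1 - 4 * hc2)
      refine ⟨u, q, hu0, hult, ?_, .inl ?_⟩
      · rw [hdeg, hfac, natDegree_mul hu0 (right_ne_zero_of_mul (hfac ▸ hG2ne)), hlast, heq]
        ring
      · rw [hu]
        simp only [derivative_sub, derivative_C_mul]
        ring
    · exfalso
      have e3 : (C 1 * p ^ 2 + C A * p * q + C B * q ^ 2).natDegree = 2 * n := by
        refine natDegree_eq_of_le_of_coeff_ne_zero e1 ?_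
        rw [e2]; exact h0
      rw [hdeg, ← one_mul (p ^ 2), ← C_1, e3, heq] at hodd
      obtain ⟨k, hk⟩ := hodd
      omega
  · refine ⟨q, p, hq, hgt, ?_, .inr (by ring)⟩
    obtain ⟨e1, e2⟩ := hco 1 A B le_rfl hgt.le
    rw [coeff_eq_zero_of_natDegree_lt hgt] at e2
    have e3 : (C 1 * p ^ 2 + C A * p * q + C B * q ^ 2).natDegree = 2 * p.natDegree := by
      refine natDegree_eq_of_le_of_coeff_ne_zero e1 ?_
      rw [e2]
      simpa using hp
    rw [hdeg, ← one_mul (p ^ 2), ← C_1, e3]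
    ring

/-- If p'q = pq' with p, q coprime, then q divides q', so q is constant in characteristic zero;
likewise p. -/
theorem wronskian_ne_zero {p q : F[X]} (hpq : IsCoprime p q)
    (hc : ¬(p.natDegree = 0 ∧ q.natDegree = 0)) :
    derivative p * q - p * derivative q ≠ 0 := by
  have key : ∀ {p q : F[X]}, IsCoprime p q → derivative p * q = p * derivative q →
      q.natDegree = 0 := by
    intro p q hpq hW
    by_contra h0
    have h1 : q ∣ derivative q := hpq.symm.dvd_of_dvd_mul_left ⟨derivative p, by rw [← hW]; ring⟩
    refine h0 (derivative_eq_zero.1 ?_)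
    exact eq_zero_of_dvd_of_natDegree_lt h1 (natDegree_derivative_lt h0)
  intro h0
  rw [sub_eq_zero] at h0
  exact hc ⟨key hpq.symm (by linear_combination -h0), key hpq h0⟩

/-- The multiplier is constant for reasons of degree. With R = p/q in lowest terms and M = Sq², the
Wronskian W = p'q − pq' is a polynomial multiple of M; as R' = W/q², the quotient W/M is R'/S, and
its degree turns out to be zero. -/
theorem Rep.exists_mult {h : Smooth A B} {h' : Smooth A' B'} {φ : Pt A B →+ Pt A' B'}
    {R S : RatFunc F} (hφ : Rep h h' φ R S) : ∃ a, a ≠ 0 ∧ dr R = cst a * S := by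
  set p := R.num with hp
  set q := R.denom with hq
  have hpq : IsCoprime p q := RatFunc.isCoprime_num_denom R
  have hq0 : q ≠ 0 := RatFunc.denom_ne_zero R
  have hR : R * algebraMap F[X] (RatFunc F) q = algebraMap F[X] (RatFunc F) p := mul_denom R
  have hq0' := algebraMap_ratFunc_ne_zero hq0
  have hinj := RatFunc.algebraMap_injective F
  have hc : ¬(p.natDegree = 0 ∧ q.natDegree = 0) := by
    rintro ⟨h1, h2⟩
    rw [natDegree_eq_zero] at h1 h2
    obtain ⟨a, ha⟩ := h1
    obtain ⟨b, hb⟩ := h2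
    have hb0 : b ≠ 0 := by rintro rfl; exact hq0 (by rw [← hb, C_0])
    refine hφ.ne_cst (a / b) (mul_right_cancel₀ hq0' ?_)
    rw [hR, ← ha, ← hb, cst, ← map_mul, ← C_mul, div_mul_cancel₀ _ hb0]
  set f := fAB A B with hf
  set G := p * q * (p ^ 2 + C A' * p * q + C B' * q ^ 2) with hG
  have hf0 : f ≠ 0 := fAB_ne_zero A B
  -- the polynomial `M = S q²`
  have hSq : algebraMap F[X] (RatFunc F) f * (S * algebraMap F[X] (RatFunc F) q ^ 2) ^ 2 =
      algebraMap F[X] (RatFunc F) G := by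
    simp only [hG, map_mul, map_add, map_pow, ← hR]
    linear_combination algebraMap F[X] (RatFunc F) q ^ 4 * hφ.equation
  -- fSq² has the polynomial square fG, so it is a polynomial N; as f is squarefree and divides N²,
  -- it divides N.
  obtain ⟨M, hM⟩ : ∃ M, algebraMap F[X] (RatFunc F) M =
      S * algebraMap F[X] (RatFunc F) q ^ 2 := by
    have hint : IsIntegral F[X]
        (algebraMap F[X] (RatFunc F) f * (S * algebraMap F[X] (RatFunc F) q ^ 2)) := by
      refine IsIntegral.of_pow (n := 2) (by norm_num) ?_
      rw [mul_pow, sq (algebraMap F[X] (RatFunc F) f), mul_assoc, hSq, ← map_mul]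
      exact isIntegral_algebraMap
    obtain ⟨N, hN⟩ := IsIntegrallyClosed.isIntegral_iff.1 hint
    have hN2 : N ^ 2 = f * G := by
      apply hinj
      rw [map_pow, hN, map_mul, ← hSq]; ring
    obtain ⟨M, rfl⟩ := ((squarefree_fAB h).dvd_pow_iff_dvd two_ne_zero).1 ⟨G, hN2⟩
    refine ⟨M, mul_left_cancel₀ (algebraMap_ratFunc_ne_zero hf0) ?_⟩
    rw [← hN, map_mul]
  have hfM : f * M ^ 2 = G := by
    apply hinj
    rw [map_mul, map_pow, hM, hSq]
  have hM0 : M ≠ 0 := by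
    rintro rfl
    rw [map_zero, eq_comm, mul_eq_zero] at hM
    exact hM.elim hφ.S_ne_zero (pow_ne_zero 2 hq0')
  set W := derivative p * q - p * derivative q with hW
  -- M divides G and its derivative, as M² divides G. For the quartic form G(p, q), Euler's relation
  -- gives qG' − 4q'G = G_p W and 4p'G − pG' = G_q W. The partial derivatives G_p, G_q are coprime
  -- because the form has no multiple zero.
  have hMW : M ∣ W := by
    have hd := congrArg derivative hfM
    rw [hG] at hd
    simp only [derivative_mul, derivative_add, pow_succ, pow_zero, one_mul, derivative_C] at hd
    have hG' : f * M ^ 2 = p * q * (p ^ 2 + C A' * p * q + C B' * q ^ 2) := hfM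
    have h1 : M ∣ (3 * p ^ 2 * q + 2 * C A' * p * q ^ 2 + C B' * q ^ 3) * W :=
      ⟨q * (derivative f * M + 2 * f * derivative M) - 4 * f * M * derivative q, by
        rw [hW]; linear_combination -q * hd + 4 * derivative q * hG'⟩
    have h2 : M ∣ (p ^ 3 + 2 * C A' * p ^ 2 * q + 3 * C B' * p * q ^ 2) * W :=
      ⟨4 * f * M * derivative p - p * (derivative f * M + 2 * f * derivative M), by
        rw [hW]; linear_combination p * hd - 4 * derivative p * hG'⟩
    have h3 : IsCoprime (3 * p ^ 2 * q + 2 * C A' * p * q ^ 2 + C B' * q ^ 3)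
        (p ^ 3 + 2 * C A' * p ^ 2 * q + 3 * C B' * p * q ^ 2) := by
      apply isCoprime_of_eval
      rintro x ⟨e1, e2⟩
      simp only [eval_add, eval_mul, eval_pow, eval_C, eval_ofNat] at e1 e2
      have hne : ¬(p.eval x = 0 ∧ q.eval x = 0) := by
        rintro ⟨e3, e4⟩
        obtain ⟨a, b, hab⟩ := hpq
        have := congrArg (eval x) hab
        simp [e3, e4] at this
      generalize p.eval x = s at *
      generalize q.eval x = t at *
      by_cases ht : t = 0
      · subst ht
        exact hne ⟨by simpa using e2, rfl⟩
      by_cases hs : s = 0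
      · subst hs
        have : B' * t ^ 3 = 0 := by linear_combination e1
        exact (mul_ne_zero h'.1 (pow_ne_zero 3 ht)) this
      have e1' : 3 * s ^ 2 + 2 * A' * s * t + B' * t ^ 2 = 0 := by
        apply mul_left_cancel₀ ht; linear_combination e1
      have e2' : s ^ 2 + 2 * A' * s * t + 3 * B' * t ^ 2 = 0 := by
        apply mul_left_cancel₀ hs; linear_combination e2
      have e3 : s ^ 2 = B' * t ^ 2 := by
        apply mul_left_cancel₀ (two_ne_zero (α := F)); linear_combination e1' - e2'
      have e4 : 2 * B' * t = -(A' * s) := by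
        apply mul_left_cancel₀ (mul_ne_zero (two_ne_zero (α := F)) ht)
        linear_combination e2' - e3
      refine h'.2 (mul_left_cancel₀ (mul_ne_zero h'.1 (pow_ne_zero 2 ht)) ?_)
      linear_combination (A' * s - 2 * B' * t) * e4 - A' ^ 2 * e3
    obtain ⟨a, b, hab⟩ := h3
    have : W = a * ((3 * p ^ 2 * q + 2 * C A' * p * q ^ 2 + C B' * q ^ 3) * W) +
        b * ((p ^ 3 + 2 * C A' * p ^ 2 * q + 3 * C B' * p * q ^ 2) * W) := by
      linear_combination -W * hab
    rw [this]
    exact dvd_add (h1.mul_left a) (h2.mul_left b)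
  obtain ⟨g, hg⟩ := hMW
  have hW0 : W ≠ 0 := wronskian_ne_zero hpq hc
  have hg0 : g ≠ 0 := by rintro rfl; exact hW0 (by rw [hg, mul_zero])
  have hdf : f.natDegree = 3 := by rw [hf, fAB]; compute_degree!
  have hdG : G.natDegree = 3 + 2 * M.natDegree := by
    rw [← hfM, natDegree_mul hf0 (pow_ne_zero 2 hM0), natDegree_pow, hdf]
  obtain ⟨u, v, hu, huv, hGuv, hWuv⟩ := exists_pencil h' hq0 hpq hc
    (show Odd G.natDegree from ⟨1 + M.natDegree, by rw [hdG]; ring⟩)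
  have hWle : W.natDegree + 1 ≤ u.natDegree + v.natDegree := by
    have := natDegree_wronskian_lt huv
    rcases hWuv with h1 | h1
    · rw [hW, h1]; exact this
    · rw [hW, h1, natDegree_neg]; exact this
  have hdW : W.natDegree = M.natDegree + g.natDegree := by rw [hg, natDegree_mul hM0 hg0]
  -- 3 + 2 deg M = deg u + 3 deg v and deg W < deg u + deg v with deg u < deg v together give deg W
  -- ≤ deg M.
  have hg1 : g.natDegree = 0 := by
    have : G.natDegree = u.natDegree + 3 * v.natDegree := hGuv
    omega
  obtain ⟨a, rfl⟩ := natDegree_eq_zero.1 hg1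
  refine ⟨a, by rintro rfl; exact hg0 C_0, mul_right_cancel₀ (pow_ne_zero 2 hq0') ?_⟩
  have h1 := congrArg dr hR
  rw [dr_mul, dr_poly, dr_poly] at h1
  have h2 := congrArg (algebraMap F[X] (RatFunc F)) hg
  rw [hW, map_sub, map_mul, map_mul, map_mul, hM, ← hR] at h2
  linear_combination algebraMap F[X] (RatFunc F) q * h1 + h2

theorem Rep.hasMult {h : Smooth A B} {h' : Smooth A' B'} {φ : Pt A B →+ Pt A' B'}
    {R S : RatFunc F} (hφ : Rep h h' φ R S) : ∃ a, HasMult h h' φ a :=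
  let ⟨a, _, ha⟩ := hφ.exists_mult
  ⟨a, .inr ⟨R, S, hφ, ha⟩⟩

theorem HasMult.eq_zero {h : Smooth A B} {h' : Smooth A' B'} {φ : Pt A B →+ Pt A' B'}
    (hφ : HasMult h h' φ 0) : φ = 0 := by
  rcases hφ with ⟨rfl, -⟩ | ⟨R, S, h1, h2⟩
  · rfl
  · obtain ⟨a, ha, h3⟩ := h1.exists_mult
    exact absurd (cst_injective (mul_right_cancel₀ h1.S_ne_zero (h3.symm.trans h2))) ha

end Mult

/-! #### Algebraic endomorphisms -/

section Algebraic

variable {F : Type*} [Field F] [CharZero F] [IsAlgClosed F] {A B : F}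

/-- Reduction modulo the equation of the curve, which eliminates y². -/
theorem exists_eval_eq (A B : F) (g : MvPolynomial (Fin 2) F) : ∃ g₀ g₁ : F[X],
    ∀ x y : F, y ^ 2 = x ^ 3 + A * x ^ 2 + B * x →
      g.eval ![x, y] = g₀.eval x + y * g₁.eval x := by
  induction g using MvPolynomial.induction_on with
  | C a => exact ⟨C a, 0, by simp⟩
  | add p q hp hq =>
    obtain ⟨p₀, p₁, hp⟩ := hp
    obtain ⟨q₀, q₁, hq⟩ := hq
    refine ⟨p₀ + q₀, p₁ + q₁, fun x y hxy => ?_⟩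
    rw [map_add, hp x y hxy, hq x y hxy, eval_add, eval_add]; ring
  | mul_X p i hp =>
    obtain ⟨p₀, p₁, hp⟩ := hp
    fin_cases i
    · refine ⟨p₀ * X, p₁ * X, fun x y hxy => ?_⟩
      simp only [Fin.zero_eta, map_mul, MvPolynomial.eval_X, Matrix.cons_val_zero, hp x y hxy,
        eval_mul, eval_X]
      ring
    · refine ⟨p₁ * fAB A B, p₀, fun x y hxy => ?_⟩
      simp only [Fin.mk_one, map_mul, MvPolynomial.eval_X, Matrix.cons_val_one, hp x y hxy,
        eval_mul, eval_fAB, ← hxy]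
      simp only [Matrix.cons_val_fin_one]
      ring

/-- An additive map commutes with negation, so its abscissa is even in y and its ordinate odd.
Averaging the formulas at (x, y) and (x, −y) removes the other parts, and the denominator k is
replaced by its norm N = k₀² − f k₁². -/
theorem exists_rep_of_isAlgebraic (h : Smooth A B) {φ : AddMonoid.End (Pt A B)}
    (hφ : IsAlgebraicEndomorphism (curveAB A B) φ) : φ = 0 ∨ ∃ R S, Rep h h φ R S := by
  refine hφ.imp_right ?_
  rintro ⟨f, g, k, T, hT, H⟩
  obtain ⟨f₀, f₁, hf⟩ := exists_eval_eq A B f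
  obtain ⟨g₀, g₁, hg⟩ := exists_eval_eq A B g
  obtain ⟨k₀, k₁, hk⟩ := exists_eval_eq A B k
  set N := k₀ ^ 2 - fAB A B * k₁ ^ 2 with hN
  have hev : ∀ᶠ P : Pt A B in cofinite, P ∉ T := by
    rw [eventually_cofinite]; simpa using hT
  rw [eventually_mkPt h] at hev
  have key : ∀ᶠ x in cofinite, ∀ y hxy, N.eval x ≠ 0 ∧ ∃ v w hvw,
      φ (mkPt h x y hxy) = mkPt h v w hvw ∧
      (f₀ * k₀ - fAB A B * f₁ * k₁).eval x = v * N.eval x ∧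
      y * (g₁ * k₀ - g₀ * k₁).eval x = w * N.eval x := by
    filter_upwards [hev] with x hx y hxy
    have hxy' : (-y) ^ 2 = x ^ 3 + A * x ^ 2 + B * x := by rw [neg_sq, hxy]
    obtain ⟨h1, h2, h3⟩ := H x y ((nonsingular_curveAB h).2 hxy) (hx y hxy)
    obtain ⟨h1', h2', h3'⟩ := H x (-y) ((nonsingular_curveAB h).2 hxy') (hx _ hxy')
    have h4 : φ (mkPt h x (-y) hxy') = -φ (mkPt h x y hxy) := by
      rw [← neg_mkPt hxy, map_neg]
    obtain ⟨v, w, hvw, h5, hv, hw⟩ : ∃ v w hvw, φ (mkPt h x y hxy) = mkPt h v w hvw ∧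
        v = f.eval ![x, y] / k.eval ![x, y] ∧ w = g.eval ![x, y] / k.eval ![x, y] :=
      ⟨_, _, (nonsingular_curveAB h).1 h2, h3, rfl, rfl⟩
    have h5' : φ (mkPt h x (-y) hxy') = mkPt h _ _ ((nonsingular_curveAB h).1 h2') := h3'
    rw [h5, h5', neg_mkPt, mkPt_inj] at h4
    obtain ⟨h6, h7⟩ := h4
    rw [div_eq_iff h1', hf _ _ hxy', hk _ _ hxy'] at h6
    rw [div_eq_iff h1', hg _ _ hxy', hk _ _ hxy'] at h7
    have h8 := (div_eq_iff h1).1 hv.symm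
    have h9 := (div_eq_iff h1).1 hw.symm
    rw [hf _ _ hxy, hk _ _ hxy] at h8
    rw [hg _ _ hxy, hk _ _ hxy] at h9
    rw [hk _ _ hxy] at h1
    rw [hk _ _ hxy'] at h1'
    have hNx : N.eval x = (k₀.eval x + y * k₁.eval x) * (k₀.eval x + -y * k₁.eval x) := by
      simp only [hN, eval_sub, eval_mul, eval_pow, eval_fAB, ← hxy]; ring
    refine ⟨by rw [hNx]; exact mul_ne_zero h1 h1', v, w, _, h5, ?_, ?_⟩
    · apply mul_left_cancel₀ (two_ne_zero (α := F))
      simp only [hNx, eval_sub, eval_mul, eval_fAB, ← hxy]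
      linear_combination (k₀.eval x - y * k₁.eval x) * h8 + (k₀.eval x + y * k₁.eval x) * h6
    · apply mul_left_cancel₀ (two_ne_zero (α := F))
      simp only [hNx, eval_sub, eval_mul]
      linear_combination (k₀.eval x - y * k₁.eval x) * h9 - (k₀.eval x + y * k₁.eval x) * h7
  have := CharZero.infinite F
  have hN0 : N ≠ 0 := by
    obtain ⟨x, hx⟩ := key.exists
    obtain ⟨y, hxy⟩ := exists_y A B x
    intro h0
    exact (hx y hxy).1 (by rw [h0, eval_zero])
  refine ⟨algebraMap F[X] (RatFunc F) (f₀ * k₀ - fAB A B * f₁ * k₁) /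
    algebraMap F[X] (RatFunc F) N, algebraMap F[X] (RatFunc F) (g₁ * k₀ - g₀ * k₁) /
    algebraMap F[X] (RatFunc F) N, ?_⟩
  filter_upwards [key] with x hx y hxy
  obtain ⟨hNx, v, w, hvw, h1, h2, h3⟩ := hx y hxy
  have e : y * ((g₁ * k₀ - g₀ * k₁).eval x / N.eval x) = w := by
    rw [← mul_div_assoc, h3, mul_div_cancel_right₀ _ hNx]
  refine ⟨v, (g₁ * k₀ - g₀ * k₁).eval x / N.eval x, by rw [e, hvw], ?_, ?_, ?_⟩
  · exact h1.trans (mkPt_congr rfl e.symm)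
  · refine ((evAt_poly _ x).div (evAt_poly N x) hNx).congr ?_
    rw [h2, mul_div_cancel_right₀ _ hNx]
  · exact (evAt_poly _ x).div (evAt_poly N x) hNx

theorem eval_aeval_X (p : F[X]) (x y : F) :
    MvPolynomial.eval ![x, y] (Polynomial.aeval (MvPolynomial.X 0 : MvPolynomial (Fin 2) F) p) =
      p.eval x := by
  induction p using Polynomial.induction_on' with
  | add p q hp hq => simp [hp, hq]
  | monomial n a => simp [aeval_monomial]

theorem Rep.isAlgebraic {h : Smooth A B} {φ : AddMonoid.End (Pt A B)} {R S : RatFunc F}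
    (hφ : Rep h h φ R S) : IsAlgebraicEndomorphism (curveAB A B) φ := by
  right
  let ev := fun p : F[X] =>
    Polynomial.aeval (MvPolynomial.X 0 : MvPolynomial (Fin 2) F) p
  have hev : ∀ᶠ P : Pt A B in cofinite, ∀ x y hxy, P = mkPt h x y hxy →
      R.denom.eval x ≠ 0 ∧ S.denom.eval x ≠ 0 ∧
      ∃ x' s hxy', φ (mkPt h x y hxy) = mkPt h x' (y * s) hxy' ∧ EvAt R x x' ∧ EvAt S x s := by
    rw [eventually_mkPt h]
    filter_upwards [hφ, eventually_denom R, eventually_denom S] with x hx hr hs y hxy x' y' hxy' he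
    obtain ⟨rfl, rfl⟩ := mkPt_inj.1 he
    exact ⟨hr, hs, hx y hxy⟩
  rw [eventually_cofinite] at hev
  refine ⟨ev (R.num * S.denom), MvPolynomial.X 1 * ev (S.num * R.denom), ev (R.denom * S.denom),
    _, hev, fun x y hxy hP => ?_⟩
  simp only [Set.mem_ofPred_eq, not_not] at hP
  obtain ⟨hr, hs, x', s, hxy', h1, h2, h3⟩ := hP x y ((nonsingular_curveAB h).1 hxy) rfl
  have hR := h2.num_denom
  have hS := h3.num_denom
  simp only [ev, map_mul, MvPolynomial.eval_X, eval_aeval_X, Matrix.cons_val_one,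
    Matrix.cons_val_fin_one, hR, hS]
  have e1 : x' * R.denom.eval x * S.denom.eval x / (R.denom.eval x * S.denom.eval x) = x' := by
    field_simp
  have e2 : y * (s * S.denom.eval x * R.denom.eval x) / (R.denom.eval x * S.denom.eval x) =
      y * s := by
    field_simp
  refine ⟨mul_ne_zero hr hs, ?_, ?_⟩
  · rw [e1, e2, nonsingular_curveAB h, hxy']
  · rw [show WeierstrassCurve.Affine.Point.some x y hxy = mkPt h x y
      ((nonsingular_curveAB h).1 hxy) from rfl, h1]
    exact mkPt_congr e1.symm e2.symm

theorem isAlgebraic_iff (h : Smooth A B) {φ : AddMonoid.End (Pt A B)} :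
    IsAlgebraicEndomorphism (curveAB A B) φ ↔ ∃ a, HasMult h h φ a := by
  constructor
  · intro hφ
    rcases exists_rep_of_isAlgebraic h hφ with rfl | ⟨R, S, hφ⟩
    · exact ⟨0, hasMult_zero⟩
    · exact hφ.hasMult
  · rintro ⟨a, ⟨rfl, -⟩ | ⟨R, S, hφ, -⟩⟩
    · exact .inl rfl
    · exact hφ.isAlgebraic

end Algebraic

/-! #### Degrees -/

section Height

variable {F : Type*} [Field F] [IsAlgClosed F]

/-- The projective point with homogeneous coordinates `a`, over the function field of the
projective line, has height `n`, and `a` is primitive. -/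
structure HasHeight {k : ℕ} (a : Fin k → F[X]) (n : ℕ) : Prop where
  le : ∀ i, (a i).natDegree ≤ n
  lead : ∃ i, (a i).coeff n ≠ 0
  prim : ∀ x, ∃ i, (a i).eval x ≠ 0

/-- A primitive vector generates the unit ideal, so of two proportional primitive vectors each is a
polynomial multiple of the other; the factor has no root, hence is constant. -/
theorem HasHeight.exists_eq_mul {k : ℕ} {a b : Fin k → F[X]} {n m : ℕ} (ha : HasHeight a n)
    (hb : HasHeight b m) (hab : ∀ i j, a i * b j = a j * b i) :
    ∃ c : F, c ≠ 0 ∧ ∀ i, a i = C c * b i := by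
  have hspan : Ideal.span (Set.range b) = ⊤ := by
    obtain ⟨g, hg⟩ := (IsPrincipalIdealRing.principal (Ideal.span (Set.range b))).principal
    have hdvd : ∀ i, g ∣ b i := fun i => by
      rw [← Ideal.mem_span_singleton, Ideal.span, ← hg]
      exact Ideal.subset_span ⟨i, rfl⟩
    rw [hg]
    change Ideal.span {g} = ⊤
    rw [Ideal.span_singleton_eq_top]
    by_contra hu
    have hdeg : g.degree ≠ 0 := fun h0 => hu (isUnit_iff_degree_eq_zero.2 h0)
    obtain ⟨x, hx⟩ := IsAlgClosed.exists_root g hdeg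
    obtain ⟨i, hi⟩ := hb.prim x
    exact hi (hx.dvd (hdvd i))
  have h1 : (1 : F[X]) ∈ Ideal.span (Set.range b) := hspan ▸ Submodule.mem_top
  obtain ⟨u, hu⟩ := Ideal.mem_span_range_iff_exists_fun.1 h1
  set c := ∑ j, u j * a j with hc
  have hac : ∀ i, a i = c * b i := fun i => by
    rw [hc, Finset.sum_mul]
    calc a i = ∑ j, u j * b j * a i := by rw [← Finset.sum_mul, hu, one_mul]
      _ = _ := Finset.sum_congr rfl fun j _ => by rw [mul_assoc, mul_comm (b j), hab i j]; ring
  have hcu : c.degree = 0 := by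
    by_contra hdeg
    obtain ⟨x, hx⟩ := IsAlgClosed.exists_root c hdeg
    obtain ⟨i, hi⟩ := ha.prim x
    exact hi (by rw [hac i, eval_mul, hx.eq_zero, zero_mul])
  obtain ⟨d, hd⟩ : ∃ d, C d = c := ⟨_, (eq_C_of_degree_eq_zero hcu).symm⟩
  refine ⟨d, ?_, fun i => by rw [hac i, hd]⟩
  rintro rfl
  rw [← hd, C_0, degree_zero] at hcu
  cases hcu

theorem HasHeight.unique {k : ℕ} {a b : Fin k → F[X]} {n m : ℕ} (ha : HasHeight a n)
    (hb : HasHeight b m) (hab : ∀ i j, a i * b j = a j * b i) : n = m := by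
  have key : ∀ {a b : Fin k → F[X]} {n m : ℕ}, HasHeight a n → HasHeight b m →
      (∀ i j, a i * b j = a j * b i) → n ≤ m := by
    intro a b n m ha hb hab
    obtain ⟨c, hc, h⟩ := ha.exists_eq_mul hb hab
    obtain ⟨i, hi⟩ := ha.lead
    by_contra hlt
    rw [h i, coeff_C_mul, coeff_eq_zero_of_natDegree_lt ((hb.le i).trans_lt (not_le.1 hlt)),
      mul_zero] at hi
    exact hi rfl
  exact le_antisymm (key ha hb hab)
    (key hb ha fun i j => by linear_combination -(hab i j))

/-- The value at `(u, v)` of the homogenization of `p` of degree `n`. -/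
def hval {R : Type*} [CommRing R] (n : ℕ) (p : ℕ → R) (u v : R) : R :=
  ∑ k ∈ Finset.range (n + 1), p k * u ^ k * v ^ (n - k)

theorem hval_eq {n : ℕ} {p : F[X]} (hp : p.natDegree ≤ n) {u v : F} (hv : v ≠ 0) :
    hval n p.coeff u v = v ^ n * p.eval (u / v) := by
  rw [hval, eval_eq_sum_range' (Nat.lt_succ_of_le hp), Finset.mul_sum]
  refine Finset.sum_congr rfl fun k hk => ?_
  have hk : k ≤ n := Nat.lt_succ_iff.1 (Finset.mem_range.1 hk)
  rw [div_pow, ← Nat.sub_add_cancel hk, pow_add, Nat.add_sub_cancel]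
  field_simp

theorem hval_zero {n : ℕ} {p : ℕ → F} {u : F} : hval n p u 0 = p n * u ^ n := by
  rw [hval, Finset.sum_range_succ, Finset.sum_eq_zero]
  · simp
  · intro k hk
    have : n - k ≠ 0 := by have := Finset.mem_range.1 hk; omega
    rw [zero_pow this, mul_zero]

theorem HasHeight.exists_hval_ne_zero {k : ℕ} {a : Fin k → F[X]} {n : ℕ} (ha : HasHeight a n)
    {u v : F} (huv : ¬(u = 0 ∧ v = 0)) : ∃ i, hval n (a i).coeff u v ≠ 0 := by
  by_cases hv : v = 0
  · subst hv
    obtain ⟨i, hi⟩ := ha.lead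
    refine ⟨i, ?_⟩
    rw [hval_zero]
    exact mul_ne_zero hi (pow_ne_zero _ fun hu => huv ⟨hu, rfl⟩)
  · obtain ⟨i, hi⟩ := ha.prim (u / v)
    refine ⟨i, ?_⟩
    rw [hval_eq (ha.le i) hv]
    exact mul_ne_zero (pow_ne_zero _ hv) hi

/-- Homogenizing in degree n creates no common zero, at finite places or at infinity, so the heights
multiply exactly. -/
theorem HasHeight.comp {k : ℕ} {a : Fin k → F[X]} {n m : ℕ} (ha : HasHeight a n)
    {b : Fin 2 → F[X]} (hb : HasHeight b m) :
    HasHeight (fun i => hval n (fun j => C ((a i).coeff j)) (b 0) (b 1)) (n * m) := by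
  have hterm : ∀ i, ∀ j ∈ Finset.range (n + 1),
      (C ((a i).coeff j) * b 0 ^ j * b 1 ^ (n - j)).natDegree ≤ n * m ∧
      (C ((a i).coeff j) * b 0 ^ j * b 1 ^ (n - j)).coeff (n * m) =
        (a i).coeff j * (b 0).coeff m ^ j * (b 1).coeff m ^ (n - j) := by
    intro i j hj
    have hj : j ≤ n := Nat.lt_succ_iff.1 (Finset.mem_range.1 hj)
    have e : n * m = j * m + (n - j) * m := by rw [← add_mul, Nat.add_sub_cancel' hj]
    have h0 := natDegree_pow_le_of_le j (hb.le 0)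
    have h1 := natDegree_pow_le_of_le (n - j) (hb.le 1)
    have h2 : (C ((a i).coeff j) * b 0 ^ j).natDegree ≤ j * m :=
      (natDegree_C_mul_le _ _).trans h0
    refine ⟨?_, ?_⟩
    · rw [e]; exact natDegree_mul_le_of_le h2 h1
    · rw [e, coeff_mul_add_eq_of_natDegree_le h2 h1, coeff_C_mul,
        coeff_pow_of_natDegree_le (hb.le 0), coeff_pow_of_natDegree_le (hb.le 1)]
  have hev : ∀ i x, (hval n (fun j => C ((a i).coeff j)) (b 0) (b 1)).eval x =
      hval n (a i).coeff ((b 0).eval x) ((b 1).eval x) := by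
    intro i x
    simp [hval, eval_finsetSum]
  refine ⟨fun i => natDegree_sum_le_of_forall_le _ _ fun j hj => (hterm i j hj).1, ?_, fun x => ?_⟩
  · have hb' : ¬((b 0).coeff m = 0 ∧ (b 1).coeff m = 0) := by
      obtain ⟨i, hi⟩ := hb.lead
      rintro ⟨h0, h1⟩
      fin_cases i
      exacts [hi h0, hi h1]
    obtain ⟨i, hi⟩ := ha.exists_hval_ne_zero hb'
    refine ⟨i, ?_⟩
    rw [hval, finsetSum_coeff, Finset.sum_congr rfl fun j hj => (hterm i j hj).2]
    exact hi
  · have hb' : ¬((b 0).eval x = 0 ∧ (b 1).eval x = 0) := by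
      obtain ⟨i, hi⟩ := hb.prim x
      rintro ⟨h0, h1⟩
      fin_cases i
      exacts [hi h0, hi h1]
    obtain ⟨i, hi⟩ := ha.exists_hval_ne_zero hb'
    exact ⟨i, by rwa [hev]⟩

/-- The symmetric functions of two points of the projective line. -/
def symTriple {R : Type*} [CommRing R] (a b : Fin 2 → R) : Fin 3 → R :=
  ![a 1 * b 1, a 0 * b 1 + a 1 * b 0, a 0 * b 0]

theorem symTriple_ne_zero {a b : Fin 2 → F} (ha : ¬(a 0 = 0 ∧ a 1 = 0))
    (hb : ¬(b 0 = 0 ∧ b 1 = 0)) : ∃ i, symTriple a b i ≠ 0 := by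
  by_contra! hn
  have h0 := hn 0
  have h1 := hn 1
  have h2 := hn 2
  simp only [symTriple, Matrix.cons_val_zero, Matrix.cons_val_one, Matrix.cons_val] at h0 h1 h2
  rcases mul_eq_zero.1 h0 with h | h <;> rcases mul_eq_zero.1 h2 with h' | h'
  · exact ha ⟨h', h⟩
  · rw [h, h', mul_zero, add_zero] at h1
    rcases mul_eq_zero.1 h1 with h1 | h1
    exacts [ha ⟨h1, h⟩, hb ⟨h', h1⟩]
  · rw [h, h', mul_zero, zero_add] at h1
    rcases mul_eq_zero.1 h1 with h1 | h1
    exacts [ha ⟨h', h1⟩, hb ⟨h1, h⟩]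
  · exact hb ⟨h', h⟩

theorem HasHeight.symTriple {a b : Fin 2 → F[X]} {n m : ℕ} (ha : HasHeight a n)
    (hb : HasHeight b m) : HasHeight (symTriple a b) (n + m) := by
  have h2 : ∀ {a : Fin 2 → F}, (∃ i, a i ≠ 0) → ¬(a 0 = 0 ∧ a 1 = 0) := by
    rintro a ⟨i, hi⟩ ⟨h0, h1⟩
    fin_cases i
    exacts [hi h0, hi h1]
  have hd : ∀ i j, (a i * b j).natDegree ≤ n + m :=
    fun i j => natDegree_mul_le_of_le (ha.le i) (hb.le j)
  have hco : ∀ i j, (a i * b j).coeff (n + m) = (a i).coeff n * (b j).coeff m :=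
    fun i j => coeff_mul_add_eq_of_natDegree_le (ha.le i) (hb.le j)
  refine ⟨fun i => ?_, ?_, fun x => ?_⟩
  · fin_cases i
    · exact hd _ _
    · exact natDegree_add_le_of_degree_le (hd _ _) (hd _ _)
    · exact hd _ _
  · obtain ⟨i, hi⟩ := symTriple_ne_zero (a := fun i => (a i).coeff n)
      (b := fun i => (b i).coeff m) (h2 ha.lead) (h2 hb.lead)
    refine ⟨i, ?_⟩
    fin_cases i <;>
      simpa [GoodTwist.symTriple, hco] using hi
  · obtain ⟨i, hi⟩ := symTriple_ne_zero (a := fun i => (a i).eval x)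
      (b := fun i => (b i).eval x) (h2 (ha.prim x)) (h2 (hb.prim x))
    refine ⟨i, ?_⟩
    fin_cases i <;>
      simpa [GoodTwist.symTriple] using hi

/-- The map `(1 : x(P) + x(Q) : x(P) x(Q)) ↦ (1 : x(P + Q) + x(P - Q) : x(P + Q) x(P - Q))`. -/
def quadTriple {R : Type*} [CommRing R] (A B : R) (t : Fin 3 → R) : Fin 3 → R :=
  ![t 1 * t 1 - 4 * (t 2 * t 0), 2 * (t 1 * t 2) + 2 * B * (t 1 * t 0) + 4 * A * (t 2 * t 0),
    t 2 * t 2 - 2 * B * (t 2 * t 0) + B ^ 2 * (t 0 * t 0)]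

variable [CharZero F]

/-- The absence of base points, which uses nonsingularity of the curve, makes the height double
exactly instead of being only bounded. -/
theorem quadTriple_ne_zero {A B : F} (h : Smooth A B) {t : Fin 3 → F} (ht : ∃ i, t i ≠ 0) :
    ∃ i, quadTriple A B t i ≠ 0 := by
  by_contra! hn
  have h0 := hn 0
  have h1 := hn 1
  have h2 := hn 2
  simp only [quadTriple, Matrix.cons_val_zero, Matrix.cons_val_one, Matrix.cons_val] at h0 h1 h2
  have e2 : t 2 = B * t 0 := by
    rw [← sub_eq_zero]
    refine pow_eq_zero_iff (two_ne_zero) |>.1 ?_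
    linear_combination h2
  rw [e2] at h0 h1
  have h3 : B * (t 0 * (t 1 + A * t 0)) = 0 := by
    apply mul_left_cancel₀ ((by norm_num : (4:F) ≠ 0)); linear_combination h1
  have h00 : t 0 = 0 := by
    rcases mul_eq_zero.1 ((mul_eq_zero.1 h3).resolve_left h.1) with h4 | h4
    · exact h4
    · have h5 : (A ^ 2 - 4 * B) * (t 0 * t 0) = 0 := by
        linear_combination h0 - (t 1 - A * t 0) * h4
      exact mul_self_eq_zero.1 ((mul_eq_zero.1 h5).resolve_left h.2)
  have h11 : t 1 = 0 := by
    rw [h00] at h0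
    exact mul_self_eq_zero.1 (by linear_combination h0)
  obtain ⟨i, hi⟩ := ht
  fin_cases i
  · exact hi h00
  · exact hi h11
  · exact hi (by rw [show t ((fun i => i) ⟨2, by decide⟩) = t 2 from rfl, e2, h00, mul_zero])

theorem HasHeight.quadTriple {A B : F} (h : Smooth A B) {t : Fin 3 → F[X]} {n : ℕ}
    (ht : HasHeight t n) : HasHeight (quadTriple (C A) (C B) t) (n + n) := by
  have hd : ∀ i j, (t i * t j).natDegree ≤ n + n :=
    fun i j => natDegree_mul_le_of_le (ht.le i) (ht.le j)
  have hdc : ∀ (c : F) i j, (C c * (t i * t j)).natDegree ≤ n + n :=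
    fun c i j => (natDegree_C_mul_le _ _).trans (hd i j)
  have hco : ∀ i j, (t i * t j).coeff (n + n) = (t i).coeff n * (t j).coeff n :=
    fun i j => coeff_mul_add_eq_of_natDegree_le (ht.le i) (ht.le j)
  have e : GoodTwist.quadTriple (C A) (C B) t = ![t 1 * t 1 - C 4 * (t 2 * t 0),
      C 2 * (t 1 * t 2) + C (2 * B) * (t 1 * t 0) + C (4 * A) * (t 2 * t 0),
      t 2 * t 2 - C (2 * B) * (t 2 * t 0) + C (B ^ 2) * (t 0 * t 0)] := by
    simp only [GoodTwist.quadTriple, C_mul, C_pow, map_ofNat]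
  refine ⟨fun i => ?_, ?_, fun x => ?_⟩
  · rw [e]
    fin_cases i
    · exact (natDegree_sub_le_of_le (hd _ _) (hdc _ _ _)).trans (max_self _).le
    · exact natDegree_add_le_of_degree_le (natDegree_add_le_of_degree_le (hdc _ _ _) (hdc _ _ _))
        (hdc _ _ _)
    · exact natDegree_add_le_of_degree_le
        ((natDegree_sub_le_of_le (hd _ _) (hdc _ _ _)).trans (max_self _).le) (hdc _ _ _)
  · obtain ⟨i, hi⟩ := quadTriple_ne_zero h (t := fun i => (t i).coeff n) ht.lead
    refine ⟨i, ?_⟩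
    rw [e]
    fin_cases i <;>
      simpa [GoodTwist.quadTriple, hco, -map_mul, -map_pow, coeff_C_mul] using hi
  · obtain ⟨i, hi⟩ := quadTriple_ne_zero h (t := fun i => (t i).eval x) (ht.prim x)
    refine ⟨i, ?_⟩
    fin_cases i <;>
      simpa [GoodTwist.quadTriple] using hi

end Height

section Degree

variable {F : Type*} [Field F] [CharZero F] [IsAlgClosed F]
  {A B A' B' A'' B'' : F} {h : Smooth A B} {h' : Smooth A' B'} {h'' : Smooth A'' B''}

/-- Homogeneous `x`-coordinates. -/
abbrev xr (P : Pt A B) : Fin 2 → F := WeierstrassCurve.Affine.Point.xRep P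

theorem xr_zero : xr (0 : Pt A B) = ![1, 0] := rfl

theorem xr_mkPt {x y : F} (hxy) : xr (mkPt h x y hxy) = ![x, 1] := rfl

theorem xr_neg (P : Pt A B) : xr (-P) = xr P := WeierstrassCurve.Affine.Point.xRep_neg P

theorem quadTriple_self (P : Pt A B) (h : Smooth A B) : ∃ k : F, k ≠ 0 ∧
    quadTriple A B (symTriple (xr P) (xr P)) = k • symTriple (xr (P + P)) (xr (0 : Pt A B)) := by
  rcases pt_cases h P with rfl | ⟨x, y, hxy, rfl⟩
  · refine ⟨1, one_ne_zero, ?_⟩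
    rw [add_zero, one_smul]
    ext i; fin_cases i <;> simp [quadTriple, symTriple]
  · by_cases hy : y = 0
    · subst hy
      have e : mkPt h x 0 hxy + mkPt h x 0 hxy = 0 := by
        have := mkPt_add_neg (h := h) hxy (by simpa using hxy)
        rwa [mkPt_congr (h := h) (y' := 0) rfl neg_zero] at this
      rw [e]
      refine ⟨(x ^ 2 - B) ^ 2, ?_, ?_⟩
      · intro h0
        have h0 := pow_eq_zero_iff (two_ne_zero) |>.1 h0
        rcases eq_or_ne x 0 with rfl | hx
        · exact h.1 (by linear_combination -h0)
        · have h1 : x ^ 2 + A * x + B = 0 := by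
            apply mul_left_cancel₀ hx; linear_combination -hxy
          have h2 : A + 2 * x = 0 := by
            apply mul_left_cancel₀ hx; linear_combination h1 + h0
          exact h.2 (by linear_combination (A - 2 * x) * h2 + 4 * h0)
      · ext i; fin_cases i
        · simp [quadTriple, symTriple, xr_mkPt, xr_zero]; ring
        · simp [quadTriple, symTriple, xr_mkPt, xr_zero]; linear_combination -4 * hxy
        · simp [quadTriple, symTriple, xr_mkPt, xr_zero]; ring
    · obtain ⟨h₃, e⟩ := mkPt_add_self (h := h) (h₁ := hxy) hy
        (l := (3 * x ^ 2 + 2 * A * x + B) / (2 * y)) (div_mul_cancel₀ _ (by simpa using hy)) rfl rfl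
      rw [e]
      refine ⟨4 * y ^ 2, by simpa using hy, ?_⟩
      ext i; fin_cases i
      · simp [quadTriple, symTriple, xr_mkPt, xr_zero]; ring
      · simp [quadTriple, symTriple, xr_mkPt, xr_zero]; linear_combination -4 * hxy
      · simp [quadTriple, symTriple, xr_mkPt, xr_zero]
        field_simp
        linear_combination 16 * (A + 2 * x) * hxy

/-- The classical formulas for the sum and product of x(P + Q) and x(P − Q). The scalar k is (x₁ −
x₂)² in the generic case; coincident or opposite points and the point at infinity are treated apart.
-/
theorem quadTriple_pt (P Q : Pt A B) (h : Smooth A B) : ∃ k : F, k ≠ 0 ∧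
    quadTriple A B (symTriple (xr P) (xr Q)) = k • symTriple (xr (P + Q)) (xr (P - Q)) := by
  by_cases hPQ : P = Q
  · subst hPQ
    rw [sub_self]
    exact quadTriple_self P h
  by_cases hPQ' : P = -Q
  · subst hPQ'
    obtain ⟨k, hk, e⟩ := quadTriple_self (-Q) h
    refine ⟨k, hk, ?_⟩
    rw [xr_neg] at e
    rw [xr_neg, e, neg_add_cancel, ← neg_add', xr_neg, ← neg_add, xr_neg]
    ext i; fin_cases i <;> simp [symTriple, xr_zero]
  rcases pt_cases h P with rfl | ⟨x₁, y₁, h₁, rfl⟩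
  · refine ⟨1, one_ne_zero, ?_⟩
    rw [zero_add, zero_sub, xr_neg, one_smul]
    ext i; fin_cases i <;> simp [quadTriple, symTriple, xr_zero] <;> ring
  rcases pt_cases h Q with rfl | ⟨x₂, y₂, h₂, rfl⟩
  · refine ⟨1, one_ne_zero, ?_⟩
    rw [add_zero, sub_zero, one_smul]
    ext i; fin_cases i <;> simp [quadTriple, symTriple, xr_zero] <;> ring
  have hx : x₁ ≠ x₂ := by
    rintro rfl
    rcases eq_or_eq_neg_of_mkPt h₁ h₂ with h3 | h3
    exacts [hPQ h3, hPQ' h3]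
  have hx' : x₁ - x₂ ≠ 0 := sub_ne_zero.2 hx
  have h₂' : (-y₂) ^ 2 = x₂ ^ 3 + A * x₂ ^ 2 + B * x₂ := by rw [neg_sq, h₂]
  obtain ⟨h₃, e₃⟩ := mkPt_add_of_ne (h := h) (h₁ := h₁) (h₂ := h₂) hx
    (l := (y₁ - y₂) / (x₁ - x₂)) (div_mul_cancel₀ _ hx') rfl rfl
  obtain ⟨h₄, e₄⟩ := mkPt_add_of_ne (h := h) (h₁ := h₁) (h₂ := h₂') hx
    (l := (y₁ - -y₂) / (x₁ - x₂)) (div_mul_cancel₀ _ hx') rfl rfl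
  rw [sub_eq_add_neg, neg_mkPt h₂, e₃, e₄]
  refine ⟨(x₁ - x₂) ^ 2, pow_ne_zero 2 hx', ?_⟩
  ext i; fin_cases i
  · simp [quadTriple, symTriple, xr_mkPt]; ring
  · simp [quadTriple, symTriple, xr_mkPt]
    field_simp
    linear_combination -2 * h₁ - 2 * h₂
  · simp [quadTriple, symTriple, xr_mkPt]
    field_simp
    linear_combination (-(y₁ ^ 2 + (x₁ ^ 3 + A * x₁ ^ 2 + B * x₁) - 2 * y₂ ^ 2 - 2 * (A + x₁ + x₂) * (x₁ - x₂) ^ 2)) * h₁ - (y₂ ^ 2 + (x₂ ^ 3 + A * x₂ ^ 2 + B * x₂) - 2 * (x₁ ^ 3 + A * x₁ ^ 2 + B * x₁) - 2 * (A + x₁ + x₂) * (x₁ - x₂) ^ 2) * h₂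

/-- The homomorphism `φ` has degree `n`. -/
def DegIs (h : Smooth A B) (φ : Pt A B →+ Pt A' B') (n : ℕ) : Prop :=
  ∃ p : Fin 2 → F[X], HasHeight p n ∧
    ∀ᶠ x in cofinite, ∀ y hxy, ∃ c : F, c ≠ 0 ∧ ∀ i, (p i).eval x = c * xr (φ (mkPt h x y hxy)) i

variable {φ ψ : Pt A B →+ Pt A' B'} {R S : RatFunc F} {n m : ℕ}

theorem exists_smul_of_triple {k : ℕ} {a b : Fin k → F[X]}
    (hab : ∀ᶠ x in cofinite, ∃ (v : Fin k → F) (c d : F),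
      (∀ i, (a i).eval x = c * v i) ∧ ∀ i, (b i).eval x = d * v i) (i j : Fin k) :
    a i * b j = a j * b i := by
  rw [← sub_eq_zero]
  refine eq_zero_of_eventually_eval (hab.mono fun x hx => ?_)
  obtain ⟨v, c, d, h1, h2⟩ := hx
  rw [eval_sub, eval_mul, eval_mul, h1, h1, h2, h2]
  ring

theorem DegIs.unique (hn : DegIs h φ n) (hm : DegIs h φ m) : n = m := by
  obtain ⟨p, hp, h1⟩ := hn
  obtain ⟨q, hq, h2⟩ := hm
  refine hp.unique hq (exists_smul_of_triple ?_)
  filter_upwards [h1, h2] with x hx₁ hx₂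
  obtain ⟨y, hxy⟩ := exists_y A B x
  obtain ⟨c, -, hc⟩ := hx₁ y hxy
  obtain ⟨d, -, hd⟩ := hx₂ y hxy
  exact ⟨_, c, d, hc, hd⟩

theorem degIs_zero (h : Smooth A B) : DegIs h (0 : Pt A B →+ Pt A' B') 0 := by
  refine ⟨![1, 0], ⟨?_, ⟨0, by simp⟩, fun x => ⟨0, by simp⟩⟩, Eventually.of_forall ?_⟩
  · intro i; fin_cases i <;> simp
  · intro x y hxy
    refine ⟨1, one_ne_zero, fun i => ?_⟩
    rw [AddMonoidHom.zero_apply, xr_zero]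
    fin_cases i <;> simp

theorem Rep.degIs (hφ : Rep h h' φ R S) :
    DegIs h φ (max R.num.natDegree R.denom.natDegree) := by
  refine ⟨![R.num, R.denom], ⟨?_, ?_, ?_⟩, ?_⟩
  · intro i; fin_cases i
    exacts [le_max_left _ _, le_max_right _ _]
  · rcases le_total R.num.natDegree R.denom.natDegree with h1 | h1
    · refine ⟨1, ?_⟩
      rw [max_eq_right h1]
      simpa using RatFunc.denom_ne_zero R
    · refine ⟨0, ?_⟩
      rw [max_eq_left h1]
      have : R.num ≠ 0 := by
        rw [Ne, RatFunc.num_eq_zero_iff]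
        intro h0
        exact hφ.ne_cst 0 (by rw [h0, cst, C_0, map_zero])
      simpa using this
  · intro x
    obtain ⟨a, b, hab⟩ := RatFunc.isCoprime_num_denom R
    by_contra! hn
    have h0 := hn 0
    have h1 := hn 1
    simp only [Matrix.cons_val_zero, Matrix.cons_val_one, Matrix.cons_val_fin_one] at h0 h1
    have := congrArg (eval x) hab
    simp [h0, h1] at this
  · filter_upwards [hφ, eventually_denom R] with x hx hd y hxy
    obtain ⟨x', s, hxy', h0, h1, h2⟩ := hx y hxy
    refine ⟨R.denom.eval x, hd, fun i => ?_⟩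
    rw [h0, xr_mkPt]
    fin_cases i
    · simpa [mul_comm] using h1.num_denom
    · simp

theorem HasMult.exists_degIs {a : F} (hφ : HasMult h h' φ a) : ∃ n, DegIs h φ n := by
  rcases hφ with ⟨rfl, -⟩ | ⟨R, S, h1, -⟩
  exacts [⟨0, degIs_zero h⟩, ⟨_, h1.degIs⟩]

theorem HasMult.eq_zero_of_degIs {a : F} (hφ : HasMult h h' φ a) (h0 : DegIs h φ 0) : φ = 0 := by
  rcases hφ with ⟨rfl, -⟩ | ⟨R, S, h1, -⟩
  · rfl
  · have h2 := h1.degIs.unique h0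
    have h3 : R.num.natDegree = 0 ∧ R.denom.natDegree = 0 := by omega
    rw [natDegree_eq_zero, natDegree_eq_zero] at h3
    obtain ⟨⟨a, ha⟩, b, hb⟩ := h3
    have hb0 : b ≠ 0 := by
      rintro rfl
      exact RatFunc.denom_ne_zero R (by rw [← hb, C_0])
    exfalso
    refine h1.ne_cst (a / b) (mul_right_cancel₀
      (algebraMap_ratFunc_ne_zero (RatFunc.denom_ne_zero R)) ?_)
    rw [mul_denom, ← ha, ← hb, cst, ← map_mul, ← C_mul, div_mul_cancel₀ _ hb0]

theorem HasMult.degIs_comp {χ : Pt A' B' →+ Pt A'' B''} {a : F} (hφ : HasMult h h' φ a)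
    (hn : DegIs h' χ n) (hm : DegIs h φ m) : DegIs h (χ.comp φ) (n * m) := by
  have hφ' := hφ
  rcases hφ with ⟨rfl, -⟩ | ⟨R, S, h1, -⟩
  · obtain rfl := hm.unique (degIs_zero h)
    rw [AddMonoidHom.comp_zero, mul_zero]
    exact degIs_zero h
  · obtain ⟨p, hp, hp'⟩ := hn
    obtain ⟨q, hq, hq'⟩ := hm
    refine ⟨_, hp.comp hq, ?_⟩
    filter_upwards [h1, hq', eventually_evAt_of_ne_cst h1.ne_cst hp'] with x hx₁ hx₂ hx₃ y hxy
    obtain ⟨x', s, hxy', e₁, r₁, t₁⟩ := hx₁ y hxy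
    obtain ⟨c, hc, e₂⟩ := hx₂ y hxy
    obtain ⟨d, hd, e₃⟩ := hx₃ x' r₁ _ hxy'
    rw [e₁, xr_mkPt] at e₂
    have e20 : (q 0).eval x = c * x' := by simpa using e₂ 0
    have e21 : (q 1).eval x = c := by simpa using e₂ 1
    refine ⟨c ^ n * d, mul_ne_zero (pow_ne_zero n hc) hd, fun i => ?_⟩
    have hev : (hval n (fun j => C ((p i).coeff j)) (q 0) (q 1)).eval x =
        hval n (p i).coeff ((q 0).eval x) ((q 1).eval x) := by
      simp [hval, eval_finsetSum]
    rw [hev, AddMonoidHom.comp_apply, e₁, mul_assoc, ← e₃ i, e20, e21, hval_eq (hp.le i) hc,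
      mul_div_cancel_left₀ _ hc]

/-- The parallelogram law for degrees. -/
theorem DegIs.parallelogram {n₁ n₂ n₃ n₄ : ℕ} (h' : Smooth A' B') (h₁ : DegIs h φ n₁)
    (h₂ : DegIs h ψ n₂) (h₃ : DegIs h (φ + ψ) n₃) (h₄ : DegIs h (φ - ψ) n₄) :
    n₃ + n₄ = 2 * n₁ + 2 * n₂ := by
  obtain ⟨p₁, hp₁, e₁⟩ := h₁
  obtain ⟨p₂, hp₂, e₂⟩ := h₂
  obtain ⟨p₃, hp₃, e₃⟩ := h₃
  obtain ⟨p₄, hp₄, e₄⟩ := h₄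
  -- Both sides are heights of the same projective point: `symTriple` adds heights and `quadTriple`
  -- doubles them.
  have key : n₃ + n₄ = (n₁ + n₂) + (n₁ + n₂) := by
    refine (hp₃.symTriple hp₄).unique ((hp₁.symTriple hp₂).quadTriple h')
      (exists_smul_of_triple ?_)
    filter_upwards [e₁, e₂, e₃, e₄] with x hx₁ hx₂ hx₃ hx₄
    obtain ⟨y, hxy⟩ := exists_y A B x
    obtain ⟨c₁, -, e₁⟩ := hx₁ y hxy
    obtain ⟨c₂, -, e₂⟩ := hx₂ y hxy
    obtain ⟨c₃, -, e₃⟩ := hx₃ y hxy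
    obtain ⟨c₄, -, e₄⟩ := hx₄ y hxy
    obtain ⟨k, -, e⟩ := quadTriple_pt (φ (mkPt h x y hxy)) (ψ (mkPt h x y hxy)) h'
    rw [AddMonoidHom.add_apply] at e₃
    rw [AddMonoidHom.sub_apply] at e₄
    refine ⟨symTriple (xr (φ (mkPt h x y hxy) + ψ (mkPt h x y hxy)))
        (xr (φ (mkPt h x y hxy) - ψ (mkPt h x y hxy))), c₃ * c₄, (c₁ * c₂) ^ 2 * k, ?_, fun i => ?_⟩
    · intro i
      fin_cases i <;> simp [symTriple, e₃, e₄] <;> ring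
    · have ei := congrFun e i
      rw [Pi.smul_apply, smul_eq_mul] at ei
      rw [mul_assoc, ← ei]
      fin_cases i <;> simp [quadTriple, symTriple, e₁, e₂] <;> ring
  omega

end Degree

/-- An element of a ring with a nondegenerate multiplicative norm satisfying the parallelogram law
is a root of an integral monic quadratic polynomial. -/
theorem exists_quadratic_of_norm {R : Type*} [Ring R] (N : R → ℤ)
    (hpar : ∀ x y, N (x + y) + N (x - y) = 2 * N x + 2 * N y)
    (hmul : ∀ x y, N (x * y) = N x * N y) (h0 : ∀ x, N x = 0 → x = 0) (x : R) :
    ∃ t n : ℤ, x * x - t • x + n • (1 : R) = 0 := by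
  -- Jordan–von Neumann: the parallelogram law makes N a quadratic form, whose polarization is the
  -- biadditive B below.
  have key : ∀ x y z, N (x + y + z) = N (x + y) + N (y + z) + N (x + z) - N x - N y - N z := by
    intro x y z
    have h1 := hpar (x + z) y
    have h2 := hpar (x - y) z
    have h3 := hpar x (y + z)
    have h4 := hpar x y
    rw [show x + z + y = x + y + z by abel] at h1
    rw [show x - y + z = x + z - y by abel] at h2
    rw [show x + (y + z) = x + y + z by abel, show x - (y + z) = x - y - z by abel] at h3
    linarith
  have hN0 : N 0 = 0 := by
    have := hpar 0 0
    rw [add_zero, sub_zero] at this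
    linarith
  let L (x : R) : R →+ ℤ := AddMonoidHom.mk' (fun y => N (x + y) - N x - N y) (fun y z => by
    rw [← add_assoc, key x y z]; ring)
  let B : R →+ R →+ ℤ := AddMonoidHom.mk' L (fun x z => by
    ext y
    change N (x + z + y) - N (x + z) - N y = (N (x + y) - N x - N y) + (N (z + y) - N z - N y)
    rw [key x z y]; ring)
  have hB : ∀ x y, B x y = N (x + y) - N x - N y := fun _ _ => rfl
  have hBB : ∀ x, B x x = 2 * N x := by
    intro x
    have h1 := hpar x x
    rw [sub_self, hN0] at h1
    rw [hB]; linarith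
  have hl : ∀ x y w, B (x * y) (x * w) = N x * B y w := by
    intro x y w
    rw [hB, hB, ← mul_add, hmul, hmul, hmul]; ring
  -- Multiplicativity N(xy) = N(x)N(y), polarized in both arguments.
  have hlin : ∀ x y z w, B (x * y) (z * w) + B (z * y) (x * w) = B x z * B y w := by
    intro x y z w
    have h1 := hl (x + z) y w
    rw [add_mul, add_mul] at h1
    simp only [map_add, AddMonoidHom.add_apply] at h1
    rw [hl, hl] at h1
    rw [hB x z]
    linarith
  -- The trace is B(x, 1) and the constant term is N(x); the norm of x² − B(x, 1)x + N(x) expands to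
  -- zero, so nondegeneracy applies.
  refine ⟨B x 1, N x, h0 _ ?_⟩
  have e1 : B (x * x) x = N x * B x 1 := by
    have := hl x x 1
    rwa [mul_one] at this
  have e2 : B (x * x) 1 + 2 * N x = B x 1 * B x 1 := by
    have := hlin x x 1 1
    rwa [mul_one, one_mul, mul_one, hBB] at this
  have hsymm : ∀ x y, B x y = B y x := fun x y => by rw [hB, hB, add_comm x y]; ring
  have h11 : N 1 * N x = N x := by rw [← hmul, one_mul]
  have hxx : N (x * x) = N x * N x := hmul x x
  have h2 := hBB (x * x - B x 1 • x + N x • (1 : R))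
  simp only [map_add, map_sub, map_zsmul, AddMonoidHom.add_apply, AddMonoidHom.sub_apply,
    AddMonoidHom.smul_apply, smul_eq_mul, hBB, hsymm x (x * x), hsymm 1 (x * x), hsymm 1 x,
    e1, hxx] at h2
  have e2' : B (x * x) 1 = B x 1 * B x 1 - 2 * N x := by linarith
  rw [e2'] at h2
  have h3 : 2 * N (x * x - B x 1 • x + N x • (1 : R)) = 0 := by
    linear_combination 2 * N x * h11 - h2
  linarith

/-! ### The ring of algebraic endomorphisms and its multipliers. -/

section

variable {F : Type*} [Field F] [CharZero F] [IsAlgClosed F] {A B : F} (h : Smooth A B)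

/-- The ring of endomorphisms with a multiplier. -/
def algEnd : Subring (AddMonoid.End (Pt A B)) where
  carrier := {φ | ∃ a, HasMult h h φ a}
  mul_mem' := fun ⟨a, ha⟩ ⟨b, hb⟩ => ⟨a * b, ha.comp hb⟩
  one_mem' := ⟨1, hasMult_id⟩
  add_mem' := fun ⟨a, ha⟩ ⟨b, hb⟩ => ⟨a + b, ha.add hb⟩
  zero_mem' := ⟨0, hasMult_zero⟩
  neg_mem' := fun ⟨a, ha⟩ => ⟨-a, ha.neg⟩

/-- The action of endomorphisms on the invariant differential. -/
def multiplier : algEnd h →+* F where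
  toFun φ := φ.2.choose
  map_one' := (Subring.one_mem (algEnd h)).choose_spec.unique hasMult_id
  map_mul' φ ψ := (φ * ψ).2.choose_spec.unique (φ.2.choose_spec.comp ψ.2.choose_spec)
  map_zero' := (Subring.zero_mem (algEnd h)).choose_spec.unique hasMult_zero
  map_add' φ ψ := (φ + ψ).2.choose_spec.unique (φ.2.choose_spec.add ψ.2.choose_spec)

theorem hasMult_multiplier (φ : algEnd h) : HasMult h h φ.1 (multiplier h φ) := φ.2.choose_spec

theorem multiplier_injective : Function.Injective (multiplier h) := by
  rw [injective_iff_map_eq_zero]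
  intro φ h0
  have := hasMult_multiplier h φ
  rw [h0] at this
  exact Subtype.ext this.eq_zero

/-- The degree of an endomorphism. -/
def endDeg (φ : algEnd h) : ℤ := ((hasMult_multiplier h φ).exists_degIs.choose : ℕ)

theorem endDeg_spec (φ : algEnd h) : ∃ n : ℕ, DegIs h φ.1 n ∧ endDeg h φ = n :=
  ⟨_, (hasMult_multiplier h φ).exists_degIs.choose_spec, rfl⟩

theorem multiplier_quadratic (φ : algEnd h) : ∃ t n : ℤ,
    multiplier h φ ^ 2 - t * multiplier h φ + n = 0 := by
  obtain ⟨t, n, e⟩ := exists_quadratic_of_norm (endDeg h) (fun x y => by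
      obtain ⟨n₁, h₁, e₁⟩ := endDeg_spec h x
      obtain ⟨n₂, h₂, e₂⟩ := endDeg_spec h y
      obtain ⟨n₃, h₃, e₃⟩ := endDeg_spec h (x + y)
      obtain ⟨n₄, h₄, e₄⟩ := endDeg_spec h (x - y)
      have := DegIs.parallelogram h h₁ h₂ h₃ h₄
      rw [e₁, e₂, e₃, e₄]
      exact_mod_cast this) (fun x y => by
      obtain ⟨n₁, h₁, e₁⟩ := endDeg_spec h x
      obtain ⟨n₂, h₂, e₂⟩ := endDeg_spec h y
      obtain ⟨n₃, h₃, e₃⟩ := endDeg_spec h (x * y)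
      have := h₃.unique ((hasMult_multiplier h y).degIs_comp h₁ h₂)
      rw [e₁, e₂, e₃]
      exact_mod_cast this) (fun x hx => by
      obtain ⟨n₁, h₁, e₁⟩ := endDeg_spec h x
      rw [hx] at e₁
      obtain rfl : n₁ = 0 := by exact_mod_cast e₁.symm
      exact Subtype.ext ((hasMult_multiplier h x).eq_zero_of_degIs h₁)) φ
  refine ⟨t, n, ?_⟩
  have := congrArg (multiplier h) e
  simpa [sq] using this

end

section Order

variable {K : Type*} [Field K] [NumberField K] {F : Type*} [Field F] [CharZero F] [IsAlgClosed F]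
  [Algebra K F] {A B : F} (h : Smooth A B)

/-- The ring of elements of `K` that are multipliers of endomorphisms. -/
def multiplierRing (K : Type*) [Field K] [Algebra K F] : Subring K :=
  (multiplier h).range.comap (algebraMap K F)

theorem mem_multiplierRing {k : K} :
    k ∈ multiplierRing h K ↔ ∃ φ, HasMult h h φ (algebraMap K F k) := by
  constructor
  · rintro ⟨φ, hφ⟩
    exact ⟨φ.1, hφ ▸ hasMult_multiplier h φ⟩
  · rintro ⟨φ, hφ⟩
    exact ⟨⟨φ, _, hφ⟩, (hasMult_multiplier h _).unique hφ⟩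

/-- The multipliers of φ, ψ and φ + ψ satisfy integral quadratic equations. Combining the three
leaves a linear equation for the multiplier of φ over K, with leading coefficient 2ω + t − t'',
nonzero because ω is irrational. -/
theorem multiplier_mem_range {ω : K} (hω : ω ∈ multiplierRing h K)
    (hω' : ∀ q : ℚ, ω ≠ algebraMap ℚ K q) (φ : algEnd h) :
    multiplier h φ ∈ (algebraMap K F).range := by
  obtain ⟨ψ, hψ⟩ := hω
  obtain ⟨t, n, e₁⟩ := multiplier_quadratic h φ
  obtain ⟨t', n', e₂⟩ := multiplier_quadratic h ψ
  obtain ⟨t'', n'', e₃⟩ := multiplier_quadratic h (φ + ψ)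
  rw [map_add] at e₃
  rw [hψ] at e₂ e₃
  set a := multiplier h φ
  have hne : (2 * ω + t - t'' : K) ≠ 0 := by
    intro h0
    refine hω' ((t'' - t) / 2) ?_
    rw [map_div₀, map_sub, map_intCast, map_intCast, map_ofNat]
    rw [eq_div_iff two_ne_zero]; linear_combination h0
  have hne' : algebraMap K F (2 * ω + t - t'') ≠ 0 := by
    rwa [Ne, map_eq_zero]
  refine ⟨(-(t' - t'') * ω + n + n' - n'') / (2 * ω + t - t''), ?_⟩
  rw [map_div₀, div_eq_iff hne']
  simp only [map_add, map_sub, map_mul, map_neg, map_intCast, map_ofNat]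
  linear_combination e₁ + e₂ - e₃

theorem isIntegral_of_mem_multiplierRing {k : K} (hk : k ∈ multiplierRing h K) :
    IsIntegral ℤ k := by
  obtain ⟨φ, hφ⟩ := hk
  obtain ⟨t, n, e⟩ := multiplier_quadratic h φ
  rw [hφ] at e
  have e' : k ^ 2 - t * k + n = 0 := by
    apply (algebraMap K F).injective
    simpa using e
  refine ⟨X ^ 2 - C t * X + C n, by monicity!, ?_⟩
  simp only [eval₂_add, eval₂_sub, eval₂_mul, eval₂_C, eval₂_X, eval₂_pow]
  simpa using e'

/-- Multipliers are integral, so they form a subgroup of the noetherian ℤ-module 𝓞 K; the elements 1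
and ω span K. -/
theorem isOrder_multiplierRing (hquad : Module.finrank ℚ K = 2) {ω : K}
    (hω : ω ∈ multiplierRing h K) (hω' : ∀ q : ℚ, ω ≠ algebraMap ℚ K q) :
    IsOrder (multiplierRing h K) := by
  constructor
  · have h1 : ((multiplierRing h K).toAddSubgroup.comap
        (algebraMap (𝓞 K) K).toAddMonoidHom).FG := by
      rw [← AddSubgroup.toIntSubmodule_toAddSubgroup ((multiplierRing h K).toAddSubgroup.comap
        (algebraMap (𝓞 K) K).toAddMonoidHom), ← Submodule.fg_iff_addSubgroup_fg]
      exact IsNoetherian.noetherian _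
    have h2 : ((multiplierRing h K).toAddSubgroup.comap
        (algebraMap (𝓞 K) K).toAddMonoidHom).map (algebraMap (𝓞 K) K).toAddMonoidHom =
        (multiplierRing h K).toAddSubgroup := by
      refine AddSubgroup.map_comap_eq_self ?_
      intro k hk
      exact ⟨⟨k, isIntegral_of_mem_multiplierRing h hk⟩, rfl⟩
    rw [← h2]
    obtain ⟨T, hT⟩ := h1
    rw [← hT, AddMonoidHom.map_closure]
    exact ⟨T.image (algebraMap (𝓞 K) K).toAddMonoidHom, by rw [Finset.coe_image]⟩
  · have hli : LinearIndependent ℚ ![(1 : K), ω] := by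
      rw [LinearIndependent.pair_iff' one_ne_zero]
      intro q hq
      exact hω' q (by rw [← hq, Algebra.algebraMap_eq_smul_one])
    have h3 := hli.span_eq_top_of_card_eq_finrank (by simp [hquad])
    rw [eq_top_iff, ← h3]
    refine Submodule.span_mono ?_
    rintro x ⟨i, rfl⟩
    fin_cases i
    · exact one_mem _
    · exact hω

/-- The endomorphism with a given multiplier. -/
theorem exists_cmHom {ω : K} (hω : ω ∈ multiplierRing h K)
    (hω' : ∀ q : ℚ, ω ≠ algebraMap ℚ K q) :
    ∃ ι : multiplierRing h K →+* AddMonoid.End (Pt A B), Function.Injective ι ∧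
      Set.range ι = {φ | IsAlgebraicEndomorphism (curveAB A B) φ} := by
  let e : algEnd h ≃+* (multiplier h).range :=
    RingEquiv.ofBijective (multiplier h).rangeRestrict
      ⟨fun x y hxy => multiplier_injective h (congrArg Subtype.val hxy),
        (multiplier h).rangeRestrict_surjective⟩
  let f : multiplierRing h K →+* (multiplier h).range :=
    ((algebraMap K F).comp (multiplierRing h K).subtype).codRestrict _ (fun x => x.2)
  refine ⟨(algEnd h).subtype.comp (e.symm.toRingHom.comp f), ?_, ?_⟩
  · refine Function.Injective.comp (g := (algEnd h).subtype) Subtype.val_injective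
      (Function.Injective.comp (g := e.symm) e.symm.injective ?_)
    exact fun x y hxy => Subtype.ext ((algebraMap K F).injective (congrArg Subtype.val hxy))
  · ext φ
    rw [Set.mem_setOf_eq, isAlgebraic_iff h]
    constructor
    · rintro ⟨x, rfl⟩
      exact (e.symm (f x)).2
    · intro hφ
      obtain ⟨k, hk⟩ := multiplier_mem_range h hω hω' ⟨φ, hφ⟩
      refine ⟨⟨k, ⟨_, hk.symm⟩⟩, ?_⟩
      change (e.symm _).1 = φ
      have : f ⟨k, ⟨_, hk.symm⟩⟩ = e ⟨φ, hφ⟩ := Subtype.ext hk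
      rw [this, RingEquiv.symm_apply_apply]

end Order

/-! ### Changes of variables and transport of endomorphisms. -/

open WeierstrassCurve in
theorem variableChange_relations {F : Type*} [Field F] {W W' : WeierstrassCurve F}
    {C : VariableChange F} (hC : C • W = W') :
    C.u * W'.a₁ = W.a₁ + 2 * C.s ∧
    (C.u : F) ^ 2 * W'.a₂ = W.a₂ - C.s * W.a₁ + 3 * C.r - C.s ^ 2 ∧
    (C.u : F) ^ 3 * W'.a₃ = W.a₃ + C.r * W.a₁ + 2 * C.t ∧
    (C.u : F) ^ 4 * W'.a₄ = W.a₄ - C.s * W.a₃ + 2 * C.r * W.a₂ - (C.t + C.r * C.s) * W.a₁ +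
      3 * C.r ^ 2 - 2 * C.s * C.t ∧
    (C.u : F) ^ 6 * W'.a₆ = W.a₆ + C.r * W.a₄ + C.r ^ 2 * W.a₂ + C.r ^ 3 - C.t * W.a₃ - C.t ^ 2 -
      C.r * C.t * W.a₁ := by
  subst hC
  simp only [variableChange_def, ← mul_assoc, ← Units.val_inv_eq_inv_val, ← mul_pow, Units.mul_inv,
    one_mul, one_pow, and_self]

section

variable {F : Type*} [Field F] {W W' : WeierstrassCurve F}
  {C : WeierstrassCurve.VariableChange F}

theorem nonsingular_variableChange (hC : C • W = W') (x y : F) :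
    W.toAffine.Nonsingular (C.u ^ 2 * x + C.r) (C.u ^ 3 * y + C.u ^ 2 * C.s * x + C.t) ↔
      W'.toAffine.Nonsingular x y := by
  obtain ⟨h1, h2, h3, h4, h6⟩ := variableChange_relations hC
  have hu : (C.u : F) ≠ 0 := C.u.ne_zero
  rw [WeierstrassCurve.Affine.nonsingular_iff', WeierstrassCurve.Affine.nonsingular_iff',
    WeierstrassCurve.Affine.equation_iff', WeierstrassCurve.Affine.equation_iff']
  set u := (C.u : F)
  set r := C.r
  set s := C.s
  set t := C.t
  have e1 : (u ^ 3 * y + u ^ 2 * s * x + t) ^ 2 +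
      W.a₁ * (u ^ 2 * x + r) * (u ^ 3 * y + u ^ 2 * s * x + t) +
      W.a₃ * (u ^ 3 * y + u ^ 2 * s * x + t) -
      ((u ^ 2 * x + r) ^ 3 + W.a₂ * (u ^ 2 * x + r) ^ 2 + W.a₄ * (u ^ 2 * x + r) + W.a₆) =
      u ^ 6 * (y ^ 2 + W'.a₁ * x * y + W'.a₃ * y -
        (x ^ 3 + W'.a₂ * x ^ 2 + W'.a₄ * x + W'.a₆)) := by
    linear_combination (-u ^ 5 * x * y) * h1 + u ^ 4 * x ^ 2 * h2 - u ^ 3 * y * h3 +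
      u ^ 2 * x * h4 + h6
  have e2 : 2 * (u ^ 3 * y + u ^ 2 * s * x + t) + W.a₁ * (u ^ 2 * x + r) + W.a₃ =
      u ^ 3 * (2 * y + W'.a₁ * x + W'.a₃) := by
    linear_combination (-u ^ 2 * x) * h1 - h3
  have e3 : W.a₁ * (u ^ 3 * y + u ^ 2 * s * x + t) -
      (3 * (u ^ 2 * x + r) ^ 2 + 2 * W.a₂ * (u ^ 2 * x + r) + W.a₄) =
      u ^ 4 * (W'.a₁ * y - (3 * x ^ 2 + 2 * W'.a₂ * x + W'.a₄)) -
      s * (u ^ 3 * (2 * y + W'.a₁ * x + W'.a₃)) := by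
    linear_combination (-u ^ 3 * y + s * u ^ 2 * x) * h1 + 2 * u ^ 2 * x * h2 + s * h3 + h4
  rw [e1, e2, e3, mul_eq_zero, mul_ne_zero_iff, or_iff_right (pow_ne_zero 6 hu),
    and_iff_right (pow_ne_zero 3 hu)]
  refine and_congr_right fun _ => ?_
  -- The partial derivative in x picks up −s times the one in y, so the two conditions match only
  -- after splitting on the vanishing of the latter.
  by_cases h0 : 2 * y + W'.a₁ * x + W'.a₃ = 0
  · simp [h0, hu]
  · simp [h0]

/-- The map on points given by a change of variables. -/
def vcFun (hC : C • W = W') : W'.toAffine.Point → W.toAffine.Point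
  | .zero => .zero
  | .some x y h => .some _ _ ((nonsingular_variableChange hC x y).2 h)

theorem vcFun_add (hC : C • W = W') (P Q : W'.toAffine.Point) :
    vcFun hC (P + Q) = vcFun hC P + vcFun hC Q := by
  obtain ⟨h1, h2, h3, h4, h6⟩ := variableChange_relations hC
  have hu : (C.u : F) ≠ 0 := C.u.ne_zero
  rcases P with _ | ⟨x₁, y₁, hP⟩
  · change vcFun hC (0 + Q) = 0 + vcFun hC Q
    rw [zero_add, zero_add]
  rcases Q with _ | ⟨x₂, y₂, hQ⟩
  · change vcFun hC (_ + 0) = vcFun hC _ + 0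
    rw [add_zero, add_zero]
  have hneg : ∀ x y, W.toAffine.negY (C.u ^ 2 * x + C.r) (C.u ^ 3 * y + C.u ^ 2 * C.s * x + C.t) =
      C.u ^ 3 * W'.toAffine.negY x y + C.u ^ 2 * C.s * x + C.t := by
    intro x y
    simp only [WeierstrassCurve.Affine.negY]
    linear_combination (C.u ^ 2 * x) * h1 + h3
  have hxx : (C.u : F) ^ 2 * x₁ + C.r = C.u ^ 2 * x₂ + C.r ↔ x₁ = x₂ := by
    simp [hu]
  by_cases hxy : x₁ = x₂ ∧ y₁ = W'.toAffine.negY x₂ y₂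
  · rw [WeierstrassCurve.Affine.Point.add_of_Y_eq hxy.1 hxy.2]
    refine (WeierstrassCurve.Affine.Point.add_of_Y_eq (hxx.2 hxy.1) ?_).symm
    rw [hneg, ← hxy.2, hxy.1]
  have hxy' : ¬((C.u : F) ^ 2 * x₁ + C.r = C.u ^ 2 * x₂ + C.r ∧
      C.u ^ 3 * y₁ + C.u ^ 2 * C.s * x₁ + C.t =
        W.toAffine.negY (C.u ^ 2 * x₂ + C.r) (C.u ^ 3 * y₂ + C.u ^ 2 * C.s * x₂ + C.t)) := by
    rw [hxx, hneg]
    rintro ⟨rfl, h5⟩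
    exact hxy ⟨rfl, by simpa [hu] using h5⟩
  -- Lines of slope l go to lines of slope ul + s.
  have hslope : W.toAffine.slope (C.u ^ 2 * x₁ + C.r) (C.u ^ 2 * x₂ + C.r)
      (C.u ^ 3 * y₁ + C.u ^ 2 * C.s * x₁ + C.t) (C.u ^ 3 * y₂ + C.u ^ 2 * C.s * x₂ + C.t) =
      C.u * W'.toAffine.slope x₁ x₂ y₁ y₂ + C.s := by
    by_cases hx : x₁ = x₂
    · subst hx
      have hy : y₁ ≠ W'.toAffine.negY x₁ y₂ := fun h5 => hxy ⟨rfl, h5⟩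
      have hy' := fun h5 => hxy' ⟨rfl, h5⟩
      rw [WeierstrassCurve.Affine.slope_of_Y_ne rfl hy, WeierstrassCurve.Affine.slope_of_Y_ne rfl hy']
      have hyy : y₁ = y₂ := WeierstrassCurve.Affine.Y_eq_of_Y_ne hP.1 hQ.1 rfl hy
      subst hyy
      rw [hneg]
      have hd : y₁ - W'.toAffine.negY x₁ y₁ ≠ 0 := sub_ne_zero.2 hy
      have hd' : (C.u : F) ^ 3 * (y₁ - W'.toAffine.negY x₁ y₁) ≠ 0 :=
        mul_ne_zero (pow_ne_zero 3 hu) hd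
      rw [show (C.u : F) ^ 3 * y₁ + C.u ^ 2 * C.s * x₁ + C.t -
        (C.u ^ 3 * W'.toAffine.negY x₁ y₁ + C.u ^ 2 * C.s * x₁ + C.t) =
        C.u ^ 3 * (y₁ - W'.toAffine.negY x₁ y₁) by ring, div_eq_iff hd', mul_div_assoc', add_mul,
        div_mul_eq_mul_div, mul_left_comm, ← mul_assoc, mul_div_cancel_right₀ _ hd]
      simp only [WeierstrassCurve.Affine.negY]
      linear_combination (C.u ^ 3 * y₁ - C.s * C.u ^ 2 * x₁) * h1 - 2 * C.u ^ 2 * x₁ * h2 -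
        C.s * h3 - h4
    · have hx' := mt hxx.1 hx
      have hd := sub_ne_zero.2 hx
      rw [WeierstrassCurve.Affine.slope_of_X_ne hx, WeierstrassCurve.Affine.slope_of_X_ne hx']
      rw [show (C.u : F) ^ 2 * x₁ + C.r - (C.u ^ 2 * x₂ + C.r) = C.u ^ 2 * (x₁ - x₂) by ring]
      field_simp
      ring
  rw [WeierstrassCurve.Affine.Point.add_some hxy]
  refine Eq.trans ?_ (WeierstrassCurve.Affine.Point.add_some hxy').symm
  have hX : (C.u : F) ^ 2 * W'.toAffine.addX x₁ x₂ (W'.toAffine.slope x₁ x₂ y₁ y₂) + C.r =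
      W.toAffine.addX (C.u ^ 2 * x₁ + C.r) (C.u ^ 2 * x₂ + C.r)
        (C.u * W'.toAffine.slope x₁ x₂ y₁ y₂ + C.s) := by
    simp only [WeierstrassCurve.Affine.addX]
    linear_combination C.u * W'.toAffine.slope x₁ x₂ y₁ y₂ * h1 - h2
  have hY : (C.u : F) ^ 3 * W'.toAffine.addY x₁ x₂ y₁ (W'.toAffine.slope x₁ x₂ y₁ y₂) +
      C.u ^ 2 * C.s * W'.toAffine.addX x₁ x₂ (W'.toAffine.slope x₁ x₂ y₁ y₂) + C.t =
      W.toAffine.addY (C.u ^ 2 * x₁ + C.r) (C.u ^ 2 * x₂ + C.r)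
        (C.u ^ 3 * y₁ + C.u ^ 2 * C.s * x₁ + C.t)
        (C.u * W'.toAffine.slope x₁ x₂ y₁ y₂ + C.s) := by
    rw [WeierstrassCurve.Affine.addY, WeierstrassCurve.Affine.addY,
      WeierstrassCurve.Affine.negAddY, WeierstrassCurve.Affine.negAddY, ← hX]
    rw [← hneg]
    congr 1
    ring
  refine WeierstrassCurve.Affine.Point.some.injEq .. |>.mpr ⟨?_, ?_⟩
  · rw [hslope, hX]
  · rw [hslope, hY]

/-- Isomorphic curves have isomorphic groups of points. -/
def vcEquiv (hC : C • W = W') : W'.toAffine.Point ≃+ W.toAffine.Point :=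
  AddEquiv.ofBijective (AddMonoidHom.mk' (vcFun hC) (vcFun_add hC)) (by
    have hu : (C.u : F) ≠ 0 := C.u.ne_zero
    constructor
    · rw [injective_iff_map_eq_zero]
      rintro (_ | ⟨x, y, hP⟩) h0
      · rfl
      · exact absurd h0 (WeierstrassCurve.Affine.Point.some_ne_zero _)
    · rintro (_ | ⟨x, y, hP⟩)
      · exact ⟨0, rfl⟩
      · have hx : C.u ^ 2 * ((x - C.r) / C.u ^ 2) + C.r = x := by field_simp; ring
        have hy : C.u ^ 3 * ((y - C.t - C.s * (x - C.r)) / C.u ^ 3) +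
            C.u ^ 2 * C.s * ((x - C.r) / C.u ^ 2) + C.t = y := by field_simp; ring
        refine ⟨.some ((x - C.r) / C.u ^ 2) ((y - C.t - C.s * (x - C.r)) / C.u ^ 3)
          ((nonsingular_variableChange hC _ _).1 ?_), ?_⟩
        · rwa [hx, hy]
        · exact WeierstrassCurve.Affine.Point.some.injEq .. |>.mpr ⟨hx, hy⟩)

theorem vcEquiv_some (hC : C • W = W') {x y : F} (h) : vcEquiv hC (.some x y h) =
    .some _ _ ((nonsingular_variableChange hC x y).2 h) := rfl

theorem vcEquiv_symm_some (hC : C • W = W') {x y : F} (h) : ∃ h',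
    (vcEquiv hC).symm (.some x y h) =
    .some ((x - C.r) / C.u ^ 2) ((y - C.t - C.s * (x - C.r)) / C.u ^ 3) h' := by
  have hu : (C.u : F) ≠ 0 := C.u.ne_zero
  have hx : C.u ^ 2 * ((x - C.r) / C.u ^ 2) + C.r = x := by field_simp; ring
  have hy : C.u ^ 3 * ((y - C.t - C.s * (x - C.r)) / C.u ^ 3) +
      C.u ^ 2 * C.s * ((x - C.r) / C.u ^ 2) + C.t = y := by field_simp; ring
  refine ⟨(nonsingular_variableChange hC _ _).1 (by rwa [hx, hy]), ?_⟩
  rw [AddEquiv.symm_apply_eq, vcEquiv_some]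
  exact WeierstrassCurve.Affine.Point.some.injEq .. |>.mpr ⟨hx.symm, hy.symm⟩

open MvPolynomial in
theorem IsAlgebraicEndomorphism.conj (hC : C • W = W') {φ : AddMonoid.End W.toAffine.Point}
    (hφ : IsAlgebraicEndomorphism W φ) :
    IsAlgebraicEndomorphism W'
      ((AddEquiv.toAddMonoidHom (vcEquiv hC).symm).comp
        (AddMonoidHom.comp φ (AddEquiv.toAddMonoidHom (vcEquiv hC)))) := by
  have hu : (C.u : F) ≠ 0 := C.u.ne_zero
  rcases hφ with rfl | ⟨f, g, k, S, hS, H⟩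
  · left
    ext P
    exact map_zero (vcEquiv hC).symm
  · right
    let v : Fin 2 → MvPolynomial (Fin 2) F :=
      ![MvPolynomial.C (C.u ^ 2 : F) * X 0 + MvPolynomial.C C.r,
        MvPolynomial.C (C.u ^ 3 : F) * X 1 + MvPolynomial.C (C.u ^ 2 * C.s : F) * X 0 +
          MvPolynomial.C C.t]
    have hv : ∀ (q : MvPolynomial (Fin 2) F) x y, MvPolynomial.eval ![x, y] (bind₁ v q) =
        MvPolynomial.eval ![C.u ^ 2 * x + C.r, C.u ^ 3 * y + C.u ^ 2 * C.s * x + C.t] q := by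
      intro q x y
      rw [← aeval_eq_eval, ← aeval_eq_eval, aeval_bind₁]
      congr 2
      ext i
      fin_cases i <;> simp [v]
    refine ⟨MvPolynomial.C ((C.u : F) ^ 2)⁻¹ * (bind₁ v f - MvPolynomial.C C.r * bind₁ v k),
      MvPolynomial.C ((C.u : F) ^ 3)⁻¹ * (bind₁ v g - MvPolynomial.C C.t * bind₁ v k -
        MvPolynomial.C C.s * (bind₁ v f - MvPolynomial.C C.r * bind₁ v k)),
      bind₁ v k, (vcEquiv hC) ⁻¹' S, hS.preimage (vcEquiv hC).injective.injOn, ?_⟩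
    intro x y hxy hP
    obtain ⟨h1, h2, h3⟩ := H _ _ ((nonsingular_variableChange hC x y).2 hxy) hP
    obtain ⟨h4, h5⟩ := vcEquiv_symm_some hC h2
    have e₁ {a d : F} (hd : d ≠ 0) :
        ((C.u : F) ^ 2)⁻¹ * (a - C.r * d) / d = (a / d - C.r) / C.u ^ 2 := by
      field_simp
    have e₂ {a b d : F} (hd : d ≠ 0) :
        ((C.u : F) ^ 3)⁻¹ * (b - C.t * d - C.s * (a - C.r * d)) / d =
          (b / d - C.t - C.s * (a / d - C.r)) / C.u ^ 3 := by
      field_simp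
    have ex : MvPolynomial.eval ![x, y] (MvPolynomial.C ((C.u : F) ^ 2)⁻¹ *
        (bind₁ v f - MvPolynomial.C C.r * bind₁ v k)) / MvPolynomial.eval ![x, y] (bind₁ v k) =
        (f.eval ![C.u ^ 2 * x + C.r, C.u ^ 3 * y + C.u ^ 2 * C.s * x + C.t] /
          k.eval ![C.u ^ 2 * x + C.r, C.u ^ 3 * y + C.u ^ 2 * C.s * x + C.t] - C.r) / C.u ^ 2 := by
      simp only [map_mul, map_sub, hv, MvPolynomial.eval_C]
      exact e₁ h1
    have ey : MvPolynomial.eval ![x, y] (MvPolynomial.C ((C.u : F) ^ 3)⁻¹ * (bind₁ v g -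
        MvPolynomial.C C.t * bind₁ v k - MvPolynomial.C C.s *
          (bind₁ v f - MvPolynomial.C C.r * bind₁ v k))) / MvPolynomial.eval ![x, y] (bind₁ v k) =
        (g.eval ![C.u ^ 2 * x + C.r, C.u ^ 3 * y + C.u ^ 2 * C.s * x + C.t] /
          k.eval ![C.u ^ 2 * x + C.r, C.u ^ 3 * y + C.u ^ 2 * C.s * x + C.t] - C.t - C.s *
        (f.eval ![C.u ^ 2 * x + C.r, C.u ^ 3 * y + C.u ^ 2 * C.s * x + C.t] /
          k.eval ![C.u ^ 2 * x + C.r, C.u ^ 3 * y + C.u ^ 2 * C.s * x + C.t] - C.r)) / C.u ^ 3 := by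
      simp only [map_mul, map_sub, hv, MvPolynomial.eval_C]
      exact e₂ h1
    refine ⟨by rwa [hv], by rwa [ex, ey], ?_⟩
    change (vcEquiv hC).symm (φ (vcEquiv hC (.some x y hxy))) = _
    rw [vcEquiv_some, h3, h5]
    exact WeierstrassCurve.Affine.Point.some.injEq .. |>.mpr ⟨ex.symm, ey.symm⟩

theorem IsAlgebraicEndomorphism.conj_symm (hC : C • W = W') {φ : AddMonoid.End W'.toAffine.Point}
    (hφ : IsAlgebraicEndomorphism W' φ) :
    IsAlgebraicEndomorphism W
      ((AddEquiv.toAddMonoidHom (vcEquiv hC)).comp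
        (AddMonoidHom.comp φ (AddEquiv.toAddMonoidHom (vcEquiv hC).symm))) := by
  have hu : (C.u : F) ≠ 0 := C.u.ne_zero
  have hC' : C⁻¹ • W' = W := by rw [← hC, inv_smul_smul]
  -- The inverse change of variables induces the inverse map, which reduces the claim to
  -- `IsAlgebraicEndomorphism.conj`.
  have key : ∀ P, vcEquiv hC' P = (vcEquiv hC).symm P := by
    rintro (_ | ⟨x, y, hP⟩)
    · exact (map_zero (vcEquiv hC')).trans (map_zero (vcEquiv hC).symm).symm
    · obtain ⟨h1, h2⟩ := vcEquiv_symm_some hC hP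
      rw [h2, vcEquiv_some]
      refine WeierstrassCurve.Affine.Point.some.injEq .. |>.mpr ⟨?_, ?_⟩
      · simp [WeierstrassCurve.VariableChange.inv_def]; field_simp; ring
      · simp [WeierstrassCurve.VariableChange.inv_def]; field_simp; ring
  suffices e : (AddEquiv.toAddMonoidHom (vcEquiv hC)).comp
      (AddMonoidHom.comp φ (AddEquiv.toAddMonoidHom (vcEquiv hC).symm)) =
      (AddEquiv.toAddMonoidHom (vcEquiv hC').symm).comp
        (AddMonoidHom.comp φ (AddEquiv.toAddMonoidHom (vcEquiv hC'))) by
    rw [e]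
    exact hφ.conj hC'
  refine AddMonoidHom.ext fun P => ?_
  change vcEquiv hC (φ ((vcEquiv hC).symm P)) = (vcEquiv hC').symm (φ (vcEquiv hC' P))
  rw [key, AddEquiv.eq_symm_apply, key, AddEquiv.symm_apply_apply]

end

/-- Complex multiplication of a curve that is geometrically isomorphic to `y² = x³ + A x² + B x`. -/
theorem hasCMBy_of_variableChange {K : Type*} [Field K] {E : WeierstrassCurve K} {R : Type*}
    [CommRing R] {W : WeierstrassCurve (AlgebraicClosure K)}
    (hE : IsIsomorphic (E⁄(AlgebraicClosure K)) W)
    (hι : ∃ ι : R →+* AddMonoid.End W.toAffine.Point, Function.Injective ι ∧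
      Set.range ι = {φ | IsAlgebraicEndomorphism W φ}) : HasCMBy E R := by
  obtain ⟨C, hC⟩ := hE
  obtain ⟨ι, hι, hr⟩ := hι
  refine ⟨{
      toFun := fun r => (AddEquiv.toAddMonoidHom (vcEquiv hC)).comp
        (AddMonoidHom.comp (ι r) (AddEquiv.toAddMonoidHom (vcEquiv hC).symm))
      map_one' := ?_
      map_mul' := fun r r' => ?_
      map_zero' := ?_
      map_add' := fun r r' => ?_ }, ?_, ?_⟩
  · ext P
    rw [map_one]
    exact (vcEquiv hC).apply_symm_apply P
  · ext P
    rw [map_mul]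
    change _ = vcEquiv hC (ι r ((vcEquiv hC).symm (vcEquiv hC (ι r' ((vcEquiv hC).symm P)))))
    rw [AddEquiv.symm_apply_apply]
    rfl
  · ext P
    rw [map_zero]
    exact map_zero (vcEquiv hC)
  · ext P
    rw [map_add]
    exact map_add (vcEquiv hC) _ _
  · intro r r' hr'
    refine hι (AddMonoidHom.ext fun P => (vcEquiv hC).injective ?_)
    have := DFunLike.congr_fun hr' (vcEquiv hC P)
    change vcEquiv hC (ι r ((vcEquiv hC).symm (vcEquiv hC P))) =
      vcEquiv hC (ι r' ((vcEquiv hC).symm (vcEquiv hC P))) at this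
    rwa [AddEquiv.symm_apply_apply] at this
  · ext φ
    constructor
    · rintro ⟨r, rfl⟩
      have h1 : ι r ∈ {φ | IsAlgebraicEndomorphism W φ} := hr ▸ Set.mem_range_self r
      exact IsAlgebraicEndomorphism.conj_symm hC h1
    · intro hφ
      have h1 : _ ∈ {φ | IsAlgebraicEndomorphism W φ} := IsAlgebraicEndomorphism.conj hC hφ
      rw [← hr] at h1
      obtain ⟨r, h2⟩ := h1
      refine ⟨r, AddMonoidHom.ext fun P => ?_⟩
      change vcEquiv hC (ι r ((vcEquiv hC).symm P)) = φ P
      rw [h2]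
      change vcEquiv hC ((vcEquiv hC).symm (φ (vcEquiv hC ((vcEquiv hC).symm P)))) = φ P
      rw [AddEquiv.apply_symm_apply, AddEquiv.apply_symm_apply]

/-! ### Quotients by a point of order two and explicit endomorphisms. -/

section

variable {F : Type*} [Field F] [CharZero F] [IsAlgClosed F] {A B A' B' : F}

theorem Smooth.isog (h : Smooth A B) : Smooth (-2 * A) (A ^ 2 - 4 * B) :=
  ⟨h.2, by
    have : (-2 * A) ^ 2 - 4 * (A ^ 2 - 4 * B) = 16 * B := by ring
    rw [this]
    exact mul_ne_zero (by norm_num) h.1⟩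

theorem isog_equation {x y : F} (hx : x ≠ 0) (hxy : y ^ 2 = x ^ 3 + A * x ^ 2 + B * x) :
    (y * (1 - B / x ^ 2)) ^ 2 = (x + A + B / x) ^ 3 + -2 * A * (x + A + B / x) ^ 2 +
      (A ^ 2 - 4 * B) * (x + A + B / x) := by
  rw [mul_pow, hxy]
  field_simp
  ring

/-- The quotient by `(0, 0)`, as a map. -/
def isogFun (h : Smooth A B) (P : Pt A B) : Pt (-2 * A) (A ^ 2 - 4 * B) :=
  if hP : ∃ x y, ∃ hxy : y ^ 2 = x ^ 3 + A * x ^ 2 + B * x, x ≠ 0 ∧ P = mkPt h x y hxy then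
    mkPt h.isog _ _ (isog_equation hP.choose_spec.choose_spec.choose_spec.1
      hP.choose_spec.choose_spec.choose)
  else 0

theorem isogFun_mkPt (h : Smooth A B) {x y : F} (hx : x ≠ 0) (hxy) :
    isogFun h (mkPt h x y hxy) = mkPt h.isog _ _ (isog_equation hx hxy) := by
  have hP : ∃ x' y', ∃ hxy' : y' ^ 2 = x' ^ 3 + A * x' ^ 2 + B * x', x' ≠ 0 ∧
    mkPt h x y hxy = mkPt h x' y' hxy' := ⟨x, y, hxy, hx, rfl⟩
  rw [isogFun, dif_pos hP]
  obtain ⟨h1, h2⟩ := mkPt_inj.1 hP.choose_spec.choose_spec.choose_spec.2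
  exact mkPt_congr (by rw [← h1]) (congrArg₂ (fun y x => y * (1 - B / x ^ 2)) h2.symm h1.symm)

theorem isogFun_of_x_eq_zero (h : Smooth A B) {y : F} (hxy) : isogFun h (mkPt h 0 y hxy) = 0 := by
  rw [isogFun, dif_neg]
  rintro ⟨x', y', hxy', hx, e⟩
  exact hx (mkPt_inj.1 e).1.symm

theorem isogFun_zero (h : Smooth A B) : isogFun h 0 = 0 := by
  rw [isogFun, dif_neg]
  rintro ⟨x', y', hxy', hx, e⟩
  exact mkPt_ne_zero _ e.symm

/-- On the line y = lx + c through the points, the image of (x, y) has abscissa (y/x)² = (l + c/x)².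
In the parameters l and wᵢ = c/xᵢ every coordinate is polynomial, and additivity is an identity. -/
theorem isogFun_add_of_generic (h : Smooth A B) {x₁ y₁ x₂ y₂ : F} (h₁ h₂) (hx₁ : x₁ ≠ 0)
    (hx₂ : x₂ ≠ 0) (hx : x₁ ≠ x₂) (hxB : x₁ * x₂ ≠ B) :
    isogFun h (mkPt h x₁ y₁ h₁ + mkPt h x₂ y₂ h₂) =
      isogFun h (mkPt h x₁ y₁ h₁) + isogFun h (mkPt h x₂ y₂ h₂) := by
  have hd : x₁ - x₂ ≠ 0 := sub_ne_zero.2 hx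
  obtain ⟨l, hl⟩ : ∃ l, l * (x₁ - x₂) = y₁ - y₂ := ⟨(y₁ - y₂) / (x₁ - x₂), div_mul_cancel₀ _ hd⟩
  obtain ⟨h₃, e⟩ := mkPt_add_of_ne (h := h) (h₁ := h₁) (h₂ := h₂) hx hl rfl rfl
  rw [e]
  obtain ⟨c, hc⟩ : ∃ c, c = y₁ - l * x₁ := ⟨_, rfl⟩
  obtain ⟨x₃, hx₃⟩ : ∃ x₃, x₃ = l ^ 2 - A - x₁ - x₂ := ⟨_, rfl⟩
  obtain rfl : y₁ = l * x₁ + c := by rw [hc]; ring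
  obtain rfl : y₂ = l * x₂ + c := by linear_combination hl
  obtain rfl : A = l ^ 2 - x₁ - x₂ - x₃ := by rw [hx₃]; ring
  have hB : B = x₁ * x₂ + x₁ * x₃ + x₂ * x₃ + 2 * l * c := by
    apply mul_right_cancel₀ hd
    linear_combination h₂ - h₁
  subst hB
  have hcc : c ^ 2 = x₁ * x₂ * x₃ := by linear_combination h₁
  have hc0 : c ≠ 0 := by
    rintro rfl
    have : x₃ = 0 := by
      have h0 : x₁ * x₂ * x₃ = 0 := by rw [← hcc]; ring
      simpa [hx₁, hx₂] using h0
    rw [this] at hxB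
    exact hxB (by ring)
  have hx30 : x₃ ≠ 0 := by
    rintro rfl
    exact hc0 (pow_eq_zero_iff two_ne_zero |>.1 (by rw [hcc]; ring))
  -- From c² = x₁x₂x₃ one gets x₁ = w₂w₃, its analogues, and c = w₁w₂w₃.
  obtain ⟨w₁, hw₁⟩ : ∃ w₁, w₁ = c / x₁ := ⟨_, rfl⟩
  obtain ⟨w₂, hw₂⟩ : ∃ w₂, w₂ = c / x₂ := ⟨_, rfl⟩
  obtain ⟨w₃, hw₃⟩ : ∃ w₃, w₃ = c / x₃ := ⟨_, rfl⟩
  have e1 : x₁ = w₂ * w₃ := by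
    rw [hw₂, hw₃, div_mul_div_comm, eq_div_iff (mul_ne_zero hx₂ hx30)]; linear_combination -hcc
  have e2 : x₂ = w₁ * w₃ := by
    rw [hw₁, hw₃, div_mul_div_comm, eq_div_iff (mul_ne_zero hx₁ hx30)]; linear_combination -hcc
  have e3 : x₃ = w₁ * w₂ := by
    rw [hw₁, hw₂, div_mul_div_comm, eq_div_iff (mul_ne_zero hx₁ hx₂)]; linear_combination -hcc
  have e4 : c = w₁ * w₂ * w₃ := by
    rw [mul_assoc, ← e1, hw₁, div_mul_cancel₀ _ hx₁]
  clear hw₁ hw₂ hw₃ hl hc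
  subst e1 e2 e3 e4
  have hw₁ : w₁ ≠ 0 := left_ne_zero_of_mul hx₂
  have hw₂ : w₂ ≠ 0 := left_ne_zero_of_mul hx₁
  have hw₃ : w₃ ≠ 0 := right_ne_zero_of_mul hx₁
  have e₃ : (l ^ 2 - (l ^ 2 - w₂ * w₃ - w₁ * w₃ - w₁ * w₂) - w₂ * w₃ - w₁ * w₃) = w₁ * w₂ := by ring
  rw [mkPt_congr (h := h) (hxy := h₃) e₃ rfl, isogFun_mkPt h hx₁, isogFun_mkPt h hx₂,
    isogFun_mkPt h hx30]
  have k₁ : w₂ * w₃ + (l ^ 2 - w₂ * w₃ - w₁ * w₃ - w₁ * w₂) + (w₂ * w₃ * (w₁ * w₃) +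
      w₂ * w₃ * (w₁ * w₂) + w₁ * w₃ * (w₁ * w₂) + 2 * l * (w₁ * w₂ * w₃)) / (w₂ * w₃) =
      (l + w₁) ^ 2 := by field_simp; ring
  have k₂ : w₁ * w₃ + (l ^ 2 - w₂ * w₃ - w₁ * w₃ - w₁ * w₂) + (w₂ * w₃ * (w₁ * w₃) +
      w₂ * w₃ * (w₁ * w₂) + w₁ * w₃ * (w₁ * w₂) + 2 * l * (w₁ * w₂ * w₃)) / (w₁ * w₃) =
      (l + w₂) ^ 2 := by field_simp; ring
  have hne : (l + w₁) ^ 2 ≠ (l + w₂) ^ 2 := by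
    intro h0
    have h1 : (w₁ - w₂) * (2 * l + w₁ + w₂) = 0 := by linear_combination h0
    rcases mul_eq_zero.1 h1 with h2 | h2
    · exact hx (by rw [sub_eq_zero.1 h2])
    · refine hxB ?_
      linear_combination -w₁ * w₂ * w₃ * h2
  -- The slope of the chord through the two images is −(l + w₁ + w₂ + w₃).
  obtain ⟨h₄, e'⟩ := mkPt_add_of_ne (h := h.isog) (h₁ := isog_equation hx₁ h₁)
    (h₂ := isog_equation hx₂ h₂) (l := -(l + w₁ + w₂ + w₃)) (by rwa [k₁, k₂])
    (by rw [k₁, k₂]; field_simp; ring) rfl rfl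
  rw [e']
  refine mkPt_congr ?_ ?_
  · rw [k₁, k₂]
    field_simp
    ring
  · rw [k₁, k₂]
    field_simp
    ring

/-- Only generic second summands need checking. Translation by (0, 0) is treated separately: it
sends x to B/x and leaves the image unchanged. -/
theorem isogFun_add (h : Smooth A B) (P Q : Pt A B) :
    isogFun h (P + Q) = isogFun h P + isogFun h Q := by
  have := infinite_pt h
  refine map_add_of_cofinite _ (fun P => ?_) P Q
  rcases pt_cases h P with rfl | ⟨x₁, y₁, h₁, rfl⟩
  · exact Eventually.of_forall fun R => by rw [zero_add, isogFun_zero, zero_add]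
  have hne : ∀ a : F, ∀ᶠ x : F in cofinite, x ≠ a := fun a => by
    rw [eventually_cofinite]; simp
  rw [eventually_mkPt h]
  by_cases hx₁ : x₁ = 0
  · subst hx₁
    obtain rfl : y₁ = 0 := by simpa using h₁
    filter_upwards [hne 0] with x hx y hxy
    obtain ⟨h₃, e⟩ := mkPt_add_of_ne (h := h) (h₁ := h₁) (h₂ := hxy) (l := y / x)
      (x₃ := B / x) (y₃ := -(y * B / x ^ 2)) hx.symm
      (by field_simp; ring) (by rw [div_pow, hxy]; field_simp; ring) (by field_simp; ring)
    rw [e, isogFun_of_x_eq_zero, zero_add, isogFun_mkPt h hx,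
      isogFun_mkPt h (div_ne_zero h.1 hx)]
    have hB := h.1
    exact mkPt_congr (by field_simp; ring) (by field_simp; ring)
  · filter_upwards [hne 0, hne x₁, hne (B / x₁)] with x hx hx' hxB y hxy
    refine isogFun_add_of_generic h h₁ hxy hx₁ hx hx'.symm (fun h0 => hxB ?_)
    rw [← h0, mul_div_cancel_left₀ _ hx₁]

/-- The quotient by `(0, 0)`. -/
theorem exists_isog (h : Smooth A B) (h' : Smooth (-2 * A) (A ^ 2 - 4 * B)) :
    ∃ φ : Pt A B →+ Pt (-2 * A) (A ^ 2 - 4 * B), HasMult h h' φ 1 := by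
  refine ⟨AddMonoidHom.mk' (isogFun h) (isogFun_add h), .inr
    ⟨algebraMap F[X] (RatFunc F) (X + C A) + algebraMap F[X] (RatFunc F) (C B) *
      (algebraMap F[X] (RatFunc F) X)⁻¹, 1 - algebraMap F[X] (RatFunc F) (C B) *
      (algebraMap F[X] (RatFunc F) X)⁻¹ ^ 2, ?_, ?_⟩⟩
  · filter_upwards [eventually_eval_ne_zero (X_ne_zero (R := F))] with x hx y hxy
    rw [eval_X] at hx
    refine ⟨x + A + B / x, 1 - B / x ^ 2, isog_equation hx hxy, isogFun_mkPt h hx hxy, ?_, ?_⟩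
    · refine ((evAt_poly _ x).add ((evAt_C B x).mul ((evAt_poly X x).inv ?_))).congr ?_
      · rwa [eval_X]
      · simp [div_eq_mul_inv]
    · refine ((evAt_poly 1 x).sub ((evAt_C B x).mul (((evAt_poly X x).inv ?_).pow 2))).congr ?_
        |> fun h => by simpa using h
      · rwa [eval_X]
      · simp [div_eq_mul_inv]
  · have hX : algebraMap F[X] (RatFunc F) X ≠ 0 := algebraMap_ratFunc_ne_zero X_ne_zero
    have h1 : dr (algebraMap F[X] (RatFunc F) X * (algebraMap F[X] (RatFunc F) X)⁻¹) = 0 := by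
      rw [mul_inv_cancel₀ hX, ← map_one (algebraMap F[X] (RatFunc F)), dr_poly, derivative_one,
        map_zero]
    rw [dr_mul, dr_poly, derivative_X, map_one, one_mul] at h1
    have h2 : dr (algebraMap F[X] (RatFunc F) X)⁻¹ = -(algebraMap F[X] (RatFunc F) X)⁻¹ ^ 2 := by
      apply mul_left_cancel₀ hX
      rw [eq_neg_of_add_eq_zero_right h1]
      field_simp
    rw [dr_add, dr_mul, dr_C, h2, dr_poly]
    simp [cst]
    ring

/-- With x = u²x' + r and y = u³y', the differential dx/y becomes u⁻¹ dx'/y'. -/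
theorem exists_variableChange (h : Smooth A B) (h' : Smooth A' B') {u r : F} (hu : u ≠ 0)
    (hr : r ^ 3 + A * r ^ 2 + B * r = 0) (hA : u ^ 2 * A' = A + 3 * r)
    (hB : u ^ 4 * B' = B + 2 * r * A + 3 * r ^ 2) :
    ∃ φ : Pt A' B' →+ Pt A B, HasMult h' h φ u⁻¹ := by
  have hC : (⟨Units.mk0 u hu, r, 0, 0⟩ : WeierstrassCurve.VariableChange F) • curveAB A B =
      curveAB A' B' := by
    rw [WeierstrassCurve.variableChange_def]
    ext
    · simp [curveAB]
    · simp [curveAB, ← hA]; field_simp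
    · simp [curveAB]
    · simp [curveAB]; field_simp; linear_combination -hB
    · simp [curveAB]; right; linear_combination hr
  refine ⟨AddEquiv.toAddMonoidHom (vcEquiv hC), .inr ⟨algebraMap F[X] (RatFunc F)
    (C (u ^ 2) * X + C r), algebraMap F[X] (RatFunc F) (C (u ^ 3)), ?_, ?_⟩⟩
  · refine Eventually.of_forall fun x y hxy => ?_
    have e : vcEquiv hC (mkPt h' x y hxy) = _ := vcEquiv_some hC _
    refine ⟨u ^ 2 * x + r, u ^ 3, ?_, e.trans ?_, ?_, evAt_C _ _⟩
    · linear_combination u ^ 6 * hxy + u ^ 4 * x ^ 2 * hA + u ^ 2 * x * hB - hr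
    · exact WeierstrassCurve.Affine.Point.some.injEq .. |>.mpr ⟨rfl, by simp [mul_comm]⟩
    · exact (evAt_poly _ x).congr (by simp)
  · rw [dr_poly, cst, ← map_mul, ← C_mul, show u⁻¹ * u ^ 3 = u ^ 2 by field_simp]
    simp

/-- Here −2A = s²A and A² − 4B = s⁴B, so the quotient by (0, 0) is the original curve rescaled by s;
following the quotient map by that rescaling gives multiplier s. -/
theorem exists_endomorphism_of_discriminant_eight (h : Smooth A B) {s d : F} (hs : s ^ 2 = -2)
    (hA : A = 2 * d * s) (hB : B = -d ^ 2) : ∃ φ : Pt A B →+ Pt A B, HasMult h h φ s := by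
  obtain ⟨φ, hφ⟩ := exists_isog h h.isog
  have hs0 : s ≠ 0 := by rintro rfl; norm_num at hs
  obtain ⟨ψ, hψ⟩ := exists_variableChange h h.isog (u := s⁻¹) (r := 0) (inv_ne_zero hs0)
    (by ring) (by subst hA hB; field_simp; linear_combination -2 * d * hs)
    (by subst hA hB; field_simp; linear_combination d ^ 2 * (s ^ 2 + 2) * hs)
  exact ⟨_, by simpa using hψ.comp hφ⟩

/-- For A = 0, scaling by a fourth root of unity is an automorphism. -/
theorem exists_endomorphism_of_discriminant_four (h : Smooth A B) {s : F} (hs : s ^ 2 = -1)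
    (hA : A = 0) : ∃ φ : Pt A B →+ Pt A B, HasMult h h φ s := by
  have hs0 : s ≠ 0 := by rintro rfl; norm_num at hs
  obtain ⟨ψ, hψ⟩ := exists_variableChange h h (u := s⁻¹) (r := 0) (inv_ne_zero hs0)
    (by ring) (by subst hA; simp)
    (by subst hA; field_simp; linear_combination -B * (s ^ 2 - 1) * hs)
  exact ⟨_, by simpa using hψ⟩

/-- The element (1 + s)/2 has norm 2, so its kernel is generated by a point of order two, which is
not (0, 0). That point is moved to the origin by α and divided out by φ; the quotient is brought
back to the curve by β with u = 2/(1 + s). -/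
theorem exists_endomorphism_of_discriminant_seven (h : Smooth A B) {s d : F} (hs : s ^ 2 = -7)
    (hA : A = -3 * s * d) (hB : B = -16 * d ^ 2) :
    ∃ φ : Pt A B →+ Pt A B, HasMult h h φ ((1 + s) / 2) := by
  have hd : d ≠ 0 := by
    rintro rfl
    exact h.1 (by rw [hB]; ring)
  have hsp : 1 + s ≠ 0 := by
    intro h0
    have : (8 : F) = 0 := by linear_combination hs - (s - 1) * h0
    norm_num at this
  have hsm : 1 - s ≠ 0 := by
    intro h0
    have : (8 : F) = 0 := by linear_combination hs + (s + 1) * h0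
    norm_num at this
  have hs3 : 3 * s + 1 ≠ 0 := by
    intro h0
    have : (64 : F) = 0 := by linear_combination 9 * hs - (3 * s - 1) * h0
    norm_num at this
  have hs3' : 3 * s - 1 ≠ 0 := by
    intro h0
    have : (64 : F) = 0 := by linear_combination 9 * hs - (3 * s + 1) * h0
    norm_num at this
  have h₁ : Smooth ((3 * s + 3) / 2 * d) ((3 * s + 1) / 2 * d ^ 2) := by
    constructor
    · exact mul_ne_zero (div_ne_zero hs3 two_ne_zero) (pow_ne_zero 2 hd)
    · rw [show ((3 * s + 3) / 2 * d) ^ 2 - 4 * ((3 * s + 1) / 2 * d ^ 2) =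
        ((3 * s - 1) / 2) ^ 2 * d ^ 2 by ring]
      exact mul_ne_zero (pow_ne_zero 2 (div_ne_zero hs3' two_ne_zero)) (pow_ne_zero 2 hd)
  obtain ⟨α, hα⟩ := exists_variableChange h₁ h (u := 1) (r := -((3 * s + 1) / 2 * d)) one_ne_zero
    (by ring) (by rw [hA]; ring) (by rw [hB]; linear_combination (-9 / 4 * d ^ 2) * hs)
  obtain ⟨φ, hφ⟩ := exists_isog h₁ h₁.isog
  obtain ⟨β, hβ⟩ := exists_variableChange h h₁.isog (u := 2 / (1 + s))
    (r := (3 * s - 1) / 2 * d) (div_ne_zero two_ne_zero hsp)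
    (by subst hA hB; linear_combination (-(3 * s - 1) / 2 * d ^ 3 * 9 / 4) * hs)
    (by subst hA hB; field_simp; linear_combination (-(1 + s)) * hs)
    (by subst hA hB; field_simp; linear_combination (9 * s ^ 4 + 42 * s ^ 3 + 76 * s ^ 2 + 22 * s + 11) * hs)
  exact ⟨_, by simpa using hβ.comp (hφ.comp hα)⟩

end

section

variable {F : Type*} [Field F] [CharZero F] [IsAlgClosed F] {A B A' B' : F}

/-- The quotient by (0, 0) has multiplication by (1 + s)/2. Conjugating that endomorphism by the
isogeny and its dual multiplies it by 2, which gives 1 + s. -/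
theorem exists_endomorphism_of_discriminant_twentyEight (h : Smooth A B) {s d : F}
    (hs : s ^ 2 = -7) (hA : A = 6 * s * d) (hB : B = d ^ 2) :
    ∃ φ : Pt A B →+ Pt A B, HasMult h h φ (1 + s) := by
  obtain ⟨φ, hφ⟩ := exists_isog h h.isog
  obtain ⟨α, hα⟩ := exists_endomorphism_of_discriminant_seven h.isog (d := 4 * d) hs
    (by rw [hA]; ring) (by rw [hA, hB]; linear_combination 36 * d ^ 2 * hs)
  obtain ⟨ψ, hψ⟩ := exists_isog h.isog h.isog.isog
  obtain ⟨β, hβ⟩ := exists_variableChange h h.isog.isog (u := 1 / 2) (r := 0) (by norm_num)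
    (by ring) (by ring) (by ring)
  refine ⟨β.comp (ψ.comp (α.comp φ)), ?_⟩
  · have := hβ.comp (hψ.comp (hα.comp hφ))
    rwa [show (1 / 2 : F)⁻¹ * (1 * ((1 + s) / 2 * 1)) = 1 + s by field_simp] at this

end

/-! ### Invariants of the explicit curves: complex multiplication, j and isogeny classes. -/

section

theorem IsIsomorphic.trans {F : Type*} [Field F] {W W' W'' : WeierstrassCurve F}
    (h : IsIsomorphic W W') (h' : IsIsomorphic W' W'') : IsIsomorphic W W'' := by
  obtain ⟨C, rfl⟩ := h
  obtain ⟨C', rfl⟩ := h'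
  exact ⟨C' * C, mul_smul _ _ _⟩

theorem IsIsomorphic.symm {F : Type*} [Field F] {W W' : WeierstrassCurve F}
    (h : IsIsomorphic W W') : IsIsomorphic W' W := by
  obtain ⟨C, rfl⟩ := h
  exact ⟨C⁻¹, inv_smul_smul _ _⟩

variable {K : Type*} [Field K] {E W : WeierstrassCurve K}

theorem IsIsomorphic.baseChange (h : IsIsomorphic E W) (L : Type*) [Field L] [Algebra K L] :
    IsIsomorphic (E⁄L) (W⁄L) := by
  obtain ⟨C, rfl⟩ := h
  exact ⟨C.map (algebraMap K L), WeierstrassCurve.map_variableChange _ _ _⟩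

theorem baseChange_curveAB (a b : K) (L : Type*) [Field L] [Algebra K L] :
    (curveAB a b)⁄L = curveAB (algebraMap K L a) (algebraMap K L b) := by
  ext <;> simp [curveAB]

theorem Smooth.map {a b : K} (h : Smooth a b) (L : Type*) [Field L] [Algebra K L] :
    Smooth (algebraMap K L a) (algebraMap K L b) :=
  ⟨by simpa using h.1, by
    rw [← map_pow, ← map_ofNat (algebraMap K L) 4, ← map_mul, ← map_sub, Ne, map_eq_zero]
    exact h.2⟩

theorem hasCMBy_multiplierRing [NumberField K] {a b : K} (h : Smooth a b)
    (hE : IsIsomorphic E (curveAB a b)) {ω : K} (hω' : ∀ q : ℚ, ω ≠ algebraMap ℚ K q)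
    (hφ : ∃ φ, HasMult (h.map (AlgebraicClosure K)) (h.map (AlgebraicClosure K)) φ
      (algebraMap K (AlgebraicClosure K) ω)) :
    HasCMBy E (multiplierRing (h.map (AlgebraicClosure K)) K) := by
  have h1 := hE.baseChange (AlgebraicClosure K)
  rw [baseChange_curveAB] at h1
  exact hasCMBy_of_variableChange h1 (exists_cmHom _ ((mem_multiplierRing _).2 hφ) hω')

theorem isIsomorphic_curveAB {F : Type*} [Field F] {a b u r : F} {W : WeierstrassCurve F}
    (hu : u ≠ 0) (h1 : W.a₁ = 0) (h3 : W.a₃ = 0)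
    (hr : r ^ 3 + W.a₂ * r ^ 2 + W.a₄ * r + W.a₆ = 0) (ha : u ^ 2 * a = W.a₂ + 3 * r)
    (hb : u ^ 4 * b = W.a₄ + 2 * r * W.a₂ + 3 * r ^ 2) : IsIsomorphic W (curveAB a b) := by
  refine ⟨⟨Units.mk0 u hu, r, 0, 0⟩, ?_⟩
  rw [WeierstrassCurve.variableChange_def]
  ext
  · simp [curveAB, h1]
  · simp [curveAB, h1, ← ha]; field_simp
  · simp [curveAB, h1, h3]
  · simp [curveAB, h1, h3]; field_simp; linear_combination -hb
  · simp [curveAB, h1, h3]; right; linear_combination hr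

theorem j_eq_of_isIsomorphic [E.IsElliptic] {a b j : K} (hE : IsIsomorphic E (curveAB a b))
    (hj : (16 * (a ^ 2 - 3 * b)) ^ 3 = j * (16 * b ^ 2 * (a ^ 2 - 4 * b))) : E.j = j := by
  obtain ⟨C, hC⟩ := hE
  have h1 := E.variableChange_j C
  rw [← h1]
  have h2 : (C • E).j * (C • E).Δ = (C • E).c₄ ^ 3 := by
    rw [WeierstrassCurve.j, mul_right_comm, ← WeierstrassCurve.coe_Δ', Units.inv_mul, one_mul]
  have h3 : (C • E).Δ ≠ 0 := (C • E).isUnit_Δ.ne_zero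
  apply mul_right_cancel₀ h3
  rw [h2, hC]
  simp only [WeierstrassCurve.c₄, WeierstrassCurve.Δ, WeierstrassCurve.b₂, WeierstrassCurve.b₄,
    WeierstrassCurve.b₆, WeierstrassCurve.b₈, curveAB]
  linear_combination hj

variable [NumberField K]

theorem ne_algebraMap_of_sq_eq_neg {s : K} {n : ℚ} (hn : 0 < n) (hs : s ^ 2 = -algebraMap ℚ K n) :
    ∀ q : ℚ, s ≠ algebraMap ℚ K q := by
  rintro q rfl
  rw [← map_pow, ← map_neg] at hs
  have := (algebraMap ℚ K).injective hs
  nlinarith [sq_nonneg q]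

theorem exists_order_of_discriminant_twentyEight (hquad : Module.finrank ℚ K = 2) {s d : K}
    (hd : d ≠ 0) (hs : s ^ 2 = -7) (hE : IsIsomorphic E (curveAB (6 * s * d) (d ^ 2))) :
    ∃ O : Subring K, IsOrder O ∧ HasCMBy E O := by
  have h : Smooth (6 * s * d) (d ^ 2) := by
    refine ⟨pow_ne_zero 2 hd, ?_⟩
    rw [show (6 * s * d) ^ 2 - 4 * d ^ 2 = -256 * d ^ 2 by linear_combination 36 * d ^ 2 * hs]
    exact mul_ne_zero (by norm_num) (pow_ne_zero 2 hd)
  have hφ := exists_endomorphism_of_discriminant_twentyEight (h.map (AlgebraicClosure K))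
    (s := algebraMap K _ s) (d := algebraMap K _ d)
    (by rw [← map_pow, hs, map_neg, map_ofNat]) (by simp [map_ofNat (algebraMap K (AlgebraicClosure K))])
    (by simp [map_ofNat (algebraMap K (AlgebraicClosure K))])
  have hφ' : ∃ φ, HasMult (h.map (AlgebraicClosure K)) (h.map (AlgebraicClosure K)) φ
      (algebraMap K (AlgebraicClosure K) (1 + s)) := by simpa using hφ
  have hω' : ∀ q : ℚ, 1 + s ≠ algebraMap ℚ K q := fun q hq =>
    ne_algebraMap_of_sq_eq_neg (n := 7) (by norm_num) (by rw [hs]; simp) (q - 1)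
      (by rw [map_sub, ← hq, map_one]; ring)
  exact ⟨_, isOrder_multiplierRing _ hquad ((mem_multiplierRing _).2 hφ') hω',
    hasCMBy_multiplierRing h hE hω' hφ'⟩

theorem exists_order_of_discriminant_seven (hquad : Module.finrank ℚ K = 2) {s d : K}
    (hd : d ≠ 0) (hs : s ^ 2 = -7) (hE : IsIsomorphic E (curveAB (-3 * s * d) (-16 * d ^ 2))) :
    ∃ O : Subring K, IsOrder O ∧ HasCMBy E O := by
  have h : Smooth (-3 * s * d) (-16 * d ^ 2) := by
    refine ⟨mul_ne_zero (by norm_num) (pow_ne_zero 2 hd), ?_⟩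
    rw [show (-3 * s * d) ^ 2 - 4 * (-16 * d ^ 2) = d ^ 2 by linear_combination 9 * d ^ 2 * hs]
    exact pow_ne_zero 2 hd
  have hφ := exists_endomorphism_of_discriminant_seven (h.map (AlgebraicClosure K))
    (s := algebraMap K _ s) (d := algebraMap K _ d)
    (by rw [← map_pow, hs, map_neg, map_ofNat]) (by simp [map_ofNat (algebraMap K (AlgebraicClosure K))])
    (by simp [map_ofNat (algebraMap K (AlgebraicClosure K))])
  have hφ' : ∃ φ, HasMult (h.map (AlgebraicClosure K)) (h.map (AlgebraicClosure K)) φ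
      (algebraMap K (AlgebraicClosure K) ((1 + s) / 2)) := by
    rwa [map_div₀, map_add, map_one, map_ofNat]
  have hω' : ∀ q : ℚ, (1 + s) / 2 ≠ algebraMap ℚ K q := fun q hq =>
    ne_algebraMap_of_sq_eq_neg (n := 7) (by norm_num) (by rw [hs]; simp) (2 * q - 1)
      (by rw [map_sub, map_mul, ← hq, map_one, map_ofNat]; ring)
  exact ⟨_, isOrder_multiplierRing _ hquad ((mem_multiplierRing _).2 hφ') hω',
    hasCMBy_multiplierRing h hE hω' hφ'⟩

theorem exists_order_of_discriminant_four (hquad : Module.finrank ℚ K = 2) {s b : K}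
    (hb : b ≠ 0) (hs : s ^ 2 = -1) (hE : IsIsomorphic E (curveAB 0 b)) :
    ∃ O : Subring K, IsOrder O ∧ HasCMBy E O := by
  have h : Smooth 0 b := ⟨hb, by simpa using hb⟩
  have hφ' := exists_endomorphism_of_discriminant_four (h.map (AlgebraicClosure K))
    (s := algebraMap K _ s) (by rw [← map_pow, hs]; simp) (by simp)
  have hω' := ne_algebraMap_of_sq_eq_neg (s := s) (n := 1) (by norm_num) (by rw [hs]; simp)
  exact ⟨_, isOrder_multiplierRing _ hquad ((mem_multiplierRing _).2 hφ') hω',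
    hasCMBy_multiplierRing h hE hω' hφ'⟩

/-- The ring of multipliers is squeezed: it contains s, and consists of integral elements, which lie
in ℤ[s] by assumption. -/
theorem hasCMBy_of_discriminant_eight {s d : K} (hd : d ≠ 0) (hs : s ^ 2 = -2)
    (hint : ∀ k : K, IsIntegral ℤ k → k ∈ Subring.closure {s})
    (hE : IsIsomorphic E (curveAB (2 * d * s) (-d ^ 2))) : HasCMBy E (Subring.closure {s}) := by
  have h : Smooth (2 * d * s) (-d ^ 2) := by
    refine ⟨neg_ne_zero.2 (pow_ne_zero 2 hd), ?_⟩
    rw [show (2 * d * s) ^ 2 - 4 * (-d ^ 2) = -4 * d ^ 2 by linear_combination 4 * d ^ 2 * hs]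
    exact mul_ne_zero (by norm_num) (pow_ne_zero 2 hd)
  have hφ' := exists_endomorphism_of_discriminant_eight (h.map (AlgebraicClosure K))
    (s := algebraMap K _ s) (d := algebraMap K _ d)
    (by rw [← map_pow, hs, map_neg, map_ofNat]) (by simp [map_ofNat (algebraMap K (AlgebraicClosure K))])
    (by simp [map_ofNat (algebraMap K (AlgebraicClosure K))])
  have hω' := ne_algebraMap_of_sq_eq_neg (s := s) (n := 2) (by norm_num) (by rw [hs]; simp)
  have := hasCMBy_multiplierRing h hE hω' hφ'
  have e : multiplierRing (h.map (AlgebraicClosure K)) K = Subring.closure {s} := by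
    refine le_antisymm (fun k hk => hint k (isIntegral_of_mem_multiplierRing _ hk)) ?_
    rw [Subring.closure_le, Set.singleton_subset_iff]
    exact (mem_multiplierRing _).2 hφ'
  rwa [e] at this

theorem isTwist_isogenyClass64a {b : K} (hb : b ≠ 0) (hE : IsIsomorphic E (curveAB 0 b)) :
    ∃ W ∈ isogenyClass64a, IsTwist E (W⁄K) := by
  refine ⟨⟨0, 0, 0, 1, 0⟩, by simp [isogenyClass64a], ?_⟩
  have h1 := hE.baseChange (AlgebraicClosure K)
  rw [baseChange_curveAB] at h1
  refine h1.trans (IsIsomorphic.symm ?_)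
  obtain ⟨u, hu⟩ := IsAlgClosed.exists_pow_nat_eq ((algebraMap K (AlgebraicClosure K) b)⁻¹)
    (n := 4) (by norm_num)
  have hb' : algebraMap K (AlgebraicClosure K) b ≠ 0 := by simpa using hb
  refine isIsomorphic_curveAB (u := u) (r := 0) ?_ ?_ ?_ ?_ ?_ ?_
  · rintro rfl
    rw [zero_pow (by norm_num)] at hu
    exact hb' (inv_eq_zero.1 hu.symm)
  all_goals simp
  rw [hu, inv_mul_cancel₀ hb']

theorem isTwist_isogenyClass256a {s d : K} (hd : d ≠ 0) (hs : s ^ 2 = -2)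
    (hE : IsIsomorphic E (curveAB (2 * d * s) (-d ^ 2))) :
    ∃ W ∈ isogenyClass256a, IsTwist E (W⁄K) := by
  refine ⟨⟨0, 1, 0, -3, 1⟩, by simp [isogenyClass256a], ?_⟩
  have h1 := hE.baseChange (AlgebraicClosure K)
  rw [baseChange_curveAB] at h1
  refine h1.trans (IsIsomorphic.symm ?_)
  -- With its point (1, 0) at the origin, [0, 1, 0, -3, 1] becomes y² = x(x² + 4x + 2), so u² has to
  -- be 4/(2ds) = −s/d.
  obtain ⟨u, hu⟩ := IsAlgClosed.exists_pow_nat_eq (algebraMap K (AlgebraicClosure K) (-s / d))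
    (n := 2) (by norm_num)
  have hs0 : s ≠ 0 := by rintro rfl; norm_num at hs
  have e1 : u ^ 2 * algebraMap K (AlgebraicClosure K) (2 * d * s) = 4 := by
    rw [hu, ← map_mul, ← map_ofNat (algebraMap K (AlgebraicClosure K)) 4]
    congr 1; field_simp; linear_combination -2 * hs
  have e2 : u ^ 4 * algebraMap K (AlgebraicClosure K) (-d ^ 2) = 2 := by
    rw [show u ^ 4 = (u ^ 2) ^ 2 by ring, hu, ← map_pow, ← map_mul,
      ← map_ofNat (algebraMap K (AlgebraicClosure K)) 2]
    congr 1; field_simp; linear_combination -hs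
  refine isIsomorphic_curveAB (u := u) (r := 1) ?_ ?_ ?_ ?_ ?_ ?_
  · rintro rfl
    norm_num at e1
  · simp
  · simp
  · simp [map_ofNat (algebraMap K (AlgebraicClosure K))]; norm_num
  · rw [e1]; simp; norm_num
  · rw [e2]; simp [map_ofNat (algebraMap K (AlgebraicClosure K))]

theorem isogenyClass49a_of_discriminant_twentyEight {s d : K} (hd : d ≠ 0) (hs : s ^ 2 = -7)
    (hE : IsIsomorphic E (curveAB (6 * s * d) (d ^ 2))) :
    ∃ W ∈ isogenyClass49a, IsIsomorphic E (quadraticTwist (W⁄K) (d * s)) := by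
  refine ⟨⟨1, -1, 0, -37, -78⟩, by simp [isogenyClass49a], hE.trans (IsIsomorphic.symm ?_)⟩
  have hs0 : s ≠ 0 := by rintro rfl; norm_num at hs
  -- −13/4 is the abscissa of the point of order two on [1, -1, 0, -37, -78]; the twist multiplies
  -- it by ds.
  refine isIsomorphic_curveAB (u := s / 2) (r := -13 / 4 * (d * s))
    (div_ne_zero hs0 two_ne_zero) rfl rfl ?_ ?_ ?_ <;>
  simp only [quadraticTwist, WeierstrassCurve.map_b₂, WeierstrassCurve.map_b₄,
    WeierstrassCurve.map_b₆] <;>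
  simp [WeierstrassCurve.b₂, WeierstrassCurve.b₄, WeierstrassCurve.b₆]
  · ring
  · linear_combination (3 / 2 * d * s) * hs
  · linear_combination (1 / 16 * d ^ 2 * s ^ 2) * hs

theorem isogenyClass49a_of_discriminant_seven {s d : K} (hd : d ≠ 0) (hs : s ^ 2 = -7)
    (hE : IsIsomorphic E (curveAB (-3 * s * d) (-16 * d ^ 2))) :
    ∃ W ∈ isogenyClass49a, IsIsomorphic E (quadraticTwist (W⁄K) (d * s)) := by
  refine ⟨⟨1, -1, 0, -2, -1⟩, by simp [isogenyClass49a], hE.trans (IsIsomorphic.symm ?_)⟩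
  have hs0 : s ≠ 0 := by rintro rfl; norm_num at hs
  -- 2 is the abscissa of the point of order two on [1, -1, 0, -2, -1].
  refine isIsomorphic_curveAB (u := s / 2) (r := 2 * (d * s))
    (div_ne_zero hs0 two_ne_zero) rfl rfl ?_ ?_ ?_ <;>
  simp only [quadraticTwist, WeierstrassCurve.map_b₂, WeierstrassCurve.map_b₄,
    WeierstrassCurve.map_b₆] <;>
  simp [WeierstrassCurve.b₂, WeierstrassCurve.b₄, WeierstrassCurve.b₆]
  · ring
  · linear_combination (-3 / 4 * d * s) * hs
  · linear_combination (-d ^ 2 * s ^ 2) * hs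

end

/-! ### Reduction types over a discrete valuation ring. -/

section Reduction

variable {R : Type*} [CommRing R] [IsDomain R] [IsDiscreteValuationRing R]
  {K : Type*} [Field K] [Algebra R K] [IsFractionRing R K]

theorem valuation_maximalIdeal_eq_one_iff (r : R) :
    (IsDiscreteValuationRing.maximalIdeal R).valuation K (algebraMap R K r) = 1 ↔ IsUnit r := by
  rw [HeightOneSpectrum.valuation_of_algebraMap, HeightOneSpectrum.intValuation_eq_one_iff]
  exact IsLocalRing.notMem_maximalIdeal

theorem exists_integral_of_hasGoodReduction {W : WeierstrassCurve K} (h : W.HasGoodReduction R) :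
    ∃ W₀ : WeierstrassCurve R, W = W₀⁄K ∧ IsUnit W₀.Δ := by
  obtain ⟨W₀, hW₀⟩ := (inferInstance : WeierstrassCurve.IsIntegral R W).integral
  refine ⟨W₀, hW₀, ?_⟩
  have h1 := h.goodReduction
  rwa [hW₀, WeierstrassCurve.baseChange, WeierstrassCurve.map_Δ, valuation_maximalIdeal_eq_one_iff] at h1

/-- An integral model with unit discriminant is minimal: its discriminant already has the largest
value allowed to an integral model. -/
theorem hasGoodReduction_of_isUnit {W : WeierstrassCurve K} {W₀ : WeierstrassCurve R}
    (hW : W = W₀⁄K) (hΔ : IsUnit W₀.Δ) : W.HasGoodReduction R := by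
  have hi : WeierstrassCurve.IsIntegral R W := ⟨⟨W₀, hW⟩⟩
  have h1 : (IsDiscreteValuationRing.maximalIdeal R).valuation K W.Δ = 1 := by
    rwa [hW, WeierstrassCurve.baseChange, WeierstrassCurve.map_Δ, valuation_maximalIdeal_eq_one_iff]
  have hm : WeierstrassCurve.IsMinimal R W := by
    refine ⟨⟨by simpa only [one_smul] using hi, fun C hC _ => ?_⟩⟩
    rw [← Subtype.coe_le_coe]
    beta_reduce
    have h2 := WeierstrassCurve.valuation_Δ_aux_eq_of_isIntegral R W
    rw [h1] at h2
    rw [one_smul, h2]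
    exact (WeierstrassCurve.valuation_Δ_aux R (C • W)).2
  exact { hm with goodReduction := h1 }

/-- jΔ = c₄³, where c₄ is a unit and Δ is not. -/
theorem one_lt_valuation_j {W : WeierstrassCurve K} [W.IsElliptic]
    (h : W.HasMultiplicativeReduction R) :
    1 < (IsDiscreteValuationRing.maximalIdeal R).valuation K W.j := by
  have h1 := h.badReduction
  have h2 := h.multiplicativeReduction
  have h3 : W.j * W.Δ = W.c₄ ^ 3 := by
    rw [WeierstrassCurve.j, mul_right_comm, ← WeierstrassCurve.coe_Δ', Units.inv_mul, one_mul]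
  by_contra! h4
  have h5 := congrArg ((IsDiscreteValuationRing.maximalIdeal R).valuation K) h3
  rw [map_mul, map_pow, h2, one_pow] at h5
  have h6 : (IsDiscreteValuationRing.maximalIdeal R).valuation K W.j *
      (IsDiscreteValuationRing.maximalIdeal R).valuation K W.Δ < 1 :=
    lt_of_le_of_lt (mul_le_of_le_one_left' h4) h1
  exact h6.ne h5

theorem valuation_le_one_of_range {r : R} :
    (IsDiscreteValuationRing.maximalIdeal R).valuation K (algebraMap R K r) ≤ 1 :=
  HeightOneSpectrum.valuation_le_one _ _

end Reduction

/-! ### Good reduction and the conductor over a number field. -/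

section

variable {K : Type*} [Field K] [NumberField K] {W W' : WeierstrassCurve K}
  {q : HeightOneSpectrum (𝓞 K)}

theorem exists_integral_of_hasGoodReductionAt (h : HasGoodReductionAt W q) :
    ∃ W₀ : WeierstrassCurve (q.valuation K).integer, IsIsomorphic W (W₀⁄K) ∧ IsUnit W₀.Δ := by
  obtain ⟨C, hC⟩ := h
  obtain ⟨W₀, h1, h2⟩ := exists_integral_of_hasGoodReduction hC
  exact ⟨W₀, ⟨C, h1⟩, h2⟩

theorem hasGoodReductionAt_of_isUnit {W₀ : WeierstrassCurve (q.valuation K).integer}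
    (h : IsIsomorphic W (W₀⁄K)) (hΔ : IsUnit W₀.Δ) : HasGoodReductionAt W q := by
  obtain ⟨C, hC⟩ := h
  exact ⟨C, hasGoodReduction_of_isUnit hC hΔ⟩

theorem IsIsomorphic.hasGoodReductionAt (h : IsIsomorphic W W') (hW : HasGoodReductionAt W q) :
    HasGoodReductionAt W' q := by
  obtain ⟨W₀, h1, h2⟩ := exists_integral_of_hasGoodReductionAt hW
  exact hasGoodReductionAt_of_isUnit (h.symm.trans h1) h2

theorem not_hasMultiplicativeReductionAt [W.IsElliptic] {j : 𝓞 K} (hj : W.j = j) :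
    ¬HasMultiplicativeReductionAt W q := by
  rintro ⟨C, hC⟩
  have h1 := one_lt_valuation_j hC
  rw [WeierstrassCurve.variableChange_j, hj] at h1
  have h2 : q.valuation K (j : K) ≤ 1 := q.valuation_le_one j
  exact h1.not_ge (valuation_le_one_of_range (R := (q.valuation K).integer) (r := ⟨j, h2⟩))

/-- Good reduction away from the primes where the equation is not integral or the discriminant is
not a unit. -/
theorem finite_not_hasGoodReductionAt [W.IsElliptic] :
    {q : HeightOneSpectrum (𝓞 K) | ¬HasGoodReductionAt W q}.Finite := by
  have key : ∀ x : K, {q : HeightOneSpectrum (𝓞 K) | 1 < q.valuation K x}.Finite := by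
    intro x
    exact HeightOneSpectrum.Support.finite (𝓞 K) x
  refine (((((key W.a₁).union (key W.a₂)).union (key W.a₃)).union (key W.a₄)).union
    ((key W.a₆).union (key W.Δ⁻¹))).subset fun q hq => ?_
  by_contra hn
  simp only [Set.mem_union, Set.mem_setOf_eq, not_or, not_lt] at hn
  obtain ⟨⟨⟨⟨h1, h2⟩, h3⟩, h4⟩, h6, hΔ⟩ := hn
  refine hq ?_
  let W₀ : WeierstrassCurve (q.valuation K).integer :=
    ⟨⟨_, h1⟩, ⟨_, h2⟩, ⟨_, h3⟩, ⟨_, h4⟩, ⟨_, h6⟩⟩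
  have hW : W = W₀⁄K := rfl
  refine hasGoodReductionAt_of_isUnit (W₀ := W₀) ⟨1, by rw [one_smul, ← hW]⟩ ?_
  have h7 : algebraMap (q.valuation K).integer K W₀.Δ = W.Δ := by
    rw [hW, WeierstrassCurve.baseChange, WeierstrassCurve.map_Δ]
  refine IsUnit.of_mul_eq_one ⟨_, hΔ⟩ (Subtype.ext ?_)
  change algebraMap (q.valuation K).integer K W₀.Δ * W.Δ⁻¹ = 1
  rw [h7, mul_inv_cancel₀ W.isUnit_Δ.ne_zero]

theorem hasGoodReductionAt_of_conductorExponent (h : conductorExponent W q = 0) :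
    HasGoodReductionAt W q := by
  by_contra hn
  rw [conductorExponent, if_neg hn] at h
  split_ifs at h <;> omega

/-- The conductor is a `finprod`, which would be 1 by convention if its support were infinite. -/
theorem conductor_support_finite [W.IsElliptic] :
    (Function.mulSupport fun q : HeightOneSpectrum (𝓞 K) =>
      q.asIdeal ^ conductorExponent W q).Finite := by
  refine (finite_not_hasGoodReductionAt (W := W)).subset fun q hq hg => ?_
  refine hq ?_
  beta_reduce
  rw [conductorExponent, if_pos hg, pow_zero]

/-- Every prime of bad reduction has positive conductor exponent, hence divides the conductor. -/
theorem hasGoodReductionAt_of_conductor [W.IsElliptic] {p : HeightOneSpectrum (𝓞 K)} {r : ℕ}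
    (h : conductor W = p.asIdeal ^ r) (hq : q ≠ p) : HasGoodReductionAt W q := by
  refine hasGoodReductionAt_of_conductorExponent ?_
  by_contra hn
  have h1 : q.asIdeal ∣ conductor W := by
    rw [conductor, finprod_eq_prod _ conductor_support_finite]
    refine dvd_trans (dvd_pow_self _ hn)
      (Finset.dvd_prod_of_mem (fun q => q.asIdeal ^ conductorExponent W q) ?_)
    rw [Set.Finite.mem_toFinset, Function.mem_mulSupport]
    intro h0
    exact q.isPrime.ne_top ((Ideal.pow_eq_top_iff.1 (h0.trans Ideal.one_eq_top)).resolve_right hn)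
  rw [h] at h1
  have h2 : q.asIdeal ∣ p.asIdeal := q.prime.dvd_of_dvd_pow h1
  rw [Ideal.dvd_iff_le] at h2
  exact hq (HeightOneSpectrum.ext (p.isMaximal.eq_of_le q.isPrime.ne_top h2).symm)

theorem conductor_eq {p : HeightOneSpectrum (𝓞 K)}
    (h : ∀ q, q ≠ p → HasGoodReductionAt W q) (hp : ¬HasGoodReductionAt W p)
    (hm : ¬HasMultiplicativeReductionAt W p) (hw : wildExponent W p = 0) :
    conductor W = p.asIdeal ^ 2 := by
  rw [conductor, finprod_eq_single _ p (fun q hq => by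
    rw [conductorExponent, if_pos (h q hq), pow_zero]), conductorExponent, if_neg hp, if_neg hm, hw]

end

/-! ### Ramification groups and the vanishing of the wild exponent. -/

section Ramification

variable {K : Type*} [Field K] [NumberField K] {L : Type*} [Field L] [NumberField L] [Algebra K L]

/-- An automorphism that is trivial modulo P² acts trivially on Pⁿ/Pⁿ⁺¹, by the product rule for
σ(ab) − ab. -/
theorem smul_sub_mem_pow {P : Ideal (𝓞 L)} {σ : L ≃ₐ[K] L}
    (hσ : ∀ x : 𝓞 L, σ • x - x ∈ P ^ 2) (n : ℕ) {y : 𝓞 L} (hy : y ∈ P ^ n) :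
    σ • y - y ∈ P ^ (n + 1) := by
  induction n generalizing y with
  | zero => exact Ideal.pow_le_pow_right (by norm_num) (hσ y)
  | succ n ih =>
    rw [pow_succ] at hy
    refine Submodule.mul_induction_on hy (fun a ha b hb => ?_) (fun a b ha hb => ?_)
    · rw [smul_mul', show σ • a * σ • b - a * b = (σ • a - a) * σ • b + a * (σ • b - b) by ring]
      refine add_mem ?_ ?_
      · rw [pow_succ]
        refine Ideal.mul_mem_mul (ih ha) ?_
        rw [show σ • b = (σ • b - b) + b by ring]
        exact add_mem (Ideal.pow_le_self two_ne_zero (hσ b)) hb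
      · rw [show n + 1 + 1 = n + 2 by ring, pow_add]
        exact Ideal.mul_mem_mul ha (hσ b)
    · rw [smul_add, show σ • a + σ • b - (a + b) = (σ • a - a) + (σ • b - b) by ring]
      exact add_mem ha hb

/-- An involution in the first ramification group at a prime not above `2` is trivial. -/
theorem eq_one_of_mem_ramificationGroup {P : Ideal (𝓞 L)} [hP : P.IsPrime] (h2 : (2 : 𝓞 L) ∉ P)
    {σ : L ≃ₐ[K] L} (hσ : σ ∈ ramificationGroup L P 1) (hinv : ∀ x, σ (σ x) = x) : σ = 1 := by
  have hσ' : ∀ x : 𝓞 L, σ • x - x ∈ P ^ 2 := hσ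
  have hinv' : ∀ x : 𝓞 L, σ • σ • x = x := fun x => by
    apply NumberField.RingOfIntegers.ext
    exact hinv x
  -- An involution negates z = σx − x. If z ∈ Pⁿ, then σz ≡ z modulo Pⁿ⁺¹, so 2z ∈ Pⁿ⁺¹, and 2 ∉ P.
  -- Krull's intersection theorem then gives z = 0.
  have key : ∀ n, ∀ x : 𝓞 L, σ • x - x ∈ P ^ n := by
    intro n
    induction n with
    | zero => intro x; simp
    | succ n ih =>
      intro x
      have h1 := smul_sub_mem_pow hσ' n (ih x)
      rw [smul_sub, hinv'] at h1
      have h3 : 2 * (σ • x - x) ∈ P ^ (n + 1) := by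
        rw [show 2 * (σ • x - x) = -(x - σ • x - (σ • x - x)) by ring]
        exact neg_mem h1
      exact (Ideal.IsPrime.mul_mem_pow P h3).resolve_left h2
  have hfix : ∀ x : 𝓞 L, σ • x = x := by
    intro x
    have h1 : σ • x - x ∈ (⨅ n : ℕ, P ^ n) := by
      rw [Submodule.mem_iInf]
      exact fun n => key n x
    rw [Ideal.iInf_pow_eq_bot_of_isDomain P hP.ne_top] at h1
    exact sub_eq_zero.1 h1
  ext z
  obtain ⟨x, y, hy, rfl⟩ := IsFractionRing.div_surjective (A := 𝓞 L) z
  have hx : ∀ x : 𝓞 L, σ (algebraMap (𝓞 L) L x) = algebraMap (𝓞 L) L x := fun x =>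
    congrArg (algebraMap (𝓞 L) L) (hfix x)
  rw [map_div₀, hx, hx]
  rfl

end Ramification

section

variable {K : Type*} [Field K] [NumberField K] {W : WeierstrassCurve K}

theorem codimFixed_bot (L : Type*) [Field L] [Algebra K L] (W : WeierstrassCurve K) (l : ℕ) :
    codimFixed L W l ⊥ = 0 := by
  have h1 : fixedPoints L W (⊥ : Subgroup (L ≃ₐ[K] L)) = ⊤ := by
    rw [fixedPoints, eq_top_iff]
    intro P _
    simp only [Subgroup.mem_bot, AddSubgroup.mem_iInf]
    rintro σ rfl
    rw [AddMonoidHom.mem_ker, AddMonoidHom.sub_apply, sub_eq_zero]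
    exact WeierstrassCurve.Affine.Point.map_id P
  rw [codimFixed, h1, AddSubgroup.relIndex_top_left, Nat.log_one_right]

/-- The coordinates of the points of order two of a curve isomorphic to
`y² = x (x² + a x + b)`. -/
theorem coordinate_of_two_nsmul {a b : K} {C : WeierstrassCurve.VariableChange K}
    (hC : C • W = curveAB a b) {L : Type*} [Field L] [CharZero L] [Algebra K L] {x y : L}
    {h : (W⁄L).toAffine.Nonsingular x y}
    (h2 : 2 • WeierstrassCurve.Affine.Point.some x y h = 0) :
    ∃ X : L, X * (X ^ 2 + algebraMap K L a * X + algebraMap K L b) = 0 ∧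
      x = algebraMap K L (C.u ^ 2) * X + algebraMap K L C.r ∧
      y = algebraMap K L (C.u ^ 2 * C.s) * X + algebraMap K L C.t := by
  have hC' : C.map (algebraMap K L) • W⁄L =
      curveAB (algebraMap K L a) (algebraMap K L b) := by
    rw [← baseChange_curveAB, ← hC]
    exact WeierstrassCurve.map_variableChange _ _ _
  obtain ⟨P, hP⟩ := (vcEquiv hC').surjective (.some x y h)
  rcases P with _ | ⟨X, Y, hXY⟩
  · exact absurd (hP.symm.trans (map_zero (vcEquiv hC')))
      (WeierstrassCurve.Affine.Point.some_ne_zero _)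
  rw [← hP, ← map_nsmul, map_eq_zero_iff _ (vcEquiv hC').injective, two_nsmul,
    ← eq_neg_iff_add_eq_zero, WeierstrassCurve.Affine.Point.neg_some,
    WeierstrassCurve.Affine.Point.some.injEq, negY_curveAB] at h2
  have hY : Y = 0 := self_eq_neg.1 h2.2
  subst hY
  rw [vcEquiv_some, WeierstrassCurve.Affine.Point.some.injEq] at hP
  have hX := (WeierstrassCurve.Affine.equation_iff' X 0).1 hXY.1
  simp only [curveAB] at hX
  refine ⟨X, by linear_combination -hX, ?_, ?_⟩
  · rw [← hP.1]
    simp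
  · rw [← hP.2]
    simp

/-- Thanks to the rational point of order two, the 2-division field is generated by roots of
quadratic polynomials over K. All its automorphisms are involutions, so the groups Gᵢ with i ≥ 1 are
trivial above an odd prime. -/
theorem wildExponent_eq_zero {a b : K} (hb : b ≠ 0) (hW : IsIsomorphic W (curveAB a b))
    {p : HeightOneSpectrum (𝓞 K)} (hp : (2 : 𝓞 K) ∉ p.asIdeal) : wildExponent W p = 0 := by
  obtain ⟨C, hC⟩ := hW
  set Ω := AlgebraicClosure K
  have hl : auxPrime p = 2 := if_neg hp
  -- The auxiliary prime equals 2 only propositionally, and the division field depends on it; hence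
  -- the generalization.
  suffices key : ∀ l, l = 2 → ∀ P ∈ p.asIdeal.primesOver (𝓞 (divisionField W l)),
      wildExponentAux (divisionField W l) W l P = 0 from key _ hl _ (Subtype.prop _)
  rintro _ rfl
  generalize hL : divisionField W 2 = L
  rintro P ⟨hP, hPp⟩
  have hroots : ∀ z ∈ {z : Ω | ∃ (x y : Ω) (h : (W⁄Ω).toAffine.Nonsingular x y),
      2 • WeierstrassCurve.Affine.Point.some x y h = 0 ∧ (z = x ∨ z = y)},
      ∃ X : Ω, X * (X ^ 2 + algebraMap K Ω a * X + algebraMap K Ω b) = 0 ∧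
      (z = algebraMap K Ω (C.u ^ 2) * X + algebraMap K Ω C.r ∨
      z = algebraMap K Ω (C.u ^ 2 * C.s) * X + algebraMap K Ω C.t) := by
    rintro z ⟨x, y, h, h2, hz⟩
    obtain ⟨X, hX, hx, hy⟩ := coordinate_of_two_nsmul hC h2
    exact ⟨X, hX, hz.imp (fun h => h.trans hx) (fun h => h.trans hy)⟩
  have hfin : {z : Ω | ∃ (x y : Ω) (h : (W⁄Ω).toAffine.Nonsingular x y),
      2 • WeierstrassCurve.Affine.Point.some x y h = 0 ∧ (z = x ∨ z = y)}.Finite := by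
    have hXf : {X : Ω | X * (X ^ 2 + algebraMap K Ω a * X + algebraMap K Ω b) = 0}.Finite := by
      have hne : (Polynomial.X * (Polynomial.X ^ 2 + Polynomial.C (algebraMap K Ω a) * Polynomial.X +
          Polynomial.C (algebraMap K Ω b)) : Polynomial Ω) ≠ 0 :=
        mul_ne_zero X_ne_zero (Polynomial.Monic.ne_zero (by monicity!))
      refine (Polynomial.finite_setOfPred_isRoot hne).subset fun x hx => ?_
      simpa [Polynomial.IsRoot] using hx
    refine ((hXf.image fun X => algebraMap K Ω (C.u ^ 2) * X + algebraMap K Ω C.r).union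
      (hXf.image fun X => algebraMap K Ω (C.u ^ 2 * C.s) * X + algebraMap K Ω C.t)).subset ?_
    intro z hz
    obtain ⟨X, hX, hz | hz⟩ := hroots z hz
    exacts [.inl ⟨X, hX, hz.symm⟩, .inr ⟨X, hX, hz.symm⟩]
  have : FiniteDimensional K L := by
    haveI : Finite _ := hfin
    rw [← hL]
    exact IntermediateField.finiteDimensional_adjoin fun x _ => Algebra.IsIntegral.isIntegral x
  have : NumberField L := NumberField.of_module_finite K L
  have h2 : (2 : 𝓞 L) ∉ P := by
    intro h2
    refine hp ?_
    rw [hPp.over, Ideal.mem_comap, map_ofNat]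
    exact h2
  -- On a generator ζ with ζ² + eζ + f = 0, either σζ = ζ or σζ = −e − ζ.
  have hinv : ∀ (σ : L ≃ₐ[K] L) (x : L), σ (σ x) = x := by
    intro σ
    have h3 : (σ * σ : L ≃ₐ[K] L).toAlgHom = AlgHom.id K L := by
      refine IntermediateField.algHom_ext_of_eq_adjoin K hL.symm fun z hz => ?_
      obtain ⟨X, hX, hz'⟩ := hroots z hz
      change σ (σ ⟨z, _⟩) = ⟨z, _⟩
      obtain ⟨e, f, hef⟩ : ∃ e f : K, z ^ 2 + algebraMap K Ω e * z + algebraMap K Ω f = 0 := by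
        have hX' : X ^ 2 + algebraMap K Ω a * X + algebraMap K Ω b = 0 ∨ X = 0 :=
          (mul_eq_zero.1 hX).symm
        have aux : ∀ c d : K, z = algebraMap K Ω c * X + algebraMap K Ω d →
            ∃ e f : K, z ^ 2 + algebraMap K Ω e * z + algebraMap K Ω f = 0 := by
          rintro c d rfl
          rcases hX' with h | rfl
          · refine ⟨c * a - 2 * d, d ^ 2 - c * a * d + c ^ 2 * b, ?_⟩
            simp only [map_add, map_sub, map_mul, map_pow, map_ofNat]
            linear_combination (algebraMap K Ω c) ^ 2 * h
          · refine ⟨-2 * d, d ^ 2, ?_⟩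
            simp only [map_mul, map_pow, map_ofNat, map_neg]
            ring
        exact hz'.elim (aux _ _) (aux _ _)
      set ζ : L := ⟨z, hL ▸ IntermediateField.subset_adjoin K _ hz⟩ with hζ
      have h4 : ζ ^ 2 + algebraMap K L e * ζ + algebraMap K L f = 0 := Subtype.ext hef
      have h5 := congrArg σ h4
      have h6 := congrArg σ h5
      simp only [map_add, map_mul, map_pow, AlgEquiv.commutes, map_zero] at h5 h6
      have h7 : (σ ζ - ζ) * (σ ζ + ζ + algebraMap K L e) = 0 := by linear_combination h5 - h4
      rcases mul_eq_zero.1 h7 with h8 | h8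
      · rw [sub_eq_zero.1 h8, sub_eq_zero.1 h8]
      · have h9 := congrArg σ h8
        simp only [map_add, AlgEquiv.commutes, map_zero] at h9
        linear_combination h9 - h8
    exact fun x => DFunLike.congr_fun h3 x
  rw [wildExponentAux]
  have hz : ∀ i : ℕ, Nat.card (ramificationGroup (K := K) L P (i + 1)) *
      codimFixed L W 2 (ramificationGroup L P (i + 1)) = 0 := by
    intro i
    have hbot : ramificationGroup (K := K) L P (i + 1) = ⊥ := by
      rw [eq_bot_iff]
      intro σ hσ
      refine eq_one_of_mem_ramificationGroup h2 (fun x => ?_) (hinv σ)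
      exact Ideal.pow_le_pow_right (by omega) (hσ x)
    rw [hbot, codimFixed_bot, mul_zero]
  rw [finsum_eq_zero_of_forall_eq_zero hz, Nat.zero_div]

end

/-! ### Good reduction at a prime above 2 in terms of A and B. -/

section LocalModel

variable {R : Type*} [CommRing R]

/-- `X` is four times the abscissa of a point of order two on `W`, whose discriminant is a unit, and
`y² = x (x² + A x + B)` is the equation of `W` obtained by moving this point to the origin. -/
structure IsLocalModel (W : WeierstrassCurve R) (X A B : R) : Prop where
  isUnit : IsUnit W.Δ
  cubic : X ^ 3 + W.b₂ * X ^ 2 + 8 * W.b₄ * X + 16 * W.b₆ = 0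
  eq_A : A = W.b₂ + 3 * X
  eq_B : B = 3 * X ^ 2 + 2 * W.b₂ * X + 8 * W.b₄

/-- A prime element of a discrete valuation ring. -/
structure IsUniformizer (τ : R) : Prop where
  prime : Prime τ
  isUnit : ∀ x, ¬τ ∣ x → IsUnit x

theorem IsUniformizer.isUnit_iff {τ : R} (h : IsUniformizer τ) {x : R} : IsUnit x ↔ ¬τ ∣ x :=
  ⟨fun hx hd => h.prime.not_isUnit (isUnit_of_dvd_unit hd hx), h.isUnit x⟩

/-- A curve `y² = x (x² + A x + B)` with good reduction at a prime `τ`, `2 = ω τ²`, whose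
reduction is supersingular. -/
structure IsRamifiedModel (τ ω α₁ α₂ α₃ α₄ α₆ x A B : R) : Prop where
  isUnit_α₁ : IsUnit α₁
  isUnit_α₃ : IsUnit α₃
  isUnit_x : IsUnit x
  cubic : x ^ 3 + (α₁ ^ 2 + ω ^ 2 * τ ^ 2 * α₂) * x ^ 2 +
    ω ^ 3 * τ ^ 2 * (τ * α₁ * α₃ + ω * τ ^ 2 * α₄) * x +
    ω ^ 4 * τ ^ 2 * (α₃ ^ 2 + ω ^ 2 * τ ^ 4 * α₆) = 0
  eq_A : A = α₁ ^ 2 + ω ^ 2 * τ ^ 2 * α₂ + 3 * x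
  eq_B : B = 3 * x ^ 2 + 2 * (α₁ ^ 2 + ω ^ 2 * τ ^ 2 * α₂) * x +
    ω ^ 3 * τ ^ 2 * (τ * α₁ * α₃ + ω * τ ^ 2 * α₄)

theorem IsRamifiedModel.scale {τ ω α₁ α₂ α₃ α₄ α₆ x A B v : R}
    (h : IsRamifiedModel τ ω α₁ α₂ α₃ α₄ α₆ x A B) (hv : IsUnit v) :
    IsRamifiedModel τ ω (v * α₁) (v ^ 2 * α₂) (v ^ 3 * α₃) (v ^ 4 * α₄) (v ^ 6 * α₆) (v ^ 2 * x)
      (v ^ 2 * A) (v ^ 4 * B) where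
  isUnit_α₁ := hv.mul h.isUnit_α₁
  isUnit_α₃ := (hv.pow 3).mul h.isUnit_α₃
  isUnit_x := (hv.pow 2).mul h.isUnit_x
  cubic := by linear_combination v ^ 6 * h.cubic
  eq_A := by rw [h.eq_A]; ring
  eq_B := by rw [h.eq_B]; ring

namespace IsLocalModel

variable {W : WeierstrassCurve R} {X A B : R} (h : IsLocalModel W X A B)

include h

/-- The discriminant of y² = x(x² + Ax + B) is 16B²(A² − 4B), and passing from W to this equation is
a scaling by 2, which multiplies Δ by 2¹². -/
theorem discriminant : B ^ 2 * (A ^ 2 - 4 * B) = 2 ^ 8 * W.Δ := by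
  rw [h.eq_A, h.eq_B]
  have h1 := h.cubic
  have h2 := W.b_relation
  rw [WeierstrassCurve.Δ]
  linear_combination (4 * W.b₂ ^ 3 - 27 * X ^ 3 - 27 * W.b₂ * X ^ 2 - 216 * X * W.b₄ - 144 * W.b₂ * W.b₄ + 432 * W.b₆) * h1 + 64 * W.b₂ ^ 2 * h2

variable {τ : R} (hτ : IsUniformizer τ)

include hτ

theorem isUnit_of_dvd_X (h2 : τ ∣ 2) (ha : ¬τ ∣ W.a₁) (hX : τ ∣ X) :
    IsUnit A ∧ IsUnit (A ^ 2 - 4 * B) := by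
  have h4 : τ ∣ 4 := h2.trans ⟨2, by norm_num⟩
  have hA : ¬τ ∣ A := by
    rw [h.eq_A, WeierstrassCurve.b₂]
    intro hd
    refine ha (hτ.prime.dvd_of_dvd_pow (n := 2) ?_)
    rw [show W.a₁ ^ 2 = W.a₁ ^ 2 + 4 * W.a₂ + 3 * X - 4 * W.a₂ - X * 3 by ring]
    exact dvd_sub (dvd_sub hd (h4.mul_right _)) (hX.mul_right _)
  refine ⟨hτ.isUnit _ hA, hτ.isUnit _ fun hd => hA (hτ.prime.dvd_of_dvd_pow (n := 2) ?_)⟩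
  rw [show A ^ 2 = A ^ 2 - 4 * B + 4 * B by ring]
  exact dvd_add hd (h4.mul_right _)

theorem isUnit_X_add (h2 : τ ∣ 2) (ha : ¬τ ∣ W.a₁) (hX : τ ∣ X) : IsUnit (X + W.b₂) := by
  have h4 : τ ∣ 4 := h2.trans ⟨2, by norm_num⟩
  refine hτ.isUnit _ fun hd => ha (hτ.prime.dvd_of_dvd_pow (n := 2) ?_)
  rw [WeierstrassCurve.b₂] at hd
  rw [show W.a₁ ^ 2 = X + (W.a₁ ^ 2 + 4 * W.a₂) - 4 * W.a₂ - X by ring]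
  exact dvd_sub (dvd_sub hd (h4.mul_right _)) hX

/-- The cubic reads X²(X + b₂) = −8(b₄X + 2b₆), where X + b₂ is a unit. When 2 is a uniformizer up
to a unit this forces 4 ∣ X, while A − a₁² = 4a₂ + 3X. -/
theorem four_dvd_sub [IsDomain R] {ω : R} (hω : IsUnit ω) (h2 : 2 = ω * τ) (ha : ¬τ ∣ W.a₁)
    (hX : τ ∣ X) : 4 ∣ A - W.a₁ ^ 2 := by
  obtain ⟨e, he⟩ := h.isUnit_X_add hτ ⟨ω, by rw [h2]; ring⟩ ha hX
  obtain ⟨Y, rfl⟩ := hX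
  have hτ0 := hτ.prime.ne_zero
  have h8 : (8 : R) = ω ^ 3 * τ ^ 3 := by linear_combination (4 + 2 * (ω * τ) + (ω * τ) ^ 2) * h2
  have h1 : τ ^ 2 * (Y ^ 2 * e) = τ ^ 2 * (τ * (-(ω ^ 3) * (W.b₄ * (τ * Y) + 2 * W.b₆))) := by
    rw [he]
    linear_combination h.cubic - (W.b₄ * τ * Y + 2 * W.b₆) * h8
  have h3 : τ ∣ Y := by
    have := mul_left_cancel₀ (pow_ne_zero 2 hτ0) h1
    have h4 : τ ∣ Y ^ 2 * e := ⟨_, this⟩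
    exact hτ.prime.dvd_of_dvd_pow ((hτ.prime.dvd_or_dvd h4).resolve_right
      (hτ.isUnit_iff.1 e.isUnit))
  obtain ⟨Z, rfl⟩ := h3
  obtain ⟨o, rfl⟩ := hω
  refine ⟨W.a₂ + 3 * (↑o⁻¹ ^ 2 * Z), ?_⟩
  rw [h.eq_A, WeierstrassCurve.b₂]
  have ho : (o : R) * ↑o⁻¹ = 1 := o.mul_inv
  linear_combination (-3 * Z * ↑o⁻¹ ^ 2 * (2 + o * τ)) * h2 - 3 * τ ^ 2 * Z * (o * ↑o⁻¹ + 1) * ho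

/-- This is the case of a point in the kernel of reduction. Dividing the cubic by the unit X² gives
8 ∣ X + b₂, from which both claims follow. -/
theorem isUnit_of_not_dvd_X (h2 : τ ∣ 2) (hX : ¬τ ∣ X) :
    IsUnit B ∧ 8 ∣ A + 2 * W.a₁ ^ 2 := by
  obtain ⟨e, he⟩ := hτ.isUnit _ hX
  have he' : (e : R) * ↑e⁻¹ = 1 := e.mul_inv
  obtain ⟨k, hk⟩ : 8 ∣ X + W.b₂ := by
    refine ⟨-(↑e⁻¹ ^ 2 * (W.b₄ * X + 2 * W.b₆)), ?_⟩
    have := h.cubic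
    rw [← he] at this ⊢
    linear_combination ↑e⁻¹ ^ 2 * this - (e * ↑e⁻¹ + 1) * (e + W.b₂) * he'
  constructor
  · refine hτ.isUnit _ fun hd => hX (hτ.prime.dvd_of_dvd_pow (n := 2) ?_)
    rw [show X ^ 2 = B - 2 * (8 * k * X + 4 * W.b₄) by rw [h.eq_B]; linear_combination -2 * X * hk]
    exact dvd_sub hd (h2.mul_right _)
  · refine ⟨3 * k - W.a₂, ?_⟩
    rw [h.eq_A]
    have hb : W.b₂ = W.a₁ ^ 2 + 4 * W.a₂ := rfl
    linear_combination 3 * hk - 2 * hb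

/-- In residue characteristic 2, the vanishing of a₁ and a₃ would make Δ vanish. -/
theorem isUnit_a₃ (h2 : τ ∣ 2) (ha : τ ∣ W.a₁) : IsUnit W.a₃ := by
  have h8 : τ ∣ 8 := h2.trans ⟨4, by norm_num⟩
  have h4 : τ ∣ 4 := h2.trans ⟨2, by norm_num⟩
  refine hτ.isUnit _ fun h3 => hτ.isUnit_iff.1 h.isUnit ?_
  have hb₂ : τ ∣ W.b₂ := dvd_add (dvd_pow ha two_ne_zero) (h4.mul_right _)
  have hb₆ : τ ∣ W.b₆ := dvd_add (dvd_pow h3 two_ne_zero) (h4.mul_right _)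
  rw [WeierstrassCurve.Δ, show -W.b₂ ^ 2 * W.b₈ - 8 * W.b₄ ^ 3 - 27 * W.b₆ ^ 2 +
    9 * W.b₂ * W.b₄ * W.b₆ = W.b₂ * (-W.b₂ * W.b₈ + 9 * W.b₄ * W.b₆) - 8 * W.b₄ ^ 3 -
    W.b₆ * (27 * W.b₆) by ring]
  exact dvd_sub (dvd_sub (hb₂.mul_right _) (h8.mul_right _)) (hb₆.mul_right _)

/-- Supersingular reduction is incompatible with a rational point of order two when 2 is unramified:
b₆ is a unit, so the Newton polygon of the cubic has the single slope 4/3 and X cannot be in the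
ring. The divisions by τ below carry this out. -/
theorem not_dvd_a₁ [IsDomain R] {ω : R} (hω : IsUnit ω) (h2 : 2 = ω * τ) : ¬τ ∣ W.a₁ := by
  intro ha
  have hd2 : τ ∣ 2 := ⟨ω, by rw [h2]; ring⟩
  have h3 := h.isUnit_a₃ hτ hd2 ha
  obtain ⟨α, hα⟩ := ha
  have hτ0 := hτ.prime.ne_zero
  have h1 := h.cubic
  rw [WeierstrassCurve.b₂, WeierstrassCurve.b₄, WeierstrassCurve.b₆, hα,
    show (4 : R) = ω ^ 2 * τ ^ 2 by linear_combination (2 + ω * τ) * h2,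
    show (8 : R) = ω ^ 3 * τ ^ 3 by linear_combination (4 + 2 * (ω * τ) + (ω * τ) ^ 2) * h2,
    show (16 : R) = ω ^ 4 * τ ^ 4 by
      linear_combination (4 + (ω * τ) ^ 2) * (2 + ω * τ) * h2, h2] at h1
  obtain ⟨Y, rfl⟩ : τ ∣ X := hτ.prime.dvd_of_dvd_pow (n := 3) ⟨-(τ * (α ^ 2 + ω ^ 2 * W.a₂) * X ^ 2 +
    ω ^ 3 * τ ^ 3 * (ω * W.a₄ + α * W.a₃) * X + ω ^ 4 * τ ^ 3 * (W.a₃ ^ 2 + ω ^ 2 * τ ^ 2 * W.a₆)),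
    by linear_combination h1⟩
  obtain ⟨Z, rfl⟩ : τ ∣ Y := hτ.prime.dvd_of_dvd_pow (n := 3) ⟨-((α ^ 2 + ω ^ 2 * W.a₂) * Y ^ 2 +
    ω ^ 3 * τ * (ω * W.a₄ + α * W.a₃) * Y + ω ^ 4 * (W.a₃ ^ 2 + ω ^ 2 * τ ^ 2 * W.a₆)), by
      refine mul_left_cancel₀ (pow_ne_zero 3 hτ0) ?_
      linear_combination h1⟩
  have h5 : τ ∣ ω ^ 4 * W.a₃ ^ 2 := ⟨-(τ * Z ^ 3 + τ * (α ^ 2 + ω ^ 2 * W.a₂) * Z ^ 2 +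
    ω ^ 3 * τ * (ω * W.a₄ + α * W.a₃) * Z + ω ^ 4 * ω ^ 2 * τ * W.a₆), by
      refine mul_left_cancel₀ (pow_ne_zero 4 hτ0) ?_
      linear_combination h1⟩
  exact hτ.isUnit_iff.1 ((hω.pow 4).mul (h3.pow 2)) h5

/-- For 2 = ωτ² and supersingular reduction, X has valuation exactly 2 and a₁ exactly 1. The
equation is therefore rescaled by τ, and the new B is a unit. -/
theorem exists_isRamifiedModel [IsDomain R] {ω : R} (hω : IsUnit ω) (h2 : 2 = ω * τ ^ 2)
    (ha : τ ∣ W.a₁) : ∃ α₁ x A' B' : R, A = τ ^ 2 * A' ∧ B = τ ^ 4 * B' ∧ IsUnit B' ∧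
      IsRamifiedModel τ ω α₁ W.a₂ W.a₃ W.a₄ W.a₆ x A' B' := by
  have hd2 : τ ∣ 2 := ⟨ω * τ, by rw [h2]; ring⟩
  have h3 := h.isUnit_a₃ hτ hd2 ha
  obtain ⟨α, hα⟩ := ha
  have hτ0 := hτ.prime.ne_zero
  have h1 := h.cubic
  have hA := h.eq_A
  have hB := h.eq_B
  have e4 : (4 : R) = ω ^ 2 * τ ^ 4 := by linear_combination (2 + ω * τ ^ 2) * h2
  have e8 : (8 : R) = ω ^ 3 * τ ^ 6 := by
    linear_combination (4 + 2 * (ω * τ ^ 2) + (ω * τ ^ 2) ^ 2) * h2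
  have e16 : (16 : R) = ω ^ 4 * τ ^ 8 := by
    linear_combination (4 + (ω * τ ^ 2) ^ 2) * (2 + ω * τ ^ 2) * h2
  rw [WeierstrassCurve.b₂, WeierstrassCurve.b₄, WeierstrassCurve.b₆, hα, e4, e8, e16] at h1
  rw [WeierstrassCurve.b₂, hα, e4] at hA
  rw [WeierstrassCurve.b₂, WeierstrassCurve.b₄, hα, e4, e8] at hB
  obtain ⟨Y, rfl⟩ : τ ∣ X := hτ.prime.dvd_of_dvd_pow (n := 3) ⟨-(τ * (α ^ 2 + ω ^ 2 * τ ^ 2 * W.a₂) *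
    X ^ 2 + ω ^ 3 * τ ^ 5 * (2 * W.a₄ + τ * α * W.a₃) * X +
    ω ^ 4 * τ ^ 7 * (W.a₃ ^ 2 + ω ^ 2 * τ ^ 4 * W.a₆)), by linear_combination h1⟩
  obtain ⟨x, rfl⟩ : τ ∣ Y := hτ.prime.dvd_of_dvd_pow (n := 3) ⟨-((α ^ 2 + ω ^ 2 * τ ^ 2 * W.a₂) *
    Y ^ 2 + ω ^ 3 * τ ^ 3 * (2 * W.a₄ + τ * α * W.a₃) * Y +
    ω ^ 4 * τ ^ 4 * (W.a₃ ^ 2 + ω ^ 2 * τ ^ 4 * W.a₆)), by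
      refine mul_left_cancel₀ (pow_ne_zero 3 hτ0) ?_
      linear_combination h1⟩
  have hx1 : x ^ 3 + (α ^ 2 + ω ^ 2 * τ ^ 2 * W.a₂) * x ^ 2 +
      ω ^ 3 * τ ^ 2 * (τ * α * W.a₃ + ω * τ ^ 2 * W.a₄) * x +
      ω ^ 4 * τ ^ 2 * (W.a₃ ^ 2 + ω ^ 2 * τ ^ 4 * W.a₆) = 0 := by
    refine mul_left_cancel₀ (pow_ne_zero 6 hτ0) ?_
    linear_combination h1 - (ω ^ 3 * τ ^ 8 * W.a₄ * x) * h2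
  have hx : ¬τ ∣ x := by
    rintro ⟨y, rfl⟩
    have h5 : τ * y ^ 3 + (α ^ 2 + ω ^ 2 * τ ^ 2 * W.a₂) * y ^ 2 +
        ω ^ 3 * τ * (τ * α * W.a₃ + ω * τ ^ 2 * W.a₄) * y +
        ω ^ 4 * (W.a₃ ^ 2 + ω ^ 2 * τ ^ 4 * W.a₆) = 0 := by
      refine mul_left_cancel₀ (pow_ne_zero 2 hτ0) ?_
      linear_combination hx1
    -- If τ divided x, the equation divided by τ² would be a square modulo τ. Its root is divisible
    -- by τ, which gives τ ∣ y and finally τ ∣ ω⁴a₃², although a₃ is a unit.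
    have h6 : (α * y + ω ^ 2 * W.a₃) ^ 2 = τ * (-(y ^ 3 + ω ^ 2 * τ * W.a₂ * y ^ 2 +
        ω ^ 4 * τ ^ 2 * W.a₄ * y + ω ^ 6 * τ ^ 3 * W.a₆) +
        (2 * α * ω ^ 2 * y * W.a₃ - ω ^ 3 * τ ^ 2 * α * W.a₃ * y) * 0) +
        (2 - ω * τ ^ 2) * (α * ω ^ 2 * W.a₃ * y) := by
      linear_combination h5
    rw [sub_eq_zero.2 h2, zero_mul, add_zero, mul_zero, add_zero] at h6
    obtain ⟨z, hz⟩ := hτ.prime.dvd_of_dvd_pow ⟨_, h6⟩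
    have h7 : τ ∣ y ^ 3 := ⟨-(z ^ 2 + ω ^ 2 * W.a₂ * y ^ 2 +
        ω ^ 4 * τ * W.a₄ * y + ω ^ 6 * τ ^ 2 * W.a₆), by
      refine mul_left_cancel₀ hτ0 ?_
      rw [hz] at h6
      linear_combination h6⟩
    obtain ⟨y', rfl⟩ := hτ.prime.dvd_of_dvd_pow h7
    have h8 : τ ∣ ω ^ 4 * W.a₃ ^ 2 := ⟨-(τ ^ 3 * y' ^ 3 + (α ^ 2 + ω ^ 2 * τ ^ 2 * W.a₂) * τ * y' ^ 2 +
        ω ^ 3 * τ * (τ * α * W.a₃ + ω * τ ^ 2 * W.a₄) * y' +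
        ω ^ 4 * (ω ^ 2 * τ ^ 3 * W.a₆)), by linear_combination h5⟩
    exact hτ.isUnit_iff.1 ((hω.pow 4).mul (h3.pow 2)) h8
  have hβ : ¬τ ∣ α := by
    rintro ⟨β, rfl⟩
    refine hx (hτ.prime.dvd_of_dvd_pow (n := 3) ⟨-((τ * β ^ 2 + ω ^ 2 * τ * W.a₂) * x ^ 2 +
      ω ^ 3 * τ * (τ * (τ * β) * W.a₃ + ω * τ ^ 2 * W.a₄) * x +
      ω ^ 4 * τ * (W.a₃ ^ 2 + ω ^ 2 * τ ^ 4 * W.a₆)), by linear_combination hx1⟩)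
  refine ⟨α, x, _, 3 * x ^ 2 + 2 * (α ^ 2 + ω ^ 2 * τ ^ 2 * W.a₂) * x +
    ω ^ 3 * τ ^ 2 * (τ * α * W.a₃ + ω * τ ^ 2 * W.a₄), ?_, ?_, ?_, hτ.isUnit _ hβ, h3,
    hτ.isUnit _ hx, hx1, rfl, rfl⟩
  · rw [hA]; ring
  · rw [hB]; linear_combination (ω ^ 3 * τ ^ 6 * W.a₄) * h2
  · refine hτ.isUnit _ fun hd => hx (hτ.prime.dvd_of_dvd_pow (n := 2) ?_)
    obtain ⟨k, hk⟩ := hd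
    exact ⟨k - ω * τ * x ^ 2 - ω * τ * (α ^ 2 + ω ^ 2 * τ ^ 2 * W.a₂) * x -
      ω ^ 3 * τ * (τ * α * W.a₃ + ω * τ ^ 2 * W.a₄), by
      linear_combination hk - (x ^ 2 + (α ^ 2 + ω ^ 2 * τ ^ 2 * W.a₂) * x) * h2⟩

end IsLocalModel

end LocalModel

/-! ### Local models at the primes of a number field. -/

section

variable {K : Type*} [Field K] [NumberField K] {q : HeightOneSpectrum (𝓞 K)}

/-- The localization of the ring of integers at `q`, as a subring of `K`. -/
abbrev integersAt (q : HeightOneSpectrum (𝓞 K)) : Subring K := (q.valuation K).integer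

theorem coe_ofNat_integersAt (n : ℕ) [n.AtLeastTwo] :
    ((ofNat(n) : integersAt q) : K) = ofNat(n) := rfl

theorem integer_dvd_iff {x y : integersAt q} : x ∣ y ↔ q.valuation K y ≤ q.valuation K x :=
  (Valuation.integer.integers (q.valuation K)).dvd_iff_le

theorem integer_isUnit_iff {x : integersAt q} : IsUnit x ↔ q.valuation K x = 1 :=
  (Valuation.integer.integers (q.valuation K)).isUnit_iff_valuation_eq_one

theorem isUniformizer_of_span {t : 𝓞 K} (ht : q.asIdeal = Ideal.span {t}) {τ : integersAt q}
    (hτ : (τ : K) = t) : IsUniformizer τ := by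
  have h0 : t ≠ 0 := by
    rintro rfl
    exact q.ne_bot (by rw [ht]; simp)
  have hv : q.valuation K t = WithZero.exp (-1 : ℤ) := by
    rw [HeightOneSpectrum.valuation_of_algebraMap]
    exact q.intValuation_singleton h0 ht
  have h1 : ∀ x : integersAt q, ¬τ ∣ x → IsUnit x := by
    intro x hx
    rw [integer_isUnit_iff]
    rw [integer_dvd_iff, hτ, hv, not_le] at hx
    refine le_antisymm x.2 ?_
    by_contra! h2
    have hx0 : q.valuation K (x : K) ≠ 0 := fun h => by simp [h] at hx
    rw [← WithZero.exp_log hx0] at h2 hx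
    rw [← WithZero.exp_zero, WithZero.exp_lt_exp] at h2
    rw [WithZero.exp_lt_exp] at hx
    omega
  have hn : ¬IsUnit τ := by
    rw [integer_isUnit_iff, hτ, hv, ← WithZero.exp_zero, WithZero.exp_inj]
    norm_num
  refine ⟨⟨?_, hn, fun x y hxy => ?_⟩, h1⟩
  · rintro rfl
    exact h0 (by simpa using hτ.symm)
  · by_contra! h
    exact hn (isUnit_of_dvd_unit hxy ((h1 x h.1).mul (h1 y h.2)))

theorem exists_isLocalModel {a b : K} (h : HasGoodReductionAt (curveAB a b) q) :
    ∃ (W₀ : WeierstrassCurve (integersAt q)) (X A B : integersAt q) (u : K), u ≠ 0 ∧ IsLocalModel W₀ X A B ∧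
      a * u ^ 2 = A ∧ b * u ^ 4 = B := by
  obtain ⟨W₀, ⟨C, hC⟩, hΔ⟩ := exists_integral_of_hasGoodReductionAt h
  set w : K := ((C.u⁻¹ : Kˣ) : K) with hw
  have hw0 : w ≠ 0 := C.u⁻¹.ne_zero
  have h2 := congrArg WeierstrassCurve.b₂ hC
  have h4 := congrArg WeierstrassCurve.b₄ hC
  have h6 := congrArg WeierstrassCurve.b₆ hC
  rw [WeierstrassCurve.variableChange_b₂, ← hw, WeierstrassCurve.baseChange,
    WeierstrassCurve.map_b₂] at h2
  rw [WeierstrassCurve.variableChange_b₄, ← hw, WeierstrassCurve.baseChange,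
    WeierstrassCurve.map_b₄] at h4
  rw [WeierstrassCurve.variableChange_b₆, ← hw, WeierstrassCurve.baseChange,
    WeierstrassCurve.map_b₆] at h6
  change _ = (W₀.b₂ : K) at h2
  change _ = (W₀.b₄ : K) at h4
  change _ = (W₀.b₆ : K) at h6
  simp only [WeierstrassCurve.b₂, WeierstrassCurve.b₄, WeierstrassCurve.b₆, curveAB] at h2 h4 h6
  change _ = (W₀.b₂ : K) at h2
  change _ = (W₀.b₄ : K) at h4
  change _ = (W₀.b₆ : K) at h6
  -- The change of variables puts the origin at abscissa −rw². Four times this is a root of a monic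
  -- integral cubic, hence integral; the factor 4 also explains the scaling by u = 2w below.
  have hX : (-4 * C.r * w ^ 2) ^ 3 + (W₀.b₂ : K) * (-4 * C.r * w ^ 2) ^ 2 +
      8 * (W₀.b₄ : K) * (-4 * C.r * w ^ 2) + 16 * (W₀.b₆ : K) = 0 := by
    rw [← h2, ← h4, ← h6]
    ring
  have hXm : -4 * C.r * w ^ 2 ∈ integersAt q := by
    refine (Valuation.integer.integers (q.valuation K)).mem_of_integral
      ⟨Polynomial.X ^ 3 + Polynomial.C W₀.b₂ * Polynomial.X ^ 2 +
        Polynomial.C (8 * W₀.b₄) * Polynomial.X + Polynomial.C (16 * W₀.b₆), ?_, ?_⟩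
    · monicity!
    · simp only [Polynomial.eval₂_add, Polynomial.eval₂_mul, Polynomial.eval₂_pow,
        Polynomial.eval₂_X, Polynomial.eval₂_C, Polynomial.eval₂_ofNat, map_mul, map_ofNat]
      exact hX
  refine ⟨W₀, ⟨_, hXm⟩, _, _, 2 * w, mul_ne_zero two_ne_zero hw0,
    ⟨hΔ, Subtype.ext ?_, rfl, rfl⟩, ?_, ?_⟩
  · simp only [Subring.coe_add, Subring.coe_mul, AddSubgroupClass.coe_sub, Subring.coe_pow, Subring.coe_zero,
      coe_ofNat_integersAt]
    exact hX
  · simp only [Subring.coe_add, Subring.coe_mul, AddSubgroupClass.coe_sub, Subring.coe_pow, Subring.coe_zero,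
      coe_ofNat_integersAt]
    rw [← h2]
    ring
  · simp only [Subring.coe_add, Subring.coe_mul, AddSubgroupClass.coe_sub, Subring.coe_pow, Subring.coe_zero,
      coe_ofNat_integersAt]
    rw [← h2, ← h4]
    ring

/-- The equation `y² = x (x² + a x + b)` is integral and minimal at `q` among its scalings. -/
structure IsMinimalAt (q : HeightOneSpectrum (𝓞 K)) (a b : K) : Prop where
  a_le : q.valuation K a ≤ 1
  b_le : q.valuation K b ≤ 1
  minimal : ∀ t : K, q.valuation K t < 1 → q.valuation K a ≤ q.valuation K t ^ 2 →
    ¬q.valuation K b ≤ q.valuation K t ^ 4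

/-- A factor u of positive valuation cannot turn an integral coefficient into a unit, and one of
negative valuation would contradict minimality. -/
theorem IsMinimalAt.valuation_eq_one {a b u : K} (h : IsMinimalAt q a b)
    (hu : u ≠ 0) (hA : q.valuation K (a * u ^ 2) ≤ 1) (hB : q.valuation K (b * u ^ 4) ≤ 1)
    (hAB : q.valuation K (a * u ^ 2) = 1 ∨ q.valuation K (b * u ^ 4) = 1) :
    q.valuation K u = 1 := by
  have hv0 : q.valuation K u ≠ 0 := (Valuation.ne_zero_iff _).2 hu
  rcases lt_trichotomy (q.valuation K u) 1 with h1 | h1 | h1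
  · exfalso
    rcases hAB with h2 | h2 <;> rw [map_mul, map_pow] at h2
    · exact (mul_lt_one_of_nonneg_of_lt_one_right h.a_le zero_le'
        (pow_lt_one₀ zero_le' h1 two_ne_zero)).ne h2
    · exact (mul_lt_one_of_nonneg_of_lt_one_right h.b_le zero_le'
        (pow_lt_one₀ zero_le' h1 four_ne_zero)).ne h2
  · exact h1
  · exfalso
    have key : ∀ (c : K) (n : ℕ), q.valuation K (c * u ^ n) ≤ 1 →
        q.valuation K c ≤ q.valuation K u⁻¹ ^ n := by
      intro c n hc
      rw [show c = c * u ^ n * u⁻¹ ^ n by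
        rw [mul_assoc, ← mul_pow, mul_inv_cancel₀ hu, one_pow, mul_one], map_mul, map_pow]
      exact mul_le_of_le_one_left' hc
    refine h.minimal u⁻¹ ?_ (key a 2 hA) (key b 4 hB)
    rw [map_inv₀]
    exact inv_lt_one_of_one_lt₀ h1

/-- Where 2 is a unit, the discriminant relation makes both B and A² − 4B units. -/
theorem valuation_eq_one_of_odd {a b : K} (h : HasGoodReductionAt (curveAB a b) q)
    (h2 : q.valuation K 2 = 1) : ∃ u : K, u ≠ 0 ∧ q.valuation K (a * u ^ 2) ≤ 1 ∧
      q.valuation K (b * u ^ 4) = 1 ∧ q.valuation K ((a ^ 2 - 4 * b) * u ^ 4) = 1 := by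
  obtain ⟨W₀, X, A, B, u, hu, hM, hA, hB⟩ := exists_isLocalModel h
  have hd := hM.discriminant
  have h2' : IsUnit (2 : integersAt q) := integer_isUnit_iff.2 h2
  have h3 : IsUnit (B ^ 2 * (A ^ 2 - 4 * B)) := by
    rw [hd]
    exact (h2'.pow 8).mul hM.isUnit
  rw [IsUnit.mul_iff, isUnit_pow_iff two_ne_zero] at h3
  refine ⟨u, hu, hA ▸ A.2, ?_, ?_⟩
  · rw [hB]
    exact integer_isUnit_iff.1 h3.1
  · have := integer_isUnit_iff.1 h3.2
    simp only [Subring.coe_add, Subring.coe_mul, AddSubgroupClass.coe_sub, Subring.coe_pow, Subring.coe_zero,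
      coe_ofNat_integersAt] at this
    rw [← hA, ← hB] at this
    rw [← this]
    congr 1
    ring

/-- Possible valuations and congruences of a minimal equation at an even prime of good ordinary
reduction. -/
theorem valuation_of_not_dvd {a b : K} (hmin : IsMinimalAt q a b) {τ : integersAt q}
    (hτ : IsUniformizer τ) (h2 : τ ∣ 2) {W₀ : WeierstrassCurve (integersAt q)}
    {X A B : integersAt q} {u : K} (hu : u ≠ 0) (hM : IsLocalModel W₀ X A B) (hA : a * u ^ 2 = A)
    (hB : b * u ^ 4 = B) (ha : ¬τ ∣ W₀.a₁) :
    (q.valuation K b = q.valuation K 16 ∧ q.valuation K (a ^ 2 - 4 * b) = 1 ∧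
      ((∃ ω, IsUnit ω ∧ 2 = ω * τ) → ∃ α : K, q.valuation K α = 1 ∧
        q.valuation K (a - α ^ 2) ≤ q.valuation K 4)) ∨
    (q.valuation K b = 1 ∧ q.valuation K (a ^ 2 - 4 * b) = q.valuation K 256 ∧
      ∃ α : K, q.valuation K α = 1 ∧ q.valuation K (a + 2 * α ^ 2) ≤ q.valuation K 8) := by
  have hd : q.valuation K ((b * u ^ 4) ^ 2 * ((a * u ^ 2) ^ 2 - 4 * (b * u ^ 4))) =
      q.valuation K (256 * W₀.Δ) := by
    have := congrArg (Subtype.val) hM.discriminant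
    simp only [Subring.coe_add, Subring.coe_mul, AddSubgroupClass.coe_sub, Subring.coe_pow, Subring.coe_zero,
      coe_ofNat_integersAt] at this
    rw [hA, hB, this]
    norm_num
  rw [map_mul _ 256, integer_isUnit_iff.1 hM.isUnit, mul_one] at hd
  have hα : ∀ α : integersAt q, IsUnit α → q.valuation K u = 1 →
      q.valuation K (α * u⁻¹) = 1 := by
    intro α h1 h3
    rw [map_mul, map_inv₀, h3, inv_one, mul_one]
    exact integer_isUnit_iff.1 h1
  have ha₁ := hτ.isUnit _ ha
  have hau : ∀ c α : K, q.valuation K u = 1 → q.valuation K (a - c * (α * u⁻¹) ^ 2) =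
      q.valuation K (a * u ^ 2 - c * α ^ 2) := by
    intro c α h3
    rw [show a * u ^ 2 - c * α ^ 2 = (a - c * (α * u⁻¹) ^ 2) * u ^ 2 by field_simp, map_mul, map_pow,
      h3, one_pow, mul_one]
  by_cases hX : τ ∣ X
  · left
    obtain ⟨h3, h4⟩ := hM.isUnit_of_dvd_X hτ h2 ha hX
    have h5 : q.valuation K u = 1 := by
      refine hmin.valuation_eq_one hu (hA ▸ A.2) (hB ▸ B.2) (.inl ?_)
      rw [hA]
      exact integer_isUnit_iff.1 h3
    have h6 := integer_isUnit_iff.1 h4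
    simp only [Subring.coe_add, Subring.coe_mul, AddSubgroupClass.coe_sub, Subring.coe_pow, Subring.coe_zero,
      coe_ofNat_integersAt] at h6
    rw [← hA, ← hB] at h6
    have h7 : q.valuation K (a ^ 2 - 4 * b) = 1 := by
      rw [show (a * u ^ 2) ^ 2 - 4 * (b * u ^ 4) = (a ^ 2 - 4 * b) * u ^ 4 by ring, map_mul,
        map_pow, h5, one_pow, mul_one] at h6
      exact h6
    refine ⟨?_, h7, ?_⟩
    · rw [map_mul, h6, mul_one, map_pow, map_mul, map_pow, h5, one_pow, mul_one,
        show (256 : K) = 16 ^ 2 by norm_num, map_pow] at hd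
      exact (pow_left_inj₀ zero_le' zero_le' two_ne_zero).1 hd
    · rintro ⟨ω, hω, h8⟩
      have h9 := integer_dvd_iff.1 (hM.four_dvd_sub hτ hω h8 ha hX)
      simp only [Subring.coe_add, Subring.coe_mul, AddSubgroupClass.coe_sub, Subring.coe_pow, Subring.coe_zero,
        coe_ofNat_integersAt] at h9
      refine ⟨_, hα _ ha₁ h5, ?_⟩
      rw [← one_mul ((_ : K) ^ 2), hau _ _ h5, one_mul, hA]
      exact h9
  · right
    obtain ⟨h3, h4⟩ := hM.isUnit_of_not_dvd_X hτ h2 hX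
    have h6 := integer_isUnit_iff.1 h3
    rw [← hB] at h6
    have h5 : q.valuation K u = 1 := hmin.valuation_eq_one hu (hA ▸ A.2) (hB ▸ B.2) (.inr h6)
    refine ⟨?_, ?_, _, hα _ ha₁ h5, ?_⟩
    · rwa [map_mul, map_pow, h5, one_pow, mul_one] at h6
    · rwa [map_mul, map_pow, h6, one_pow, one_mul,
        show (a * u ^ 2) ^ 2 - 4 * (b * u ^ 4) = (a ^ 2 - 4 * b) * u ^ 4 by ring, map_mul,
        map_pow, h5, one_pow, mul_one] at hd
    · have h9 := integer_dvd_iff.1 h4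
      simp only [Subring.coe_add, Subring.coe_mul, AddSubgroupClass.coe_sub, Subring.coe_pow, Subring.coe_zero,
        coe_ofNat_integersAt] at h9
      rw [show a + 2 * ((W₀.a₁ : K) * u⁻¹) ^ 2 = a - (-2) * ((W₀.a₁ : K) * u⁻¹) ^ 2 by ring,
        hau _ _ h5, hA, show (A : K) - (-2) * (W₀.a₁ : K) ^ 2 = A + 2 * (W₀.a₁ : K) ^ 2 by ring]
      exact h9

theorem valuation_of_unramified {a b : K} (h : HasGoodReductionAt (curveAB a b) q)
    (hmin : IsMinimalAt q a b) {τ ω : integersAt q}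
    (hτ : IsUniformizer τ) (hω : IsUnit ω) (h2 : 2 = ω * τ) :
    (q.valuation K b = q.valuation K 16 ∧ q.valuation K (a ^ 2 - 4 * b) = 1 ∧
      ∃ α : K, q.valuation K α = 1 ∧ q.valuation K (a - α ^ 2) ≤ q.valuation K 4) ∨
    (q.valuation K b = 1 ∧ q.valuation K (a ^ 2 - 4 * b) = q.valuation K 256 ∧
      ∃ α : K, q.valuation K α = 1 ∧ q.valuation K (a + 2 * α ^ 2) ≤ q.valuation K 8) := by
  obtain ⟨W₀, X, A, B, u, hu, hM, hA, hB⟩ := exists_isLocalModel h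
  refine (valuation_of_not_dvd hmin hτ ⟨ω, by rw [h2, mul_comm]⟩ hu hM hA hB
    (hM.not_dvd_a₁ hτ hω h2)).imp_left fun ⟨h3, h4, h5⟩ => ⟨h3, h4, h5 ⟨ω, hω, h2⟩⟩

/-- The first two alternatives are ordinary reduction, with the point of order two outside or inside
the kernel of reduction; the third is supersingular reduction. -/
theorem valuation_of_ramified {a b : K} (h : HasGoodReductionAt (curveAB a b) q)
    (hmin : IsMinimalAt q a b) {τ ω : integersAt q}
    (hτ : IsUniformizer τ) (hω : IsUnit ω) (h2 : 2 = ω * τ ^ 2) :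
    (q.valuation K b = q.valuation K 16 ∧ q.valuation K (a ^ 2 - 4 * b) = 1) ∨
    (q.valuation K b = 1 ∧ q.valuation K (a ^ 2 - 4 * b) = q.valuation K 256) ∨
    (q.valuation K b = 1 ∧ q.valuation K (a ^ 2 - 4 * b) = q.valuation K 4 ∧
      ∃ α₁ α₂ α₃ α₄ α₆ x A B : integersAt q, IsRamifiedModel τ ω α₁ α₂ α₃ α₄ α₆ x A B ∧
        a = A ∧ b = B) := by
  obtain ⟨W₀, X, A, B, u, hu, hM, hA, hB⟩ := exists_isLocalModel h
  have hd2 : τ ∣ 2 := ⟨ω * τ, by rw [h2]; ring⟩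
  by_cases ha : τ ∣ W₀.a₁
  · right; right
    obtain ⟨α, x, A', B', rfl, rfl, h3, h4⟩ := hM.exists_isRamifiedModel hτ hω h2 ha
    have hτ0 : (τ : K) ≠ 0 := fun h => hτ.prime.ne_zero (Subtype.ext h)
    -- The minimal equation is the one already divided by τ² and τ⁴, so w, not u, is the unit
    -- scaling.
    set w : K := u * (τ : K)⁻¹ with hw
    have hw0 : w ≠ 0 := mul_ne_zero hu (inv_ne_zero hτ0)
    simp only [Subring.coe_add, Subring.coe_mul, AddSubgroupClass.coe_sub, Subring.coe_pow, Subring.coe_zero,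
      coe_ofNat_integersAt] at hA hB
    have hA' : a * w ^ 2 = A' := by
      rw [hw, mul_pow, ← mul_assoc, hA]
      field_simp
    have hB' : b * w ^ 4 = B' := by
      rw [hw, mul_pow, ← mul_assoc, hB]
      field_simp
    have h5 : q.valuation K w = 1 := by
      refine hmin.valuation_eq_one hw0 (hA' ▸ A'.2) (hB' ▸ B'.2) (.inr ?_)
      rw [hB']
      exact integer_isUnit_iff.1 h3
    have h6 : q.valuation K w⁻¹ = 1 := by rw [map_inv₀, h5, inv_one]
    have h7 := h4.scale (v := ⟨w⁻¹, h6.le⟩) (integer_isUnit_iff.2 h6)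
    have hb1 : q.valuation K b = 1 := by
      have := integer_isUnit_iff.1 h3
      rwa [← hB', map_mul, map_pow, h5, one_pow, mul_one] at this
    refine ⟨hb1, ?_, _, _, _, _, _, _, _, _, h7, ?_, ?_⟩
    · have hd : q.valuation K ((b * u ^ 4) ^ 2 * ((a * u ^ 2) ^ 2 - 4 * (b * u ^ 4))) =
          q.valuation K (256 * W₀.Δ) := by
        have := congrArg (Subtype.val) hM.discriminant
        simp only [Subring.coe_add, Subring.coe_mul, AddSubgroupClass.coe_sub, Subring.coe_pow, Subring.coe_zero,
          coe_ofNat_integersAt] at this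
        rw [hA, hB, this]
        norm_num
      have h8 : q.valuation K 4 = q.valuation K τ ^ 4 := by
        have h9 : (4 : integersAt q) = ω ^ 2 * τ ^ 4 := by
          linear_combination (2 + ω * τ ^ 2) * h2
        have h10 := congrArg (fun z : integersAt q => q.valuation K z) h9
        simp only [Subring.coe_mul, Subring.coe_pow, map_mul, map_pow,
          integer_isUnit_iff.1 hω, one_pow, one_mul] at h10
        exact h10
      have hvτ : q.valuation K τ ≠ 0 := (Valuation.ne_zero_iff _).2 hτ0
      have hu' : u = w * τ := by rw [hw]; field_simp
      -- Count of valuations in b²(a² − 4b)u¹² = 256Δ: the right side has valuation 16 and u has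
      -- valuation 1, so a² − 4b has valuation 4, that of the number 4.
      rw [map_mul _ 256, integer_isUnit_iff.1 hM.isUnit, mul_one,
        show (b * u ^ 4) ^ 2 * ((a * u ^ 2) ^ 2 - 4 * (b * u ^ 4)) =
          b ^ 2 * (a ^ 2 - 4 * b) * u ^ 12 by ring, hu', map_mul, map_mul, map_pow, map_pow, map_mul,
        h5, hb1, one_pow, one_mul, one_mul, show (256 : K) = 4 ^ 4 by norm_num, map_pow, h8,
        show (q.valuation K τ ^ 4) ^ 4 = q.valuation K τ ^ 4 * q.valuation K τ ^ 12 by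
          rw [← pow_mul, ← pow_add]] at hd
      rw [h8]
      exact mul_right_cancel₀ (pow_ne_zero 12 hvτ) hd
    · simp only [Subring.coe_add, Subring.coe_mul, AddSubgroupClass.coe_sub, Subring.coe_pow, Subring.coe_zero,
        coe_ofNat_integersAt]
      rw [← hA']
      field_simp
    · simp only [Subring.coe_add, Subring.coe_mul, AddSubgroupClass.coe_sub, Subring.coe_pow, Subring.coe_zero,
        coe_ofNat_integersAt]
      rw [← hB']
      field_simp
  · rcases valuation_of_not_dvd hmin hτ hd2 hu hM hA hB ha with h3 | h3
    · exact .inl ⟨h3.1, h3.2.1⟩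
    · exact .inr (.inl ⟨h3.1, h3.2.1⟩)

end

/-! ### Arithmetic of imaginary quadratic fields: units and the factorization of 2. -/

theorem not_isSquare_of_lt {n : ℕ} (k : ℕ) (h1 : k ^ 2 < n := by norm_num)
    (h2 : n < (k + 1) ^ 2 := by norm_num) : ¬IsSquare n := by
  rintro ⟨m, rfl⟩
  rw [← sq] at h1 h2
  have h3 := lt_of_pow_lt_pow_left₀ 2 (Nat.zero_le _) h1
  have h4 := lt_of_pow_lt_pow_left₀ 2 (Nat.zero_le _) h2
  omega

/-- `K` is an imaginary quadratic field. -/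
structure IsImaginaryQuadratic (K : Type*) [Field K] [NumberField K] : Prop where
  finrank_eq : Module.finrank ℚ K = 2
  isTotallyComplex : NumberField.IsTotallyComplex K

namespace IsImaginaryQuadratic

variable {K : Type*} [Field K] [NumberField K] (h : IsImaginaryQuadratic K)

include h

theorem exists_eq_add_mul {x : K} (hx : ∀ r : ℚ, x ≠ algebraMap ℚ K r) (y : K) :
    ∃ m n : ℚ, y = algebraMap ℚ K m + algebraMap ℚ K n * x := by
  have hli : LinearIndependent ℚ ![(1 : K), x] := by
    rw [LinearIndependent.pair_iff]
    intro m n hmn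
    rw [Algebra.smul_def, Algebra.smul_def, mul_one] at hmn
    by_cases hn : n = 0
    · subst hn
      simpa using hmn
    · refine absurd ?_ (hx (-m / n))
      have hn' : algebraMap ℚ K n ≠ 0 := by simpa using hn
      rw [map_div₀, map_neg, eq_div_iff hn']
      linear_combination hmn
  have h1 := hli.span_eq_top_of_card_eq_finrank (by simp [h.finrank_eq])
  have h2 : y ∈ Submodule.span ℚ (Set.range ![(1 : K), x]) := h1 ▸ Submodule.mem_top
  rw [Matrix.range_cons, Matrix.range_cons, Matrix.range_empty, Set.union_empty,
    Set.singleton_union, Submodule.mem_span_pair] at h2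
  obtain ⟨m, n, hmn⟩ := h2
  refine ⟨m, n, ?_⟩
  rw [← hmn, Algebra.smul_def, Algebra.smul_def, mul_one]

/-- An element with nonnegative rational square is real in every complex embedding. If irrational it
would generate K and make the embedding real. -/
theorem exists_rat_of_sq_eq {x : K} {r : ℚ} (hr : 0 ≤ r) (hx : x ^ 2 = algebraMap ℚ K r) :
    ∃ m : ℚ, x = algebraMap ℚ K m := by
  by_contra! hx'
  have φ : K →+* ℂ := (IsAlgClosed.lift : K →ₐ[ℚ] ℂ).toRingHom
  have := h.isTotallyComplex
  refine NumberField.IsTotallyComplex.complexEmbedding_not_isReal φ ?_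
  rw [NumberField.ComplexEmbedding.isReal_iff]
  have hφx : φ x ^ 2 = ((Real.sqrt r : ℝ) : ℂ) ^ 2 := by
    rw [← map_pow, hx, ← Complex.ofReal_pow, Real.sq_sqrt (by exact_mod_cast hr), eq_ratCast,
      map_ratCast, Complex.ofReal_ratCast]
  have hcx : (starRingEnd ℂ) (φ x) = φ x := by
    rcases sq_eq_sq_iff_eq_or_eq_neg.1 hφx with h1 | h1 <;> rw [h1] <;> simp
  ext y
  obtain ⟨m, n, rfl⟩ := h.exists_eq_add_mul hx' y
  simp [NumberField.ComplexEmbedding.conjugate_coe_eq, hcx]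

theorem sq_ne_natCast {n : ℕ} (hn : ¬IsSquare n) (x : K) : x ^ 2 ≠ n := by
  intro hx
  obtain ⟨m, rfl⟩ := h.exists_rat_of_sq_eq (r := n) (by positivity) (by rw [hx, map_natCast])
  refine hn (Rat.isSquare_natCast_iff.1 ⟨m, ?_⟩)
  refine (algebraMap ℚ K).injective ?_
  rw [map_natCast, ← hx, map_mul, sq]

theorem sq_ne_natCast_integer {n : ℕ} (hn : ¬IsSquare n) (x : 𝓞 K) : x ^ 2 ≠ n := fun hx =>
  h.sq_ne_natCast hn (x : K) (by exact_mod_cast congrArg (algebraMap (𝓞 K) K) hx)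

theorem sq_eq_trace_mul_sub_norm (x : 𝓞 K) :
    x ^ 2 = Algebra.trace ℤ (𝓞 K) x * x - Algebra.norm ℤ x := by
  have hr : Module.finrank ℤ (𝓞 K) = 2 := (NumberField.RingOfIntegers.rank K).trans h.finrank_eq
  let b := Module.finBasisOfFinrankEq ℤ (𝓞 K) hr
  apply Algebra.leftMulMatrix_injective b
  rw [Algebra.trace_eq_matrix_trace b, Algebra.norm_eq_matrix_det b, map_sub, map_mul, map_pow,
    map_intCast, map_intCast]
  generalize Algebra.leftMulMatrix b x = M
  rw [Matrix.trace_fin_two, Matrix.det_fin_two]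
  ext i j
  fin_cases i <;> fin_cases j <;>
    simp [sq, Matrix.mul_apply, Fin.sum_univ_two, Matrix.intCast_apply] <;> ring

theorem exists_int_of_rat {x : 𝓞 K} {r : ℚ} (hx : (x : K) = algebraMap ℚ K r) :
    ∃ k : ℤ, x = k := by
  have h1 : IsIntegral ℤ r := by
    rw [← isIntegral_algebraMap_iff (algebraMap ℚ K).injective, ← hx]
    exact x.isIntegral_coe
  obtain ⟨k, hk⟩ := IsIntegrallyClosed.isIntegral_iff.1 h1
  refine ⟨k, NumberField.RingOfIntegers.ext ?_⟩
  rw [hx, ← hk]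
  simp

theorem trace_intCast (k : ℤ) : Algebra.trace ℤ (𝓞 K) (k : 𝓞 K) = 2 * k := by
  have := Algebra.trace_algebraMap (S := 𝓞 K) k
  rwa [NumberField.RingOfIntegers.rank, h.finrank_eq, nsmul_eq_mul, eq_intCast] at this

theorem norm_intCast (k : ℤ) : Algebra.norm ℤ (k : 𝓞 K) = k ^ 2 := by
  have := Algebra.norm_algebraMap (S := 𝓞 K) k
  rwa [NumberField.RingOfIntegers.rank, h.finrank_eq, eq_intCast] at this

/-- (2x − t)² = t² − 4n is rational, and by `exists_rat_of_sq_eq` it is negative unless x is a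
rational integer. -/
theorem trace_sq_le (x : 𝓞 K) : Algebra.trace ℤ (𝓞 K) x ^ 2 ≤ 4 * Algebra.norm ℤ x ∧
    (Algebra.trace ℤ (𝓞 K) x ^ 2 = 4 * Algebra.norm ℤ x → ∃ k : ℤ, x = k) := by
  have hx := h.sq_eq_trace_mul_sub_norm x
  set t := Algebra.trace ℤ (𝓞 K) x with ht
  set n := Algebra.norm ℤ x with hn
  have key : 4 * n ≤ t ^ 2 → ∃ k : ℤ, x = k := by
    intro hle
    have h1 : ((2 * x - t : 𝓞 K) : K) ^ 2 = algebraMap ℚ K ((t : ℚ) ^ 2 - 4 * n) := by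
      have h2 := congrArg (algebraMap (𝓞 K) K) hx
      simp only [map_pow, map_mul, map_sub, map_intCast, map_ofNat] at h2 ⊢
      linear_combination 4 * h2
    obtain ⟨m, hm⟩ := h.exists_rat_of_sq_eq (by exact_mod_cast (by linarith : (0:ℤ) ≤ t ^ 2 - 4 * n)) h1
    refine h.exists_int_of_rat (r := (m + t) / 2) ?_
    rw [map_div₀, map_add, ← hm]
    simp [map_ofNat (algebraMap (𝓞 K) K)]
  refine ⟨?_, fun h1 => key h1.ge⟩
  by_contra! h1
  obtain ⟨k, hk⟩ := key h1.le
  rw [ht, hn, hk, h.trace_intCast, h.norm_intCast] at h1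
  linarith

theorem norm_nonneg (x : 𝓞 K) : 0 ≤ Algebra.norm ℤ x := by
  nlinarith [(h.trace_sq_le x).1, sq_nonneg (Algebra.trace ℤ (𝓞 K) x)]

theorem norm_add_intCast (x : 𝓞 K) (m : ℤ) : Algebra.norm ℤ (x + m) =
    Algebra.norm ℤ x + m * Algebra.trace ℤ (𝓞 K) x + m ^ 2 := by
  have h1 := h.sq_eq_trace_mul_sub_norm x
  have h2 := h.sq_eq_trace_mul_sub_norm (x + m)
  rw [map_add, h.trace_intCast] at h2
  have h3 : ((Algebra.norm ℤ (x + m) : ℤ) : 𝓞 K) =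
      ((Algebra.norm ℤ x + m * Algebra.trace ℤ (𝓞 K) x + m ^ 2 : ℤ) : 𝓞 K) := by
    push_cast at h2 ⊢
    linear_combination h2 - h1
  exact_mod_cast h3

theorem isUnit_iff_norm {x : 𝓞 K} : IsUnit x ↔ Algebra.norm ℤ x = 1 := by
  constructor
  · intro hx
    have h1 := hx.map (Algebra.norm ℤ)
    have h2 := h.norm_nonneg x
    rcases Int.isUnit_iff.1 h1 with h3 | h3
    · exact h3
    · rw [h3] at h2
      norm_num at h2
  · intro hx
    refine IsUnit.of_mul_eq_one ((Algebra.trace ℤ (𝓞 K) x : 𝓞 K) - x) ?_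
    have h1 := h.sq_eq_trace_mul_sub_norm x
    rw [hx] at h1
    push_cast at h1
    linear_combination -h1

/-- A unit has norm 1 and trace t with |t| ≤ 2; the five values of t give the five cases. -/
theorem sq_eq_of_isUnit {x : 𝓞 K} (hx : IsUnit x) :
    x = 1 ∨ x = -1 ∨ x ^ 2 = -1 ∨ x ^ 2 = x - 1 ∨ x ^ 2 = -x - 1 := by
  have h1 := h.sq_eq_trace_mul_sub_norm x
  have h2 := (h.trace_sq_le x).1
  rw [h.isUnit_iff_norm.1 hx] at h1 h2
  obtain ⟨h3, h4⟩ := abs_le_of_sq_le_sq' (h2.trans (by norm_num : (4 * 1 : ℤ) ≤ 2 ^ 2)) (by norm_num)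
  generalize Algebra.trace ℤ (𝓞 K) x = t at h1 h3 h4
  interval_cases t <;> push_cast at h1
  · right; left
    exact eq_neg_of_add_eq_zero_left (pow_eq_zero_iff two_ne_zero |>.1
      (by linear_combination h1 : (x + 1) ^ 2 = 0))
  · right; right; right; right
    linear_combination h1
  · right; right; left
    linear_combination h1
  · right; right; right; left
    linear_combination h1
  · left
    exact sub_eq_zero.1 (pow_eq_zero_iff two_ne_zero |>.1
      (by linear_combination h1 : (x - 1) ^ 2 = 0))

/-- Without i the units are ±1 and roots of unity of order 3 or 6, all of them squares up to sign.
-/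
theorem exists_sq_of_isUnit (hi : ∀ x : 𝓞 K, x ^ 2 ≠ -1) {x : 𝓞 K} (hx : IsUnit x) :
    ∃ y, IsUnit y ∧ (x = y ^ 2 ∨ x = -y ^ 2) := by
  rcases h.sq_eq_of_isUnit hx with h1 | h1 | h1 | h1 | h1
  · exact ⟨1, isUnit_one, .inl (by rw [h1, one_pow])⟩
  · exact ⟨1, isUnit_one, .inr (by rw [h1, one_pow])⟩
  · exact absurd h1 (hi x)
  · exact ⟨x ^ 2, hx.pow 2, .inr (by linear_combination (x ^ 2 + x) * h1)⟩
  · exact ⟨x ^ 2, hx.pow 2, .inl (by linear_combination (-x ^ 2 + x) * h1)⟩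

/-- A root of unity of order 3 or 6 next to s would give the square root s(2x ± 1) of 3. -/
theorem eq_of_isUnit_of_sq_eq_neg_one {s : 𝓞 K} (hs : s ^ 2 = -1) {x : 𝓞 K} (hx : IsUnit x) :
    x = 1 ∨ x = -1 ∨ x = s ∨ x = -s := by
  rcases h.sq_eq_of_isUnit hx with h1 | h1 | h1 | h1 | h1
  · exact .inl h1
  · exact .inr (.inl h1)
  · rw [← hs] at h1
    exact .inr (.inr (sq_eq_sq_iff_eq_or_eq_neg.1 h1))
  · exact absurd (by push_cast; linear_combination (-4 : 𝓞 K) * h1 + (2 * x - 1) ^ 2 * hs)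
      (h.sq_ne_natCast_integer (n := 3) (not_isSquare_of_lt 1) (s * (2 * x - 1)))
  · exact absurd (by push_cast; linear_combination (-4 : 𝓞 K) * h1 + (2 * x + 1) ^ 2 * hs)
      (h.sq_ne_natCast_integer (n := 3) (not_isSquare_of_lt 1) (s * (2 * x + 1)))

/-- Further roots of unity would produce a square root of 2 or of 6. -/
theorem eq_of_isUnit_of_sq_eq_neg_two {s : 𝓞 K} (hs : s ^ 2 = -2) {x : 𝓞 K} (hx : IsUnit x) :
    x = 1 ∨ x = -1 := by
  rcases h.sq_eq_of_isUnit hx with h1 | h1 | h1 | h1 | h1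
  · exact .inl h1
  · exact .inr h1
  · exact absurd (by push_cast; linear_combination (-2 : 𝓞 K) * h1 + x ^ 2 * hs)
      (h.sq_ne_natCast_integer (n := 2) (not_isSquare_of_lt 1) (s * x))
  · exact absurd (by push_cast; linear_combination (-8 : 𝓞 K) * h1 + (2 * x - 1) ^ 2 * hs)
      (h.sq_ne_natCast_integer (n := 6) (not_isSquare_of_lt 2) (s * (2 * x - 1)))
  · exact absurd (by push_cast; linear_combination (-8 : 𝓞 K) * h1 + (2 * x + 1) ^ 2 * hs)
      (h.sq_ne_natCast_integer (n := 6) (not_isSquare_of_lt 2) (s * (2 * x + 1)))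

theorem irreducible_of_norm {x : 𝓞 K} (hx : Algebra.norm ℤ x = 2) : Irreducible x := by
  refine ⟨fun h1 => ?_, fun a b hab => ?_⟩
  · rw [h.isUnit_iff_norm.1 h1] at hx
    norm_num at hx
  · rw [h.isUnit_iff_norm, h.isUnit_iff_norm]
    rw [hab, map_mul] at hx
    have ha := h.norm_nonneg a
    have hb := h.norm_nonneg b
    have ha2 : Algebra.norm ℤ a ≤ 2 := by
      refine Int.le_of_dvd (by norm_num) ⟨_, hx.symm⟩
    generalize Algebra.norm ℤ a = m at *
    generalize Algebra.norm ℤ b = n at *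
    interval_cases m <;> omega

/-- The factorization of `2`. -/
theorem factorization_two [IsPrincipalIdealRing (𝓞 K)] : Prime (2 : 𝓞 K) ∨
    (∃ τ ω : 𝓞 K, Prime τ ∧ IsUnit ω ∧ 2 = ω * τ ^ 2 ∧ Algebra.norm ℤ τ = 2) ∨
    ∃ τ σ : 𝓞 K, Prime τ ∧ Prime σ ∧ 2 = τ * σ ∧ ¬τ ∣ σ ∧ ¬σ ∣ τ ∧
      Algebra.norm ℤ τ = 2 ∧ Algebra.norm ℤ σ = 2 := by
  have h2 : Algebra.norm ℤ (2 : 𝓞 K) = 4 := by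
    have := h.norm_intCast 2
    exact_mod_cast this
  have hu : ¬IsUnit (2 : 𝓞 K) := by
    rw [h.isUnit_iff_norm, h2]
    norm_num
  obtain ⟨τ, hτ, σ, hσ⟩ := WfDvdMonoid.exists_irreducible_factor hu two_ne_zero
  have hN : Algebra.norm ℤ τ * Algebra.norm ℤ σ = 4 := by rw [← map_mul, ← hσ, h2]
  have hτ1 : Algebra.norm ℤ τ ≠ 1 := fun h1 => hτ.not_isUnit (h.isUnit_iff_norm.2 h1)
  by_cases hσ1 : IsUnit σ
  · left
    rw [hσ]
    exact ((irreducible_mul_isUnit hσ1).2 hτ).prime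
  · right
    have hσ2 : Algebra.norm ℤ σ ≠ 1 := fun h1 => hσ1 (h.isUnit_iff_norm.2 h1)
    have hτN : Algebra.norm ℤ τ = 2 ∧ Algebra.norm ℤ σ = 2 := by
      have ha := h.norm_nonneg τ
      have ha2 : Algebra.norm ℤ τ ≤ 4 := Int.le_of_dvd (by norm_num) ⟨_, hN.symm⟩
      generalize Algebra.norm ℤ τ = m at *
      generalize Algebra.norm ℤ σ = n at *
      interval_cases m <;> omega
    have hσp := h.irreducible_of_norm hτN.2
    by_cases hd : τ ∣ σ
    · left
      obtain ⟨ω, hω⟩ := hd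
      refine ⟨τ, ω, hτ.prime, (hσp.isUnit_or_isUnit hω).resolve_left hτ.not_isUnit, ?_, hτN.1⟩
      rw [hσ, hω]
      ring
    · right
      exact ⟨τ, σ, hτ.prime, hσp.prime, hσ, hd,
        fun h1 => hd ((hσp.dvd_comm hτ).1 h1), hτN⟩

/-- The imaginary quadratic fields where `2` is the square of a principal prime. -/
theorem sq_eq_of_ramified {τ ω : 𝓞 K} (hω : IsUnit ω) (h2 : 2 = ω * τ ^ 2)
    (hτ : Algebra.norm ℤ τ = 2) : ∃ s : 𝓞 K, s ^ 2 = -1 ∨ s ^ 2 = -2 := by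
  have h1 := h.sq_eq_trace_mul_sub_norm τ
  have h3 := (h.trace_sq_le τ).1
  rw [hτ] at h1 h3
  obtain ⟨h4, h5⟩ := abs_le_of_sq_le_sq' (h3.trans (by norm_num : (4 * 2 : ℤ) ≤ 3 ^ 2)) (by norm_num)
  -- τ² = tτ − 2 with |t| ≤ 2. As τ divides t it is not ±1; the value t = 0 gives τ² = −2, and t =
  -- ±2 gives (τ ∓ 1)² = −1.
  have hτu : ¬IsUnit τ := (h.irreducible_of_norm hτ).not_isUnit
  have hτ0 : τ ≠ 0 := (h.irreducible_of_norm hτ).ne_zero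
  generalize Algebra.trace ℤ (𝓞 K) τ = t at h1 h3 h4 h5
  have h6 : (t : 𝓞 K) = τ * (1 + ω) := by
    refine mul_left_cancel₀ hτ0 ?_
    push_cast at h1
    linear_combination h2 - h1
  have h7 : t ^ 2 ≠ 1 := by
    intro h7
    have : (t : 𝓞 K) ^ 2 = 1 := by exact_mod_cast h7
    exact hτu (isUnit_of_dvd_one ⟨(1 + ω) * t, by linear_combination t * h6 - this⟩)
  have h8 : t = -2 ∨ t = 0 ∨ t = 2 := by
    clear h1 h6
    interval_cases t <;> omega
  rcases h8 with rfl | rfl | rfl <;> push_cast at h1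
  · exact ⟨τ + 1, .inl (by linear_combination h1)⟩
  · exact ⟨τ, .inr (by linear_combination h1)⟩
  · exact ⟨τ - 1, .inl (by linear_combination h1)⟩

end IsImaginaryQuadratic

/-! ### Normal forms, quadratic twists and globally minimal equations. -/

theorem HasPointOfOrderTwo.exists_isIsomorphic {F : Type*} [Field F] [CharZero F]
    {W : WeierstrassCurve F} (h : HasPointOfOrderTwo W) :
    ∃ a b : F, IsIsomorphic W (curveAB a b) := by
  obtain ⟨P, hP⟩ := h
  rcases P with _ | ⟨x, y, hxy⟩
  · change addOrderOf (0 : W.toAffine.Point) = 2 at hP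
    simp at hP
  have h2 : 2 • WeierstrassCurve.Affine.Point.some x y hxy = 0 := by
    rw [← hP]
    exact addOrderOf_nsmul_eq_zero _
  rw [two_nsmul, ← eq_neg_iff_add_eq_zero, WeierstrassCurve.Affine.Point.neg_some,
    WeierstrassCurve.Affine.Point.some.injEq, WeierstrassCurve.Affine.negY] at h2
  have hy := h2.2
  have he := (WeierstrassCurve.Affine.equation_iff' x y).1 hxy.1
  refine ⟨((⟨1, x, -W.a₁ / 2, y⟩ : WeierstrassCurve.VariableChange F) • W).a₂,
    ((⟨1, x, -W.a₁ / 2, y⟩ : WeierstrassCurve.VariableChange F) • W).a₄,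
    ⟨1, x, -W.a₁ / 2, y⟩, ?_⟩
  rw [WeierstrassCurve.variableChange_def]
  ext
  · simp [curveAB]; ring
  · simp [curveAB]
  · simp [curveAB]; linear_combination hy
  · simp [curveAB]
  · simp [curveAB]; linear_combination -he

theorem quadraticTwist_curveAB {F : Type*} [Field F] [CharZero F] (a b d : F) :
    quadraticTwist (curveAB a b) d = curveAB (d * a) (d ^ 2 * b) := by
  ext <;> simp [quadraticTwist, curveAB, WeierstrassCurve.b₂, WeierstrassCurve.b₄,
    WeierstrassCurve.b₆] <;> ring

theorem IsIsomorphic.quadraticTwist {F : Type*} [Field F] [CharZero F] {W W' : WeierstrassCurve F}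
    (h : IsIsomorphic W W') (d : F) :
    IsIsomorphic (quadraticTwist W d) (quadraticTwist W' d) := by
  obtain ⟨C, rfl⟩ := h
  refine ⟨⟨C.u, d * C.r, 0, 0⟩, ?_⟩
  rw [WeierstrassCurve.variableChange_def]
  simp only [GoodTwist.quadraticTwist, WeierstrassCurve.variableChange_b₂,
    WeierstrassCurve.variableChange_b₄, WeierstrassCurve.variableChange_b₆]
  ext <;> simp <;> ring

section

variable {K : Type*} [Field K] [NumberField K]

theorem exists_prime_span [IsPrincipalIdealRing (𝓞 K)] (q : HeightOneSpectrum (𝓞 K)) :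
    ∃ t : 𝓞 K, Prime t ∧ q.asIdeal = Ideal.span {t} := by
  obtain ⟨t, ht⟩ := (IsPrincipalIdealRing.principal q.asIdeal).principal
  have ht' : q.asIdeal = Ideal.span {t} := ht
  have h0 : t ≠ 0 := by
    rintro rfl
    exact q.ne_bot (by rw [ht']; simp)
  refine ⟨t, ?_, ht'⟩
  rw [← Ideal.span_singleton_prime h0, ← ht']
  exact q.isPrime

/-- The height one prime generated by a prime element. -/
def primeSpan {t : 𝓞 K} (ht : Prime t) : HeightOneSpectrum (𝓞 K) where
  asIdeal := Ideal.span {t}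
  isPrime := (Ideal.span_singleton_prime ht.ne_zero).2 ht
  ne_bot := by simpa using ht.ne_zero

theorem valuation_span {q : HeightOneSpectrum (𝓞 K)} {t : 𝓞 K} (ht : q.asIdeal = Ideal.span {t}) :
    q.valuation K t = WithZero.exp (-1 : ℤ) := by
  rw [HeightOneSpectrum.valuation_of_algebraMap]
  refine q.intValuation_singleton ?_ ht
  rintro rfl
  exact q.ne_bot (by rw [ht]; simp)

theorem valuation_le_span_pow_iff {q : HeightOneSpectrum (𝓞 K)} {t : 𝓞 K}
    (ht : q.asIdeal = Ideal.span {t}) (x : 𝓞 K) (n : ℕ) :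
    q.valuation K x ≤ q.valuation K t ^ n ↔ t ^ n ∣ x := by
  rw [valuation_span ht, ← WithZero.exp_nsmul, HeightOneSpectrum.valuation_of_algebraMap, smul_neg,
    nsmul_eq_mul, mul_one, q.intValuation_le_pow_iff_mem, ht, Ideal.span_singleton_pow,
    Ideal.mem_span_singleton]

theorem valuation_le_span_of_lt_one {q : HeightOneSpectrum (𝓞 K)} {t : 𝓞 K}
    (ht : q.asIdeal = Ideal.span {t}) {x : K} (hx : q.valuation K x < 1) :
    q.valuation K x ≤ q.valuation K t := by
  have h1 := isUniformizer_of_span ht (τ := ⟨t, q.valuation_le_one t⟩) rfl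
  by_contra! h2
  have h3 := h1.isUnit ⟨x, hx.le⟩ (fun h => (integer_dvd_iff.1 h).not_gt h2)
  exact hx.ne (integer_isUnit_iff.1 h3)

theorem exists_unit_of_valuation {x : K} (hx0 : x ≠ 0)
    (hx : ∀ q : HeightOneSpectrum (𝓞 K), q.valuation K x = 1) :
    ∃ ε : 𝓞 K, IsUnit ε ∧ (ε : K) = x := by
  obtain ⟨ε, hε⟩ := HeightOneSpectrum.mem_integers_of_valuation_le_one K x fun q => (hx q).le
  obtain ⟨η, hη⟩ := HeightOneSpectrum.mem_integers_of_valuation_le_one K x⁻¹ fun q => by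
    rw [map_inv₀, hx, inv_one]
  refine ⟨ε, IsUnit.of_mul_eq_one η (NumberField.RingOfIntegers.ext ?_), hε⟩
  change algebraMap (𝓞 K) K (ε * η) = algebraMap (𝓞 K) K 1
  rw [map_mul, hε, hη, map_one, mul_inv_cancel₀ hx0]

theorem dvd_of_valuation_le {x y : 𝓞 K} (hy : y ≠ 0)
    (h : ∀ q : HeightOneSpectrum (𝓞 K), q.valuation K x ≤ q.valuation K y) : y ∣ x := by
  have hy0 : (y : K) ≠ 0 := by simpa using hy
  obtain ⟨z, hz⟩ := HeightOneSpectrum.mem_integers_of_valuation_le_one K ((x : K) / y) fun q => by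
    rw [map_div₀]
    exact div_le_one_of_le₀ (h q) zero_le'
  refine ⟨z, NumberField.RingOfIntegers.ext ?_⟩
  change algebraMap (𝓞 K) K x = algebraMap (𝓞 K) K (y * z)
  rw [map_mul, hz]
  exact (mul_div_cancel₀ _ hy0).symm

theorem isIsomorphic_curveAB_scale {F : Type*} [Field F] {a b u : F} (hu : u ≠ 0) :
    IsIsomorphic (curveAB (u ^ 2 * a) (u ^ 4 * b)) (curveAB a b) :=
  isIsomorphic_curveAB hu rfl rfl (r := 0) (by simp [curveAB]) (by simp [curveAB])
    (by simp [curveAB])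

/-- A pair (a', b') with |N(b')| smallest is minimal everywhere: primes are principal, so a failure
at one prime can be corrected by a global scaling. -/
theorem exists_isMinimalAt (hK : IsImaginaryQuadratic K) [IsPrincipalIdealRing (𝓞 K)] {W : WeierstrassCurve K} {a b : K}
    (hb : b ≠ 0) (hW : IsIsomorphic W (curveAB a b)) :
    ∃ a' b' : 𝓞 K, (a = 0 → a' = 0) ∧ b' ≠ 0 ∧ IsIsomorphic W (curveAB (a' : K) (b' : K)) ∧
      ∀ q, IsMinimalAt q (a' : K) (b' : K) := by
  let S : Set ℕ := {n | ∃ a' b' : 𝓞 K, (a = 0 → a' = 0) ∧ b' ≠ 0 ∧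
    IsIsomorphic W (curveAB (a' : K) (b' : K)) ∧ (Algebra.norm ℤ b').natAbs = n}
  have hS : S.Nonempty := by
    obtain ⟨x, y, hy, hxy⟩ := IsFractionRing.div_surjective (A := 𝓞 K) a
    obtain ⟨z, w, hw, hzw⟩ := IsFractionRing.div_surjective (A := 𝓞 K) b
    have hy0 : algebraMap (𝓞 K) K y ≠ 0 := by simpa using nonZeroDivisors.ne_zero hy
    have hw0 : algebraMap (𝓞 K) K w ≠ 0 := by simpa using nonZeroDivisors.ne_zero hw
    refine ⟨_, x * y * w ^ 2, y ^ 4 * z * w ^ 3, ?_, ?_, ?_, rfl⟩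
    · intro ha
      rw [ha, div_eq_zero_iff, or_iff_left hy0] at hxy
      have : x = 0 := by simpa using hxy
      rw [this, zero_mul, zero_mul]
    · have hz0 : z ≠ 0 := by
        rintro rfl
        exact hb (by rw [← hzw, map_zero, zero_div])
      exact mul_ne_zero (mul_ne_zero (pow_ne_zero 4 (nonZeroDivisors.ne_zero hy)) hz0)
        (pow_ne_zero 3 (nonZeroDivisors.ne_zero hw))
    · have h1 := isIsomorphic_curveAB_scale (a := a) (b := b) (mul_ne_zero hy0 hw0)
      have h2 := hW.trans h1.symm
      convert h2 using 2
      · simp only [map_mul, map_pow, ← hxy]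
        field_simp
      · simp only [map_mul, map_pow, ← hzw]
        field_simp
  obtain ⟨a', b', ha, hb', hE, hn⟩ := Nat.sInf_mem hS
  refine ⟨a', b', ha, hb', hE, fun q => ⟨q.valuation_le_one _, q.valuation_le_one _, ?_⟩⟩
  intro t ht h2 h4
  obtain ⟨π, hπ, hq⟩ := exists_prime_span q
  have h3 := valuation_le_span_of_lt_one hq ht
  obtain ⟨x, rfl⟩ := (valuation_le_span_pow_iff hq a' 2).1 (h2.trans (pow_le_pow_left₀ zero_le' h3 2))
  obtain ⟨y, rfl⟩ := (valuation_le_span_pow_iff hq b' 4).1 (h4.trans (pow_le_pow_left₀ zero_le' h3 4))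
  have hπ0 : (π : K) ≠ 0 := by simpa using hπ.ne_zero
  have hy : y ≠ 0 := right_ne_zero_of_mul hb'
  -- Replacing (π²x, π⁴y) by (x, y) divides the norm of the last coefficient by N(π)⁴ ≥ 16.
  have h5 : (Algebra.norm ℤ y).natAbs ∈ S := by
    refine ⟨x, y, fun h => (mul_eq_zero.1 (ha h)).resolve_left (pow_ne_zero 2 hπ.ne_zero), hy,
      hE.trans ?_, rfl⟩
    simp only [map_mul, map_pow]
    exact isIsomorphic_curveAB_scale hπ0
  have h6 := Nat.sInf_le h5
  rw [← hn, map_mul, map_pow, Int.natAbs_mul, Int.natAbs_pow] at h6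
  have h7 : (Algebra.norm ℤ y).natAbs ≠ 0 := by
    rw [Int.natAbs_ne_zero, Algebra.norm_ne_zero_iff]
    exact hy
  have h8 : (Algebra.norm ℤ π).natAbs ≠ 1 := by
    intro h
    have := hK.norm_nonneg π
    exact hπ.not_isUnit (hK.isUnit_iff_norm.2 (by omega))
  have h9 : (Algebra.norm ℤ π).natAbs ≠ 0 := by
    rw [Int.natAbs_ne_zero, Algebra.norm_ne_zero_iff]
    exact hπ.ne_zero
  have h10 : 2 ^ 4 ≤ (Algebra.norm ℤ π).natAbs ^ 4 := Nat.pow_le_pow_left (by omega) 4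
  nlinarith [Nat.pos_of_ne_zero h7]

/-- The equation at the prime where a quadratic twist has good reduction. -/
theorem exists_of_quadraticTwist {p : HeightOneSpectrum (𝓞 K)} (h2 : (2 : 𝓞 K) ∉ p.asIdeal)
    {π : 𝓞 K} (hπ : p.asIdeal = Ideal.span {π}) {a b : 𝓞 K} (hmin : IsMinimalAt p (a : K) (b : K))
    {d : K} (hd : d ≠ 0) (hgood : HasGoodReductionAt (curveAB (d * a) (d ^ 2 * b)) p) :
    ∃ δ a' b' : 𝓞 K, (δ = 1 ∨ δ = π) ∧ a = δ * a' ∧ b = δ ^ 2 * b' ∧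
      p.valuation K b' = 1 ∧ p.valuation K (a' ^ 2 - 4 * b' : 𝓞 K) = 1 := by
  have hv2 : p.valuation K (2 : K) = 1 := by
    have := HeightOneSpectrum.valuation_eq_one_iff_notMem (K := K) p |>.2 h2
    rwa [map_ofNat] at this
  obtain ⟨u, hu, hA, hB, hC⟩ := valuation_eq_one_of_odd hgood hv2
  have hw0 : d * u ^ 2 ≠ 0 := mul_ne_zero hd (pow_ne_zero 2 hu)
  rw [show d * (a : K) * u ^ 2 = a * (d * u ^ 2) by ring] at hA
  rw [show d ^ 2 * (b : K) * u ^ 4 = b * (d * u ^ 2) ^ 2 by ring] at hB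
  rw [show ((d * (a : K)) ^ 2 - 4 * (d ^ 2 * (b : K))) * u ^ 4 =
    ((a ^ 2 - 4 * b : 𝓞 K) : K) * (d * u ^ 2) ^ 2 by
      simp only [map_sub, map_mul, map_pow, map_ofNat (algebraMap (𝓞 K) K)]; ring] at hC
  generalize d * u ^ 2 = w at hw0 hA hB hC
  have hscale : ∀ (c : K) (n : ℕ), p.valuation K (c * w ^ n) ≤ 1 →
      p.valuation K c ≤ p.valuation K w⁻¹ ^ n := by
    intro c n hc
    rw [show c = c * w ^ n * w⁻¹ ^ n by
      rw [mul_assoc, ← mul_pow, mul_inv_cancel₀ hw0, one_pow, mul_one], map_mul, map_pow]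
    exact mul_le_of_le_one_left' hc
  have hvw0 : p.valuation K w ≠ 0 := (Valuation.ne_zero_iff _).2 hw0
  -- With w = du²: positive order contradicts integrality of b, order zero gives δ = 1, and for
  -- negative order minimality allows only −1, which gives δ = π.
  rcases lt_trichotomy (p.valuation K w) 1 with h1 | h1 | h1
  · exfalso
    rw [map_mul, map_pow] at hB
    exact (mul_lt_one_of_nonneg_of_lt_one_right hmin.b_le zero_le'
      (pow_lt_one₀ zero_le' h1 two_ne_zero)).ne hB
  · refine ⟨1, a, b, .inl rfl, by ring, by ring, ?_, ?_⟩
    · rwa [map_mul, map_pow, h1, one_pow, mul_one] at hB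
    · rwa [map_mul, map_pow, h1, one_pow, mul_one] at hC
  · have h3 : p.valuation K w⁻¹ < 1 := by
      rw [map_inv₀]
      exact inv_lt_one_of_one_lt₀ h1
    have h4 := valuation_le_span_of_lt_one hπ h3
    have hπ0 : p.valuation K π ≠ 0 := by
      rw [valuation_span hπ]
      exact WithZero.exp_ne_zero
    have h5 : p.valuation K (w⁻¹ / π) = 1 := by
      by_contra h5
      have h6 : p.valuation K (w⁻¹ / π) < 1 := by
        refine lt_of_le_of_ne ?_ h5
        rw [map_div₀]
        exact div_le_one_of_le₀ h4 zero_le'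
      have h7 := valuation_le_span_of_lt_one hπ h6
      have h8 : p.valuation K w⁻¹ ≤ p.valuation K π ^ 2 := by
        rw [map_div₀, div_le_iff₀ (zero_lt_iff.2 hπ0)] at h7
        rwa [sq]
      refine hmin.minimal π ?_ ?_ ?_
      · rw [valuation_span hπ, ← WithZero.exp_zero, WithZero.exp_lt_exp]
        norm_num
      · refine (hscale a 1 (by rwa [pow_one])).trans ?_
        rwa [pow_one]
      · refine (hscale b 2 hB.le).trans ((pow_le_pow_left₀ zero_le' h8 2).trans_eq ?_)
        rw [← pow_mul]
    have h9 : p.valuation K w⁻¹ = p.valuation K π := by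
      rw [map_div₀] at h5
      exact (div_eq_one_iff_eq hπ0).1 h5
    have h10 : p.valuation K (w * π) = 1 := by
      rw [map_mul, ← h9, ← map_mul, mul_inv_cancel₀ hw0, map_one]
    obtain ⟨a', rfl⟩ : π ^ 1 ∣ a := (valuation_le_span_pow_iff hπ a 1).1
      (h9 ▸ hscale a 1 (by rwa [pow_one]))
    obtain ⟨b', rfl⟩ : π ^ 2 ∣ b := (valuation_le_span_pow_iff hπ b 2).1
      (h9 ▸ hscale b 2 hB.le)
    refine ⟨π, a', b', .inr rfl, by rw [pow_one], rfl, ?_, ?_⟩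
    · rw [show ((π ^ 2 * b' : 𝓞 K) : K) * w ^ 2 = b' * (w * π) ^ 2 by
        simp only [map_mul, map_pow]; ring, map_mul, map_pow, h10, one_pow, mul_one] at hB
      exact hB
    · rw [show (π ^ 1 * a') ^ 2 - 4 * (π ^ 2 * b') = π ^ 2 * (a' ^ 2 - 4 * b') by ring,
        show ((π ^ 2 * (a' ^ 2 - 4 * b') : 𝓞 K) : K) * w ^ 2 =
        ((a' ^ 2 - 4 * b' : 𝓞 K) : K) * (w * π) ^ 2 by
          simp only [map_mul, map_pow, map_sub, map_ofNat (algebraMap (𝓞 K) K)]; ring, map_mul,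
        map_pow, h10, one_pow, mul_one] at hC
      exact hC

end

/-! ### Unit equations. -/

theorem exists_of_mul_eq_prime_pow {R : Type*} [CommRing R] [IsDomain R] {π x y u : R}
    (hπ : Prime π) (hu : IsUnit u) (h : x * y = u * π ^ 6) (h1 : π ∣ y - x) (h2 : ¬π ^ 2 ∣ y - x) :
    ∃ u₁ u₂, IsUnit u₁ ∧ IsUnit u₂ ∧ u₁ * u₂ = u ∧
      (x = π * u₁ ∧ y = π ^ 5 * u₂ ∨ x = π ^ 5 * u₁ ∧ y = π * u₂) := by
  have hx : π ∣ x := by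
    rcases hπ.dvd_or_dvd (h ▸ Dvd.intro_left _ (by rw [pow_succ, ← mul_assoc]) : π ∣ x * y) with h3 | h3
    · exact h3
    · exact (dvd_sub_right h3).1 h1
  have hy : π ∣ y := (dvd_sub_left hx).1 h1
  obtain ⟨x, rfl⟩ := hx
  obtain ⟨y, rfl⟩ := hy
  -- After removing one π from each factor, at most one of them is still divisible by π, because the
  -- original difference is not divisible by π²; that factor takes all of π⁴.
  have h3 : x * y = u * π ^ 4 := by
    refine mul_left_cancel₀ (pow_ne_zero 2 hπ.ne_zero) ?_
    linear_combination h
  have key : ∀ x y : R, x * y = u * π ^ 4 → ¬π ∣ x →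
      ∃ z, y = π ^ 4 * z ∧ x * z = u := by
    intro x y h4 h5
    obtain ⟨z, rfl⟩ := hπ.pow_dvd_of_dvd_mul_left 4 h5 (h4.symm ▸ dvd_mul_left (π ^ 4) u)
    refine ⟨z, rfl, mul_left_cancel₀ (pow_ne_zero 4 hπ.ne_zero) ?_⟩
    linear_combination h4
  by_cases h4 : π ∣ x
  · have h5 : ¬π ∣ y := by
      intro h5
      refine h2 ?_
      rw [sq, ← mul_sub]
      exact mul_dvd_mul_left _ (dvd_sub h5 h4)
    obtain ⟨z, rfl, hz⟩ := key y x (by rw [mul_comm, h3]) h5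
    rw [mul_comm] at hz
    have hz' := hz ▸ hu
    exact ⟨z, y, isUnit_of_mul_isUnit_left hz', isUnit_of_mul_isUnit_right hz', hz,
      .inr ⟨by ring, rfl⟩⟩
  · obtain ⟨z, rfl, hz⟩ := key x y h3 h4
    have hz' := hz ▸ hu
    exact ⟨x, z, isUnit_of_mul_isUnit_left hz', isUnit_of_mul_isUnit_right hz', hz,
      .inl ⟨rfl, by ring⟩⟩

namespace IsImaginaryQuadratic

variable {K : Type*} [Field K] [NumberField K] (h : IsImaginaryQuadratic K)

include h

theorem dvd_or_dvd_sub_one {τ : 𝓞 K} (hτ : Algebra.norm ℤ τ = 2) (x : 𝓞 K) :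
    τ ∣ x ∨ τ ∣ x - 1 := by
  have hc : Nat.card (𝓞 K ⧸ Ideal.span {τ}) = 2 := by
    have h1 := Ideal.absNorm_span_singleton τ
    rw [hτ] at h1
    exact h1
  have h01 : (0 : 𝓞 K ⧸ Ideal.span {τ}) ≠ 1 := by
    have : Nontrivial (𝓞 K ⧸ Ideal.span {τ}) := by
      have : Finite (𝓞 K ⧸ Ideal.span {τ}) := Nat.finite_of_card_ne_zero (by omega)
      exact Finite.one_lt_card_iff_nontrivial.1 (by omega)
    exact zero_ne_one
  obtain ⟨a, b, hab, huniv⟩ := Nat.card_eq_two_iff.1 hc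
  have hmem : ∀ y : 𝓞 K ⧸ Ideal.span {τ}, y = a ∨ y = b := fun y => by
    have : y ∈ ({a, b} : Set _) := huniv ▸ Set.mem_univ y
    simpa using this
  have h3 : Ideal.Quotient.mk (Ideal.span {τ}) x = 0 ∨ Ideal.Quotient.mk (Ideal.span {τ}) x = 1 := by
    rcases hmem 0 with h4 | h4 <;> rcases hmem 1 with h5 | h5 <;>
      rcases hmem (Ideal.Quotient.mk (Ideal.span {τ}) x) with h6 | h6 <;> simp_all
  rw [← Ideal.mem_span_singleton, ← Ideal.mem_span_singleton, ← Ideal.Quotient.eq_zero_iff_mem,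
    ← Ideal.Quotient.eq_zero_iff_mem, map_sub, map_one, sub_eq_zero]
  exact h3

/-- The norm of ε/η + 64 equals 4097 + 64t with |t| ≤ 2, t being the trace of ε/η, and it must be a
square. Only 63² and 65² occur, for t = ∓2, and then ε/η = ∓1. -/
theorem eq_or_eq_neg_of_sq_eq [IsPrincipalIdealRing (𝓞 K)] {a ε η : 𝓞 K} (hε : IsUnit ε)
    (hη : IsUnit η) (ha : a ^ 2 = ε + 64 * η) : ε = η ∨ ε = -η := by
  obtain ⟨ζ, hζ⟩ := hη.exists_right_inv
  have hζu : IsUnit ζ := IsUnit.of_mul_eq_one_right _ hζ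
  have h1 : Algebra.norm ℤ (ε * ζ + (64 : ℤ)) = Algebra.norm ℤ a ^ 2 := by
    rw [← map_pow, ha, show ε * ζ + ((64 : ℤ) : 𝓞 K) = (ε + 64 * η) * ζ by
      push_cast; linear_combination (-64 : 𝓞 K) * hζ, map_mul, h.isUnit_iff_norm.1 hζu, mul_one]
  have hκ := hε.mul hζu
  have h2 := (h.trace_sq_le (ε * ζ)).1
  have h3 := h.sq_eq_trace_mul_sub_norm (ε * ζ)
  rw [h.norm_add_intCast] at h1
  rw [h.isUnit_iff_norm.1 hκ] at h1 h2 h3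
  obtain ⟨h4, h5⟩ := abs_le_of_sq_le_sq' (h2.trans (by norm_num : (4 * 1 : ℤ) ≤ 2 ^ 2)) (by norm_num)
  generalize Algebra.trace ℤ (𝓞 K) (ε * ζ) = t at *
  have h6 := h.norm_nonneg a
  generalize Algebra.norm ℤ a = n at *
  have h7 : t = -2 ∨ t = 2 := by
    clear h3 h2
    have h8 : n < 66 := by nlinarith
    have h9 : 62 < n := by nlinarith
    interval_cases n <;> omega
  rcases h7 with rfl | rfl <;> push_cast at h3
  · right
    have h8 : ε * ζ + 1 = 0 := pow_eq_zero_iff two_ne_zero |>.1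
      (by linear_combination h3 : (ε * ζ + 1) ^ 2 = 0)
    linear_combination η * h8 - ε * hζ
  · left
    have h8 : ε * ζ - 1 = 0 := pow_eq_zero_iff two_ne_zero |>.1
      (by linear_combination h3 : (ε * ζ - 1) ^ 2 = 0)
    linear_combination η * h8 - ε * hζ

/-- In ℚ(√-65) the prime 2 ramifies. In a principal ideal domain it would be a unit times a square,
so K would contain √-1 or √-2, and then √65 or √130 as well. -/
theorem sq_ne_neg_sixtyFive [IsPrincipalIdealRing (𝓞 K)] (x : 𝓞 K) : x ^ 2 ≠ -65 := by
  intro hx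
  have h1 : (1 + x) ^ 2 = 2 * (x - 32) := by linear_combination hx
  have key : ¬(2 : 𝓞 K) ∣ 1 + x := by
    rintro ⟨y, hy⟩
    have h2 : (2 : 𝓞 K) * (y ^ 2 - y + 17) = 1 := by
      refine mul_left_cancel₀ (two_ne_zero : (2 : 𝓞 K) ≠ 0) ?_
      rw [hy] at h1
      linear_combination h1 + 2 * hy
    have h3 := h.isUnit_iff_norm.1 (IsUnit.of_mul_eq_one _ h2)
    have h4 : Algebra.norm ℤ (2 : 𝓞 K) = 2 ^ 2 := by
      have := h.norm_intCast 2
      exact_mod_cast this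
    rw [h4] at h3
    norm_num at h3
  rcases h.factorization_two with h2 | ⟨τ, ω, -, hω, h2, hτ⟩ | ⟨τ, σ, hτ, hσ, h2, h3, h4, -⟩
  · exact key (h2.dvd_of_dvd_pow ⟨_, h1⟩)
  · obtain ⟨s, hs | hs⟩ := h.sq_eq_of_ramified hω h2 hτ
    · exact h.sq_ne_natCast_integer (n := 65) (not_isSquare_of_lt 8) (s * x)
        (by push_cast; linear_combination x ^ 2 * hs - hx)
    · exact h.sq_ne_natCast_integer (n := 130) (not_isSquare_of_lt 11) (s * x)
        (by push_cast; linear_combination x ^ 2 * hs - 2 * hx)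
  · have h5 : τ ∣ 1 + x := hτ.dvd_of_dvd_pow ⟨σ * (x - 32), by rw [h1, h2]; ring⟩
    have h6 : σ ∣ 1 + x := hσ.dvd_of_dvd_pow ⟨τ * (x - 32), by rw [h1, h2]; ring⟩
    obtain ⟨y, hy⟩ := h5
    rw [hy] at h6
    obtain ⟨z, rfl⟩ := (hσ.dvd_or_dvd h6).resolve_left h4
    exact key ⟨z, by rw [hy, h2]; ring⟩

/-- Since ε = ±η and, without i, units are squares up to sign, a² is one of ±65, ±63 times the
square of a unit. Only −63 = 9 · (−7) is possible. The presence of i is excluded separately. -/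
theorem exists_of_sq_eq_add [IsPrincipalIdealRing (𝓞 K)] {a ε η : 𝓞 K} (hε : IsUnit ε)
    (hη : IsUnit η) (ha : a ^ 2 = ε + 64 * η) :
    ∃ s ν : 𝓞 K, s ^ 2 = -7 ∧ IsUnit ν ∧ a = 3 * s * ν ∧ η = -ν ^ 2 ∧ ε = ν ^ 2 := by
  by_cases hi : ∃ ι : 𝓞 K, ι ^ 2 = -1
  · exfalso
    obtain ⟨ι, hι⟩ := hi
    have h1 : η ^ 2 = 1 ∨ η ^ 2 = -1 := by
      rcases h.eq_of_isUnit_of_sq_eq_neg_one hι hη with rfl | rfl | rfl | rfl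
      · left; ring
      · left; ring
      · exact .inr hι
      · right; rw [← hι]; ring
    rcases h.eq_or_eq_neg_of_sq_eq hε hη ha with rfl | rfl <;> rcases h1 with h1 | h1
    · have h2 : (ε - 1) * (ε + 1) = 0 := by linear_combination h1
      rcases mul_eq_zero.1 h2 with h3 | h3
      · exact h.sq_ne_natCast_integer (n := 65) (not_isSquare_of_lt 8) a
          (by push_cast; linear_combination ha + 65 * h3)
      · exact h.sq_ne_natCast_integer (n := 65) (not_isSquare_of_lt 8) (ι * a)
          (by push_cast; linear_combination a ^ 2 * hι - ha - 65 * h3)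
    -- For ε² = −1 one has (1 + ε)² = 2ε, which turns a² = 65ε into a square root of 130.
    · exact h.sq_ne_natCast_integer (n := 130) (not_isSquare_of_lt 11) (ι * a * (1 + ε))
          (by push_cast; linear_combination (a * (1 + ε)) ^ 2 * hι - (1 + ε) ^ 2 * ha -
            65 * (ε + 2) * h1)
    · have h2 : (η - 1) * (η + 1) = 0 := by linear_combination h1
      rcases mul_eq_zero.1 h2 with h3 | h3
      · exact h.sq_ne_natCast_integer (n := 63) (not_isSquare_of_lt 7) a
          (by push_cast; linear_combination ha + 63 * h3)
      · exact h.sq_ne_natCast_integer (n := 63) (not_isSquare_of_lt 7) (ι * a)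
          (by push_cast; linear_combination a ^ 2 * hι - ha - 63 * h3)
    · exact h.sq_ne_natCast_integer (n := 126) (not_isSquare_of_lt 11) (ι * a * (1 + η))
          (by push_cast; linear_combination (a * (1 + η)) ^ 2 * hι - (1 + η) ^ 2 * ha -
            63 * (η + 2) * h1)
  · push Not at hi
    obtain ⟨ν, hν, h1⟩ := h.exists_sq_of_isUnit hi hη
    obtain ⟨μ, hμ⟩ := hν.exists_right_inv
    rcases h.eq_or_eq_neg_of_sq_eq hε hη ha with rfl | rfl <;> rcases h1 with rfl | rfl
    · exact absurd (by push_cast; linear_combination μ ^ 2 * ha + 65 * (ν * μ + 1) * hμ)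
        (h.sq_ne_natCast_integer (n := 65) (not_isSquare_of_lt 8) (a * μ))
    · exact absurd (by linear_combination μ ^ 2 * ha - 65 * (ν * μ + 1) * hμ)
        (h.sq_ne_neg_sixtyFive (a * μ))
    · exact absurd (by push_cast; linear_combination μ ^ 2 * ha + 63 * (ν * μ + 1) * hμ)
        (h.sq_ne_natCast_integer (n := 63) (not_isSquare_of_lt 7) (a * μ))
    · have h2 : (a * μ) ^ 2 = -63 := by
        linear_combination μ ^ 2 * ha - 63 * (ν * μ + 1) * hμ
      obtain ⟨s, hs⟩ : (3 : 𝓞 K) ∣ a * μ := by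
        rw [← IsIntegrallyClosed.pow_dvd_pow_iff two_ne_zero, h2]
        exact ⟨-7, by norm_num⟩
      refine ⟨s, ν, ?_, hν, ?_, rfl, by ring⟩
      · have h9 : (9 : 𝓞 K) ≠ 0 := by norm_num
        refine mul_left_cancel₀ h9 ?_
        rw [hs] at h2
        linear_combination h2
      · linear_combination ν * hs - a * hμ

theorem exists_two_mul_eq {s : 𝓞 K} (hs : s ^ 2 = -7) : ∃ θ : 𝓞 K, 2 * θ = 1 - s := by
  have h1 : IsIntegral ℤ ((1 - (s : K)) / 2) := by
    refine ⟨Polynomial.X ^ 2 - Polynomial.X + Polynomial.C 2, by monicity!, ?_⟩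
    have h2 : (s : K) ^ 2 = -7 := by
      rw [← map_pow, hs, map_neg, map_ofNat]
    simp only [Polynomial.eval₂_add, Polynomial.eval₂_sub, Polynomial.eval₂_pow,
      Polynomial.eval₂_X, Polynomial.eval₂_C, Polynomial.eval₂_ofNat, map_ofNat]
    linear_combination h2 / 4
  refine ⟨⟨_, h1⟩, NumberField.RingOfIntegers.ext ?_⟩
  change (2 : K) * ((1 - (s : K)) / 2) = 1 - s
  ring

/-- Multiplying by 4u₂σ⁴ and completing the square gives (2u₂σ⁴ − u₁)² = u₁² + 64u₂e, an instance of
`exists_of_sq_eq_add`. The sign of s is adjusted to match the root. -/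
theorem exists_of_mul_prime_pow_sub [IsPrincipalIdealRing (𝓞 K)] {τ σ e u₁ u₂ : 𝓞 K}
    (h2 : 2 = τ * σ) (he : IsUnit e) (hu₁ : IsUnit u₁) (hu₂ : IsUnit u₂)
    (hu : e * τ ^ 4 = σ ^ 4 * u₂ - u₁) :
    ∃ s : 𝓞 K, s ^ 2 = -7 ∧ u₂ * e = -u₁ ^ 2 ∧ 2 * u₁ * σ ^ 4 = -(e * (1 + 3 * s)) := by
  have h1 : (2 * u₂ * σ ^ 4 - u₁) ^ 2 = u₁ ^ 2 + 64 * (u₂ * e) := by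
    linear_combination -4 * u₂ * σ ^ 4 * hu -
      4 * u₂ * e * (4 + (τ * σ) ^ 2) * (2 + τ * σ) * h2
  obtain ⟨s, ν, hs, hν, h3, h4, h5⟩ := h.exists_of_sq_eq_add (hu₁.pow 2) (hu₂.mul he) h1
  have key : ∀ s : 𝓞 K, 2 * u₂ * σ ^ 4 - u₁ = 3 * s * u₁ → u₂ * e = -u₁ ^ 2 →
      2 * u₁ * σ ^ 4 = -(e * (1 + 3 * s)) := by
    intro s h6 h7
    refine mul_left_cancel₀ hu₁.ne_zero ?_
    linear_combination -e * h6 + 2 * σ ^ 4 * h7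
  rw [← h5] at h4
  rcases sq_eq_sq_iff_eq_or_eq_neg.1 h5 with h6 | h6
  · exact ⟨s, hs, h4, key s (by rw [h3, h6]) h4⟩
  · exact ⟨-s, by rw [neg_sq, hs], h4, key (-s) (by rw [h3, h6]; ring) h4⟩

theorem sq_ne_neg_sq (hi : ∀ x : 𝓞 K, x ^ 2 ≠ -1) {x y : 𝓞 K} (hy : y ≠ 0) : x ^ 2 ≠ -y ^ 2 := by
  intro hxy
  obtain ⟨z, rfl⟩ : y ∣ x := by
    rw [← IsIntegrallyClosed.pow_dvd_pow_iff two_ne_zero, hxy]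
    exact dvd_neg.2 dvd_rfl
  refine hi z (mul_left_cancel₀ (pow_ne_zero 2 hy) ?_)
  linear_combination hxy

/-- The case of different reduction types at the two primes above `2`. -/
theorem exists_of_mixed [IsPrincipalIdealRing (𝓞 K)] {τ σ : 𝓞 K} (hτ : Prime τ) (hσ : Prime σ)
    (h2 : 2 = τ * σ) (hτσ : ¬τ ∣ σ) (hστ : ¬σ ∣ τ) (hN : Algebra.norm ℤ τ = 2) {a b ε η : 𝓞 K}
    (hε : IsUnit ε) (hη : IsUnit η) (hb : b = ε * τ ^ 4) (hc : a ^ 2 - 4 * b = η * σ ^ 8) :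
    ∃ s d : 𝓞 K, s ^ 2 = -7 ∧ IsUnit d ∧ 2 * a = 3 * d * (1 - s) ∧ 2 * b = d ^ 2 * (1 - 3 * s) := by
  -- With i in K the number 2 would ramify, whereas here τ ∤ σ.
  have hi : ∀ x : 𝓞 K, x ^ 2 ≠ -1 := by
    intro x hx
    have h3 : (1 + x) ^ 2 = τ * σ * x := by rw [← h2]; linear_combination hx
    obtain ⟨y, hy⟩ := hτ.dvd_of_dvd_pow ⟨σ * x, by rw [h3]; ring⟩
    refine hτσ ⟨-x * y ^ 2, mul_left_cancel₀ hτ.ne_zero ?_⟩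
    rw [hy] at h3
    linear_combination x * h3 + τ * σ * hx
  have h20 : (2 : 𝓞 K) ≠ 0 := two_ne_zero
  have hτ0 := hτ.ne_zero
  have hσ0 := hσ.ne_zero
  -- With a = σa₀ the equation takes the symmetric form a₀² = ησ⁶ + ετ⁶. Both units are squares up
  -- to sign, which leaves three kinds of cases.
  obtain ⟨a₀, rfl⟩ : σ ∣ a := hσ.dvd_of_dvd_pow (n := 2) ⟨η * σ ^ 7 + ε * τ ^ 6 * σ, by
      linear_combination hc + 4 * hb + ε * τ ^ 4 * (2 + τ * σ) * h2⟩
  have ha₀ : a₀ ^ 2 = η * σ ^ 6 + ε * τ ^ 6 := by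
    refine mul_left_cancel₀ (pow_ne_zero 2 hσ0) ?_
    linear_combination hc + 4 * hb + ε * τ ^ 4 * (2 + τ * σ) * h2
  obtain ⟨e, he, he'⟩ := h.exists_sq_of_isUnit hi hε
  obtain ⟨f, hf, hf'⟩ := h.exists_sq_of_isUnit hi hη
  have hnd : ∀ {π ρ g : 𝓞 K}, Prime π → 2 = π * ρ → ¬π ∣ ρ → IsUnit g →
      π ∣ 2 * g * ρ ^ 3 ∧ ¬π ^ 2 ∣ 2 * g * ρ ^ 3 := by
    intro π ρ g hπ h3 h4 hg
    rw [h3]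
    refine ⟨⟨ρ * g * ρ ^ 3, by ring⟩, ?_⟩
    rintro ⟨k, hk⟩
    have h5 : g * ρ ^ 4 = π * k := by
      refine mul_left_cancel₀ hπ.ne_zero ?_
      linear_combination hk
    rcases hπ.dvd_or_dvd ⟨k, h5⟩ with h6 | h6
    · exact hπ.not_isUnit (isUnit_of_dvd_unit h6 hg)
    · exact h4 (hπ.dvd_of_dvd_pow h6)
  have h2' : 2 = σ * τ := by rw [h2, mul_comm]
  rcases he' with rfl | rfl
  -- Here (a₀ − eτ³)(a₀ + eτ³) = ησ⁶, and the two factors differ by 2eτ³, exactly divisible by σ, so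
  -- they have σ-orders 1 and 5.
  · have key : ∀ e : 𝓞 K, IsUnit e → b = e ^ 2 * τ ^ 4 →
        ∀ u₁ u₂, IsUnit u₁ → IsUnit u₂ → a₀ - e * τ ^ 3 = σ * u₁ →
        a₀ + e * τ ^ 3 = σ ^ 5 * u₂ →
        ∃ s d : 𝓞 K, s ^ 2 = -7 ∧ IsUnit d ∧ 2 * (σ * a₀) = 3 * d * (1 - s) ∧
          2 * b = d ^ 2 * (1 - 3 * s) := by
      intro e he hb u₁ u₂ hu₁ hu₂ h3 h4
      obtain ⟨s, hs, h5, h6⟩ := h.exists_of_mul_prime_pow_sub h2 he hu₁ hu₂ (by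
        refine mul_left_cancel₀ hσ0 ?_
        linear_combination h4 - h3 - e * τ ^ 3 * h2)
      -- κ = (1 − s)/2 satisfies 2κ⁴ = 1 + 3s, so σ⁴ and κ⁴ agree up to a unit. That unit is a
      -- square because i ∉ K, whence σ² = gκ².
      obtain ⟨κ, hκ⟩ := h.exists_two_mul_eq hs
      have hκ2 : 2 * κ ^ 2 = -3 - s := by
        refine mul_left_cancel₀ h20 ?_
        linear_combination (2 * κ + 1 - s) * hκ + hs
      have hκ4 : 2 * κ ^ 4 = 1 + 3 * s := by
        refine mul_left_cancel₀ h20 ?_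
        linear_combination (2 * κ ^ 2 - 3 - s) * hκ2 + hs
      have hκ0 : κ ^ 2 ≠ 0 := by
        intro h0
        have h1 : (1 : 𝓞 K) - s = 0 := by
          rw [← hκ, (pow_eq_zero_iff two_ne_zero).1 h0, mul_zero]
        have h7 : (8 : 𝓞 K) = 0 := by linear_combination (1 + s) * h1 + hs
        exact absurd h7 (by norm_num)
      obtain ⟨v, hv⟩ := hu₁.exists_right_inv
      have hvu : IsUnit v := IsUnit.of_mul_eq_one_right _ hv
      have h7 : (σ ^ 2) ^ 2 = -(e * v) * (κ ^ 2) ^ 2 := by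
        refine mul_left_cancel₀ h20 ?_
        linear_combination v * h6 - 2 * σ ^ 4 * hv + e * v * hκ4
      obtain ⟨g, hg, h8, h9⟩ : ∃ g, IsUnit g ∧ σ ^ 2 = g * κ ^ 2 ∧ g ^ 2 = -(e * v) := by
        obtain ⟨w, hw, h8 | h8⟩ := h.exists_sq_of_isUnit hi (he.mul hvu).neg
        · rw [h8, ← mul_pow] at h7
          rcases sq_eq_sq_iff_eq_or_eq_neg.1 h7 with h9 | h9
          · exact ⟨w, hw, h9, h8.symm⟩
          · exact ⟨-w, hw.neg, by rw [h9]; ring, by rw [h8]; ring⟩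
        · exact absurd (by rw [h7, h8]; ring)
            (h.sq_ne_neg_sq hi (x := σ ^ 2) (mul_ne_zero hw.ne_zero hκ0))
      have h10 : e = -(u₁ * g ^ 2) := by
        rw [h9]
        linear_combination -e * hv
      have h11 : 2 * g * τ ^ 2 = s - 3 := by
        refine mul_left_cancel₀ (show (8 : 𝓞 K) ≠ 0 by norm_num) ?_
        linear_combination g * τ ^ 2 * hs - (s - 3) * g * τ ^ 2 * hκ2 - 2 * (s - 3) * τ ^ 2 * h8 -
          2 * (s - 3) * (2 + τ * σ) * h2
      refine ⟨s, g * u₁, hs, hg.mul hu₁, ?_, ?_⟩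
      · linear_combination 2 * σ * h3 - 2 * e * τ ^ 2 * h2 + 2 * u₁ * h8 + g * u₁ * hκ2 +
          4 * τ ^ 2 * h10 - 2 * u₁ * g * h11
      · refine mul_left_cancel₀ h20 ?_
        rw [hb, h10]
        linear_combination u₁ ^ 2 * g ^ 2 * ((2 * g * τ ^ 2 + s - 3) * h11 + hs)
    obtain ⟨u₁, u₂, hu₁, hu₂, hu, h3 | h3⟩ := exists_of_mul_eq_prime_pow hσ hη
      (x := a₀ - e * τ ^ 3) (y := a₀ + e * τ ^ 3) (by linear_combination ha₀)
      (by convert (hnd hσ h2' hστ he).1 using 1; ring)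
      (by convert (hnd hσ h2' hστ he).2 using 2; ring)
    · exact key e he hb u₁ u₂ hu₁ hu₂ h3.1 h3.2
    · exact key (-e) he.neg (by rw [hb]; ring) u₂ u₁ hu₂ hu₁ (by rw [← h3.2]; ring)
        (by rw [← h3.1]; ring)
  · exfalso
    rcases hf' with rfl | rfl
    -- The same factorization with τ and σ exchanged now exhibits (eτ²)² as minus a square, which
    -- would give i ∈ K.
    · have key : ∀ f : 𝓞 K, IsUnit f → ∀ u₁ u₂, IsUnit u₁ → IsUnit u₂ → u₁ * u₂ = -e ^ 2 →
          a₀ - f * σ ^ 3 = τ * u₁ → a₀ + f * σ ^ 3 = τ ^ 5 * u₂ → False := by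
        intro f hf u₁ u₂ hu₁ hu₂ hu h3 h4
        obtain ⟨s, hs, h5, h6⟩ := h.exists_of_mul_prime_pow_sub h2' hf hu₁ hu₂ (by
          refine mul_left_cancel₀ hτ0 ?_
          linear_combination h4 - h3 - f * σ ^ 3 * h2)
        obtain ⟨κ, hκ⟩ := h.exists_two_mul_eq hs
        have hκ2 : 2 * κ ^ 2 = -3 - s := by
          refine mul_left_cancel₀ h20 ?_
          linear_combination (2 * κ + 1 - s) * hκ + hs
        have hκ4 : 2 * κ ^ 4 = 1 + 3 * s := by
          refine mul_left_cancel₀ h20 ?_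
          linear_combination (2 * κ ^ 2 - 3 - s) * hκ2 + hs
        have hκ0 : κ ^ 2 ≠ 0 := by
          intro h0
          have h1 : (1 : 𝓞 K) - s = 0 := by
            rw [← hκ, (pow_eq_zero_iff two_ne_zero).1 h0, mul_zero]
          have h7 : (8 : 𝓞 K) = 0 := by linear_combination (1 + s) * h1 + hs
          exact absurd h7 (by norm_num)
        refine h.sq_ne_neg_sq hi (x := e * τ ^ 2) (mul_ne_zero hu₁.ne_zero hκ0) ?_
        refine mul_left_cancel₀ h20 ?_
        linear_combination 2 * τ ^ 4 * hu - u₂ * h6 + (1 + 3 * s) * h5 + u₁ ^ 2 * hκ4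
      obtain ⟨u₁, u₂, hu₁, hu₂, hu, h3 | h3⟩ := exists_of_mul_eq_prime_pow hτ (he.pow 2).neg
        (x := a₀ - f * σ ^ 3) (y := a₀ + f * σ ^ 3) (by linear_combination ha₀)
        (by convert (hnd hτ h2 hτσ hf).1 using 1; ring)
        (by convert (hnd hτ h2 hτσ hf).2 using 2; ring)
      · exact key f hf u₁ u₂ hu₁ hu₂ hu h3.1 h3.2
      · exact key (-f) hf.neg u₂ u₁ hu₂ hu₁ (by rw [← hu, mul_comm]) (by rw [← h3.2]; ring)
          (by rw [← h3.1]; ring)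
    -- If both units are minus squares, then a₀² + (fσ³)² is divisible by τ². Both squares are 1
    -- modulo τ², since the residue field has two elements, so τ² would divide 2.
    · have hsq : ∀ x : 𝓞 K, ¬τ ∣ x → τ ^ 2 ∣ x ^ 2 - 1 := by
        intro x hx
        obtain ⟨k, hk⟩ := (h.dvd_or_dvd_sub_one hN x).resolve_left hx
        exact ⟨σ * k + k ^ 2, by linear_combination (x + 1) * hk + τ * k * hk + τ * k * h2⟩
      have h3 : ¬τ ∣ f * σ ^ 3 := by
        intro h4
        rcases hτ.dvd_or_dvd h4 with h5 | h5
        · exact hτ.not_isUnit (isUnit_of_dvd_unit h5 hf)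
        · exact hτσ (hτ.dvd_of_dvd_pow h5)
      have h4 : ¬τ ∣ a₀ := by
        rintro ⟨k, hk⟩
        exact h3 (hτ.dvd_of_dvd_pow (n := 2) ⟨-τ * k ^ 2 - e ^ 2 * τ ^ 5, by
          rw [hk] at ha₀; linear_combination ha₀⟩)
      obtain ⟨k, hk⟩ := hsq _ h3
      obtain ⟨l, hl⟩ := hsq _ h4
      refine hτσ ⟨-(k + l + e ^ 2 * τ ^ 4), mul_left_cancel₀ hτ0 ?_⟩
      linear_combination ha₀ - hk - hl - h2

end IsImaginaryQuadratic

/-! ### The field ℚ(√-7): congruences modulo 4 and the resulting curves. -/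

section

variable {K : Type*} [Field K] [NumberField K]

theorem coe_ofNat_integers (n : ℕ) [n.AtLeastTwo] :
    algebraMap (𝓞 K) K ofNat(n) = ofNat(n) := map_ofNat _ n

theorem valuation_two_of_notMem {q : HeightOneSpectrum (𝓞 K)} (h2 : (2 : 𝓞 K) ∉ q.asIdeal) :
    q.valuation K (2 : K) = 1 := by
  have := HeightOneSpectrum.valuation_eq_one_iff_notMem (K := K) q |>.2 h2
  rwa [map_ofNat] at this

theorem not_hasGoodReductionAt_of_valuation {p : HeightOneSpectrum (𝓞 K)}
    (h2 : (2 : 𝓞 K) ∉ p.asIdeal) {a b : K} {k : ℤ} (hb : p.valuation K b = WithZero.exp k)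
    (hk : ¬4 ∣ k) : ¬HasGoodReductionAt (curveAB a b) p := by
  intro h
  obtain ⟨u, hu, -, hB, -⟩ := valuation_eq_one_of_odd h (valuation_two_of_notMem h2)
  have hu0 : p.valuation K u ≠ 0 := (Valuation.ne_zero_iff _).2 hu
  rw [map_mul, map_pow, hb, ← WithZero.exp_log hu0, ← WithZero.exp_nsmul, ← WithZero.exp_add,
    ← WithZero.exp_zero, WithZero.exp_inj, nsmul_eq_mul] at hB
  push_cast at hB
  omega

theorem conductor_eq_sq {E : WeierstrassCurve K} [E.IsElliptic] {p : HeightOneSpectrum (𝓞 K)}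
    (h2 : (2 : 𝓞 K) ∉ p.asIdeal) {a b : K} (hE : IsIsomorphic E (curveAB a b)) (hb0 : b ≠ 0) {k : ℤ}
    (hb : p.valuation K b = WithZero.exp k) (hk : ¬4 ∣ k)
    (hgood : ∀ q ≠ p, HasGoodReductionAt E q) {j : 𝓞 K} (hj : E.j = j) :
    conductor E = p.asIdeal ^ 2 :=
  conductor_eq hgood
    (fun h => not_hasGoodReductionAt_of_valuation h2 hb hk (hE.hasGoodReductionAt h))
    (not_hasMultiplicativeReductionAt hj) (wildExponent_eq_zero hb0 hE h2)

theorem four_dvd_of_valuation {x : 𝓞 K} {n : ℕ} (h : ∀ q : HeightOneSpectrum (𝓞 K),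
    (2 : 𝓞 K) ∈ q.asIdeal → q.valuation K x ≤ q.valuation K (2 : K) ^ n) : 2 ^ n ∣ x := by
  refine dvd_of_valuation_le (pow_ne_zero n two_ne_zero) fun q => ?_
  simp only [map_pow, map_ofNat (algebraMap (𝓞 K) K)]
  by_cases h2 : (2 : 𝓞 K) ∈ q.asIdeal
  · exact h q h2
  · rw [valuation_two_of_notMem h2, one_pow]
    exact q.valuation_le_one x

/-- At a prime with residue field of two elements, units are congruent to `1`. -/
theorem valuation_sub_one_le (hK : IsImaginaryQuadratic K) {q : HeightOneSpectrum (𝓞 K)}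
    {τ : 𝓞 K} (hτ : q.asIdeal = Ideal.span {τ}) (hN : Algebra.norm ℤ τ = 2) {x : K}
    (hx : q.valuation K x = 1) : q.valuation K (x - 1) ≤ q.valuation K τ := by
  obtain ⟨y, hy⟩ := q.exists_valuation_sub_lt_of_integer hx.le 1
  have hy' : q.valuation K (algebraMap (𝓞 K) K y - x) ≤ q.valuation K τ :=
    valuation_le_span_of_lt_one hτ (by simpa using hy)
  have hτ1 : q.valuation K τ < 1 := by
    rw [valuation_span hτ, ← WithZero.exp_zero, WithZero.exp_lt_exp]
    norm_num
  have hy1 : ¬τ ∣ y := by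
    intro hd
    rw [← pow_one τ, ← valuation_le_span_pow_iff hτ, pow_one] at hd
    have h1 : q.valuation K x ≤ q.valuation K τ := by
      rw [show x = algebraMap (𝓞 K) K y - (algebraMap (𝓞 K) K y - x) by ring]
      exact (Valuation.map_sub _ _ _).trans (max_le hd hy')
    rw [hx] at h1
    exact h1.not_gt hτ1
  have h1 := (hK.dvd_or_dvd_sub_one hN y).resolve_left hy1
  rw [← pow_one τ, ← valuation_le_span_pow_iff hτ, pow_one] at h1
  rw [show x - 1 = (algebraMap (𝓞 K) K (y - 1)) - (algebraMap (𝓞 K) K y - x) by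
    rw [map_sub, map_one]; ring]
  exact (Valuation.map_sub _ _ _).trans (max_le h1 hy')

theorem valuation_sq_sub_one_le (hK : IsImaginaryQuadratic K) {q : HeightOneSpectrum (𝓞 K)}
    {τ : 𝓞 K} (hτ : q.asIdeal = Ideal.span {τ}) (hN : Algebra.norm ℤ τ = 2)
    (h2 : q.valuation K τ = q.valuation K (2 : K)) {x : K} (hx : q.valuation K x = 1) :
    q.valuation K (x ^ 2 - 1) ≤ q.valuation K (2 : K) ^ 2 := by
  have h1 := valuation_sub_one_le hK hτ hN hx
  rw [h2] at h1
  have h3 : q.valuation K (x - 1 + 2) ≤ q.valuation K 2 :=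
    (Valuation.map_add _ _ _).trans (max_le h1 le_rfl)
  rw [show x ^ 2 - 1 = (x - 1) * (x - 1 + 2) by ring, map_mul, sq]
  exact mul_le_mul' h1 h3

section SquareRootNegSeven

variable (hK : IsImaginaryQuadratic K)

include hK

theorem IsImaginaryQuadratic.norm_eq_two {θ : 𝓞 K} (h1 : 2 = (1 - θ) * θ) :
    Algebra.norm ℤ θ = 2 := by
  have h3 := hK.sq_eq_trace_mul_sub_norm θ
  have h4 : ((Algebra.trace ℤ (𝓞 K) θ - 1 : ℤ) : 𝓞 K) * θ =
      ((Algebra.norm ℤ θ - 2 : ℤ) : 𝓞 K) := by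
    push_cast
    linear_combination h1 - h3
  by_cases h5 : Algebra.trace ℤ (𝓞 K) θ - 1 = 0
  · rw [h5, Int.cast_zero, zero_mul] at h4
    have h6 : Algebra.norm ℤ θ - 2 = 0 := by exact_mod_cast h4.symm
    omega
  · exfalso
    generalize Algebra.trace ℤ (𝓞 K) θ - 1 = m at *
    generalize Algebra.norm ℤ θ - 2 = n at *
    have h6 : ((m ^ 2 * 2 : ℤ) : 𝓞 K) = ((m - n) * n : ℤ) := by
      push_cast
      linear_combination (m : 𝓞 K) ^ 2 * h1 + (m - m * θ - n) * h4
    have h7 : m ^ 2 * 2 = (m - n) * n := by exact_mod_cast h6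
    have h8 : 0 < m ^ 2 := by positivity
    nlinarith [sq_nonneg (2 * n - m)]

theorem IsImaginaryQuadratic.asIdeal_eq_span [IsPrincipalIdealRing (𝓞 K)] {τ : 𝓞 K}
    {q : HeightOneSpectrum (𝓞 K)} (h3 : Algebra.norm ℤ τ = 2) (h4 : τ ∈ q.asIdeal) :
    q.asIdeal = Ideal.span {τ} := by
  obtain ⟨t, ht, hq⟩ := exists_prime_span q
  rw [hq, Ideal.mem_span_singleton] at h4
  rw [hq, Ideal.span_singleton_eq_span_singleton]
  exact ht.irreducible.associated_of_dvd (hK.irreducible_of_norm h3) h4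

theorem IsImaginaryQuadratic.not_two_dvd_of_norm {θ : 𝓞 K} (h : Algebra.norm ℤ θ = 2) :
    ¬2 ∣ θ := by
  rintro ⟨k, rfl⟩
  have h2 := hK.norm_intCast 2
  push_cast at h2
  rw [map_mul, h2] at h
  omega

variable {s : 𝓞 K} (hs : s ^ 2 = -7)

include hs

theorem exists_of_sq_eq_neg_seven : ∃ θ : 𝓞 K, 2 * θ = 1 - s ∧ 2 = (1 - θ) * θ := by
  obtain ⟨θ, hθ⟩ := hK.exists_two_mul_eq hs
  refine ⟨θ, hθ, mul_left_cancel₀ (show (4 : 𝓞 K) ≠ 0 by norm_num) ?_⟩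
  linear_combination (2 * θ + (1 - s) - 2) * hθ + hs

/-- The primes above `2` in `ℚ(√-7)`. -/
theorem exists_span_of_sq_eq_neg_seven [IsPrincipalIdealRing (𝓞 K)]
    {q : HeightOneSpectrum (𝓞 K)} (h2 : (2 : 𝓞 K) ∈ q.asIdeal) :
    ∃ τ : 𝓞 K, q.asIdeal = Ideal.span {τ} ∧ Algebra.norm ℤ τ = 2 ∧ 2 = (1 - τ) * τ := by
  obtain ⟨θ, hθ, h1⟩ := exists_of_sq_eq_neg_seven hK hs
  have hN := hK.norm_eq_two h1
  have hN' := hK.norm_eq_two (θ := 1 - θ) (by linear_combination h1)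
  have hp := fun τ => hK.asIdeal_eq_span (τ := τ) (q := q)
  rw [h1] at h2
  rcases q.isPrime.mem_or_mem h2 with h3 | h3
  · exact ⟨1 - θ, hp _ hN' h3, hN', by linear_combination h1⟩
  · exact ⟨θ, hp _ hN h3, hN, h1⟩

/-- This forces the parameter D to generate 𝔭. For ±1 the elements (1 ∓ s)/2 have norm 2, so 2 does
not divide them; other roots of unity would give a square root of 7 or of 21. -/
theorem not_dvd_sub_of_sq_eq_neg_seven {D : 𝓞 K} (hD : IsUnit D) : ¬4 ∣ D - s := by
  rintro ⟨k, hk⟩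
  obtain ⟨θ, hθ, h1⟩ := exists_of_sq_eq_neg_seven hK hs
  have h20 : (2 : 𝓞 K) ≠ 0 := two_ne_zero
  rcases hK.sq_eq_of_isUnit hD with h3 | h3 | h3 | h3 | h3
  · refine hK.not_two_dvd_of_norm (hK.norm_eq_two h1) ⟨k, mul_left_cancel₀ h20 ?_⟩
    linear_combination hθ + hk - h3
  · refine hK.not_two_dvd_of_norm (hK.norm_eq_two (θ := 1 - θ) (by linear_combination h1))
      ⟨-k, mul_left_cancel₀ h20 ?_⟩
    linear_combination -hθ - hk + h3
  · exact absurd (by push_cast; linear_combination D ^ 2 * hs - 7 * h3)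
      (hK.sq_ne_natCast_integer (n := 7) (not_isSquare_of_lt 2) (s * D))
  · exact absurd (by push_cast; linear_combination (-28 : 𝓞 K) * h3 + (2 * D - 1) ^ 2 * hs)
      (hK.sq_ne_natCast_integer (n := 21) (not_isSquare_of_lt 4) (s * (2 * D - 1)))
  · exact absurd (by push_cast; linear_combination (-28 : 𝓞 K) * h3 + (2 * D + 1) ^ 2 * hs)
      (hK.sq_ne_natCast_integer (n := 21) (not_isSquare_of_lt 4) (s * (2 * D + 1)))

variable [IsPrincipalIdealRing (𝓞 K)] {q : HeightOneSpectrum (𝓞 K)}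

theorem exists_uniformizer_of_sq_eq_neg_seven (h2 : (2 : 𝓞 K) ∈ q.asIdeal) :
    (∃ τ ω : integersAt q, IsUniformizer τ ∧ IsUnit ω ∧ 2 = ω * τ) ∧
      q.valuation K (2 : K) < 1 ∧
      ∀ x : K, q.valuation K x = 1 → q.valuation K (x ^ 2 - 1) ≤ q.valuation K (2 : K) ^ 2 := by
  obtain ⟨τ, hτ, hN, h3⟩ := exists_span_of_sq_eq_neg_seven hK hs h2
  have hτ1 : q.valuation K τ < 1 := by
    rw [valuation_span hτ, ← WithZero.exp_zero, WithZero.exp_lt_exp]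
    norm_num
  have hω1 : q.valuation K (1 - (τ : K)) = 1 := Valuation.map_one_sub_of_lt _ hτ1
  have h3' : (2 : K) = (1 - (τ : K)) * τ := by
    rw [← map_one (algebraMap (𝓞 K) K), ← map_sub, ← map_mul, ← h3, map_ofNat]
  have h4 : q.valuation K (τ : K) = q.valuation K (2 : K) := by rw [h3', map_mul, hω1, one_mul]
  refine ⟨⟨⟨τ, hτ1.le⟩, ⟨1 - τ, hω1.le⟩, isUniformizer_of_span hτ rfl,
    integer_isUnit_iff.2 hω1, Subtype.ext h3'⟩, h4 ▸ hτ1,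
    fun x hx => valuation_sq_sub_one_le hK hτ hN h4 hx⟩

theorem coe_sq_eq_neg_seven : (s : K) ^ 2 = -7 := by
  rw [← map_pow, hs, map_neg, map_ofNat]

/-- D² is a unit at q, so 6sD ≡ −2α² modulo 8. As α² ≡ 1 modulo 4, multiplying 3sD ≡ −1 by s gives D
≡ s. -/
theorem valuation_sub_le_of_discriminant_twentyEight (h2 : (2 : 𝓞 K) ∈ q.asIdeal) {D : 𝓞 K}
    (hD : q.valuation K (D : K) = 1)
    (h : HasGoodReductionAt (curveAB (6 * (s : K) * D) ((D : K) ^ 2)) q) :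
    q.valuation K (D - s : 𝓞 K) ≤ q.valuation K (2 : K) ^ 2 := by
  obtain ⟨⟨τ, ω, hτ, hω, h3⟩, h4, h5⟩ := exists_uniformizer_of_sq_eq_neg_seven hK hs h2
  have hsK := coe_sq_eq_neg_seven hK hs
  have hb : q.valuation K ((D : K) ^ 2) = 1 := by rw [map_pow, hD, one_pow]
  have hmin : IsMinimalAt q (6 * (s : K) * D) ((D : K) ^ 2) := by
    refine ⟨?_, hb.le, fun t ht _ h6 => ?_⟩
    · simpa [coe_ofNat_integers] using q.valuation_le_one (K := K) (6 * s * D)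
    · rw [hb] at h6
      exact h6.not_gt (pow_lt_one₀ zero_le' ht four_ne_zero)
  rcases valuation_of_unramified h hmin hτ hω h3 with ⟨h6, -⟩ | ⟨-, -, α, hα, h6⟩
  · rw [hb, show (16 : K) = 2 ^ 4 by norm_num, map_pow] at h6
    exact absurd h6.symm (pow_lt_one₀ zero_le' h4 four_ne_zero).ne
  · rw [show 6 * (s : K) * D + 2 * α ^ 2 = 2 * (3 * s * D + α ^ 2) by ring,
      show (8 : K) = 2 * 2 ^ 2 by norm_num, map_mul, map_mul, map_pow,
      mul_le_mul_iff_right₀ (zero_lt_iff.2 ((Valuation.ne_zero_iff _).2 two_ne_zero))] at h6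
    have h7 : q.valuation K (s : K) ≤ 1 := q.valuation_le_one s
    have h8 : q.valuation K (-(5 * (D : K))) ≤ 1 := by
      simpa [coe_ofNat_integers] using q.valuation_le_one (K := K) (5 * D)
    rw [NumberField.RingOfIntegers.coe_eq_algebraMap, map_sub, show (D : K) - s = s * (α ^ 2 - 1) - s * (3 * s * D + α ^ 2) +
      2 ^ 2 * -(5 * D) by linear_combination (3 * D : K) * hsK]
    refine (Valuation.map_add _ _ _).trans (max_le ((Valuation.map_sub _ _ _).trans
      (max_le ?_ ?_)) ?_)
    · rw [map_mul]
      exact (mul_le_mul' h7 (h5 α hα)).trans_eq (one_mul _)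
    · rw [map_mul]
      exact (mul_le_mul' h7 h6).trans_eq (one_mul _)
    · rw [map_mul, map_pow]
      exact (mul_le_mul' le_rfl h8).trans_eq (mul_one _)

/-- The middle coefficient is now a unit at q, so −3sD ≡ α² ≡ 1 modulo 4, and multiplication by s
gives D ≡ s. -/
theorem valuation_sub_le_of_discriminant_seven (h2 : (2 : 𝓞 K) ∈ q.asIdeal) {D : 𝓞 K}
    (hD : q.valuation K (D : K) = 1)
    (h : HasGoodReductionAt (curveAB (-3 * (s : K) * D) (-16 * (D : K) ^ 2)) q) :
    q.valuation K (D - s : 𝓞 K) ≤ q.valuation K (2 : K) ^ 2 := by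
  obtain ⟨⟨τ, ω, hτ, hω, h3⟩, h4, h5⟩ := exists_uniformizer_of_sq_eq_neg_seven hK hs h2
  have hsK := coe_sq_eq_neg_seven hK hs
  have ha : q.valuation K (-3 * (s : K) * D) = 1 := by
    rw [← pow_left_inj₀ zero_le' zero_le' two_ne_zero, ← map_pow, one_pow,
      show (-3 * (s : K) * D) ^ 2 = -((1 - 2 ^ 6) * D ^ 2 * -1) by
        linear_combination (9 * D ^ 2 : K) * hsK, Valuation.map_neg, map_mul, map_mul,
      Valuation.map_one_sub_of_lt, map_pow, hD, Valuation.map_neg, map_one, one_pow, one_mul,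
      one_mul]
    rw [map_pow]
    exact pow_lt_one₀ zero_le' h4 (by norm_num)
  have hmin : IsMinimalAt q (-3 * (s : K) * D) (-16 * (D : K) ^ 2) := by
    refine ⟨ha.le, ?_, fun t ht h6 _ => ?_⟩
    · simpa [coe_ofNat_integers, sq] using q.valuation_le_one (K := K) (16 * (D * D))
    · rw [ha] at h6
      exact h6.not_gt (pow_lt_one₀ zero_le' ht two_ne_zero)
  rcases valuation_of_unramified h hmin hτ hω h3 with ⟨-, -, α, hα, h6⟩ | ⟨h6, -⟩
  · rw [show (4 : K) = 2 ^ 2 by norm_num, map_pow] at h6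
    have h7 : q.valuation K (s : K) ≤ 1 := q.valuation_le_one s
    have h8 : q.valuation K (-(5 * (D : K))) ≤ 1 := by
      simpa [coe_ofNat_integers] using q.valuation_le_one (K := K) (5 * D)
    rw [NumberField.RingOfIntegers.coe_eq_algebraMap, map_sub, show (D : K) - s = s * (α ^ 2 - 1) + s * (-3 * s * D - α ^ 2) +
      2 ^ 2 * -(5 * D) by linear_combination (3 * D : K) * hsK]
    refine (Valuation.map_add _ _ _).trans (max_le ((Valuation.map_add _ _ _).trans
      (max_le ?_ ?_)) ?_)
    · rw [map_mul]
      exact (mul_le_mul' h7 (h5 α hα)).trans_eq (one_mul _)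
    · rw [map_mul]
      exact (mul_le_mul' h7 h6).trans_eq (one_mul _)
    · rw [map_mul, map_pow]
      exact (mul_le_mul' le_rfl h8).trans_eq (mul_one _)
  · rw [show -16 * (D : K) ^ 2 = -(2 ^ 4 * D ^ 2) by ring, Valuation.map_neg, map_mul, map_pow,
      map_pow, hD, one_pow, mul_one] at h6
    exact absurd h6 (pow_lt_one₀ zero_le' h4 four_ne_zero).ne

omit hK hs in
/-- The conclusion for `ℚ(√-7)`. -/
def IsSquareRootNegSevenCase (E : WeierstrassCurve K) [E.IsElliptic]
    (p : HeightOneSpectrum (𝓞 K)) : Prop :=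
  ∃ s π : 𝓞 K, s ^ 2 = -7 ∧ p.asIdeal = Ideal.span {π} ∧ 4 ∣ π - s ∧
    conductor E = p.asIdeal ^ 2 ∧
    (∃ W ∈ isogenyClass49a, IsIsomorphic E (quadraticTwist (W⁄K) ((π : K) * (s : K)))) ∧
    (E.j = -15 ^ 3 ∨ E.j = 255 ^ 3) ∧
    ∃ O : Subring K, IsOrder O ∧ HasCMBy E O

variable {p : HeightOneSpectrum (𝓞 K)} {E : WeierstrassCurve K} [E.IsElliptic]
  (h2 : (2 : 𝓞 K) ∉ p.asIdeal) (hgood : ∀ q ≠ p, HasGoodReductionAt E q) {D : 𝓞 K}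
  (hD : IsUnit D ∨ p.asIdeal = Ideal.span {D})

include h2 hgood hD

omit hK hs h2 hgood in
theorem valuation_eq_one_of_ne (hqp : q ≠ p) : q.valuation K (D : K) = 1 := by
  refine (HeightOneSpectrum.valuation_eq_one_iff_notMem (K := K) q).2 fun hm => ?_
  rcases hD with hD | hD
  · exact q.isPrime.ne_top (Ideal.eq_top_of_isUnit_mem _ hm hD)
  · refine hqp (HeightOneSpectrum.ext ?_)
    refine ((p.isMaximal).eq_of_le q.isPrime.ne_top ?_).symm
    rw [hD, Ideal.span_singleton_le_iff_mem]
    exact hm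

theorem isSquareRootNegSevenCase_of_discriminant_twentyEight
    (hE : IsIsomorphic E (curveAB (6 * (s : K) * D) ((D : K) ^ 2))) :
    IsSquareRootNegSevenCase E p := by
  have h3 : 4 ∣ D - s := by
    rw [show (4 : 𝓞 K) = 2 ^ 2 by norm_num]
    refine four_dvd_of_valuation fun q hq => ?_
    have hqp : q ≠ p := by rintro rfl; exact h2 hq
    exact valuation_sub_le_of_discriminant_twentyEight hK hs hq (valuation_eq_one_of_ne hD hqp)
      (hE.hasGoodReductionAt (hgood q hqp))
  have hp := hD.resolve_left fun h => not_dvd_sub_of_sq_eq_neg_seven hK hs h h3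
  have hv := valuation_span (K := K) hp
  have hD0 : (D : K) ≠ 0 := fun h => by rw [h, map_zero] at hv; exact WithZero.exp_ne_zero hv.symm
  have hsK := coe_sq_eq_neg_seven hK hs
  have hj : E.j = 255 ^ 3 := by
    refine j_eq_of_isIsomorphic hE ?_
    rw [show (6 * (s : K) * D) ^ 2 = -252 * D ^ 2 by linear_combination (36 * D ^ 2 : K) * hsK]
    ring
  refine ⟨s, D, hs, hp, h3, conductor_eq_sq h2 hE (pow_ne_zero 2 hD0) (k := -2) ?_ (by norm_num)
    hgood (j := 255 ^ 3) (by rw [hj]; simp [NumberField.RingOfIntegers.coe_eq_algebraMap, coe_ofNat_integers]),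
    isogenyClass49a_of_discriminant_twentyEight hD0 hsK hE, .inr hj,
    exists_order_of_discriminant_twentyEight hK.finrank_eq hD0 hsK hE⟩
  rw [map_pow, hv, ← WithZero.exp_nsmul]
  norm_num

theorem isSquareRootNegSevenCase_of_discriminant_seven
    (hE : IsIsomorphic E (curveAB (-3 * (s : K) * D) (-16 * (D : K) ^ 2))) :
    IsSquareRootNegSevenCase E p := by
  have h3 : 4 ∣ D - s := by
    rw [show (4 : 𝓞 K) = 2 ^ 2 by norm_num]
    refine four_dvd_of_valuation fun q hq => ?_
    have hqp : q ≠ p := by rintro rfl; exact h2 hq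
    exact valuation_sub_le_of_discriminant_seven hK hs hq (valuation_eq_one_of_ne hD hqp)
      (hE.hasGoodReductionAt (hgood q hqp))
  have hp := hD.resolve_left fun h => not_dvd_sub_of_sq_eq_neg_seven hK hs h h3
  have hv := valuation_span (K := K) hp
  have hD0 : (D : K) ≠ 0 := fun h => by rw [h, map_zero] at hv; exact WithZero.exp_ne_zero hv.symm
  have hsK := coe_sq_eq_neg_seven hK hs
  have hj : E.j = -15 ^ 3 := by
    refine j_eq_of_isIsomorphic hE ?_
    rw [show (-3 * (s : K) * D) ^ 2 = -63 * D ^ 2 by linear_combination (9 * D ^ 2 : K) * hsK]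
    ring
  refine ⟨s, D, hs, hp, h3, conductor_eq_sq h2 hE (mul_ne_zero (by norm_num) (pow_ne_zero 2 hD0))
    (k := -2) ?_ (by norm_num) hgood (j := -15 ^ 3) (by rw [hj]; simp [NumberField.RingOfIntegers.coe_eq_algebraMap, coe_ofNat_integers]),
    isogenyClass49a_of_discriminant_seven hD0 hsK hE, .inl hj,
    exists_order_of_discriminant_seven hK.finrank_eq hD0 hsK hE⟩
  rw [show -16 * (D : K) ^ 2 = -(2 ^ 4 * D ^ 2) by ring, Valuation.map_neg, map_mul, map_pow,
    valuation_two_of_notMem h2, map_pow, hv, ← WithZero.exp_nsmul, one_pow, one_mul]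
  norm_num

end SquareRootNegSeven

end

/-! ### Congruences forced by supersingular reduction at a ramified prime above 2. -/

section RamifiedModel

variable {R : Type*} [CommRing R] [IsDomain R] {τ ω : R} (hτ : IsUniformizer τ)
  (hR : ∀ x : R, IsUnit x → τ ∣ x - 1) (h2 : 2 = ω * τ ^ 2)

include hτ hR

theorem IsUniformizer.dvd_or_dvd_sub_one (x : R) : τ ∣ x ∨ τ ∣ x - 1 :=
  or_iff_not_imp_left.2 fun h => hR x (hτ.isUnit x h)

include h2

omit hτ in
theorem dvd_sq_sub_one {x : R} (hx : IsUnit x) : τ ^ 2 ∣ x ^ 2 - 1 := by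
  obtain ⟨y, hy⟩ := hR _ hx
  exact ⟨y * (y + ω * τ), by linear_combination (x - 1 + τ * y + 2) * hy + τ * y * h2⟩

variable {α₁ α₂ α₃ α₄ α₆ x A B : R} (h : IsRamifiedModel τ ω α₁ α₂ α₃ α₄ α₆ x A B)

include h

-- Modulo τ², the equation for A reads 0 ≡ 1 + 3x, because the unit α₁ has square 1.
omit hτ in
theorem IsRamifiedModel.two_dvd_sub_one (hω : IsUnit ω) (hA : 2 ∣ A) : 2 ∣ x - 1 := by
  have h3 : Associated 2 (τ ^ 2) := by
    obtain ⟨o, rfl⟩ := hω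
    rw [h2, mul_comm]
    exact associated_mul_unit_left _ _ o.isUnit
  obtain ⟨k, hk⟩ := dvd_sq_sub_one hR h2 h.isUnit_α₁
  obtain ⟨A', rfl⟩ := hA
  rw [h3.dvd_iff_dvd_left]
  exact ⟨ω * A' - k - ω ^ 2 * α₂ - ω * x - ω, by
    linear_combination (-1 : R) * h.eq_A - hk + (A' - x - 1) * h2⟩

omit hτ in
theorem IsRamifiedModel.two_dvd_B_sub_one (hω : IsUnit ω) (hA : 2 ∣ A) : 2 ∣ B - 1 := by
  obtain ⟨m, hm⟩ := h.two_dvd_sub_one hR h2 hω hA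
  exact ⟨x ^ 2 + (α₁ ^ 2 + ω ^ 2 * τ ^ 2 * α₂) * x + m * (x + 1) +
    ω ^ 2 * (τ * α₁ * α₃ + ω * τ ^ 2 * α₄), by
    linear_combination h.eq_B + (x + 1) * hm - ω ^ 2 * (τ * α₁ * α₃ + ω * τ ^ 2 * α₄) * h2⟩

/-- B ≡ 1 modulo 2, whereas e² ≡ 1 gives B ≡ s; but s − 1 is not divisible by τ² = (1 + s)². -/
theorem IsRamifiedModel.not_of_sq_eq_neg_one {s e : R} (hω : IsUnit ω) (hs : s ^ 2 = -1)
    (hτs : τ = 1 + s) (hA : A = 2 * τ * e) (hB : B = s * e ^ 2) : False := by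
  obtain ⟨k, hk⟩ := h.two_dvd_B_sub_one hR h2 hω (hA ▸ ⟨τ * e, by ring⟩)
  have he : ¬τ ∣ e := by
    rintro ⟨f, rfl⟩
    exact hτ.prime.not_isUnit (isUnit_of_dvd_one
      ⟨s * τ * f ^ 2 - ω * τ * k, by linear_combination (-1 : R) * hk + hB - k * h2⟩)
  obtain ⟨f, hf⟩ := dvd_sq_sub_one hR h2 (hτ.isUnit _ he)
  refine hτ.prime.not_isUnit (isUnit_of_dvd_one ⟨ω * k - s * f + ω, mul_left_cancel₀
    hτ.prime.ne_zero ?_⟩)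
  linear_combination hτs - s * hf + hk - hB + (1 + k) * h2

end RamifiedModel

section SquareRootNegTwo

variable {R : Type*} [CommRing R] [IsDomain R] {τ : R} (hτ : IsUniformizer τ)
  (hR : ∀ x : R, IsUnit x → τ ∣ x - 1) {α₁ α₂ α₃ α₄ α₆ x A B : R}
  (h : IsRamifiedModel τ (-1) α₁ α₂ α₃ α₄ α₆ x A B) (ht : τ ^ 2 = -2)

include hτ hR h ht

/-- Divided by τ², the cubic equates τα₁α₃x with a sum congruent to x³ + α₃² ≡ 0 modulo τ², although
α₁α₃x is a unit. -/
theorem IsRamifiedModel.not_of_sq_eq_neg_two (hA : A = 0) : False := by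
  have h2 : (2 : R) = -1 * τ ^ 2 := by linear_combination ht
  obtain ⟨m, hm⟩ := h.two_dvd_sub_one hR h2 isUnit_one.neg (hA ▸ dvd_zero _)
  obtain ⟨k, hk⟩ := dvd_sq_sub_one hR h2 h.isUnit_α₃
  have hτ0 := hτ.prime.ne_zero
  have hx : IsUnit (α₁ * α₃ * x) := (h.isUnit_α₁.mul h.isUnit_α₃).mul h.isUnit_x
  have h3 : τ * α₁ * α₃ * x = x ^ 3 + τ ^ 2 * α₄ * x + α₃ ^ 2 + τ ^ 4 * α₆ := by
    refine mul_left_cancel₀ (pow_ne_zero 2 hτ0) ?_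
    linear_combination -h.cubic - x ^ 2 * h.eq_A + x ^ 2 * hA - x ^ 3 * ht
  refine hτ.isUnit_iff.1 hx ⟨-m * (x ^ 2 + x + 1) - 1 + α₄ * x + k + τ ^ 2 * α₆,
    mul_left_cancel₀ hτ0 ?_⟩
  linear_combination h3 + (x ^ 2 + x + 1) * hm + hk + (1 + m * (x ^ 2 + x + 1)) * h2

/-- The equation for B fixes D modulo 2 as 1 + τ. Writing D = 1 + τ + 2n, the cubic then shows that
n(n + 1) is even. -/
theorem IsRamifiedModel.dvd_of_sq_eq_neg_two {D : R} (hA : A = 2 * τ * D) (hB : B = -D ^ 2)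
    (hD : IsUnit D) : 4 ∣ D - (1 + τ) ∨ 4 ∣ D - (-1 + τ) := by
  have h2 : (2 : R) = -1 * τ ^ 2 := by linear_combination ht
  have h20 : (2 : R) ≠ 0 := by
    rw [h2]
    exact mul_ne_zero (by norm_num) (pow_ne_zero 2 hτ.prime.ne_zero)
  obtain ⟨m, hm⟩ := h.two_dvd_sub_one hR h2 isUnit_one.neg (hA ▸ ⟨τ * D, by ring⟩)
  obtain rfl : x = 1 + 2 * m := by linear_combination hm
  obtain ⟨k, hk⟩ := hR _ h.isUnit_α₃
  obtain rfl : α₃ = 1 + τ * k := by linear_combination hk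
  obtain ⟨d, hd⟩ := hR _ hD
  obtain ⟨n, rfl⟩ : ∃ n, D = 1 + τ + 2 * n := by
    -- If D were 1 modulo τ², the equation for B divided by 2 would make 1 a multiple of τ.
    have h3 : ¬τ ∣ d := by
      rintro ⟨e, rfl⟩
      obtain ⟨a, ha⟩ := hR _ h.isUnit_α₁
      obtain rfl : α₁ = 1 + τ * a := by linear_combination ha
      obtain rfl : D = 1 + τ * (τ * e) := by linear_combination hd
      obtain ⟨u, hu⟩ : ∃ u, u = a + e - e ^ 2 + k + 3 * m + 3 * m ^ 2 - α₄ + 2 * e * τ -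
        2 * m * τ + a * k * τ + 4 * e * m * τ := ⟨_, rfl⟩
      refine hτ.prime.not_isUnit (isUnit_of_dvd_one ⟨3 + τ * u, mul_left_cancel₀ h20 ?_⟩)
      rw [hu]
      linear_combination h.eq_B - hB + 2 * (1 + 2 * m) * (hA - h.eq_A) +
        (2*a + 2*e - 2*e^2 + 2*k - 2*α₄ - τ - a*τ^2 + 4*e*τ + e^2*τ^2 - k*τ^2 + α₄*τ^2 +
          2*a*k*τ - a*k*τ^3 + 8*e*m*τ - 2 * (a + e - e ^ 2 + k + 3 * m + 3 * m ^ 2 - α₄ +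
          2 * e * τ - 2 * m * τ + a * k * τ + 4 * e * m * τ)) * ht
    obtain ⟨e, he⟩ := hR _ (hτ.isUnit _ h3)
    exact ⟨-e, by linear_combination hd + τ * he + e * ht⟩
  have h4 : (1 + 2 * m) ^ 3 - 2 * τ * (1 + τ + 2 * n) * (1 + 2 * m) ^ 2 -
      (1 + τ + 2 * n) ^ 2 * (1 + 2 * m) = 2 * ((1 + τ * k) ^ 2 + 4 * α₆) := by
    linear_combination h.cubic + (1 + 2 * m) ^ 2 * (hA - h.eq_A) + (1 + 2 * m) * (h.eq_B - hB) -
      ((1 + τ * k) ^ 2 + α₆ * (τ ^ 4 - 2 * τ ^ 2 + 4)) * ht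
  obtain ⟨w, hw⟩ : ∃ w, w = - k + 2*m + 3*m^2 + m^3 - α₆ - τ - k*m - k*τ - m*n - m*n^2 - 2*m*τ - m^2*τ - n*τ - 3*m*n*τ - 2*m^2*n*τ := ⟨_, rfl⟩
  -- The cubic divided by 4. Modulo τ it gives τ ∣ 1 + m + k, since n² + n vanishes there; fed back,
  -- it gives 2 ∣ n(n + 1).
  have h5 : n ^ 2 + n - ((1 + m + k) ^ 2 + τ * (1 + m + k)) = 2 * w := by
    refine mul_left_cancel₀ (mul_ne_zero h20 h20) ?_
    rw [hw]
    linear_combination (-1 : R) * h4 + (- 3 - 2*k^2 - 10*m - 8*m^2) * ht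
  have h6 : τ ∣ 1 + m + k := by
    refine hτ.prime.dvd_of_dvd_pow (n := 2) ?_
    rcases hτ.dvd_or_dvd_sub_one hR n with ⟨i, rfl⟩ | ⟨i, hi⟩
    · exact ⟨i * (τ * i + 1) - (1 + m + k) + τ * w, by linear_combination -h5 - w * ht⟩
    · exact ⟨n * (i - τ) - (1 + m + k) + τ * w, by
        linear_combination -h5 - w * ht + n * hi + n * ht⟩
  obtain ⟨i, hi⟩ := h6
  have h7 : 2 ∣ n * (n + 1) := by
    refine ⟨w - i ^ 2 - i, ?_⟩
    linear_combination h5 + (1 + m + k + τ * i + τ) * hi + (i ^ 2 + i) * ht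
  have h8 : 2 ∣ n ∨ 2 ∣ n + 1 := by
    rcases hτ.dvd_or_dvd_sub_one hR n with h8 | h8
    · refine .inl ((hτ.isUnit (n + 1) fun h9 => ?_).dvd_mul_right.1 h7)
      exact hτ.prime.not_isUnit (isUnit_of_dvd_one (by simpa using dvd_sub h9 h8))
    · refine .inr ((hτ.isUnit n fun h9 => ?_).dvd_mul_left.1 h7)
      exact hτ.prime.not_isUnit (isUnit_of_dvd_one (by simpa using dvd_sub h9 h8))
  rcases h8 with ⟨l, rfl⟩ | ⟨l, hl⟩
  · exact .inl ⟨l, by ring⟩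
  · exact .inr ⟨l, by linear_combination 2 * hl⟩

end SquareRootNegTwo

section SquareRootNegOne

variable {R : Type*} [CommRing R] [IsDomain R] {τ s : R} (hτ : IsUniformizer τ)
  (hR : ∀ x : R, IsUnit x → τ ∣ x - 1) {α₁ α₂ α₃ α₄ α₆ x A B : R}
  (h : IsRamifiedModel τ (-s) α₁ α₂ α₃ α₄ α₆ x A B) (hs : s ^ 2 = -1) (hτs : τ = 1 + s)

include hτ hR h hs hτs

/-- For A = 0 the cubic becomes x³ + Bx + 2sβ = 0 with β = α₃² + 4α₆. Substituting x = 1 + 2y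
expresses B modulo 8 through β modulo 4, which is ±1, and Q = y(τ + 3y) modulo 2, which is 0 or s;
the four combinations give two classes. -/
theorem IsRamifiedModel.dvd_of_sq_eq_neg_one (hA : A = 0) :
    8 ∣ B - (-1 + 2 * s) ∨ 8 ∣ B - (-1 - 2 * s) := by
  have h2 : (2 : R) = -s * τ ^ 2 := by rw [hτs]; linear_combination (s + 2) * hs
  have hω : IsUnit (-s) := IsUnit.of_mul_eq_one s (by linear_combination -hs)
  have hτ0 := hτ.prime.ne_zero
  obtain ⟨y, hy⟩ := h.two_dvd_sub_one hR h2 hω (hA ▸ dvd_zero _)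
  obtain ⟨k, hk⟩ := hR _ h.isUnit_α₃
  obtain ⟨β, hβ⟩ : ∃ β, β = α₃ ^ 2 + 4 * α₆ := ⟨_, rfl⟩
  obtain ⟨Q, hQ⟩ : ∃ Q, Q = y * (τ + 3 * y) := ⟨_, rfl⟩
  have h3 : x ^ 3 + B * x + 2 * s * β = 0 := by
    rw [hβ]
    have h3 := h.cubic
    have h4 := h.eq_B
    have h5 := h.eq_A
    rw [hτs] at h3 h4 h5
    linear_combination h3 + x ^ 2 * (hA - h5) + x * h4 - (α₃ ^ 2 * (-2*s + 2*s^3 + s^4) +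
      α₆ * (-8*s + 8*s^3 - 8*s^5 + s^6 + 14*s^7 + 14*s^8 + 6*s^9 + s^10)) * hs
  have h4 : (B - (-1 + 2 * s)) * x = -2 * s * (β + 1) - 4 * Q - 8 * y ^ 3 := by
    rw [hQ, hτs]
    linear_combination h3 + (-x ^ 2 - x * (2 * y + 1) - (2 * y + 1) ^ 2 + 1 - 2 * s) * hy
  have h5 : 4 ∣ β - 1 ∨ 4 ∣ β + 1 := by
    rw [hβ, show α₃ = 1 + τ * k by linear_combination hk, hτs]
    rcases hτ.dvd_or_dvd_sub_one hR k with ⟨e, he⟩ | ⟨e, he⟩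
    · left
      rw [he, hτs]
      exact ⟨- e^2 + α₆ + e*s, by
        linear_combination (2*e + 5*e^2 + 4*e^2*s + e^2*s^2) * hs⟩
    · right
      rw [show k = 1 + (1 + s) * e by rw [← hτs]; linear_combination he]
      exact ⟨1 - e - e^2 + s + α₆ + 2*e*s, by
        linear_combination (1 + 8*e + 5*e^2 + 2*e*s + 4*e^2*s + e^2*s^2) * hs⟩
  have h6 : 2 ∣ Q ∨ 2 ∣ Q - s := by
    rw [hQ]
    rcases hτ.dvd_or_dvd_sub_one hR y with ⟨e, he⟩ | ⟨e, he⟩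
    · left
      rw [he, hτs]
      exact ⟨e*s + 3*e^2*s, by linear_combination (e + 3*e^2) * hs⟩
    · right
      rw [show y = 1 + (1 + s) * e by rw [← hτs]; linear_combination he, hτs]
      exact ⟨2 + 3*e + 4*e*s + 3*e^2*s, by linear_combination (e + 3*e^2) * hs⟩
  have h7 : ∀ E, 8 ∣ E * x → 8 ∣ E := fun E hE => h.isUnit_x.dvd_mul_right.1 hE
  rcases h5 with ⟨f, hf⟩ | ⟨f, hf⟩ <;> rcases h6 with ⟨g, hg⟩ | ⟨g, hg⟩
  · refine .inr (h7 _ ⟨-s * f - g - y ^ 3 + s * y, ?_⟩)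
    linear_combination h4 - 2 * s * hf - 4 * hg + 4 * s * hy
  · refine .inl (h7 _ ⟨-s * f - g - y ^ 3 - s, ?_⟩)
    linear_combination h4 - 2 * s * hf - 4 * hg
  · refine .inl (h7 _ ⟨-s * f - g - y ^ 3, ?_⟩)
    linear_combination h4 - 2 * s * hf - 4 * hg
  · refine .inr (h7 _ ⟨-s * f - g - y ^ 3 + s * y, ?_⟩)
    linear_combination h4 - 2 * s * hf - 4 * hg + 4 * s * hy

end SquareRootNegOne

/-! ### From congruences in the localizations to congruences in 𝓞 K. -/

section

variable {K : Type*} [Field K] [NumberField K]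

/-- The inclusion of the ring of integers in its localization at `q`. -/
def integersAtHom (q : HeightOneSpectrum (𝓞 K)) : 𝓞 K →+* integersAt q :=
  (algebraMap (𝓞 K) K).codRestrict _ q.valuation_le_one

theorem coe_integersAtHom (q : HeightOneSpectrum (𝓞 K)) (x : 𝓞 K) :
    (integersAtHom q x : K) = x := rfl

section Ramified

variable (hK : IsImaginaryQuadratic K) {τ ω : 𝓞 K} (hN : Algebra.norm ℤ τ = 2) (hω : IsUnit ω)
  (h2 : 2 = ω * τ ^ 2) {q : HeightOneSpectrum (𝓞 K)} (hq : q.asIdeal = Ideal.span {τ})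

include hK hN hq in
theorem dvd_sub_one_of_isUnit {x : integersAt q} (hx : IsUnit x) : integersAtHom q τ ∣ x - 1 := by
  rw [integer_dvd_iff]
  exact valuation_sub_one_le hK hq hN (integer_isUnit_iff.1 hx)

include hq in
theorem isUniformizer_integersAtHom : IsUniformizer (integersAtHom q τ) :=
  isUniformizer_of_span hq rfl

include h2 in
theorem two_eq_integersAtHom : 2 = integersAtHom q ω * integersAtHom q τ ^ 2 := by
  rw [← map_pow, ← map_mul, ← h2, map_ofNat]

include hω h2 hq in
theorem two_pow_dvd_of_integersAtHom {n : ℕ} {x : 𝓞 K} (h : 2 ^ n ∣ integersAtHom q x) :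
    2 ^ n ∣ x := by
  have h1 : integersAtHom q (τ ^ (2 * n)) ∣ integersAtHom q x := by
    refine Dvd.dvd.trans ⟨integersAtHom q (ω ^ n), ?_⟩ h
    rw [two_eq_integersAtHom h2]
    simp only [map_pow]
    ring
  rw [integer_dvd_iff, coe_integersAtHom, coe_integersAtHom,
    NumberField.RingOfIntegers.coe_eq_algebraMap (τ ^ (2 * n)), map_pow, map_pow] at h1
  have h3 := (valuation_le_span_pow_iff hq x (2 * n)).1 h1
  rw [h2, mul_pow, ← pow_mul]
  exact (hω.pow n).mul_left_dvd.2 h3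

include hK hN hω h2 in
theorem asIdeal_eq_span_of_two_mem [IsPrincipalIdealRing (𝓞 K)] (h : (2 : 𝓞 K) ∈ q.asIdeal) :
    q.asIdeal = Ideal.span {τ} := by
  rw [h2] at h
  refine hK.asIdeal_eq_span hN (q.isPrime.mem_of_pow_mem 2 ?_)
  exact (q.isPrime.mem_or_mem h).resolve_left
    fun h1 => q.isPrime.ne_top (Ideal.eq_top_of_isUnit_mem _ h1 hω)

end Ramified

section

variable {q : HeightOneSpectrum (𝓞 K)}

theorem valuation_two_lt_one (h : (2 : 𝓞 K) ∈ q.asIdeal) : q.valuation K (2 : K) < 1 := by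
  have : q.valuation K (algebraMap (𝓞 K) K 2) < 1 :=
    (HeightOneSpectrum.valuation_lt_one_iff_mem (K := K) q 2).2 h
  rwa [map_ofNat] at this

theorem valuation_four_ne (h : (2 : 𝓞 K) ∈ q.asIdeal) :
    q.valuation K (4 : K) ≠ q.valuation K 256 := by
  rw [show (4 : K) = 2 ^ 2 by norm_num, show (256 : K) = 2 ^ 8 by norm_num, map_pow, map_pow]
  exact (pow_lt_pow_right_of_lt_one₀ (zero_lt_iff.2 ((Valuation.ne_zero_iff _).2 two_ne_zero))
    (valuation_two_lt_one h) (by norm_num)).ne'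

theorem valuation_sixteen_ne (h : (2 : 𝓞 K) ∈ q.asIdeal) : q.valuation K (16 : K) ≠ 1 := by
  rw [show (16 : K) = 2 ^ 4 by norm_num, map_pow]
  exact (pow_lt_one₀ zero_le' (valuation_two_lt_one h) four_ne_zero).ne

theorem valuation_zero_sub_ne (h : (2 : 𝓞 K) ∈ q.asIdeal) (b : 𝓞 K) :
    q.valuation K (0 ^ 2 - 4 * (b : K)) ≠ 1 := by
  rw [zero_pow two_ne_zero, zero_sub, Valuation.map_neg, map_mul,
    show (4 : K) = 2 ^ 2 by norm_num, map_pow]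
  exact (mul_lt_one_of_nonneg_of_lt_one_left zero_le'
    (pow_lt_one₀ zero_le' (valuation_two_lt_one h) two_ne_zero) (q.valuation_le_one b)).ne

theorem valuation_zero_sub_ne' (h : (2 : 𝓞 K) ∈ q.asIdeal) {b : K} (hb : q.valuation K b = 1) :
    q.valuation K (0 ^ 2 - 4 * b) ≠ q.valuation K 256 := by
  rw [zero_pow two_ne_zero, zero_sub, Valuation.map_neg, map_mul, hb, mul_one]
  exact valuation_four_ne h

/-- For a = 0 the number a² − 4b = −4b is not a unit at q, and if b is a unit it does not have the
valuation of 256; no ordinary case is left. -/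
theorem not_hasGoodReductionAt_of_unramified {b τ ω : 𝓞 K} (hω : ω ∉ q.asIdeal) (h2 : 2 = ω * τ)
    (hq : q.asIdeal = Ideal.span {τ}) (hmin : IsMinimalAt q 0 (b : K)) :
    ¬HasGoodReductionAt (curveAB 0 (b : K)) q := by
  intro h
  have h2q : (2 : 𝓞 K) ∈ q.asIdeal := by
    rw [hq, Ideal.mem_span_singleton, h2]
    exact dvd_mul_left _ _
  have hω' : IsUnit (integersAtHom q ω) :=
    integer_isUnit_iff.2 ((HeightOneSpectrum.valuation_eq_one_iff_notMem (K := K) q).2 hω)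
  rcases valuation_of_unramified h hmin (isUniformizer_integersAtHom hq) hω'
    (by rw [← map_mul, ← h2, map_ofNat]) with ⟨-, h3, -⟩ | ⟨h3, h4, -⟩
  · exact valuation_zero_sub_ne h2q b h3
  · exact valuation_zero_sub_ne' h2q h3 h4

theorem exists_isRamifiedModel_of_eq_zero {b τ ω : 𝓞 K} (hω : IsUnit ω) (h2 : 2 = ω * τ ^ 2)
    (hq : q.asIdeal = Ideal.span {τ}) (hmin : IsMinimalAt q 0 (b : K))
    (h : HasGoodReductionAt (curveAB 0 (b : K)) q) :
    q.valuation K (b : K) = 1 ∧ ∃ α₁ α₂ α₃ α₄ α₆ x : integersAt q, IsRamifiedModel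
      (integersAtHom q τ) (integersAtHom q ω) α₁ α₂ α₃ α₄ α₆ x 0 (integersAtHom q b) := by
  have h2q : (2 : 𝓞 K) ∈ q.asIdeal := by
    rw [hq, Ideal.mem_span_singleton, h2]
    exact (dvd_pow_self τ two_ne_zero).mul_left _
  rcases valuation_of_ramified h hmin (isUniformizer_integersAtHom hq) (hω.map _)
    (two_eq_integersAtHom h2) with ⟨-, h3⟩ | ⟨h3, h4⟩ | ⟨h3, -, α₁, α₂, α₃, α₄, α₆, x, A, B, h4, h5, h6⟩
  · exact absurd h3 (valuation_zero_sub_ne h2q b)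
  · exact absurd h4 (valuation_zero_sub_ne' h2q h3)
  · obtain rfl : A = 0 := Subtype.ext h5.symm
    obtain rfl : B = integersAtHom q b := Subtype.ext h6.symm
    exact ⟨h3, _, _, _, _, _, _, h4⟩

end

section SquareRootNegTwo

variable (hK : IsImaginaryQuadratic K) {s : 𝓞 K} (hs : s ^ 2 = -2)
  {q : HeightOneSpectrum (𝓞 K)} (hq : q.asIdeal = Ideal.span {s})

include hK hs

theorem norm_of_sq_eq_neg_two : Algebra.norm ℤ s = 2 := by
  have h1 := hK.norm_intCast (-2)
  push_cast at h1
  rw [← hs, map_pow] at h1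
  nlinarith [hK.norm_nonneg s]

/-- The units are ±1, and s is not divisible by 2; hence the parameter D generates 𝔭. -/
theorem not_dvd_sub_of_sq_eq_neg_two {D : 𝓞 K} (hD : IsUnit D) :
    ¬(4 ∣ D - (1 + s) ∨ 4 ∣ D - (-1 + s)) := by
  have h1 := hK.not_two_dvd_of_norm (norm_of_sq_eq_neg_two hK hs)
  rintro (⟨k, hk⟩ | ⟨k, hk⟩) <;> rcases hK.eq_of_isUnit_of_sq_eq_neg_two hs hD with h2 | h2
  · exact h1 ⟨-2 * k, by linear_combination h2 - hk⟩
  · exact h1 ⟨-2 * k - 1, by linear_combination h2 - hk⟩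
  · exact h1 ⟨-2 * k + 1, by linear_combination h2 - hk⟩
  · exact h1 ⟨-2 * k, by linear_combination h2 - hk⟩

include hq

theorem not_hasGoodReductionAt_of_sq_eq_neg_two {b : 𝓞 K} (hmin : IsMinimalAt q 0 (b : K)) :
    ¬HasGoodReductionAt (curveAB 0 (b : K)) q := by
  intro h
  obtain ⟨-, α₁, α₂, α₃, α₄, α₆, x, h1⟩ := exists_isRamifiedModel_of_eq_zero isUnit_one.neg
    (by linear_combination hs) hq hmin h
  rw [map_neg, map_one] at h1
  exact h1.not_of_sq_eq_neg_two (isUniformizer_integersAtHom hq)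
    (fun x => dvd_sub_one_of_isUnit hK (norm_of_sq_eq_neg_two hK hs) hq)
    (by rw [← map_pow, hs, map_neg, map_ofNat]) rfl

theorem dvd_of_discriminant_eight {D : 𝓞 K} (hD : q.valuation K (D : K) = 1)
    (h : HasGoodReductionAt (curveAB (2 * (D : K) * s) (-(D : K) ^ 2)) q) :
    4 ∣ D - (1 + s) ∨ 4 ∣ D - (-1 + s) := by
  have h2 : (2 : 𝓞 K) = -1 * s ^ 2 := by linear_combination hs
  have h2q : (2 : 𝓞 K) ∈ q.asIdeal := by
    rw [hq, Ideal.mem_span_singleton, h2]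
    exact (dvd_pow_self s two_ne_zero).mul_left _
  have hsK : (s : K) ^ 2 = -2 := by rw [← map_pow, hs, map_neg, map_ofNat]
  have hb : q.valuation K (-(D : K) ^ 2) = 1 := by
    rw [Valuation.map_neg, map_pow, hD, one_pow]
  have hmin : IsMinimalAt q (2 * (D : K) * s) (-(D : K) ^ 2) := by
    refine ⟨?_, hb.le, fun t ht _ h6 => ?_⟩
    · simpa [coe_ofNat_integers] using q.valuation_le_one (K := K) (2 * D * s)
    · rw [hb] at h6
      exact h6.not_gt (pow_lt_one₀ zero_le' ht four_ne_zero)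
  have hτ := isUniformizer_integersAtHom (K := K) hq
  rcases valuation_of_ramified h hmin hτ (isUnit_one.neg.map _)
    (two_eq_integersAtHom h2) with ⟨h3, -⟩ | ⟨-, h3⟩ | ⟨-, -, α₁, α₂, α₃, α₄, α₆, x, A, B, h4, h5, h6⟩
  · exact absurd (h3.symm.trans hb) (valuation_sixteen_ne h2q)
  · rw [show (2 * (D : K) * s) ^ 2 - 4 * -(D : K) ^ 2 = -(4 * D ^ 2) by
      linear_combination (4 * D ^ 2 : K) * hsK, Valuation.map_neg, map_mul, map_pow, hD, one_pow,
      mul_one] at h3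
    exact absurd h3 (valuation_four_ne h2q)
  · rw [map_neg, map_one] at h4
    have hA : A = 2 * integersAtHom q s * integersAtHom q D := by
      refine Subtype.ext (h5.symm.trans ?_)
      simp only [Subring.coe_mul, coe_ofNat_integersAt, coe_integersAtHom]
      ring
    have hB : B = -integersAtHom q D ^ 2 := Subtype.ext h6.symm
    have h7 := h4.dvd_of_sq_eq_neg_two hτ
      (fun x => dvd_sub_one_of_isUnit hK (norm_of_sq_eq_neg_two hK hs) hq)
      (by rw [← map_pow, hs, map_neg, map_ofNat]) hA hB (integer_isUnit_iff.2 hD)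
    rw [show (4 : integersAt q) = 2 ^ 2 by norm_num, show (4 : 𝓞 K) = 2 ^ 2 by norm_num] at *
    refine h7.imp (fun h7 => ?_) (fun h7 => ?_) <;>
    · refine two_pow_dvd_of_integersAtHom isUnit_one.neg h2 hq ?_
      simpa using h7

end SquareRootNegTwo

section SquareRootNegOne

variable (hK : IsImaginaryQuadratic K) {s : 𝓞 K} (hs : s ^ 2 = -1)
  {q : HeightOneSpectrum (𝓞 K)} (hq : q.asIdeal = Ideal.span {1 + s})

include hs

theorem isUnit_neg_of_sq_eq_neg_one : IsUnit (-s) :=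
  IsUnit.of_mul_eq_one s (by linear_combination -hs)

theorem two_eq_of_sq_eq_neg_one : 2 = -s * (1 + s) ^ 2 := by
  linear_combination (s + 2) * hs

include hK

theorem norm_of_sq_eq_neg_one : Algebra.norm ℤ (1 + s) = 2 := by
  have h1 := hK.norm_intCast 2
  push_cast at h1
  rw [two_eq_of_sq_eq_neg_one hs, map_mul, map_pow,
    hK.isUnit_iff_norm.1 (isUnit_neg_of_sq_eq_neg_one hs)] at h1
  nlinarith [hK.norm_nonneg (1 + s)]

include hq

theorem dvd_of_discriminant_four {b : 𝓞 K} (hmin : IsMinimalAt q 0 (b : K))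
    (h : HasGoodReductionAt (curveAB 0 (b : K)) q) :
    8 ∣ b - (-1 + 2 * s) ∨ 8 ∣ b - (-1 - 2 * s) := by
  obtain ⟨-, α₁, α₂, α₃, α₄, α₆, x, h1⟩ := exists_isRamifiedModel_of_eq_zero
    (isUnit_neg_of_sq_eq_neg_one hs) (two_eq_of_sq_eq_neg_one hs) hq hmin h
  rw [map_neg] at h1
  have h7 := h1.dvd_of_sq_eq_neg_one (isUniformizer_integersAtHom hq)
    (fun x => dvd_sub_one_of_isUnit hK (norm_of_sq_eq_neg_one hK hs) hq)
    (by rw [← map_pow, hs, map_neg, map_one]) (by rw [map_add, map_one]) rfl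
  rw [show (8 : integersAt q) = 2 ^ 3 by norm_num] at h7
  rw [show (8 : 𝓞 K) = 2 ^ 3 by norm_num]
  refine h7.imp (fun h7 => ?_) (fun h7 => ?_) <;>
  · refine two_pow_dvd_of_integersAtHom (isUnit_neg_of_sq_eq_neg_one hs)
      (two_eq_of_sq_eq_neg_one hs) hq ?_
    simpa [map_ofNat (integersAtHom q)] using h7

theorem not_isRamifiedModel_of_sq_eq_neg_one {e : 𝓞 K} {α₁ α₂ α₃ α₄ α₆ x : integersAt q}
    {a b : 𝓞 K} (ha : a = 2 * (1 + s) * e) (hb : b = s * e ^ 2) :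
    ¬IsRamifiedModel (integersAtHom q (1 + s)) (integersAtHom q (-s)) α₁ α₂ α₃ α₄ α₆ x
      (integersAtHom q a) (integersAtHom q b) := fun h =>
  h.not_of_sq_eq_neg_one (isUniformizer_integersAtHom hq)
    (fun x => dvd_sub_one_of_isUnit hK (norm_of_sq_eq_neg_one hK hs) hq)
    (two_eq_integersAtHom (two_eq_of_sq_eq_neg_one hs))
    ((isUnit_neg_of_sq_eq_neg_one hs).map _) (s := integersAtHom q s) (e := integersAtHom q e)
    (by rw [← map_pow, hs, map_neg, map_one]) (by rw [map_add, map_one])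
    (by rw [ha]; simp [map_ofNat (integersAtHom q)]) (by rw [hb]; simp)

end SquareRootNegOne

end

/-! ### The conclusions for ℚ(√-2) and ℚ(i). -/

section

variable {K : Type*} [Field K] [NumberField K] (hK : IsImaginaryQuadratic K)

include hK

/-- (2x − t)σ has the nonnegative square 8N − 2t², so it is a rational integer u. Parity forces 2 ∣
t and 4 ∣ u, and x becomes an integral combination of 1 and σ. -/
theorem mem_closure_of_sq_eq_neg_two {s : K} (hs : s ^ 2 = -2) {k : K} (hk : IsIntegral ℤ k) :
    k ∈ Subring.closure {s} := by
  have hsi : IsIntegral ℤ s := 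
    IsIntegral.of_pow two_pos (hs ▸ by simpa using isIntegral_algebraMap (R := ℤ) (A := K) (x := -2))
  obtain ⟨x, rfl⟩ : ∃ x : 𝓞 K, (x : K) = k := ⟨⟨k, hk⟩, rfl⟩
  obtain ⟨σ, rfl⟩ : ∃ x : 𝓞 K, (x : K) = s := ⟨⟨s, hsi⟩, rfl⟩
  have hσ : σ ^ 2 = -2 := by
    refine NumberField.RingOfIntegers.ext ?_
    rw [NumberField.RingOfIntegers.coe_eq_algebraMap, NumberField.RingOfIntegers.coe_eq_algebraMap,
      map_pow, map_neg, coe_ofNat_integers, hs]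
  have h1 := hK.sq_eq_trace_mul_sub_norm x
  have h3 := (hK.trace_sq_le x).1
  generalize Algebra.trace ℤ (𝓞 K) x = t at h1 h3
  generalize Algebra.norm ℤ x = N at h1 h3
  have h4 : ((2 * x - t) * σ) ^ 2 = ((8 * N - 2 * t ^ 2 : ℤ) : 𝓞 K) := by
    push_cast
    linear_combination (2 * x - t) ^ 2 * hσ - 8 * h1
  obtain ⟨m, hm⟩ := hK.exists_rat_of_sq_eq (x := (((2 * x - t) * σ : 𝓞 K) : K))
    (r := (8 * N - 2 * t ^ 2 : ℤ)) (by exact_mod_cast (by linarith : (0 : ℤ) ≤ 8 * N - 2 * t ^ 2))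
    (by rw [← map_pow, h4]; simp [coe_ofNat_integers])
  obtain ⟨u, hu⟩ := hK.exists_int_of_rat hm
  rw [hu] at h4
  have h5 : u ^ 2 = 8 * N - 2 * t ^ 2 := by exact_mod_cast h4
  obtain ⟨v, rfl⟩ : 2 ∣ u := Int.prime_two.dvd_of_dvd_pow (n := 2) ⟨4 * N - t ^ 2, by linarith⟩
  obtain ⟨r, rfl⟩ : 2 ∣ t := Int.prime_two.dvd_of_dvd_pow (n := 2) ⟨2 * N - v ^ 2, by linarith⟩
  obtain ⟨w, rfl⟩ : 2 ∣ v := Int.prime_two.dvd_of_dvd_pow (n := 2) ⟨N - r ^ 2, by linarith⟩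
  have h6 : x = r - w * σ := by
    refine mul_left_cancel₀ (show (4 : 𝓞 K) ≠ 0 by norm_num) ?_
    push_cast at hu
    linear_combination (2 * x - 2 * r) * hσ - σ * hu
  have h7 : algebraMap (𝓞 K) K x = r - w * algebraMap (𝓞 K) K σ := by
    rw [h6, map_sub, map_mul, map_intCast, map_intCast]
  change algebraMap (𝓞 K) K x ∈ _
  rw [h7]
  exact sub_mem (intCast_mem _ _) (mul_mem (intCast_mem _ _) (Subring.subset_closure rfl))

omit hK in
theorem IsMinimalAt.valuation_eq_one_of_odd {a b : K} {q : HeightOneSpectrum (𝓞 K)}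
    (hmin : IsMinimalAt q a b) (h : HasGoodReductionAt (curveAB a b) q)
    (h2 : (2 : 𝓞 K) ∉ q.asIdeal) :
    q.valuation K b = 1 ∧ q.valuation K (a ^ 2 - 4 * b) = 1 := by
  obtain ⟨u, hu, hA, hB, hC⟩ := GoodTwist.valuation_eq_one_of_odd h (valuation_two_of_notMem h2)
  have h1 := hmin.valuation_eq_one hu hA hB.le (.inr hB)
  rw [map_mul, map_pow, h1, one_pow, mul_one] at hB hC
  exact ⟨hB, hC⟩

section

variable {s : 𝓞 K} (hs : s ^ 2 = -1)

include hs

theorem not_dvd_sub_of_sq_eq_neg_one {ε : 𝓞 K} (hε : IsUnit ε) :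
    ¬(4 ∣ ε - (-1 + 2 * s) ∨ 4 ∣ ε - (-1 - 2 * s)) := by
  have h1 := hK.not_two_dvd_of_norm (norm_of_sq_eq_neg_one hK hs)
  rintro (⟨k, hk⟩ | ⟨k, hk⟩) <;>
    rcases hK.eq_of_isUnit_of_sq_eq_neg_one hs hε with rfl | rfl | rfl | rfl
  · exact h1 ⟨k + s, mul_left_cancel₀ two_ne_zero (by linear_combination hk)⟩
  · exact h1 ⟨k * s - k, mul_left_cancel₀ two_ne_zero (by linear_combination (s - 1) * hk + 2 * hs)⟩
  · exact h1 ⟨2 * k + ε, by linear_combination hk⟩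
  · exact h1 ⟨2 * k + 2 * s, by linear_combination hk⟩
  · exact h1 ⟨k, mul_left_cancel₀ two_ne_zero (by linear_combination hk)⟩
  · exact h1 ⟨k - s * k, mul_left_cancel₀ two_ne_zero (by linear_combination (1 - s) * hk + 2 * hs)⟩
  · exact h1 ⟨2 * k - ε, by linear_combination hk⟩
  · exact h1 ⟨2 * k, by linear_combination hk⟩

/-- Odd squares in ℤ[i] are ±1 modulo 4. This excludes an even power of π as the coefficient b,
since no unit satisfies the congruence. -/
theorem dvd_sq_sub_or_of_sq_eq_neg_one {t : 𝓞 K} (ht : ¬(1 + s) ∣ t) :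
    4 ∣ t ^ 2 - 1 ∨ 4 ∣ t ^ 2 + 1 := by
  have hN := norm_of_sq_eq_neg_one hK hs
  obtain ⟨k, hk⟩ := (hK.dvd_or_dvd_sub_one hN t).resolve_left ht
  obtain rfl : t = 1 + (1 + s) * k := by linear_combination hk
  rcases hK.dvd_or_dvd_sub_one hN k with ⟨e, rfl⟩ | ⟨e, he⟩
  · exact .inl ⟨- e^2 + e*s, by linear_combination (2*e + 5*e^2 + 4*e^2*s + e^2*s^2) * hs⟩
  · obtain rfl : k = 1 + (1 + s) * e := by linear_combination he
    exact .inr ⟨1 - e - e^2 + s + 2*e*s, by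
      linear_combination (1 + 8*e + 5*e^2 + 2*e*s + 4*e^2*s + e^2*s^2) * hs⟩

end


variable [IsPrincipalIdealRing (𝓞 K)] {s : 𝓞 K} {p q : HeightOneSpectrum (𝓞 K)}
  {E : WeierstrassCurve K} [E.IsElliptic]
  (h2 : (2 : 𝓞 K) ∉ p.asIdeal) (hgood : ∀ q ≠ p, HasGoodReductionAt E q) 

omit hK  in
/-- The conclusion for `ℚ(√-2)`. -/
def IsSquareRootNegTwoCase (E : WeierstrassCurve K) [E.IsElliptic]
    (p : HeightOneSpectrum (𝓞 K)) : Prop :=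
  ∃ s π : 𝓞 K, s ^ 2 = -2 ∧ p.asIdeal = Ideal.span {π} ∧
    (4 ∣ π - (1 + s) ∨ 4 ∣ π - (-1 + s)) ∧
    conductor E = p.asIdeal ^ 2 ∧
    IsIsomorphic E (curveAB (2 * (π : K) * (s : K)) (-(π : K) ^ 2)) ∧
    (∃ W ∈ isogenyClass256a, IsTwist E (W⁄K)) ∧
    E.j = 20 ^ 3 ∧
    HasCMBy E (Subring.closure {(s : K)})

omit hK  in
/-- The conclusion for `ℚ(√-1)`. -/
def IsSquareRootNegOneCase (E : WeierstrassCurve K) [E.IsElliptic]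
    (p : HeightOneSpectrum (𝓞 K)) : Prop :=
  ∃ s π b : 𝓞 K, s ^ 2 = -1 ∧ p.asIdeal = Ideal.span {π} ∧ (b = π ∨ b = π ^ 3) ∧
    (8 ∣ b - (-1 + 2 * s) ∨ 8 ∣ b - (-1 - 2 * s)) ∧
    conductor E = p.asIdeal ^ 2 ∧
    IsIsomorphic E (curveAB 0 (b : K)) ∧
    (∃ W ∈ isogenyClass64a, IsTwist E (W⁄K)) ∧
    E.j = 12 ^ 3 ∧
    ∃ O : Subring K, IsOrder O ∧ HasCMBy E O

include h2 hgood

theorem isSquareRootNegTwoCase (hs : s ^ 2 = -2) {D : 𝓞 K}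
    (hD : IsUnit D ∨ p.asIdeal = Ideal.span {D})
    (hE : IsIsomorphic E (curveAB (2 * (D : K) * s) (-(D : K) ^ 2))) :
    IsSquareRootNegTwoCase E p := by
  have hs' := (hK.irreducible_of_norm (norm_of_sq_eq_neg_two hK hs)).prime
  have hsp : primeSpan hs' ≠ p := by
    rintro rfl
    refine h2 (Ideal.mem_span_singleton.2 ?_)
    exact ⟨-s, by linear_combination hs⟩
  have h3 := dvd_of_discriminant_eight hK hs (q := primeSpan hs') rfl
    (valuation_eq_one_of_ne hD hsp) (hE.hasGoodReductionAt (hgood _ hsp))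
  have hp := hD.resolve_left fun h => not_dvd_sub_of_sq_eq_neg_two hK hs h h3
  have hv := valuation_span (K := K) hp
  have hD0 : (D : K) ≠ 0 := fun h => by rw [h, map_zero] at hv; exact WithZero.exp_ne_zero hv.symm
  have hsK : (s : K) ^ 2 = -2 := by rw [← map_pow, hs, map_neg, map_ofNat]
  have hj : E.j = 20 ^ 3 := by
    refine j_eq_of_isIsomorphic hE ?_
    rw [show (2 * (D : K) * s) ^ 2 = -8 * D ^ 2 by linear_combination (4 * D ^ 2 : K) * hsK]
    ring
  refine ⟨s, D, hs, hp, h3, conductor_eq_sq h2 hE (neg_ne_zero.2 (pow_ne_zero 2 hD0)) (k := -2) ?_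
    (by norm_num) hgood (j := 20 ^ 3)
    (by rw [hj]; simp [NumberField.RingOfIntegers.coe_eq_algebraMap, coe_ofNat_integers]), hE,
    isTwist_isogenyClass256a hD0 hsK hE, hj,
    hasCMBy_of_discriminant_eight hD0 hsK (fun k => mem_closure_of_sq_eq_neg_two hK hsK) hE⟩
  rw [Valuation.map_neg, map_pow, hv, ← WithZero.exp_nsmul]
  norm_num

/-- b is a unit away from 𝔭, so b = εtᵏ, with k < 4 by minimality. The congruence reduced modulo 4
excludes k = 0 and k = 2. -/
theorem isSquareRootNegOneCase (hs : s ^ 2 = -1) {b : 𝓞 K} (hb0 : b ≠ 0)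
    (hE : IsIsomorphic E (curveAB 0 (b : K))) (hmin : ∀ q, IsMinimalAt q 0 (b : K)) :
    IsSquareRootNegOneCase E p := by
  have hs' := (hK.irreducible_of_norm (norm_of_sq_eq_neg_one hK hs)).prime
  have h2q : (2 : 𝓞 K) ∈ (primeSpan hs').asIdeal := Ideal.mem_span_singleton.2
    ⟨1 - s, by linear_combination hs⟩
  have hsp : primeSpan hs' ≠ p := by
    rintro rfl
    exact h2 h2q
  have h3 := dvd_of_discriminant_four hK hs (q := primeSpan hs') rfl
    (hmin _) (hE.hasGoodReductionAt (hgood _ hsp))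
  have hv1 : ∀ q ≠ p, q.valuation K (b : K) = 1 := by
    intro q hqp
    have hgq := hE.hasGoodReductionAt (hgood q hqp)
    by_cases hq : (2 : 𝓞 K) ∈ q.asIdeal
    · have hu := isUnit_neg_of_sq_eq_neg_one hs
      have h2' := two_eq_of_sq_eq_neg_one hs
      exact (exists_isRamifiedModel_of_eq_zero hu h2' (asIdeal_eq_span_of_two_mem hK
        (norm_of_sq_eq_neg_one hK hs) hu h2' hq) (hmin q) hgq).1
    · exact ((hmin q).valuation_eq_one_of_odd hgq hq).1
  obtain ⟨t, ht, hpt⟩ := exists_prime_span p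
  obtain ⟨k, ε, hk, hε, hb⟩ : ∃ (k : ℕ) (ε : 𝓞 K), k < 4 ∧ IsUnit ε ∧ b = ε * t ^ k := by
    obtain ⟨c, hc, hd⟩ := (FiniteMultiplicity.of_not_isUnit ht.not_isUnit hb0).exists_eq_pow_mul_and_not_dvd
    generalize multiplicity t b = k at hc
    have hv : ∀ q : HeightOneSpectrum (𝓞 K), q.valuation K (b : K) =
        q.valuation K (t : K) ^ k * q.valuation K (c : K) := fun q => by
      rw [← map_pow, ← map_mul, hc]
      simp [NumberField.RingOfIntegers.coe_eq_algebraMap]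
    have hc1 : ∀ q : HeightOneSpectrum (𝓞 K), q.valuation K (c : K) = 1 := by
      intro q
      by_cases hqp : q = p
      · rw [hqp, HeightOneSpectrum.valuation_eq_one_iff_notMem, hpt, Ideal.mem_span_singleton]
        exact hd
      · rw [← hv1 q hqp, hv, valuation_eq_one_of_ne (.inr hpt) hqp, one_pow, one_mul]
    have hc0 : (c : K) ≠ 0 := fun h0 => by
      have := hc1 p
      rw [h0, map_zero] at this
      exact zero_ne_one this
    obtain ⟨ε, hε, hεc⟩ := exists_unit_of_valuation hc0 hc1
    obtain rfl : ε = c := NumberField.RingOfIntegers.ext hεc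
    refine ⟨k, ε, ?_, hε, by rw [hc, mul_comm]⟩
    by_contra! hk
    have ht1 : p.valuation K (t : K) < 1 := by
      rw [valuation_span hpt, ← WithZero.exp_zero, WithZero.exp_lt_exp]
      norm_num
    refine (hmin p).minimal t ht1 (by rw [map_zero]; exact zero_le') ?_
    rw [hv, hc1, mul_one]
    exact pow_le_pow_right_of_le_one' ht1.le hk
  have hk2 : k = 1 ∨ k = 3 := by
    have h4 : 4 ∣ b - (-1 + 2 * s) ∨ 4 ∣ b - (-1 - 2 * s) :=
      h3.imp (fun h => Dvd.dvd.trans ⟨2, by norm_num⟩ h) (fun h => Dvd.dvd.trans ⟨2, by norm_num⟩ h)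
    have ht' : ¬(1 + s) ∣ t := fun h => by
      have := valuation_eq_one_of_ne (K := K) (.inr hpt) hsp
      rw [HeightOneSpectrum.valuation_eq_one_iff_notMem] at this
      exact this (Ideal.mem_span_singleton.2 h)
    interval_cases k
    · rw [hb, pow_zero, mul_one] at h4
      exact absurd h4 (not_dvd_sub_of_sq_eq_neg_one hK hs hε)
    · exact .inl rfl
    · exfalso
      rcases dvd_sq_sub_or_of_sq_eq_neg_one hK hs ht' with ⟨l, hl⟩ | ⟨l, hl⟩
      · refine not_dvd_sub_of_sq_eq_neg_one hK hs hε (h4.imp ?_ ?_) <;>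
        · rintro ⟨m, hm⟩
          exact ⟨m - ε * l, by linear_combination hm - hb - ε * hl⟩
      · refine not_dvd_sub_of_sq_eq_neg_one hK hs hε.neg (h4.imp ?_ ?_) <;>
        · rintro ⟨m, hm⟩
          exact ⟨m - ε * l, by linear_combination hm - hb - ε * hl⟩
    · exact .inr rfl
  obtain ⟨π, hπ, hbπ⟩ : ∃ π, p.asIdeal = Ideal.span {π} ∧ (b = π ∨ b = π ^ 3) := by
    rcases hk2 with rfl | rfl
    · refine ⟨ε * t, ?_, .inl (by rw [hb, pow_one])⟩
      rw [hpt, Ideal.span_singleton_mul_left_unit hε]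
    -- As ε⁴ = 1, the unit is absorbed by εt³ = (ε³t)³.
    · refine ⟨ε ^ 3 * t, ?_, .inr ?_⟩
      · rw [hpt, Ideal.span_singleton_mul_left_unit (hε.pow 3)]
      · have h4 : ε ^ 4 = 1 := by
          rcases hK.eq_of_isUnit_of_sq_eq_neg_one hs hε with rfl | rfl | rfl | rfl
          · norm_num
          · norm_num
          · linear_combination (ε ^ 2 - 1) * hs
          · linear_combination (s ^ 2 - 1) * hs
        rw [hb]
        linear_combination (-ε * t ^ 3 * (ε ^ 4 + 1)) * h4
  have hsK : (s : K) ^ 2 = -1 := by rw [← map_pow, hs, map_neg, map_one]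
  have hb0' : (b : K) ≠ 0 := by simpa using hb0
  have hj : E.j = 12 ^ 3 := by
    refine j_eq_of_isIsomorphic hE ?_
    ring
  have hv := valuation_span (K := K) hπ
  obtain ⟨m, hm, hm4⟩ : ∃ m : ℤ, p.valuation K (b : K) = WithZero.exp m ∧ ¬4 ∣ m := by
    rcases hbπ with rfl | rfl
    · exact ⟨-1, hv, by norm_num⟩
    · refine ⟨-3, ?_, by norm_num⟩
      rw [NumberField.RingOfIntegers.coe_eq_algebraMap, map_pow, map_pow, hv, ← WithZero.exp_nsmul]
      norm_num
  exact ⟨s, π, b, hs, hπ, hbπ, h3, conductor_eq_sq h2 hE hb0' hm hm4 hgood (j := 12 ^ 3)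
    (by rw [hj]; simp [NumberField.RingOfIntegers.coe_eq_algebraMap, coe_ofNat_integers]), hE,
    isTwist_isogenyClass64a hb0' hE, hj, exists_order_of_discriminant_four hK.finrank_eq hb0' hsK hE⟩

end

/-! ### The coefficients up to units, and reduction to the unit equations. -/

section

variable {K : Type*} [Field K] [NumberField K] (hK : IsImaginaryQuadratic K)
  [IsPrincipalIdealRing (𝓞 K)] {p q : HeightOneSpectrum (𝓞 K)}

include p in
theorem exists_unit_mul_of_valuation_eq {x y : 𝓞 K} (hy : y ≠ 0)
    (h : ∀ q : HeightOneSpectrum (𝓞 K), q.valuation K (x : K) = q.valuation K (y : K)) :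
    ∃ ε : 𝓞 K, IsUnit ε ∧ x = ε * y := by
  have hy0 : (y : K) ≠ 0 := by simpa using hy
  have hx0 : (x : K) ≠ 0 := fun hx => by
    have h1 := h p
    rw [hx, map_zero, eq_comm, Valuation.zero_iff] at h1
    exact hy0 h1
  obtain ⟨ε, hε, h1⟩ := exists_unit_of_valuation (x := (x : K) / y) (div_ne_zero hx0 hy0)
    fun q => by rw [map_div₀, h, div_self ((Valuation.ne_zero_iff _).2 hy0)]
  refine ⟨ε, hε, NumberField.RingOfIntegers.ext ?_⟩
  change algebraMap (𝓞 K) K x = algebraMap (𝓞 K) K (ε * y)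
  rw [map_mul]
  exact ((eq_div_iff hy0).1 h1).symm

theorem span_of_two_mem (hq : (2 : 𝓞 K) ∈ q.asIdeal) {τ σ : 𝓞 K} (hτ : Prime τ) (hσ : Prime σ)
    (h2 : 2 = σ * τ) : q = primeSpan hτ ∨ q = primeSpan hσ := by
  have key : ∀ {t : 𝓞 K} (ht : Prime t), t ∈ q.asIdeal → q = primeSpan ht := by
    intro t ht h
    refine HeightOneSpectrum.ext (((primeSpan ht).isMaximal.eq_of_le q.isPrime.ne_top ?_).symm)
    exact (Ideal.span_singleton_le_iff_mem _).2 h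
  rw [h2] at hq
  exact (q.isPrime.mem_or_mem hq).symm.imp (key hτ) (key hσ)

section

variable {δ a b : 𝓞 K} {E : WeierstrassCurve K} [E.IsElliptic] (h2p : (2 : 𝓞 K) ∉ p.asIdeal)
  (hgood : ∀ q ≠ p, HasGoodReductionAt E q) (hδ : IsUnit δ ∨ p.asIdeal = Ideal.span {δ})
  (hE : IsIsomorphic E (curveAB ((δ * a : 𝓞 K) : K) ((δ ^ 2 * b : 𝓞 K) : K)))
  (hmin : ∀ q, IsMinimalAt q ((δ * a : 𝓞 K) : K) ((δ ^ 2 * b : 𝓞 K) : K))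
  (hb : p.valuation K (b : K) = 1) (hc : p.valuation K ((a ^ 2 - 4 * b : 𝓞 K) : K) = 1)

theorem coe_discriminant (x y : 𝓞 K) : (x : K) ^ 2 - 4 * (y : K) = (x ^ 2 - 4 * y : 𝓞 K) := by
  simp [NumberField.RingOfIntegers.coe_eq_algebraMap, coe_ofNat_integers]

include hδ

theorem valuation_twist (hqp : q ≠ p) :
    q.valuation K ((δ ^ 2 * b : 𝓞 K) : K) = q.valuation K (b : K) ∧
    q.valuation K (((δ * a : 𝓞 K) : K) ^ 2 - 4 * ((δ ^ 2 * b : 𝓞 K) : K)) =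
      q.valuation K ((a ^ 2 - 4 * b : 𝓞 K) : K) := by
  have h1 := valuation_eq_one_of_ne (K := K) hδ hqp
  have key : ∀ x : 𝓞 K, q.valuation K ((δ ^ 2 * x : 𝓞 K) : K) = q.valuation K (x : K) := by
    intro x
    rw [NumberField.RingOfIntegers.coe_eq_algebraMap, map_mul, map_pow, map_mul, map_pow, h1,
      one_pow, one_mul]
  rw [coe_discriminant, show (δ * a) ^ 2 - 4 * (δ ^ 2 * b) = δ ^ 2 * (a ^ 2 - 4 * b) by ring]
  exact ⟨key _, key _⟩

include hgood hE hmin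

theorem valuation_of_unramified_twist (hqp : q ≠ p) {τ ω : 𝓞 K} (hω : ω ∉ q.asIdeal)
    (h2 : 2 = ω * τ) (hq : q.asIdeal = Ideal.span {τ}) :
    (q.valuation K (b : K) = q.valuation K (16 : K) ∧
      q.valuation K ((a ^ 2 - 4 * b : 𝓞 K) : K) = 1) ∨
    (q.valuation K (b : K) = 1 ∧
      q.valuation K ((a ^ 2 - 4 * b : 𝓞 K) : K) = q.valuation K (256 : K)) := by
  have hω' : IsUnit (integersAtHom q ω) :=
    integer_isUnit_iff.2 ((HeightOneSpectrum.valuation_eq_one_iff_notMem (K := K) q).2 hω)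
  rw [← (valuation_twist (b := b) (a := a) hδ hqp).1, ← (valuation_twist hδ hqp).2]
  rcases valuation_of_unramified (hE.hasGoodReductionAt (hgood q hqp)) (hmin q)
    (isUniformizer_integersAtHom hq) hω'
    (by rw [← map_mul, ← h2, map_ofNat]) with ⟨h3, h4, -⟩ | ⟨h3, h4, -⟩
  · exact .inl ⟨h3, h4⟩
  · exact .inr ⟨h3, h4⟩

theorem valuation_of_ramified_twist (hqp : q ≠ p) {τ ω : 𝓞 K} (hω : IsUnit ω)
    (h2 : 2 = ω * τ ^ 2) (hq : q.asIdeal = Ideal.span {τ}) :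
    (q.valuation K (b : K) = q.valuation K (16 : K) ∧
      q.valuation K ((a ^ 2 - 4 * b : 𝓞 K) : K) = 1) ∨
    (q.valuation K (b : K) = 1 ∧
      q.valuation K ((a ^ 2 - 4 * b : 𝓞 K) : K) = q.valuation K (256 : K)) ∨
    (q.valuation K (b : K) = 1 ∧
      q.valuation K ((a ^ 2 - 4 * b : 𝓞 K) : K) = q.valuation K (4 : K) ∧
      ∃ α₁ α₂ α₃ α₄ α₆ x : integersAt q, IsRamifiedModel
        (integersAtHom q τ) (integersAtHom q ω) α₁ α₂ α₃ α₄ α₆ x (integersAtHom q (δ * a))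
          (integersAtHom q (δ ^ 2 * b))) := by
  rw [← (valuation_twist (b := b) (a := a) hδ hqp).1, ← (valuation_twist hδ hqp).2]
  rcases valuation_of_ramified (hE.hasGoodReductionAt (hgood q hqp)) (hmin q)
    (isUniformizer_integersAtHom hq) (hω.map _) (two_eq_integersAtHom h2) with
    h3 | h3 | ⟨h3, h4, α₁, α₂, α₃, α₄, α₆, x, A, B, h5, h6, h7⟩
  · exact .inl h3
  · exact .inr (.inl h3)
  · obtain rfl : A = integersAtHom q (δ * a) := Subtype.ext h6.symm
    obtain rfl : B = integersAtHom q (δ ^ 2 * b) := Subtype.ext h7.symm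
    exact .inr (.inr ⟨h3, h4, _, _, _, _, _, _, h5⟩)

include hb hc

theorem valuation_of_two_notMem (hq : (2 : 𝓞 K) ∉ q.asIdeal) :
    q.valuation K (b : K) = 1 ∧ q.valuation K ((a ^ 2 - 4 * b : 𝓞 K) : K) = 1 := by
  by_cases hqp : q = p
  · rw [hqp]
    exact ⟨hb, hc⟩
  · rw [← (valuation_twist (b := b) (a := a) hδ hqp).1, ← (valuation_twist hδ hqp).2]
    exact (hmin q).valuation_eq_one_of_odd (hE.hasGoodReductionAt (hgood q hqp)) hq

include p in
omit hgood hE hmin hb hc hδ in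
theorem eq_of_valuation {n : ℕ} {x : 𝓞 K}
    (h : ∀ q : HeightOneSpectrum (𝓞 K), (2 : 𝓞 K) ∉ q.asIdeal → q.valuation K (x : K) = 1)
    (h' : ∀ q : HeightOneSpectrum (𝓞 K), (2 : 𝓞 K) ∈ q.asIdeal →
      q.valuation K (x : K) = q.valuation K (2 : K) ^ n) :
    ∃ ε : 𝓞 K, IsUnit ε ∧ x = ε * 2 ^ n := by
  refine exists_unit_mul_of_valuation_eq (p := p) (pow_ne_zero n two_ne_zero) fun q => ?_
  rw [NumberField.RingOfIntegers.coe_eq_algebraMap (2 ^ n), map_pow, map_pow, coe_ofNat_integers]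
  by_cases hq : (2 : 𝓞 K) ∈ q.asIdeal
  · exact h' q hq
  · rw [h q hq, valuation_two_of_notMem hq, one_pow]

omit hgood hE hmin hb hc in
theorem isUnit_or_span_mul {ν : 𝓞 K} (hν : IsUnit ν) :
    IsUnit (ν * δ) ∨ p.asIdeal = Ideal.span {ν * δ} :=
  hδ.imp hν.mul fun h => by rw [h, Ideal.span_singleton_mul_left_unit hν]

include hK h2p

/-- Globally b = 16η and a² − 4b = ε, so a² = ε + 64η. -/
theorem isSquareRootNegSevenCase_of_left (h : ∀ q : HeightOneSpectrum (𝓞 K),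
    (2 : 𝓞 K) ∈ q.asIdeal → q.valuation K (b : K) = q.valuation K (16 : K) ∧
      q.valuation K ((a ^ 2 - 4 * b : 𝓞 K) : K) = 1) : IsSquareRootNegSevenCase E p := by
  have h0 := fun q => valuation_of_two_notMem hgood hδ hE hmin hb hc (q := q)
  obtain ⟨η, hη, h1⟩ := eq_of_valuation (p := p) (n := 4) (fun q hq => (h0 q hq).1) fun q hq => by
    rw [(h q hq).1, ← map_pow]
    norm_num
  obtain ⟨ε, hε, h3⟩ := eq_of_valuation (p := p) (n := 0) (fun q hq => (h0 q hq).2) fun q hq => by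
    rw [(h q hq).2, pow_zero]
  obtain ⟨s, ν, hs, hν, h4, h5, h6⟩ := hK.exists_of_sq_eq_add (a := a) hε hη
    (by linear_combination h3 + 4 * h1)
  refine isSquareRootNegSevenCase_of_discriminant_seven hK (s := -s) (by rw [neg_sq, hs]) h2p hgood
    (isUnit_or_span_mul hδ hν) ?_
  convert hE using 2
  · rw [h4]
    simp [NumberField.RingOfIntegers.coe_eq_algebraMap, coe_ofNat_integers]
    ring
  · rw [h1, h5]
    simp [NumberField.RingOfIntegers.coe_eq_algebraMap, coe_ofNat_integers]
    ring

omit hgood hE hmin hb hc hδ hK h2p in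
theorem exists_two_mul_of_sq {x y : 𝓞 K} (h : x ^ 2 = 4 * y) : ∃ z, x = 2 * z ∧ z ^ 2 = y := by
  obtain ⟨z, rfl⟩ : 2 ∣ x := by
    rw [← IsIntegrallyClosed.pow_dvd_pow_iff two_ne_zero]
    exact ⟨y, by linear_combination h⟩
  exact ⟨z, rfl, mul_left_cancel₀ (show (4 : 𝓞 K) ≠ 0 by norm_num) (by linear_combination h)⟩

/-- Globally b = ε and a² − 4b = 256η, so a = 2a' with a'² = ε + 64η. -/
theorem isSquareRootNegSevenCase_of_right (h : ∀ q : HeightOneSpectrum (𝓞 K),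
    (2 : 𝓞 K) ∈ q.asIdeal → q.valuation K (b : K) = 1 ∧
      q.valuation K ((a ^ 2 - 4 * b : 𝓞 K) : K) = q.valuation K (256 : K)) :
    IsSquareRootNegSevenCase E p := by
  have h0 := fun q => valuation_of_two_notMem hgood hδ hE hmin hb hc (q := q)
  obtain ⟨ε, hε, h1⟩ := eq_of_valuation (p := p) (n := 0) (fun q hq => (h0 q hq).1) fun q hq => by
    rw [(h q hq).1, pow_zero]
  obtain ⟨η, hη, h3⟩ := eq_of_valuation (p := p) (n := 8) (fun q hq => (h0 q hq).2) fun q hq => by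
    rw [(h q hq).2, ← map_pow]
    norm_num
  obtain ⟨a, rfl, ha⟩ := exists_two_mul_of_sq (x := a) (y := ε + 64 * η)
    (by linear_combination h3 + 4 * h1)
  obtain ⟨s, ν, hs, hν, h4, h5, h6⟩ := hK.exists_of_sq_eq_add (a := a) hε hη ha
  refine isSquareRootNegSevenCase_of_discriminant_twentyEight hK (s := s) hs h2p hgood
    (isUnit_or_span_mul hδ hν) ?_
  convert hE using 2
  · rw [h4]
    simp [NumberField.RingOfIntegers.coe_eq_algebraMap, coe_ofNat_integers]
    ring
  · rw [h1, h6]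
    simp [NumberField.RingOfIntegers.coe_eq_algebraMap, coe_ofNat_integers]
    ring

/-- Globally b = ετ⁴ and a² − 4b = ησ⁸. The solution is the curve of
`isSquareRootNegSevenCase_of_left` with another point of order two at the origin. -/
theorem isSquareRootNegSevenCase_of_mixed {τ σ : 𝓞 K} (hτ : Prime τ) (hσ : Prime σ)
    (h2 : 2 = τ * σ) (hτσ : ¬τ ∣ σ) (hστ : ¬σ ∣ τ) (hN : Algebra.norm ℤ τ = 2)
    (hτb : (primeSpan hτ).valuation K (b : K) = (primeSpan hτ).valuation K (16 : K))
    (hτc : (primeSpan hτ).valuation K ((a ^ 2 - 4 * b : 𝓞 K) : K) = 1)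
    (hσb : (primeSpan hσ).valuation K (b : K) = 1)
    (hσc : (primeSpan hσ).valuation K ((a ^ 2 - 4 * b : 𝓞 K) : K) =
      (primeSpan hσ).valuation K (256 : K)) :
    IsSquareRootNegSevenCase E p := by
  have h0 := fun q => valuation_of_two_notMem hgood hδ hE hmin hb hc (q := q)
  have hne : primeSpan hτ ≠ primeSpan hσ := fun h => by
    have : Ideal.span {τ} = Ideal.span {σ} := congrArg HeightOneSpectrum.asIdeal h
    exact hτσ (Ideal.mem_span_singleton.1 (this ▸ Ideal.mem_span_singleton_self σ))
  have hτ1 : ∀ q ≠ primeSpan hτ, q.valuation K (τ : K) = 1 := fun q hq =>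
    valuation_eq_one_of_ne (p := primeSpan hτ) (.inr rfl) hq
  have hσ1 : ∀ q ≠ primeSpan hσ, q.valuation K (σ : K) = 1 := fun q hq =>
    valuation_eq_one_of_ne (p := primeSpan hσ) (.inr rfl) hq
  have h2K : (2 : K) = τ * σ := by
    rw [← coe_ofNat_integers, h2, map_mul]
  have h2τ : (primeSpan hτ).valuation K (2 : K) = (primeSpan hτ).valuation K (τ : K) := by
    rw [h2K, map_mul, hσ1 _ hne, mul_one]
  have h2σ : (primeSpan hσ).valuation K (2 : K) = (primeSpan hσ).valuation K (σ : K) := by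
    rw [h2K, map_mul, hτ1 _ hne.symm, one_mul]
  have hnot : ∀ q, q ≠ primeSpan hτ → q ≠ primeSpan hσ → (2 : 𝓞 K) ∉ q.asIdeal := fun q h3 h4 h5 =>
    (span_of_two_mem h5 hτ hσ (by rw [h2, mul_comm])).elim h3 h4
  obtain ⟨ε, hε, h1⟩ := exists_unit_mul_of_valuation_eq (p := p) (x := b) (y := τ ^ 4)
    (pow_ne_zero 4 hτ.ne_zero) fun q => by
      rw [NumberField.RingOfIntegers.coe_eq_algebraMap (τ ^ 4), map_pow, map_pow]
      by_cases h3 : q = primeSpan hτ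
      · rw [h3, hτb, ← h2τ, ← map_pow]
        norm_num
      · rw [hτ1 q h3, one_pow]
        by_cases h4 : q = primeSpan hσ
        · rw [h4, hσb]
        · exact (h0 q (hnot q h3 h4)).1
  obtain ⟨η, hη, h3⟩ := exists_unit_mul_of_valuation_eq (p := p) (x := a ^ 2 - 4 * b) (y := σ ^ 8)
    (pow_ne_zero 8 hσ.ne_zero) fun q => by
      rw [NumberField.RingOfIntegers.coe_eq_algebraMap (σ ^ 8), map_pow, map_pow]
      by_cases h3 : q = primeSpan hσ
      · rw [h3, hσc, ← h2σ, ← map_pow]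
        norm_num
      · rw [hσ1 q h3, one_pow]
        by_cases h4 : q = primeSpan hτ
        · rw [h4, hτc]
        · exact (h0 q (hnot q h4 h3)).2
  obtain ⟨s, d, hs, hd, h4, h5⟩ := hK.exists_of_mixed hτ hσ h2 hτσ hστ hN hε hη h1 h3
  have h4K : 2 * (a : K) = 3 * d * (1 - s) := by
    have := congrArg (algebraMap (𝓞 K) K) h4
    simpa [NumberField.RingOfIntegers.coe_eq_algebraMap, coe_ofNat_integers] using this
  have h5K : 2 * (b : K) = d ^ 2 * (1 - 3 * s) := by
    have := congrArg (algebraMap (𝓞 K) K) h5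
    simpa [NumberField.RingOfIntegers.coe_eq_algebraMap, coe_ofNat_integers] using this
  have hsK := coe_sq_eq_neg_seven hK hs
  have ha' : (a : K) = 3 * d * (1 - s) / 2 := by linear_combination h4K / 2
  have hb' : (b : K) = d ^ 2 * (1 - 3 * s) / 2 := by linear_combination h5K / 2
  refine isSquareRootNegSevenCase_of_discriminant_seven hK (s := -s) (by rw [neg_sq, hs]) h2p hgood
    (isUnit_or_span_mul hδ hd) (hE.trans ?_)
  -- r is the abscissa of the point of order two that has to be moved to the origin.
  refine isIsomorphic_curveAB (u := 1) (r := -(1 - 3 * (s : K)) / 2 * (d * δ)) one_ne_zero rfl rfl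
    ?_ ?_ ?_ <;>
  simp only [curveAB, NumberField.RingOfIntegers.coe_eq_algebraMap, map_mul, map_pow, map_neg] <;>
  rw [← NumberField.RingOfIntegers.coe_eq_algebraMap a, ha'] <;>
  try rw [← NumberField.RingOfIntegers.coe_eq_algebraMap b, hb']
  · ring
  · ring
  · linear_combination (-9 / 4 * (d * δ) ^ 2 : K) * hsK

end

end

/-! ### The supersingular equations and the distribution of cases. -/

theorem ne_zero_of_isIsomorphic {F : Type*} [Field F] {E : WeierstrassCurve F} [E.IsElliptic]
    {a b : F} (hE : IsIsomorphic E (curveAB a b)) : b ≠ 0 := by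
  obtain ⟨C, hC⟩ := hE
  have h := (C • E).isUnit_Δ.ne_zero
  rw [hC] at h
  rintro rfl
  exact h (by simp [curveAB, WeierstrassCurve.Δ, WeierstrassCurve.b₄, WeierstrassCurve.b₆,
    WeierstrassCurve.b₈])

section

variable {K : Type*} [Field K] [NumberField K] (hK : IsImaginaryQuadratic K)

include hK

/-- Squares which are sums of two units in `ℤ[i]`. -/
theorem exists_of_sq_eq_add_of_sq_eq_neg_one {s : 𝓞 K} (hs : s ^ 2 = -1) {a ε η : 𝓞 K}
    (hε : IsUnit ε) (hη : IsUnit η) (h : a ^ 2 = ε + η) :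
    a = 0 ∨ ∃ e, a = (1 + s) * e ∧ ε = s * e ^ 2 := by
  -- Among the sums of two fourth roots of unity, ±1 ± i have norm 2 and are not squares, and ±2
  -- would give √2. What remains is 0 and ±2i, and 2i = (1 + i)².
  have h1 : ∀ x : 𝓞 K, Algebra.norm ℤ x = 2 → a ^ 2 ≠ x := by
    rintro x hx rfl
    rw [map_pow] at hx
    have h2 := hK.norm_nonneg a
    have h3 : Algebra.norm ℤ a < 2 := by nlinarith
    generalize Algebra.norm ℤ a = n at *
    interval_cases n <;> omega
  have hN := norm_of_sq_eq_neg_one hK hs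
  have hN' := norm_of_sq_eq_neg_one hK (s := -s) (by rw [neg_sq, hs])
  have hneg : ∀ x : 𝓞 K, Algebra.norm ℤ (-x) = Algebra.norm ℤ x := fun x => by
    have := hK.norm_intCast (-1)
    push_cast at this
    rw [← neg_one_mul, map_mul, this]
    ring
  have h2 := hK.sq_ne_natCast_integer (n := 2) (not_isSquare_of_lt 1)
  have h3 : ∀ u, a ^ 2 = (u * (1 + s)) ^ 2 → ε = s * u ^ 2 →
      ∃ e, a = (1 + s) * e ∧ ε = s * e ^ 2 := by
    intro u hu hε
    rcases sq_eq_sq_iff_eq_or_eq_neg.1 hu with h4 | h4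
    · exact ⟨u, by rw [h4, mul_comm], hε⟩
    · exact ⟨-u, by rw [h4]; ring, by rw [hε]; ring⟩
  have h0 : a ^ 2 = 0 → a = 0 := fun h => pow_eq_zero_iff two_ne_zero |>.1 h
  rcases hK.eq_of_isUnit_of_sq_eq_neg_one hs hε with h4 | h4 | h4 | h4 <;>
    rcases hK.eq_of_isUnit_of_sq_eq_neg_one hs hη with h5 | h5 | h5 | h5 <;> rw [h4, h5] at h
  · exact absurd (by push_cast; linear_combination h) (h2 a)
  · exact .inl (h0 (by linear_combination h))
  · exact absurd h (h1 _ hN)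
  · exact absurd h (h1 _ hN')
  · exact .inl (h0 (by linear_combination h))
  · exact absurd (by push_cast; linear_combination s ^ 2 * h - 2 * hs) (h2 (s * a))
  · exact absurd h (h1 _ (by rw [← hneg, ← hN']; congr 1; ring))
  · exact absurd h (h1 _ (by rw [← hneg, ← hN]; congr 1; ring))
  · exact absurd h (h1 _ (by rw [← hN]; congr 1; ring))
  · exact absurd h (h1 _ (by rw [← hneg, ← hN']; congr 1; ring))
  · exact .inr (h3 1 (by linear_combination h - hs) (by rw [h4]; ring))
  · exact .inl (h0 (by linear_combination h))
  · exact absurd h (h1 _ (by rw [← hN']; congr 1; ring))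
  · exact absurd h (h1 _ (by rw [← hneg, ← hN]; congr 1; ring))
  · exact .inl (h0 (by linear_combination h))
  · exact .inr (h3 s (by linear_combination h - (s + 1) ^ 2 * hs + hs)
      (by rw [h4]; linear_combination (-s) * hs))

theorem exists_of_sq_eq_add_of_sq_eq_neg_two {s : 𝓞 K} (hs : s ^ 2 = -2) {a ε η : 𝓞 K}
    (hε : IsUnit ε) (hη : IsUnit η) (h : a ^ 2 = ε + η) : a = 0 ∨ ε = -1 ∧ (a = s ∨ a = -s) := by
  have h2 := hK.sq_ne_natCast_integer (n := 2) (not_isSquare_of_lt 1)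
  have h0 : a ^ 2 = 0 → a = 0 := fun h => pow_eq_zero_iff two_ne_zero |>.1 h
  rcases hK.eq_of_isUnit_of_sq_eq_neg_two hs hε with h4 | h4 <;>
    rcases hK.eq_of_isUnit_of_sq_eq_neg_two hs hη with h5 | h5 <;> rw [h4, h5] at h
  · exact absurd (by push_cast; linear_combination h) (h2 a)
  · exact .inl (h0 (by linear_combination h))
  · exact .inl (h0 (by linear_combination h))
  · exact .inr ⟨h4, sq_eq_sq_iff_eq_or_eq_neg.1 (by linear_combination h - hs)⟩

variable [IsPrincipalIdealRing (𝓞 K)] {p : HeightOneSpectrum (𝓞 K)} {δ a b : 𝓞 K}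
  {E : WeierstrassCurve K} [E.IsElliptic] (h2p : (2 : 𝓞 K) ∉ p.asIdeal)
  (hgood : ∀ q ≠ p, HasGoodReductionAt E q)

include h2p hgood

/-- The unramified primes above 2 exclude 2 inert or split; in the ramified case the field is ℚ(i)
or ℚ(√-2), and the latter is excluded by `not_hasGoodReductionAt_of_sq_eq_neg_two`. -/
theorem isSquareRootNegOneCase_of_eq_zero (hb : b ≠ 0) (hE : IsIsomorphic E (curveAB 0 (b : K)))
    (hmin : ∀ q, IsMinimalAt q 0 (b : K)) : IsSquareRootNegOneCase E p := by
  have hne : ∀ q : HeightOneSpectrum (𝓞 K), (2 : 𝓞 K) ∈ q.asIdeal → q ≠ p := by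
    rintro q hq rfl
    exact h2p hq
  have hE' := fun q hq => hE.hasGoodReductionAt (hgood q (hne q hq))
  rcases hK.factorization_two with h2 | ⟨τ, ω, hτ, hω, h2, hN⟩ | ⟨τ, σ, hτ, hσ, h2, h3, h4, -⟩
  · exact absurd (hE' (primeSpan h2) (Ideal.mem_span_singleton_self _))
      (not_hasGoodReductionAt_of_unramified (ω := 1)
        (fun h => (primeSpan h2).isPrime.ne_top (Ideal.eq_top_of_isUnit_mem _ h isUnit_one))
        (one_mul _).symm rfl (hmin _))
  · obtain ⟨s, hs | hs⟩ := hK.sq_eq_of_ramified hω h2 hN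
    · exact isSquareRootNegOneCase hK h2p hgood hs hb hE hmin
    · have hs' := (hK.irreducible_of_norm (norm_of_sq_eq_neg_two hK hs)).prime
      exact absurd (hE' (primeSpan hs') (Ideal.mem_span_singleton.2
        ⟨-s, by linear_combination hs⟩)) (not_hasGoodReductionAt_of_sq_eq_neg_two hK hs rfl (hmin _))
  · exact absurd (hE' (primeSpan hτ) (Ideal.mem_span_singleton.2 ⟨σ, h2⟩))
      (not_hasGoodReductionAt_of_unramified (ω := σ)
        (fun h => h3 (Ideal.mem_span_singleton.1 h)) (by rw [h2, mul_comm]) rfl (hmin _))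

variable (hδ : IsUnit δ ∨ p.asIdeal = Ideal.span {δ})
  (hE : IsIsomorphic E (curveAB ((δ * a : 𝓞 K) : K) ((δ ^ 2 * b : 𝓞 K) : K)))
  (hmin : ∀ q, IsMinimalAt q ((δ * a : 𝓞 K) : K) ((δ ^ 2 * b : 𝓞 K) : K))
  (hb : p.valuation K (b : K) = 1) (hc : p.valuation K ((a ^ 2 - 4 * b : 𝓞 K) : K) = 1)

include hδ hE hmin hb hc

/-- There is one prime above 2. Ordinary reduction leads to a² = ε + 64η as before; supersingular
reduction gives b = ε and a² − 4b = 4η, so a = 2a' with a'² = ε + η. -/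
theorem cases_of_ramified (ha : a ≠ 0) {τ ω : 𝓞 K} (hω : IsUnit ω) (h2 : 2 = ω * τ ^ 2)
    (hN : Algebra.norm ℤ τ = 2)
    (hcase : ω = -1 ∧ τ ^ 2 = -2 ∨ ω = -(τ - 1) ∧ (τ - 1) ^ 2 = -1) :
    IsSquareRootNegSevenCase E p ∨ IsSquareRootNegTwoCase E p := by
  have hτ := (hK.irreducible_of_norm hN).prime
  have hq : ∀ q : HeightOneSpectrum (𝓞 K), (2 : 𝓞 K) ∈ q.asIdeal → q = primeSpan hτ :=
    fun q hq => HeightOneSpectrum.ext (asIdeal_eq_span_of_two_mem hK hN hω h2 hq)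
  have h2q : (2 : 𝓞 K) ∈ (primeSpan hτ).asIdeal :=
    Ideal.mem_span_singleton.2 (h2 ▸ (dvd_pow_self τ two_ne_zero).mul_left _)
  have hqp : primeSpan hτ ≠ p := by
    rintro rfl
    exact h2p h2q
  rcases valuation_of_ramified_twist hgood hδ hE hmin hqp hω h2 rfl with
    h3 | h3 | ⟨h3, h4, α₁, α₂, α₃, α₄, α₆, x, h5⟩
  · exact .inl (isSquareRootNegSevenCase_of_left hK h2p hgood hδ hE hmin hb hc
      fun q h4 => by rwa [hq q h4])
  · exact .inl (isSquareRootNegSevenCase_of_right hK h2p hgood hδ hE hmin hb hc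
      fun q h4 => by rwa [hq q h4])
  · have h0 := fun q => valuation_of_two_notMem hgood hδ hE hmin hb hc (q := q)
    obtain ⟨ε, hε, h6⟩ := eq_of_valuation (p := p) (n := 0) (fun q hq => (h0 q hq).1)
      fun q h7 => by rw [hq q h7, h3, pow_zero]
    obtain ⟨η, hη, h7⟩ := eq_of_valuation (p := p) (n := 2) (fun q hq => (h0 q hq).2)
      fun q h7 => by
        rw [hq q h7, h4, ← map_pow]
        norm_num
    obtain rfl : b = ε := by rw [h6, pow_zero, mul_one]
    obtain ⟨a, rfl, ha'⟩ := exists_two_mul_of_sq (x := a) (y := b + η)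
      (by linear_combination h7)
    rcases hcase with ⟨rfl, hs⟩ | ⟨hω', hs⟩
    · right
      rcases exists_of_sq_eq_add_of_sq_eq_neg_two hK hs hε hη ha' with rfl | ⟨rfl, rfl | rfl⟩
      · exact absurd (mul_zero _) ha
      · refine isSquareRootNegTwoCase hK h2p hgood hs hδ ?_
        convert hE using 2 <;>
        · simp [NumberField.RingOfIntegers.coe_eq_algebraMap, coe_ofNat_integers]
          try ring
      · refine isSquareRootNegTwoCase hK h2p hgood hs (isUnit_or_span_mul hδ isUnit_one.neg) ?_
        convert hE using 2 <;>
        · simp [NumberField.RingOfIntegers.coe_eq_algebraMap, coe_ofNat_integers]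
          try ring
    · exfalso
      obtain ⟨s, rfl⟩ : ∃ s, τ = 1 + s := ⟨τ - 1, by ring⟩
      rw [add_sub_cancel_left] at hω' hs
      subst hω'
      rcases exists_of_sq_eq_add_of_sq_eq_neg_one hK hs hε hη ha' with rfl | ⟨e, rfl, rfl⟩
      · exact absurd (mul_zero _) ha
      · exact not_isRamifiedModel_of_sq_eq_neg_one hK hs (q := primeSpan hτ) rfl (e := δ * e)
          (by ring) (by ring) h5

/-- The factorization of 2 decides: inert gives one uniform ordinary type, ramified is
`cases_of_ramified`, and split gives two uniform and two mixed combinations of types. -/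
theorem cases_of_ne_zero (ha : a ≠ 0) :
    IsSquareRootNegSevenCase E p ∨ IsSquareRootNegTwoCase E p := by
  have hne : ∀ q : HeightOneSpectrum (𝓞 K), (2 : 𝓞 K) ∈ q.asIdeal → q ≠ p := by
    rintro q hq rfl
    exact h2p hq
  rcases hK.factorization_two with h2 | ⟨τ, ω, hτ, hω, h2, hN⟩ | ⟨τ, σ, hτ, hσ, h2, h3, h4, hN, hN'⟩
  · left
    have hq : ∀ q : HeightOneSpectrum (𝓞 K), (2 : 𝓞 K) ∈ q.asIdeal → q = primeSpan h2 :=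
      fun q hq => HeightOneSpectrum.ext (((primeSpan h2).isMaximal.eq_of_le q.isPrime.ne_top
        ((Ideal.span_singleton_le_iff_mem _).2 hq)).symm)
    rcases valuation_of_unramified_twist hgood hδ hE hmin
      (hne (primeSpan h2) (Ideal.mem_span_singleton_self _)) (ω := 1)
      (fun h => (primeSpan h2).isPrime.ne_top (Ideal.eq_top_of_isUnit_mem _ h isUnit_one))
      (one_mul _).symm rfl with h3 | h3
    · exact isSquareRootNegSevenCase_of_left hK h2p hgood hδ hE hmin hb hc
        fun q h4 => by rwa [hq q h4]
    · exact isSquareRootNegSevenCase_of_right hK h2p hgood hδ hE hmin hb hc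
        fun q h4 => by rwa [hq q h4]
  · obtain ⟨s, hs | hs⟩ := hK.sq_eq_of_ramified hω h2 hN
    · exact cases_of_ramified hK h2p hgood hδ hE hmin hb hc ha (isUnit_neg_of_sq_eq_neg_one hs)
        (two_eq_of_sq_eq_neg_one hs) (norm_of_sq_eq_neg_one hK hs)
        (.inr (by rw [add_sub_cancel_left]; exact ⟨rfl, hs⟩))
    · exact cases_of_ramified hK h2p hgood hδ hE hmin hb hc ha isUnit_one.neg
        (by linear_combination hs) (norm_of_sq_eq_neg_two hK hs) (.inl ⟨rfl, hs⟩)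
  · left
    have hmemτ : (2 : 𝓞 K) ∈ (primeSpan hτ).asIdeal := Ideal.mem_span_singleton.2 ⟨σ, h2⟩
    have hmemσ : (2 : 𝓞 K) ∈ (primeSpan hσ).asIdeal :=
      Ideal.mem_span_singleton.2 ⟨τ, by rw [h2, mul_comm]⟩
    have h2' : 2 = σ * τ := by rw [h2, mul_comm]
    rcases valuation_of_unramified_twist hgood hδ hE hmin (hne _ hmemτ) (ω := σ)
      (fun h => h3 (Ideal.mem_span_singleton.1 h)) h2' rfl with ⟨h5, h6⟩ | ⟨h5, h6⟩ <;>
    rcases valuation_of_unramified_twist hgood hδ hE hmin (hne _ hmemσ) (ω := τ)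
      (fun h => h4 (Ideal.mem_span_singleton.1 h)) h2 rfl with ⟨h7, h8⟩ | ⟨h7, h8⟩
    · refine isSquareRootNegSevenCase_of_left hK h2p hgood hδ hE hmin hb hc fun q hq => ?_
      rcases span_of_two_mem hq hτ hσ h2' with rfl | rfl
      exacts [⟨h5, h6⟩, ⟨h7, h8⟩]
    · exact isSquareRootNegSevenCase_of_mixed hK h2p hgood hδ hE hmin hb hc hτ hσ h2 h3 h4 hN
        h5 h6 h7 h8
    · exact isSquareRootNegSevenCase_of_mixed hK h2p hgood hδ hE hmin hb hc hσ hτ h2' h4 h3 hN'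
        h7 h8 h5 h6
    · refine isSquareRootNegSevenCase_of_right hK h2p hgood hδ hE hmin hb hc fun q hq => ?_
      rcases span_of_two_mem hq hτ hσ h2' with rfl | rfl
      exacts [⟨h5, h6⟩, ⟨h7, h8⟩]

end

end

end GoodTwist

/-! ### Assembly of the cases. -/

theorem mainTheorem9 {K : Type*} [Field K] [NumberField K]
    (hquad : Module.finrank ℚ K = 2) (himag : NumberField.IsTotallyComplex K)
    (hclass : NumberField.classNumber K = 1)
    (p : HeightOneSpectrum (𝓞 K)) (hodd : (2 : 𝓞 K) ∉ p.asIdeal)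
    (E : WeierstrassCurve K) [E.IsElliptic]
    (htors : GoodTwist.HasPointOfOrderTwo E)
    (hcond : ∃ r : ℕ, GoodTwist.conductor E = p.asIdeal ^ r)
    (htwist :
      -- a quadratic twist of `E` has good reduction at `p`
      (∃ d : K, d ≠ 0 ∧ GoodTwist.HasGoodReductionAt (GoodTwist.quadraticTwist E d) p) ∨
      -- or `E : y² = x³ + b x` and a quartic twist of `E` has good reduction at `p`
      (∃ b d : K, GoodTwist.IsIsomorphic E (GoodTwist.curveAB 0 b) ∧ d ≠ 0 ∧
        GoodTwist.HasGoodReductionAt (GoodTwist.curveAB 0 (d * b)) p)) :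
    -- `K = ℚ(√-7)`
    (∃ s π : 𝓞 K, s ^ 2 = -7 ∧ p.asIdeal = Ideal.span {π} ∧ 4 ∣ π - s ∧
      GoodTwist.conductor E = p.asIdeal ^ 2 ∧
      (∃ W ∈ GoodTwist.isogenyClass49a,
        GoodTwist.IsIsomorphic E (GoodTwist.quadraticTwist (W⁄K) ((π : K) * (s : K)))) ∧
      (E.j = -15 ^ 3 ∨ E.j = 255 ^ 3) ∧
      ∃ O : Subring K, GoodTwist.IsOrder O ∧ GoodTwist.HasCMBy E O) ∨
    -- `K = ℚ(√-1)`
    (∃ s π b : 𝓞 K, s ^ 2 = -1 ∧ p.asIdeal = Ideal.span {π} ∧ (b = π ∨ b = π ^ 3) ∧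
      (8 ∣ b - (-1 + 2 * s) ∨ 8 ∣ b - (-1 - 2 * s)) ∧
      GoodTwist.conductor E = p.asIdeal ^ 2 ∧
      GoodTwist.IsIsomorphic E (GoodTwist.curveAB 0 (b : K)) ∧
      (∃ W ∈ GoodTwist.isogenyClass64a, GoodTwist.IsTwist E (W⁄K)) ∧
      E.j = 12 ^ 3 ∧
      ∃ O : Subring K, GoodTwist.IsOrder O ∧ GoodTwist.HasCMBy E O) ∨
    -- `K = ℚ(√-2)`
    (∃ s π : 𝓞 K, s ^ 2 = -2 ∧ p.asIdeal = Ideal.span {π} ∧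
      (4 ∣ π - (1 + s) ∨ 4 ∣ π - (-1 + s)) ∧
      GoodTwist.conductor E = p.asIdeal ^ 2 ∧
      GoodTwist.IsIsomorphic E
        (GoodTwist.curveAB (2 * (π : K) * (s : K)) (-(π : K) ^ 2)) ∧
      (∃ W ∈ GoodTwist.isogenyClass256a, GoodTwist.IsTwist E (W⁄K)) ∧
      E.j = 20 ^ 3 ∧
      GoodTwist.HasCMBy E (Subring.closure {(s : K)})) := by
  have hK : GoodTwist.IsImaginaryQuadratic K := ⟨hquad, himag⟩
  have := (NumberField.classNumber_eq_one_iff (K := K)).1 hclass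
  obtain ⟨r, hr⟩ := hcond
  have hgood : ∀ q ≠ p, GoodTwist.HasGoodReductionAt E q := fun q hq =>
    GoodTwist.hasGoodReductionAt_of_conductor hr hq
  -- For y² = x³ + bx the conclusion comes from good reduction away from 𝔭; this also serves a
  -- quadratic twist whose equation has a = 0.
  have hfour : ∀ b : K, GoodTwist.IsIsomorphic E (GoodTwist.curveAB 0 b) →
      GoodTwist.IsSquareRootNegOneCase E p := by
    intro b hE
    obtain ⟨a', b', ha', hb', hE', hmin⟩ := GoodTwist.exists_isMinimalAt hK
      (GoodTwist.ne_zero_of_isIsomorphic hE) hE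
    rw [ha' rfl] at hE' hmin
    have h0 : ((0 : 𝓞 K) : K) = 0 := map_zero _
    rw [h0] at hE' hmin
    exact GoodTwist.isSquareRootNegOneCase_of_eq_zero hK hodd hgood hb' hE' hmin
  rcases htwist with ⟨d, hd, hp⟩ | ⟨b, -, hE, -, -⟩
  · obtain ⟨a, b, hE⟩ := htors.exists_isIsomorphic
    by_cases ha : a = 0
    · rw [ha] at hE
      exact .inr (.inl (hfour b hE))
    obtain ⟨a', b', -, hb', hE', hmin⟩ := GoodTwist.exists_isMinimalAt hK
      (GoodTwist.ne_zero_of_isIsomorphic hE) hE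
    obtain ⟨t, -, ht⟩ := GoodTwist.exists_prime_span p
    obtain ⟨δ, a, b, hδ, rfl, rfl, hb, hc⟩ := GoodTwist.exists_of_quadraticTwist hodd ht (hmin p) hd
      (by
        rw [← GoodTwist.quadraticTwist_curveAB]
        exact (hE'.quadraticTwist d).hasGoodReductionAt hp)
    by_cases ha' : a = 0
    · refine .inr (.inl (hfour ((δ ^ 2 * b : 𝓞 K) : K) ?_))
      have h0 : ((0 : 𝓞 K) : K) = 0 := map_zero _
      rwa [ha', mul_zero, h0] at hE'
    · refine (GoodTwist.cases_of_ne_zero hK hodd hgood (hδ.imp ?_ ?_) hE' hmin hb hc ha').imp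
        (fun h => h) .inr
      · rintro rfl
        exact isUnit_one
      · rintro rfl
        exact ht
  · exact .inr (.inl (hfour b hE))
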